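/- **Setting.** Let $k$ be a field of characteristic zero and $n,m\ge 0$. Let $L=k\langle y\rangle=k(y^u_\mu)$ be the field of rational functions in the jets $y^u_\mu$ ($1\le u\le m$, $\mu\in\mathbb N^n$), with the derivations $d_i$ defined by $d_i|_k=0$, $d_iy^u_\mu=y^u_{\mu+1_i}$; put $L_q=k(y^u_\mu:|\mu|\le q)$ for $q\in\mathbb N\cup\{\infty\}$ (so $L_\infty=L$) and $k(y)=k(y^1,\dots,y^m)$. The jets of invertible transformations $\bar y=g(y)$ have coordinates $y^s$ and $\bar y^u_\nu=\partial^\nu\bar y^u/\partial y^\nu$ ($\nu\in\mathbb N^m$, $\bar y^u_0=\bar y^u$). Let $P$ be the localization of $k[y,\bar y_\nu]$ at $\det(\partial\bar y/\partial y)$, the nonzero polynomials in $y$ and the nonzero polynomials in $\bar y$; it carries the derivations $\partial_r=\partial/\partial y^r$, with $\partial_ry^s=\delta_{rs}$, $\partial_r\bar y^u_\nu=\bar y^u_{\nu+1_r}$. An *algebraic Lie pseudogroup* $\Gamma$ over $k$, of order $q_0\ge1$, is an ideal $I\subset P$ which is generated, as an ideal stable under the $\partial_r$, by its polynomials of order $\le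 q_0$, and such that for every finite $q\ge q_0$ the polynomials of order $\le q$ in $I$ define a subgroupoid $R_q$ of the groupoid of invertible $q$-jets (with generic source and target). The coordinate ring is $k[\Gamma]=P/I$, an algebra over $k(y)$ by the source. By the chain rule, a $q$-jet $y_q$ may be composed with a $q$-jet $g_q$ of $R_q$ at the point $y$, giving $\bar y_q=g_q\circ y_q$; we then say that $g_q$ relates $y_q$ and $\bar y_q$. Let $K$ be a differential subfield of $L$ containing $k$, and $K_q=K\cap L_q$. The extension $L/K$ is *automorphic* for $\Gamma$ if for every finite $q\ge q_0$ the graph of the action of $R_q$ on generic $q$-jets is an isomorphism onto $L_q\otimes_{K_q}L_q$: for every commutative $k$-algebra $B$ and $k$-homomorphisms $a,b:L_q\to B$ (two generic $q$-jets with values in $B$), if $a|_{K_q}=b|_{K_q}$ there is one and only one $g_q\in R_q(B)$ relating $a$ to $b$, and if there is some such $g_q$ then $a|_{K_q}=b|_{K_q}$. Let $\Theta(q)\subset\mathrm{Der}_k(L_q)$ be the distribution of the infinitesimal transformations $\sharp(\eta_q)$, where $\eta_q$ runs over the sections over $k(y)$ of the linearization of $R_q$ at the identity. The *reciprocal distribution*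 $\Delta(q)$ consists of the derivations $\delta$ of $L_q$ over $k(y)$ commuting with the action of $\Gamma$: whenever $g_q$ relates $a$ and $b$, it also relates the jets $y_q+\varepsilon\,\delta y_q$ ($\varepsilon^2=0$) taken at $a$ and at $b$. If $\delta$ extends to a ring $T$ containing $L_q\otimes_{K_q}L_q$ by $x\otimes1\mapsto\delta x\otimes1$, $1\otimes x\mapsto1\otimes\delta x$, it is said to act on $T$; $cst(T)$ is the set of elements of $T$ killed by all $\delta\in\Delta(q)$. $Q(\cdot)$ denotes the total ring of fractions. **Theorem 5.3.** Let $L/K$ be a differential automorphic extension for $\Gamma$. 1. Let $q_0\le q\le\infty$. One has $[\Theta(q),\Delta(q)]=0$; if $K_q$ is algebraically closed in $L_q$, then $\Delta(q)$ is the set of all derivations of $L_q$ over $k(y)$ that commute with $\Theta(q)$. The distribution $\Delta(q)$ has maximal rank: every derivation of $L_q$ over $k(y)$ agrees, on any finite set of jet coordinates, with an $L_q$-linear combination of elements of $\Delta(q)$. Each $\delta\in\Delta(q)$ acts on $L_q\otimes_{K_q}L_q$, by a unique derivation. 2. Let $q_0\le q\le\infty$ and write $y_\mu$, $\bar y_\mu$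 for $y_\mu\otimes1$, $1\otimes y_\mu$. There is one and only one $q$-jet of $R_q$ with values in $L_q\otimes_{K_q}L_q$ relating the jets $(y,y_x,y_{xx},\dots)$ and $(\bar y,\bar y_x,\bar y_{xx},\dots)$ of order $\le q$. Its components $\partial\bar y/\partial y,\partial^2\bar y/\partial y^2,\dots$ up to order $q$, which are thus rational functions of the jets of $y$ and $\bar y$ up to order $q$, are constants for $\Delta(q)$. 3. There is an injective homomorphism $j:k[\Gamma]\to L\otimes_KL$ with values in $cst(L\otimes_KL)$, sending $y$ to $y\otimes1$, $\bar y$ to $1\otimes y$ and the groupoid coordinates to elements satisfying the chain rule between the jets of $y$ and of $\bar y$; the coordinates of order at most a finite $q\ge q_0$ are sent to the subring generated by $L_q\otimes1$ and $1\otimes L_q$. The ring $k[\Gamma]$ is a Hopf ring over $k(y)$ (the function ring of a groupoid with objects $y$), with the source and target maps $k(y)\to k[\Gamma]$ given by $y$ and $\bar y$, whose diagonal, antipode and augmentation are induced through $j$ by $a\otimes b\mapsto a\otimes1\otimes b$, $a\otimes b\mapsto b\otimes a$ and $a\otimes b\mapsto ab$. 4. Each $\delta\in\Delta(\infty)$ acts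 on $L\otimes_KL$ and on $Q(L\otimes_KL)$, by a unique derivation. The map $j$ extends to an isomorphism of $k(\Gamma)=Q(k[\Gamma])$ onto $cst(Q(L\otimes_KL))$. 5. The $\partial_r$ extend to $k(\Gamma)$, and $k(\Gamma)$ is a finite direct sum of differential fields for these derivations; the $d_i$ extend to $Q(L\otimes_KL)$ (by $x\otimes 1\mapsto d_ix\otimes1$, $1\otimes x\mapsto 1\otimes d_ix$), and $Q(L\otimes_KL)$ is a finite direct sum of differential fields for these derivations. 6. There is an isomorphism $Q(L\otimes_{k(y)}k[\Gamma])\simeq Q(L\otimes_KL)$ sending $x\otimes h$ to $(x\otimes1)\,j(h)$. -/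

import Mathlib

open scoped TensorProduct

universe u

namespace DiffGalois

/-! ### Jets and the chain rule -/

/-- Indices `(u, μ)` of the jet coordinates `y^u_μ` of order `|μ| ≤ q` of a map from a space of
dimension `d` to a space of dimension `m`; all orders are allowed when `q = ⊤`. -/
abbrev JetIdx (d m : ℕ) (q : ℕ∞) : Type :=
  {p : Fin m × (Fin d →₀ ℕ) // ((p.2.degree : ℕ) : ℕ∞) ≤ q}

/-- The index of the coordinate `y^u` of order zero. -/
def JetIdx.zero {d m : ℕ} {q : ℕ∞} (u : Fin m) : JetIdx d m q :=
  ⟨(u, 0), by simp⟩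

open Classical in
/-- A jet of order `q`, filled up by zeros in the orders greater than `q`. -/
noncomputable def extendJet {d m : ℕ} {q : ℕ∞} {B : Type*} [Zero B] (v : JetIdx d m q → B)
    (p : Fin m × (Fin d →₀ ℕ)) : B :=
  if h : ((p.2.degree : ℕ) : ℕ∞) ≤ q then v ⟨p, h⟩ else 0

/-- Polynomials in the jets `y^u_μ` of a map `y = f(x)` (left variables) and in the jets
`∂^ν g^u / ∂y^ν` of a map `g` of the target (right variables). -/
abbrev ChainRing (k : Type u) [Field k] (n m : ℕ) : Type u :=
  MvPolynomial ((Fin m × (Fin n →₀ ℕ)) ⊕ (Fin m × (Fin m →₀ ℕ))) k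

/-- The total derivative with respect to `x^i`:
`y^u_μ ↦ y^u_{μ+1_i}` and `g^u_ν ↦ ∑_r y^r_i g^u_{ν+1_r}`. -/
noncomputable def chainDeriv (k : Type u) [Field k] (n m : ℕ) (i : Fin n) :
    Derivation k (ChainRing k n m) (ChainRing k n m) :=
  MvPolynomial.mkDerivation k (Sum.elim
    (fun p => MvPolynomial.X (Sum.inl (p.1, p.2 + Finsupp.single i 1)))
    (fun p => ∑ r : Fin m, MvPolynomial.X (Sum.inl (r, Finsupp.single i 1)) *
      MvPolynomial.X (Sum.inr (p.1, p.2 + Finsupp.single r 1))))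

/-- The chain rule: the jet coordinate `(u, μ)` of `g ∘ f` as a polynomial in the jets of `f`
and `g`, namely the iterated total derivative `d_μ g^u`. -/
noncomputable def chainPoly (k : Type u) [Field k] (n m : ℕ) (p : Fin m × (Fin n →₀ ℕ)) :
    ChainRing k n m :=
  (((List.finRange n).map fun i =>
      ((chainDeriv k n m i : ChainRing k n m →ₗ[k] ChainRing k n m) :
        Module.End k (ChainRing k n m)) ^ (p.2 i)).prod)
    (MvPolynomial.X (Sum.inr (p.1, 0)))

/-- Composition of the `q`-jet `a` of a map `f` with the `q`-jet `g` of a transformation of the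
target, with values in a `k`-algebra: the `q`-jet of `g ∘ f`. -/
noncomputable def chain (k : Type u) [Field k] {n m : ℕ} {q : ℕ∞} {B : Type*} [CommRing B]
    [Algebra k B] (a : JetIdx n m q → B) (g : JetIdx m m q → B) : JetIdx n m q → B :=
  fun p => MvPolynomial.aeval (Sum.elim (extendJet a) (extendJet g)) (chainPoly k n m p.1)

/-! ### The fields `k(y)` and `L_q = k(y_q)` -/

/-- The field `k(y) = k(y^1, …, y^m)`. -/
def BaseField (k : Type u) [Field k] (m : ℕ) : Type u :=
  FractionRing (MvPolynomial (Fin m) k)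

/-- The field of rational functions of the jets of order at most `q`. For `q = ⊤` it is
`L = k<y>`, the fraction field of the ring of differential polynomials in `y^1, …, y^m` with
respect to `n` derivations, the elements of `k` being killed by the derivations. -/
def JetField (k : Type u) [Field k] (n m : ℕ) (q : ℕ∞) : Type u :=
  FractionRing (MvPolynomial (JetIdx n m q) k)

section Fields

variable (k : Type u) [Field k] (n m : ℕ) (q : ℕ∞)

noncomputable instance : Field (BaseField k m) :=
  inferInstanceAs (Field (FractionRing (MvPolynomial (Fin m) k)))

noncomputable instance : Algebra k (BaseField k m) :=
  inferInstanceAs (Algebra k (FractionRing (MvPolynomial (Fin m) k)))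

noncomputable instance : Algebra (MvPolynomial (Fin m) k) (BaseField k m) :=
  inferInstanceAs (Algebra (MvPolynomial (Fin m) k) (FractionRing (MvPolynomial (Fin m) k)))

instance : IsScalarTower k (MvPolynomial (Fin m) k) (BaseField k m) :=
  inferInstanceAs (IsScalarTower k (MvPolynomial (Fin m) k)
    (FractionRing (MvPolynomial (Fin m) k)))

instance : IsFractionRing (MvPolynomial (Fin m) k) (BaseField k m) :=
  inferInstanceAs (IsFractionRing (MvPolynomial (Fin m) k)
    (FractionRing (MvPolynomial (Fin m) k)))

noncomputable instance : Field (JetField k n m q) :=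
  inferInstanceAs (Field (FractionRing (MvPolynomial (JetIdx n m q) k)))

noncomputable instance : Algebra k (JetField k n m q) :=
  inferInstanceAs (Algebra k (FractionRing (MvPolynomial (JetIdx n m q) k)))

noncomputable instance : Algebra (MvPolynomial (JetIdx n m q) k) (JetField k n m q) :=
  inferInstanceAs (Algebra (MvPolynomial (JetIdx n m q) k)
    (FractionRing (MvPolynomial (JetIdx n m q) k)))

instance : IsScalarTower k (MvPolynomial (JetIdx n m q) k) (JetField k n m q) :=
  inferInstanceAs (IsScalarTower k (MvPolynomial (JetIdx n m q) k)
    (FractionRing (MvPolynomial (JetIdx n m q) k)))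

instance : IsFractionRing (MvPolynomial (JetIdx n m q) k) (JetField k n m q) :=
  inferInstanceAs (IsFractionRing (MvPolynomial (JetIdx n m q) k)
    (FractionRing (MvPolynomial (JetIdx n m q) k)))

end Fields

/-- The coordinate `y^u` in `k(y)`. -/
noncomputable def baseCoord (k : Type u) [Field k] (m : ℕ) (u : Fin m) : BaseField k m :=
  algebraMap (MvPolynomial (Fin m) k) _ (MvPolynomial.X u)

/-- The jet coordinate `y^u_μ` in the jet field. -/
noncomputable def jetCoord (k : Type u) [Field k] (n m : ℕ) (q : ℕ∞) (p : JetIdx n m q) :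
    JetField k n m q :=
  algebraMap (MvPolynomial (JetIdx n m q) k) _ (MvPolynomial.X p)

theorem JetIdx.zero_injective {d m : ℕ} {q : ℕ∞} :
    Function.Injective (JetIdx.zero : Fin m → JetIdx d m q) := by
  intro u v h
  exact congrArg (fun p => p.1.1) h

/-- The inclusion of `k(y)` in the jet field. -/
noncomputable def baseIncl (k : Type u) [Field k] (n m : ℕ) (q : ℕ∞) :
    BaseField k m →ₐ[k] JetField k n m q :=
  IsFractionRing.liftAlgHom (A := MvPolynomial (Fin m) k)
    (g := (IsScalarTower.toAlgHom k (MvPolynomial (JetIdx n m q) k) (JetField k n m q)).comp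
      (MvPolynomial.rename JetIdx.zero))
    ((IsFractionRing.injective (MvPolynomial (JetIdx n m q) k) (JetField k n m q)).comp
      (MvPolynomial.rename_injective _ JetIdx.zero_injective))

noncomputable instance (k : Type u) [Field k] (n m : ℕ) (q : ℕ∞) :
    Algebra (BaseField k m) (JetField k n m q) :=
  (baseIncl k n m q).toRingHom.toAlgebra

/-- The inclusion `L_q ⊆ L`. -/
noncomputable def jetIncl (k : Type u) [Field k] (n m : ℕ) (q : ℕ∞) :
    JetField k n m q →ₐ[k] JetField k n m ⊤ :=
  IsFractionRing.liftAlgHom (A := MvPolynomial (JetIdx n m q) k)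
    (g := (IsScalarTower.toAlgHom k (MvPolynomial (JetIdx n m ⊤) k) (JetField k n m ⊤)).comp
      (MvPolynomial.rename fun p => ⟨p.1, le_top⟩))
    ((IsFractionRing.injective (MvPolynomial (JetIdx n m ⊤) k) (JetField k n m ⊤)).comp
      (MvPolynomial.rename_injective _ fun _ _ h => Subtype.ext (congrArg (fun p => p.1) h)))

/-- The field `K_q = K ∩ L_q` of the elements of order at most `q` of a subfield `K` of `L`. -/
noncomputable def truncate {k : Type u} [Field k] {n m : ℕ}
    (K : IntermediateField k (JetField k n m ⊤)) (q : ℕ∞) :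
    IntermediateField k (JetField k n m q) :=
  K.comap (jetIncl k n m q)

section FractionDerivation

variable {k A F : Type*} [CommRing k] [CommRing A] [Field F] [Algebra k A]
  [Algebra k F] [Algebra A F] [IsScalarTower k A F]

/-- The homomorphism `x ↦ x + ε d x`. -/
noncomputable def dualHom (d : Derivation k A A) : A →ₐ[k] DualNumber F :=
  AlgHom.ofLinearMap
    ((TrivSqZeroExt.inlAlgHom k F F).toLinearMap.comp (IsScalarTower.toAlgHom k A F).toLinearMap +
      (TrivSqZeroExt.inrHom F F).restrictScalars k ∘ₗ
        (IsScalarTower.toAlgHom k A F).toLinearMap ∘ₗ (d : A →ₗ[k] A))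
    (by ext <;> simp)
    (by
      intro x y
      change (TrivSqZeroExt.inl (algebraMap A F (x * y)) +
          TrivSqZeroExt.inr (algebraMap A F (d (x * y))) : DualNumber F) =
        (TrivSqZeroExt.inl (algebraMap A F x) + TrivSqZeroExt.inr (algebraMap A F (d x))) *
          (TrivSqZeroExt.inl (algebraMap A F y) + TrivSqZeroExt.inr (algebraMap A F (d y)))
      rw [Derivation.leibniz, smul_eq_mul, smul_eq_mul, map_add, map_mul, map_mul, map_mul]
      ext
      · simp only [TrivSqZeroExt.fst_add, TrivSqZeroExt.fst_mul, TrivSqZeroExt.fst_inl,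
          TrivSqZeroExt.fst_inr, add_zero]
      · simp only [TrivSqZeroExt.snd_add, TrivSqZeroExt.snd_mul, TrivSqZeroExt.fst_add,
          TrivSqZeroExt.fst_inl, TrivSqZeroExt.fst_inr, TrivSqZeroExt.snd_inl,
          TrivSqZeroExt.snd_inr, add_zero, zero_add, smul_eq_mul, MulOpposite.smul_eq_mul_unop,
          MulOpposite.unop_op]
        ring)

theorem dualHom_apply (d : Derivation k A A) (x : A) :
    dualHom (F := F) d x =
      TrivSqZeroExt.inl (algebraMap A F x) + TrivSqZeroExt.inr (algebraMap A F (d x)) := rfl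

variable [IsDomain A] [IsFractionRing A F]

theorem isUnit_dualHom (d : Derivation k A A) (y : nonZeroDivisors A) :
    IsUnit (dualHom (F := F) d y) := by
  rw [TrivSqZeroExt.isUnit_iff_isUnit_fst, dualHom_apply]
  simp

/-- The homomorphism `x ↦ x + ε d x` on fractions. -/
noncomputable def dualHomFraction (d : Derivation k A A) : F →ₐ[k] DualNumber F :=
  IsLocalization.liftAlgHom (M := nonZeroDivisors A) (isUnit_dualHom (F := F) d)

theorem dualHomFraction_algebraMap (d : Derivation k A A) (x : A) :
    dualHomFraction (F := F) d (algebraMap A F x) = dualHom d x :=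
  IsLocalization.lift_eq _ x

theorem fst_dualHomFraction (d : Derivation k A A) (x : F) : (dualHomFraction d x).fst = x := by
  have h : ((TrivSqZeroExt.fstHom k F F).comp (dualHomFraction d) : F →ₐ[k] F).toRingHom =
      RingHom.id F := by
    apply IsLocalization.ringHom_ext (nonZeroDivisors A)
    ext x
    change (dualHomFraction d (algebraMap A F x)).fst = algebraMap A F x
    rw [dualHomFraction_algebraMap, dualHom_apply]
    simp
  exact DFunLike.congr_fun h x

/-- The unique extension of a derivation of a domain to its fraction field (quotient rule). -/
noncomputable def fractionDerivation (d : Derivation k A A) : Derivation k F F :=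
  Derivation.mk' ((TrivSqZeroExt.sndHom F F).restrictScalars k ∘ₗ (dualHomFraction d).toLinearMap)
    (fun x y => by
      change (dualHomFraction d (x * y)).snd = x • (dualHomFraction d y).snd +
        y • (dualHomFraction d x).snd
      rw [map_mul, TrivSqZeroExt.snd_mul, fst_dualHomFraction, fst_dualHomFraction]
      simp [mul_comm])

theorem fractionDerivation_algebraMap (d : Derivation k A A) (x : A) :
    fractionDerivation (F := F) d (algebraMap A F x) = algebraMap A F (d x) := by
  change (dualHomFraction d (algebraMap A F x)).snd = _
  rw [dualHomFraction_algebraMap, dualHom_apply, TrivSqZeroExt.snd_add,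
    TrivSqZeroExt.snd_inl, TrivSqZeroExt.snd_inr, zero_add]

end FractionDerivation

/-- The formal derivative `d_i` of `L = k<y>`, with `d_i y^u_μ = y^u_{μ+1_i}`. -/
noncomputable def totalDeriv (k : Type u) [Field k] (n m : ℕ) (i : Fin n) :
    Derivation k (JetField k n m ⊤) (JetField k n m ⊤) :=
  fractionDerivation (A := MvPolynomial (JetIdx n m ⊤) k)
    (MvPolynomial.mkDerivation k fun p =>
      MvPolynomial.X ⟨(p.1.1, p.1.2 + Finsupp.single i 1), le_top⟩)

/-! ### The groupoid of jets of invertible transformations of the target -/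

/-- Polynomials in the source coordinates `y^s` (left variables) and in the groupoid jets
`∂^ν ȳ^u / ∂y^ν` (right variables), where `ν = 0` gives the target coordinates `ȳ^u`. -/
abbrev GroupoidPoly (k : Type u) [Field k] (m : ℕ) : Type u :=
  MvPolynomial (Fin m ⊕ (Fin m × (Fin m →₀ ℕ))) k

/-- The Jacobian matrix `∂ȳ / ∂y` of a groupoid jet. -/
noncomputable def jacobian {m : ℕ} {B : Type*} (v : Fin m × (Fin m →₀ ℕ) → B) : Matrix (Fin m) (Fin m) B :=
  Matrix.of fun u r => v (u, Finsupp.single r 1)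

/-- The nonzero polynomials in `y`, the nonzero polynomials in `ȳ`, and `det (∂ȳ / ∂y)`. -/
noncomputable def groupoidDenominators (k : Type u) [Field k] (m : ℕ) :
    Submonoid (GroupoidPoly k m) :=
  Submonoid.closure
    (({f | ∃ p : MvPolynomial (Fin m) k, p ≠ 0 ∧ f = MvPolynomial.rename Sum.inl p} ∪
      {f | ∃ p : MvPolynomial (Fin m) k, p ≠ 0 ∧
        f = MvPolynomial.rename (fun u => Sum.inr (u, 0)) p}) ∪
      {(jacobian fun p => (MvPolynomial.X (Sum.inr p) : GroupoidPoly k m)).det})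

/-- The coordinate ring, over the rational functions of the source and of the target, of the
groupoid of jets of all orders of invertible transformations `ȳ = g(y)`. -/
abbrev JetGroupoidRing (k : Type u) [Field k] (m : ℕ) : Type u :=
  Localization (groupoidDenominators k m)

/-- The formal derivative with respect to `y^r` on groupoid jets:
`∂^ν ȳ^u / ∂y^ν ↦ ∂^{ν+1_r} ȳ^u / ∂y^{ν+1_r}`. -/
noncomputable def groupoidDeriv (k : Type u) [Field k] (m : ℕ) (r : Fin m) :
    Derivation k (GroupoidPoly k m) (GroupoidPoly k m) :=
  MvPolynomial.mkDerivation k (Sum.elim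
    (fun s => if s = r then 1 else 0)
    (fun p => MvPolynomial.X (Sum.inr (p.1, p.2 + Finsupp.single r 1))))

/-- The polynomials of order at most `q` in the groupoid jets. -/
noncomputable def groupoidPolyUpTo (k : Type u) [Field k] (m : ℕ) (q : ℕ∞) :
    Subalgebra k (GroupoidPoly k m) :=
  MvPolynomial.supported k {v | ∀ p, v = Sum.inr p → ((p.2.degree : ℕ) : ℕ∞) ≤ q}

section Points

variable {k : Type u} [Field k] {m : ℕ} {B : Type*} [CommRing B] [Algebra k B]

/-- `g` is a `q`-jet of invertible transformation with values in `B`, with (generic) target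
point `t`. -/
def IsInvertibleJet (q : ℕ∞) (t : BaseField k m →ₐ[k] B) (g : JetIdx m m q → B) : Prop :=
  (∀ u, g (JetIdx.zero u) = t (baseCoord k m u)) ∧ IsUnit (jacobian (extendJet g)).det

/-- `g` is a `B`-valued point, with source `s` and target `t`, of the subvariety of the groupoid
of invertible `q`-jets defined by the equations of order at most `q` in the ideal `I`. -/
def IsSolutionJet (I : Ideal (JetGroupoidRing k m)) (q : ℕ∞) (s t : BaseField k m →ₐ[k] B)
    (g : JetIdx m m q → B) : Prop :=
  IsInvertibleJet q t g ∧
    ∀ f ∈ groupoidPolyUpTo k m q, algebraMap (GroupoidPoly k m) (JetGroupoidRing k m) f ∈ I →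
      MvPolynomial.aeval (Sum.elim (fun u => s (baseCoord k m u)) (extendJet g)) f = 0

open Classical in
/-- The `q`-jet of the identity at the point `s`. -/
noncomputable def idJet (q : ℕ∞) (s : BaseField k m →ₐ[k] B) : JetIdx m m q → B :=
  fun p => if p.1.2 = 0 then s (baseCoord k m p.1.1)
    else if p.1.2 = Finsupp.single p.1.1 1 then 1 else 0

end Points

/-- The equations of order at most `q` of `I` belong to `J`. -/
def ContainsUpTo {k : Type u} [Field k] {m : ℕ} (q : ℕ∞) (I J : Ideal (JetGroupoidRing k m)) :
    Prop :=
  ∀ f ∈ groupoidPolyUpTo k m q, algebraMap (GroupoidPoly k m) (JetGroupoidRing k m) f ∈ I →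
    algebraMap (GroupoidPoly k m) (JetGroupoidRing k m) f ∈ J

/-- The ideal `I` is stable under the derivations `∂/∂y^r`. -/
def IsDifferentialIdeal {k : Type u} [Field k] {m : ℕ} (I : Ideal (JetGroupoidRing k m)) : Prop :=
  ∀ (r : Fin m) (f : GroupoidPoly k m),
    algebraMap (GroupoidPoly k m) (JetGroupoidRing k m) f ∈ I →
      algebraMap (GroupoidPoly k m) (JetGroupoidRing k m) (groupoidDeriv k m r f) ∈ I

/-- An algebraic Lie pseudogroup `Γ` of transformations `ȳ = g(y)` in dimension `m`, defined
over `k`: a system of algebraic PD equations of some order `≥ 1` in `ȳ`, all whose consequences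
are obtained by differentiation, such that for every order `q ≥ order` the system `R_q` of the
equations of order at most `q` is a subgroupoid of the groupoid of invertible `q`-jets. -/
structure AlgebraicPseudogroup (k : Type u) [Field k] (m : ℕ) where
  /-- The equations, of all orders. -/
  ideal : Ideal (JetGroupoidRing k m)
  /-- The order of the system. -/
  order : ℕ
  one_le_order : 1 ≤ order
  isDifferential : IsDifferentialIdeal ideal
  /-- The equations of higher order are the prolongations of those of order at most `order`. -/
  prolongation : ∀ J : Ideal (JetGroupoidRing k m), IsDifferentialIdeal J →
    ContainsUpTo order ideal J → ideal ≤ J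
  id_mem : ∀ q : ℕ, order ≤ q → ∀ (B : Type u) [CommRing B] [Algebra k B]
    (s : BaseField k m →ₐ[k] B), IsSolutionJet ideal q s s (idJet q s)
  comp_mem : ∀ q : ℕ, order ≤ q → ∀ (B : Type u) [CommRing B] [Algebra k B]
    (s t r : BaseField k m →ₐ[k] B) (g h : JetIdx m m q → B),
    IsSolutionJet ideal q s t g → IsSolutionJet ideal q t r h →
      IsSolutionJet ideal q s r (chain k g h)
  inv_mem : ∀ q : ℕ, order ≤ q → ∀ (B : Type u) [CommRing B] [Algebra k B]
    (s t : BaseField k m →ₐ[k] B) (g h : JetIdx m m q → B),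
    IsSolutionJet ideal q s t g → IsInvertibleJet q s h → chain k g h = idJet q s →
      IsSolutionJet ideal q t s h

namespace AlgebraicPseudogroup

variable {k : Type u} [Field k] {m : ℕ} (Γ : AlgebraicPseudogroup k m)

/-! ### The ring `k[Γ]` -/

/-- The ring `k[Γ]`. -/
def CoordRing : Type u := JetGroupoidRing k m ⧸ Γ.ideal

noncomputable instance : CommRing Γ.CoordRing :=
  inferInstanceAs (CommRing (JetGroupoidRing k m ⧸ Γ.ideal))

noncomputable instance : Algebra k Γ.CoordRing :=
  inferInstanceAs (Algebra k (JetGroupoidRing k m ⧸ Γ.ideal))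

/-- The canonical map from polynomials in `y` and the groupoid jets to `k[Γ]`. -/
noncomputable def toCoordRing : GroupoidPoly k m →ₐ[k] Γ.CoordRing :=
  (Ideal.Quotient.mkₐ k Γ.ideal).comp
    (IsScalarTower.toAlgHom k (GroupoidPoly k m) (JetGroupoidRing k m))

theorem isUnit_toCoordRing {f : GroupoidPoly k m} (hf : f ∈ groupoidDenominators k m) :
    IsUnit (Γ.toCoordRing f) :=
  (IsLocalization.map_units (JetGroupoidRing k m)
    (⟨f, hf⟩ : groupoidDenominators k m)).map (Ideal.Quotient.mkₐ k Γ.ideal)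

/-- The source map `k(y) → k[Γ]`. -/
noncomputable def source : BaseField k m →ₐ[k] Γ.CoordRing :=
  IsLocalization.liftAlgHom (M := nonZeroDivisors (MvPolynomial (Fin m) k))
    (f := Γ.toCoordRing.comp (MvPolynomial.rename Sum.inl))
    (fun p => Γ.isUnit_toCoordRing (Submonoid.subset_closure
      (Or.inl (Or.inl ⟨p.1, nonZeroDivisors.ne_zero p.2, rfl⟩))))

/-- The target map `k(ȳ) → k[Γ]`. -/
noncomputable def target : BaseField k m →ₐ[k] Γ.CoordRing :=
  IsLocalization.liftAlgHom (M := nonZeroDivisors (MvPolynomial (Fin m) k))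
    (f := Γ.toCoordRing.comp (MvPolynomial.rename fun u => Sum.inr (u, 0)))
    (fun p => Γ.isUnit_toCoordRing (Submonoid.subset_closure
      (Or.inl (Or.inr ⟨p.1, nonZeroDivisors.ne_zero p.2, rfl⟩))))

/-- The groupoid jet `∂^ν ȳ^u / ∂y^ν` in `k[Γ]`. -/
noncomputable def jet (p : Fin m × (Fin m →₀ ℕ)) : Γ.CoordRing :=
  Γ.toCoordRing (MvPolynomial.X (Sum.inr p))

/-- `k[Γ]` is an algebra over `k(y)` through the source map. -/
noncomputable instance : Algebra (BaseField k m) Γ.CoordRing :=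
  Γ.source.toRingHom.toAlgebra

/-! ### Automorphic extensions -/

/-- The `B`-valued points `a`, `b` of the jet space, of order `q` and generic, are related by the
transformation `g` of the groupoid `R_q` of `Γ`: `b` is the jet `g ∘ a`. -/
def Relates {n : ℕ} (q : ℕ∞) {B : Type*} [CommRing B] [Algebra k B]
    (a b : JetField k n m q →ₐ[k] B) (g : JetIdx m m q → B) : Prop :=
  IsSolutionJet Γ.ideal q (a.comp (baseIncl k n m q)) (b.comp (baseIncl k n m q)) g ∧
    ∀ p, b (jetCoord k n m q p) = chain k (fun p => a (jetCoord k n m q p)) g p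

/-- The field `L_q`, over its subfield `E`, is a principal homogeneous space for `R_q`, that is,
the graph of the action is an isomorphism: two points with the same differential invariants are
related by one and only one element of the groupoid, and elements of the groupoid preserve the
differential invariants. -/
def IsPHS {n : ℕ} (q : ℕ∞) (E : IntermediateField k (JetField k n m q)) : Prop :=
  ∀ (B : Type u) [CommRing B] [Algebra k B] (a b : JetField k n m q →ₐ[k] B),
    ((∀ x ∈ E, a x = b x) → ∃! g, Γ.Relates q a b g) ∧
    ((∃ g, Γ.Relates q a b g) → ∀ x ∈ E, a x = b x)

/-- `L/K`, with `L = k<y>`, is a differential automorphic extension for `Γ`. -/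
def IsAutomorphic {n : ℕ} (K : IntermediateField k (JetField k n m ⊤)) : Prop :=
  (∀ i, ∀ x ∈ K, totalDeriv k n m i x ∈ K) ∧
    ∀ q : ℕ, Γ.order ≤ q → Γ.IsPHS q (truncate K q)

/-! ### Infinitesimal transformations and the reciprocal distribution -/

/-- A section `η_q` over `k(y)` of the system `R_q(Y)` of infinitesimal Lie equations of `Γ`:
`id + ε η_q` is a solution of the finite Lie equations, where `ε² = 0`. -/
def IsInfinitesimal (q : ℕ∞) (η : JetIdx m m q → BaseField k m) : Prop :=
  ∃ t : BaseField k m →ₐ[k] DualNumber (BaseField k m),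
    IsSolutionJet Γ.ideal q (TrivSqZeroExt.inlAlgHom k (BaseField k m) (BaseField k m)) t
      (fun p => TrivSqZeroExt.inl (idJet q (AlgHom.id k (BaseField k m)) p) +
        TrivSqZeroExt.inr (η p))

/-- The distribution `Θ(q)`: the derivations `♯(η_q)` of `L_q`, with
`♯(η_q) = η^u ∂/∂y^u + η^u_r y^r_i ∂/∂y^u_i + (η^u_r y^r_ij + η^u_rs y^r_i y^s_j) ∂/∂y^u_ij + ⋯`. -/
def Theta (n : ℕ) (q : ℕ∞) : Set (Derivation k (JetField k n m q) (JetField k n m q)) :=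
  {θ | ∃ η, Γ.IsInfinitesimal q η ∧
    ∀ p, θ (jetCoord k n m q p) = chain k (jetCoord k n m q) (fun r => baseIncl k n m q (η r)) p}

/-- The derivation `δ` of `L_q` is invariant under the finite transformations of `Γ`: if the
points `a`, `b` are related by `g`, then `g` also relates the infinitesimally displaced jets
`y_q + ε δ y_q` at `a` and at `b`. -/
def IsInvariant {n : ℕ} {q : ℕ∞} (δ : Derivation k (JetField k n m q) (JetField k n m q)) :
    Prop :=
  ∀ (B : Type u) [CommRing B] [Algebra k B] (a b : JetField k n m q →ₐ[k] B)
    (g : JetIdx m m q → B), Γ.Relates q a b g →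
    ∀ p, (TrivSqZeroExt.inl (b (jetCoord k n m q p)) +
        TrivSqZeroExt.inr (b (δ (jetCoord k n m q p))) : DualNumber B) =
      chain k (fun r => TrivSqZeroExt.inl (a (jetCoord k n m q r)) +
          TrivSqZeroExt.inr (a (δ (jetCoord k n m q r))))
        (fun r => TrivSqZeroExt.inl (g r)) p

/-- `δ` is zero on `k(y)`. -/
def KillsBase {n : ℕ} {q : ℕ∞} (δ : Derivation k (JetField k n m q) (JetField k n m q)) : Prop :=
  ∀ c : BaseField k m, δ (baseIncl k n m q c) = 0

/-- The reciprocal distribution `Δ(q)` of `Γ`: the derivations of `L_q` which are zero on `k(y)`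
and commute with the action of `Γ`. Commuting with the finite transformations of `Γ` implies
commuting with `Θ(q)`, and is what this means if `Γ` has several components: for the isometries of
the plane, the rotation of all jets commutes with `Θ(q)` and preserves the differential
invariants, but does not commute with the reflections. -/
def Delta (n : ℕ) (q : ℕ∞) : Set (Derivation k (JetField k n m q) (JetField k n m q)) :=
  {δ | KillsBase δ ∧ Γ.IsInvariant δ}

end AlgebraicPseudogroup

/-! ### Constants -/

section Tensor

variable {k F : Type*} [Field k] [Field F] [Algebra k F] (E : IntermediateField k F)

/-- The map `x ↦ x ⊗ 1`. -/
noncomputable def leftMap : F →ₐ[k] F ⊗[E] F :=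
  (Algebra.TensorProduct.includeLeft : F →ₐ[E] F ⊗[E] F).restrictScalars k

/-- The map `x ↦ 1 ⊗ x`; one writes `x̄` for `1 ⊗ x`. -/
noncomputable def rightMap : F →ₐ[k] F ⊗[E] F :=
  (Algebra.TensorProduct.includeRight : F →ₐ[E] F ⊗[E] F).restrictScalars k

/-- The map `a ⊗ b ↦ a ⊗ b ⊗ 1`. -/
noncomputable def firstSecond : F ⊗[E] F →ₐ[k] F ⊗[E] (F ⊗[E] F) :=
  (Algebra.TensorProduct.map (AlgHom.id E F)
    (Algebra.TensorProduct.includeLeft : F →ₐ[E] F ⊗[E] F)).restrictScalars k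

/-- The map `a ⊗ b ↦ 1 ⊗ a ⊗ b`. -/
noncomputable def secondThird : F ⊗[E] F →ₐ[k] F ⊗[E] (F ⊗[E] F) :=
  (Algebra.TensorProduct.includeRight : F ⊗[E] F →ₐ[E] F ⊗[E] (F ⊗[E] F)).restrictScalars k

/-- The map `a ⊗ b ↦ a ⊗ 1 ⊗ b`. -/
noncomputable def firstThird : F ⊗[E] F →ₐ[k] F ⊗[E] (F ⊗[E] F) :=
  (Algebra.TensorProduct.map (AlgHom.id E F)
    (Algebra.TensorProduct.includeRight : F →ₐ[E] F ⊗[E] F)).restrictScalars k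

end Tensor

section Constants

variable {k F : Type*} [Field k] [Field F] [Algebra k F] (E : IntermediateField k F)
  (T : Type*) [CommRing T] [Algebra k T] [Algebra (F ⊗[E] F) T]

/-- The derivation `D` of `T`, an algebra over `F ⊗_E F` such as the tensor product itself or its
total ring of fractions, extends the derivation `δ` of `F` by acting on both factors. -/
def ExtendsToTensor (δ : Derivation k F F) (D : Derivation k T T) : Prop :=
  ∀ x : F, D (algebraMap (F ⊗[E] F) T (x ⊗ₜ 1)) = algebraMap (F ⊗[E] F) T (δ x ⊗ₜ 1) ∧
    D (algebraMap (F ⊗[E] F) T (1 ⊗ₜ x)) = algebraMap (F ⊗[E] F) T (1 ⊗ₜ δ x)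

/-- The derivation `δ` of `F` has one and only one extension to `T`. -/
def ExtendsUniquely (δ : Derivation k F F) : Prop :=
  ∃! D : Derivation k T T, ExtendsToTensor E T δ D

/-- The constants of `T`: the elements killed by (the extensions of) all `δ ∈ Δ`. -/
def cst (Δ : Set (Derivation k F F)) : Set T :=
  {z | ∀ δ ∈ Δ, ∀ D : Derivation k T T, ExtendsToTensor E T δ D → D z = 0}

end Constants

/-! ### Direct sums of differential fields -/

/-- The ring `Q` with derivations `d` is a direct sum of finitely many differential fields. -/
def IsDirectSumOfDifferentialFields {k : Type u} [Field k] {Q : Type u} [CommRing Q] [Algebra k Q]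
    {N : ℕ} (d : Fin N → Derivation k Q Q) : Prop :=
  ∃ (c : ℕ) (F : Fin c → Type u) (_ : ∀ i, Field (F i)) (_ : ∀ i, Algebra k (F i))
    (dF : ∀ i, Fin N → Derivation k (F i) (F i)) (e : Q ≃ₐ[k] (∀ i, F i)),
    (∀ i r s x, dF i r (dF i s x) = dF i s (dF i r x)) ∧
      ∀ r x i, e (d r x) i = dF i r (e x i)

/-! ### Hopf rings over `k(y)` -/

/-- The ring `H ⊗_R H` of composable pairs, the left factor being an algebra over `R` through the
target map and the right factor through the source map. -/
abbrev ComposableRing {k R H : Type u} [CommRing k] [CommRing R] [CommRing H] [Algebra k R]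
    [Algebra k H] (src tgt : R →ₐ[k] H) : Type u :=
  (H ⊗[k] H) ⧸ Ideal.span (Set.range fun r : R => tgt r ⊗ₜ[k] (1 : H) - (1 : H) ⊗ₜ[k] src r)

/-- The structure maps of a commutative Hopf ring (the ring of functions of a groupoid) `H` over
the ring `R` of functions of the objects. -/
structure HopfRing (k R H : Type u) [CommRing k] [CommRing R] [CommRing H] [Algebra k R]
    [Algebra k H] where
  src : R →ₐ[k] H
  tgt : R →ₐ[k] H
  /-- The augmentation. -/
  counit : H →ₐ[k] R
  antipode : H →ₐ[k] H
  /-- The diagonal. -/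
  comul : H →ₐ[k] ComposableRing src tgt

namespace HopfRing

variable {k R H : Type u} [CommRing k] [CommRing R] [CommRing H] [Algebra k R] [Algebra k H]
  (S : HopfRing k R H)

/-- The composition of points `x`, `y` with values in `B` induced by the diagonal, when the
target of `x` is the source of `y`. -/
noncomputable def conv {B : Type*} [CommRing B] [Algebra k B] (x y : H →ₐ[k] B)
    (h : x.comp S.tgt = y.comp S.src) : H →ₐ[k] B :=
  (Ideal.Quotient.liftₐ (Ideal.span (Set.range fun r : R =>
      S.tgt r ⊗ₜ[k] (1 : H) - (1 : H) ⊗ₜ[k] S.src r))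
    (Algebra.TensorProduct.productMap x y) (fun a ha => by
      have hle : Ideal.span (Set.range fun r : R =>
          S.tgt r ⊗ₜ[k] (1 : H) - (1 : H) ⊗ₜ[k] S.src r) ≤
          RingHom.ker (Algebra.TensorProduct.productMap x y) := by
        rw [Ideal.span_le]
        rintro _ ⟨r, rfl⟩
        have hr : x (S.tgt r) = y (S.src r) := DFunLike.congr_fun h r
        simp [RingHom.mem_ker, hr]
      exact hle ha)).comp S.comul

/-- The axioms of a Hopf ring, dual to those of a groupoid. Each is the commutativity of a
diagram of algebras, written on points with values in an arbitrary commutative algebra. -/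
structure IsHopf : Prop where
  counit_src : S.counit.comp S.src = AlgHom.id k R
  counit_tgt : S.counit.comp S.tgt = AlgHom.id k R
  antipode_src : S.antipode.comp S.src = S.tgt
  antipode_tgt : S.antipode.comp S.tgt = S.src
  conv_src : ∀ (B : Type u) [CommRing B] [Algebra k B] (x y : H →ₐ[k] B) h,
    (S.conv x y h).comp S.src = x.comp S.src
  conv_tgt : ∀ (B : Type u) [CommRing B] [Algebra k B] (x y : H →ₐ[k] B) h,
    (S.conv x y h).comp S.tgt = y.comp S.tgt
  conv_assoc : ∀ (B : Type u) [CommRing B] [Algebra k B] (x y z : H →ₐ[k] B) h₁ h₂ h₃ h₄,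
    S.conv (S.conv x y h₁) z h₂ = S.conv x (S.conv y z h₃) h₄
  unit_conv : ∀ (B : Type u) [CommRing B] [Algebra k B] (x : H →ₐ[k] B) h,
    S.conv ((x.comp S.src).comp S.counit) x h = x
  conv_unit : ∀ (B : Type u) [CommRing B] [Algebra k B] (x : H →ₐ[k] B) h,
    S.conv x ((x.comp S.tgt).comp S.counit) h = x
  conv_antipode : ∀ (B : Type u) [CommRing B] [Algebra k B] (x : H →ₐ[k] B) h,
    S.conv x (x.comp S.antipode) h = (x.comp S.src).comp S.counit
  antipode_conv : ∀ (B : Type u) [CommRing B] [Algebra k B] (x : H →ₐ[k] B) h,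
    S.conv (x.comp S.antipode) x h = (x.comp S.tgt).comp S.counit

end HopfRing

end DiffGalois

open DiffGalois

/-!
The idea is to read everything off points. A point of the field `L_q` with values in a ring `B` is a
generic jet, a point of `k[Γ]` is a groupoid jet of infinite order (`exists_coordHom`), and a point
of `L_q ⊗ L_q` over `K_q` is a pair of generic jets agreeing on the invariants (`IsTensorSquare`).
That `L / K` is automorphic says that such a pair is related by exactly one groupoid jet (`IsPHS`);
by uniqueness this passes from finite orders to infinite order (`IsAutomorphic.isPHS`). The identity
of `L ⊗_K L` is therefore a universal pair, related by a universal transformation `g` with values in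
`L ⊗_K L`, and `j : k[Γ] → L ⊗_K L` is the point `g`. The composition law of jets is proved for
indeterminate jets, where a composite is determined by its derivatives (`eq_fullChain`); it makes
`k[Γ]` a Hopf ring (`exists_representsGroupoid`), and uniqueness of transformations identifies its
structure maps (`IsPHS.exists_hopfRing`). A homomorphism to dual numbers is a displacement of a
point along a derivation. An element of the reciprocal distribution displaces the universal pair
without changing the transformation relating it, so that it acts on `L_q ⊗ L_q`
(`IsPHS.exists_extension`) and kills `g` (`IsPHS.extension_eq_zero`); two displacements give the
commutation with `Θ(q)` (`commutator_eq_zero`).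

Most of the other claims rest on one linear fact: a subspace of `F ⊗ A` stable under a set of
derivations of the field `F` is spanned by its elements with constant coefficients
(`le_span_constants`). For the characterization of the reciprocal distribution by `Θ(q)` one needs
the constants of `Θ(q)`. A derivation of `L_q` over `K_q` is an infinitesimal transformation with
coefficients in `L_q`, whose coordinates in a basis over `k(y)` are elements of `Θ(q)`
(`IsPHS.exists_infinitesimal`); so all derivations over `K_q` kill the constants of `Θ(q)`, which
are then algebraic over `K_q` (`IsPHS.isAlgebraic_of_theta`). The deviation from invariance of a
derivation commuting with `Θ(q)` spans a stable subspace of the kernel of `L_q ⊗ L_q → L_q`, which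
contains no nonzero element with coefficients in `K_q`, and so is zero
(`IsPHS.mem_delta_of_commutator_eq_zero`).

The reciprocal distribution has maximal rank because the tangent map of the universal transformation
is a cocycle (`chainTangent_chain`), hence a coboundary by faithfully flat descent, which is
elementary over a field (`IsContraction.exists_basis`): the invariant differential forms contain a
basis, and the dual basis is in the reciprocal distribution (`IsPHS.exists_mem_span_delta`).
Consequently its constants in `L` are `k(y)` (`IsPHS.exists_baseIncl_eq`).

The map `j` is injective since every groupoid jet relates two generic jets over an extension of its
ring of values (`exists_relates_of_isSolutionJet`). Then `L ⊗_{k(y)} k[Γ] → L ⊗_K L` is injective,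
its kernel being stable under the reciprocal distribution (`IsPHS.injective_tensorCoordHom`), and by
the chain rule `L ⊗_K L` consists of fractions of the image; the total rings of fractions agree
(`IsPHS.exists_fractionRing_equiv`). The same argument for the denominators of a constant gives the
constants of `Q(L ⊗_K L)` (`IsPHS.range_fractionHom`).

What remains is that `Q(L ⊗_K L)` and `k(Γ)` are finite products of fields; derivations preserve the
factors automatically (`isDirectSumOfDifferentialFields`). In characteristic zero `L ⊗_K L` is
reduced (`isReduced_tensorSquare`), and it has finitely many minimal primes as soon as the elements
of `L` algebraic over `K` are in a finitely generated extension of `K`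
(`finite_minimalPrimes_tensorSquare`). They are in the field generated by the jets up to the order
of `Γ`: if two related generic jets agree up to this order, the groupoid jet relating them is the
identity up to this order, and its powers depend polynomially on the exponent
(`exists_polynomial_jetPow`). So it belongs to a one-parameter group, along which the elements
algebraic over the invariants cannot move (`IsAutomorphic.eq_of_isAlgebraic`).
-/

namespace DiffGalois

/-! ### The chain rule -/

@[elab_as_elim]
theorem multiIndex_induction {d : ℕ} {motive : (Fin d →₀ ℕ) → Prop} (μ : Fin d →₀ ℕ)
    (zero : motive 0) (add_single : ∀ μ i, motive μ → motive (μ + Finsupp.single i 1)) :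
    motive μ := by
  induction h : μ.degree generalizing μ with
  | zero => rwa [(Finsupp.degree_eq_zero_iff μ).1 h]
  | succ N ih =>
    obtain ⟨i, hi⟩ : ∃ i, μ i ≠ 0 := by
      by_contra! h'
      have : μ = 0 := Finsupp.ext h'
      simp [this] at h
    have hμ : μ - Finsupp.single i 1 + Finsupp.single i 1 = μ :=
      tsub_add_cancel_of_le (Finsupp.single_le_iff.2 (Nat.one_le_iff_ne_zero.2 hi))
    rw [← hμ]
    apply add_single
    apply ih
    rw [← hμ, map_add, Finsupp.degree_single] at h
    omega

section Chain

variable (k : Type u) [Field k] {n m : ℕ} {B : Type*} [CommRing B] [Algebra k B]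

/-- Composition of jets of unrestricted order: the jet of `g ∘ f`, where `a` is the jet of `f`. -/
noncomputable def fullChain (a : Fin m × (Fin n →₀ ℕ) → B) (g : Fin m × (Fin m →₀ ℕ) → B) :
    Fin m × (Fin n →₀ ℕ) → B :=
  fun p => MvPolynomial.aeval (Sum.elim a g) (chainPoly k n m p)

theorem chainDeriv_X_inl (i : Fin n) (p : Fin m × (Fin n →₀ ℕ)) :
    chainDeriv k n m i (MvPolynomial.X (Sum.inl p)) =
      MvPolynomial.X (Sum.inl (p.1, p.2 + Finsupp.single i 1)) := by
  simp [chainDeriv, MvPolynomial.mkDerivation_X]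

theorem chainDeriv_X_inr (i : Fin n) (p : Fin m × (Fin m →₀ ℕ)) :
    chainDeriv k n m i (MvPolynomial.X (Sum.inr p)) =
      ∑ r : Fin m, MvPolynomial.X (Sum.inl (r, Finsupp.single i 1)) *
        MvPolynomial.X (Sum.inr (p.1, p.2 + Finsupp.single r 1)) := by
  simp [chainDeriv, MvPolynomial.mkDerivation_X]

/-- The total derivatives commute. -/
theorem chainDeriv_comm (i j : Fin n) (f : ChainRing k n m) :
    chainDeriv k n m i (chainDeriv k n m j f) = chainDeriv k n m j (chainDeriv k n m i f) := by
  have h : ⁅chainDeriv k n m i, chainDeriv k n m j⁆ = 0 := by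
    apply MvPolynomial.derivation_ext
    rintro (p | p)
    · simp only [Derivation.commutator_apply, chainDeriv_X_inl, Derivation.coe_zero, Pi.zero_apply]
      rw [add_right_comm, sub_self]
    · simp only [Derivation.commutator_apply, chainDeriv_X_inr, Derivation.coe_zero, Pi.zero_apply,
        map_sum, Derivation.leibniz, chainDeriv_X_inl, smul_eq_mul, Finset.sum_add_distrib,
        Finset.mul_sum]
      rw [sub_eq_zero]
      congr 1
      · rw [Finset.sum_comm]
        refine Finset.sum_congr rfl fun r _ => Finset.sum_congr rfl fun s _ => ?_
        rw [add_right_comm, mul_left_comm]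
      · refine Finset.sum_congr rfl fun r _ => ?_
        rw [add_comm (Finsupp.single j 1)]
  have := DFunLike.congr_fun h f
  rwa [Derivation.commutator_apply, Derivation.coe_zero, Pi.zero_apply, sub_eq_zero] at this

theorem chainPoly_zero (u : Fin m) :
    chainPoly k n m (u, 0) = MvPolynomial.X (Sum.inr (u, 0)) := by
  have : ((List.finRange n).map fun i => ((chainDeriv k n m i : ChainRing k n m →ₗ[k]
      ChainRing k n m) : Module.End k (ChainRing k n m)) ^ ((0 : Fin n →₀ ℕ) i)).prod = 1 := by
    apply List.prod_eq_one
    intro x hx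
    obtain ⟨i, -, rfl⟩ := List.mem_map.1 hx
    simp
  rw [chainPoly, this]
  rfl

/-- The product of the powers of commuting elements, for an exponent raised by one: in a list
without repetition a single factor changes. -/
theorem prod_pow_add_single {M : Type*} [Monoid M] (d : Fin n → M)
    (hd : ∀ i j, Commute (d i) (d j)) (μ : Fin n →₀ ℕ) (i : Fin n) (l : List (Fin n))
    (hl : l.Nodup) :
    (l.map fun j => d j ^ ((μ + Finsupp.single i 1 : Fin n →₀ ℕ) j)).prod =
      if i ∈ l then d i * (l.map fun j => d j ^ μ j).prod
      else (l.map fun j => d j ^ μ j).prod := by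
  classical
  induction l with
  | nil => simp
  | cons a l ih =>
    rw [List.nodup_cons] at hl
    rw [List.map_cons, List.map_cons, List.prod_cons, List.prod_cons, ih hl.2]
    by_cases ha : i = a
    · subst ha
      simp only [hl.1, if_false, List.mem_cons, true_or, if_true, Finsupp.add_apply,
        Finsupp.single_eq_same]
      rw [pow_succ', mul_assoc]
    · have h1 : (μ + Finsupp.single i 1 : Fin n →₀ ℕ) a = μ a := by
        simp [ha]
      simp only [List.mem_cons, ha, false_or, h1]
      split_ifs
      · rw [← mul_assoc, ← mul_assoc, ((hd i a).pow_right _).eq]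
      · rfl

/-- The chain rule of one order more is obtained by a further total derivative, in any order. -/
theorem chainPoly_add_single (u : Fin m) (μ : Fin n →₀ ℕ) (i : Fin n) :
    chainPoly k n m (u, μ + Finsupp.single i 1) =
      chainDeriv k n m i (chainPoly k n m (u, μ)) := by
  unfold chainPoly
  rw [prod_pow_add_single (fun i => ((chainDeriv k n m i : ChainRing k n m →ₗ[k]
      ChainRing k n m) : Module.End k (ChainRing k n m)))
    (fun i j => LinearMap.ext fun f => chainDeriv_comm k i j f) μ i _ (List.nodup_finRange n),
    if_pos (List.mem_finRange i)]
  rfl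

theorem fullChain_zero (a : Fin m × (Fin n →₀ ℕ) → B) (g : Fin m × (Fin m →₀ ℕ) → B)
    (u : Fin m) : fullChain k a g (u, 0) = g (u, 0) := by
  simp [fullChain, chainPoly_zero]

/-- If derivations `D i` of `B` act on the jets `a` and `g` in the way of the total derivatives,
then they shift the orders of the composite jet. -/
theorem deriv_fullChain (D : Fin n → Derivation k B B) {a : Fin m × (Fin n →₀ ℕ) → B}
    {g : Fin m × (Fin m →₀ ℕ) → B}
    (ha : ∀ i u μ, D i (a (u, μ)) = a (u, μ + Finsupp.single i 1))
    (hg : ∀ i u ν, D i (g (u, ν)) =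
      ∑ r, a (r, Finsupp.single i 1) * g (u, ν + Finsupp.single r 1))
    (i : Fin n) (f : ChainRing k n m) :
    D i (MvPolynomial.aeval (Sum.elim a g) f) =
      MvPolynomial.aeval (Sum.elim a g) (chainDeriv k n m i f) := by
  induction f using MvPolynomial.induction_on with
  | C c =>
    rw [← MvPolynomial.algebraMap_eq]
    simp
  | add p q hp hq => simp [hp, hq]
  | mul_X p s hp =>
    simp only [map_mul, Derivation.leibniz, hp, MvPolynomial.aeval_X, map_add, smul_eq_mul]
    congr 2
    rcases s with ⟨u, μ⟩ | ⟨u, ν⟩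
    · simp [ha, chainDeriv_X_inl]
    · simp [hg, chainDeriv_X_inr]

/-- In the presence of derivations of `B` inducing the total derivatives, the composite jet is
obtained from its part of order zero by differentiation. -/
theorem eq_fullChain (D : Fin n → Derivation k B B) {a : Fin m × (Fin n →₀ ℕ) → B}
    {g : Fin m × (Fin m →₀ ℕ) → B}
    (ha : ∀ i u μ, D i (a (u, μ)) = a (u, μ + Finsupp.single i 1))
    (hg : ∀ i u ν, D i (g (u, ν)) =
      ∑ r, a (r, Finsupp.single i 1) * g (u, ν + Finsupp.single r 1))
    (b : Fin m × (Fin n →₀ ℕ) → B) (h0 : ∀ u, b (u, 0) = g (u, 0))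
    (hb : ∀ i u μ, D i (b (u, μ)) = b (u, μ + Finsupp.single i 1)) :
    fullChain k a g = b := by
  funext ⟨u, μ⟩
  induction μ using multiIndex_induction with
  | zero => rw [fullChain_zero, h0]
  | add_single μ i ih =>
    rw [← hb, ← ih, fullChain, fullChain, chainPoly_add_single, deriv_fullChain k D ha hg]

theorem map_fullChain {C : Type*} [CommRing C] [Algebra k C] (φ : B →ₐ[k] C)
    (a : Fin m × (Fin n →₀ ℕ) → B) (g : Fin m × (Fin m →₀ ℕ) → B) (p : Fin m × (Fin n →₀ ℕ)) :
    φ (fullChain k a g p) = fullChain k (fun r => φ (a r)) (fun r => φ (g r)) p := by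
  have h : φ.comp (MvPolynomial.aeval (Sum.elim a g)) =
      MvPolynomial.aeval (Sum.elim (fun r => φ (a r)) fun r => φ (g r)) := by
    ext (r | r) <;> simp
  exact DFunLike.congr_fun h _

theorem fullChain_eq_of_eq {a a' : Fin m × (Fin n →₀ ℕ) → B} {g g' : Fin m × (Fin m →₀ ℕ) → B}
    (ha : a = a') (hg : g = g') (p : Fin m × (Fin n →₀ ℕ)) :
    fullChain k a g p = fullChain k a' g' p := by
  rw [ha, hg]

open MvPolynomial in
/-- Composition of jets is associative. -/
theorem fullChain_assoc (a : Fin m × (Fin n →₀ ℕ) → B) (g h : Fin m × (Fin m →₀ ℕ) → B) :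
    fullChain k (fullChain k a g) h = fullChain k a (fullChain k g h) := by
  -- It suffices to treat the universal case, where all the coordinates are indeterminates: both
  -- sides are then the iterated total derivatives of the part of order zero of `h`.
  let σ := (Fin m × (Fin n →₀ ℕ)) ⊕ ((Fin m × (Fin m →₀ ℕ)) ⊕ (Fin m × (Fin m →₀ ℕ)))
  let A : Fin m × (Fin n →₀ ℕ) → MvPolynomial σ k := fun p => X (Sum.inl p)
  let G : Fin m × (Fin m →₀ ℕ) → MvPolynomial σ k := fun p => X (Sum.inr (Sum.inl p))
  let H : Fin m × (Fin m →₀ ℕ) → MvPolynomial σ k := fun p => X (Sum.inr (Sum.inr p))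
  let D : Fin n → Derivation k (MvPolynomial σ k) (MvPolynomial σ k) := fun i =>
    mkDerivation k (Sum.elim (fun p => A (p.1, p.2 + Finsupp.single i 1))
      (Sum.elim (fun p => ∑ r, A (r, Finsupp.single i 1) * G (p.1, p.2 + Finsupp.single r 1))
        (fun p => ∑ r, fullChain k A G (r, Finsupp.single i 1) *
          H (p.1, p.2 + Finsupp.single r 1))))
  have hA : ∀ i u μ, D i (A (u, μ)) = A (u, μ + Finsupp.single i 1) := fun i u μ => by
    simp only [D, A, mkDerivation_X, Sum.elim_inl]
  have hG : ∀ i u ν, D i (G (u, ν)) =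
      ∑ r, A (r, Finsupp.single i 1) * G (u, ν + Finsupp.single r 1) := fun i u ν => by
    simp only [D, G, mkDerivation_X, Sum.elim_inl, Sum.elim_inr]
  have hH : ∀ i u ν, D i (H (u, ν)) =
      ∑ r, fullChain k A G (r, Finsupp.single i 1) * H (u, ν + Finsupp.single r 1) :=
    fun i u ν => by simp only [D, H, mkDerivation_X, Sum.elim_inr]
  have hAG : ∀ i u μ, D i (fullChain k A G (u, μ)) =
      fullChain k A G (u, μ + Finsupp.single i 1) := fun i u μ => by
    rw [fullChain, fullChain, chainPoly_add_single, deriv_fullChain k D hA hG]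
  have hGH : ∀ i (f : ChainRing k m m), D i (aeval (Sum.elim G H) f) =
      ∑ r, A (r, Finsupp.single i 1) * aeval (Sum.elim G H) (chainDeriv k m m r f) := by
    intro i f
    induction f using MvPolynomial.induction_on with
    | C c => simp [← MvPolynomial.algebraMap_eq]
    | add p q hp hq => simp only [map_add, hp, hq, mul_add, Finset.sum_add_distrib]
    | mul_X p s hp =>
      simp only [map_mul, Derivation.leibniz, hp, MvPolynomial.aeval_X, map_add, smul_eq_mul,
        mul_add, Finset.sum_add_distrib, Finset.mul_sum]
      congr 1
      · rcases s with ⟨u, ν⟩ | ⟨u, ν⟩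
        · simp only [Sum.elim_inl, hG, chainDeriv_X_inl, aeval_X, Finset.mul_sum]
          exact Finset.sum_congr rfl fun r _ => by ring
        · simp only [Sum.elim_inr, hH, chainDeriv_X_inr, map_sum, map_mul, aeval_X, Sum.elim_inl,
            Finset.mul_sum]
          rw [Finset.sum_comm]
          refine Finset.sum_congr rfl fun r _ => ?_
          rw [← zero_add (Finsupp.single i 1), ← hAG, fullChain_zero, hG, Finset.sum_mul,
            Finset.mul_sum]
          refine Finset.sum_congr rfl fun s _ => ?_
          rw [zero_add, zero_add]
          ring
      · exact Finset.sum_congr rfl fun r _ => by ring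
  have key : fullChain k (fullChain k A G) H = fullChain k A (fullChain k G H) := by
    apply eq_fullChain k D hAG hH
    · intro u
      rw [fullChain_zero, fullChain_zero]
    · intro i u μ
      rw [fullChain, fullChain, chainPoly_add_single, deriv_fullChain k D hA]
      intro i u ν
      rw [fullChain, hGH]
      simp only [fullChain, chainPoly_add_single]
  funext p
  have := congrArg (aeval (R := k) (Sum.elim a (Sum.elim g h))) (congrFun key p)
  rw [map_fullChain, map_fullChain] at this
  convert this using 2
  · funext r
    rw [map_fullChain]
    simp only [A, G, aeval_X, Sum.elim_inl, Sum.elim_inr]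
  · simp only [H, aeval_X, Sum.elim_inr]
  · simp only [A, aeval_X, Sum.elim_inl]
  · funext r
    rw [map_fullChain]
    simp only [H, G, aeval_X, Sum.elim_inl, Sum.elim_inr]

open MvPolynomial in
/-- The composite jet depends linearly on the jet of the second map. -/
theorem fullChain_add_mul (a : Fin m × (Fin n →₀ ℕ) → B) (g h : Fin m × (Fin m →₀ ℕ) → B)
    (c : B) (p : Fin m × (Fin n →₀ ℕ)) :
    fullChain k a (fun r => g r + c * h r) p = fullChain k a g p + c * fullChain k a h p := by
  -- As for associativity, it suffices to treat indeterminate jets, with an indeterminate constant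
  -- `c`.
  let σ := (Fin m × (Fin n →₀ ℕ)) ⊕ ((Fin m × (Fin m →₀ ℕ)) ⊕ (Fin m × (Fin m →₀ ℕ)) ⊕ Unit)
  let A : Fin m × (Fin n →₀ ℕ) → MvPolynomial σ k := fun p => X (Sum.inl p)
  let G : Fin m × (Fin m →₀ ℕ) → MvPolynomial σ k := fun p => X (Sum.inr (Sum.inl p))
  let H : Fin m × (Fin m →₀ ℕ) → MvPolynomial σ k := fun p => X (Sum.inr (Sum.inr (Sum.inl p)))
  let c' : MvPolynomial σ k := X (Sum.inr (Sum.inr (Sum.inr ())))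
  let D : Fin n → Derivation k (MvPolynomial σ k) (MvPolynomial σ k) := fun i =>
    mkDerivation k (Sum.elim (fun p => A (p.1, p.2 + Finsupp.single i 1))
      (Sum.elim (fun p => ∑ r, A (r, Finsupp.single i 1) * G (p.1, p.2 + Finsupp.single r 1))
        (Sum.elim (fun p => ∑ r, A (r, Finsupp.single i 1) *
          H (p.1, p.2 + Finsupp.single r 1)) (fun _ => 0))))
  have hA : ∀ i u μ, D i (A (u, μ)) = A (u, μ + Finsupp.single i 1) := fun i u μ => by
    simp only [D, A, mkDerivation_X, Sum.elim_inl]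
  have hG : ∀ i u ν, D i (G (u, ν)) =
      ∑ r, A (r, Finsupp.single i 1) * G (u, ν + Finsupp.single r 1) := fun i u ν => by
    simp only [D, G, mkDerivation_X, Sum.elim_inl, Sum.elim_inr]
  have hH : ∀ i u ν, D i (H (u, ν)) =
      ∑ r, A (r, Finsupp.single i 1) * H (u, ν + Finsupp.single r 1) :=
    fun i u ν => by simp only [D, H, mkDerivation_X, Sum.elim_inr, Sum.elim_inl]
  have hc : ∀ i, D i c' = 0 := fun i => by simp only [D, c', mkDerivation_X, Sum.elim_inr]
  have key : fullChain k A (fun r => G r + c' * H r) =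
      fun p => fullChain k A G p + c' * fullChain k A H p := by
    apply eq_fullChain k D hA
    · intro i u ν
      simp only [map_add, Derivation.leibniz, hc, mul_zero, add_zero, hG, hH, smul_eq_mul,
        mul_add, Finset.sum_add_distrib, Finset.mul_sum, mul_left_comm]
    · intro u
      simp only [fullChain_zero]
    · intro i u μ
      simp only [map_add, Derivation.leibniz, hc, mul_zero, add_zero, smul_eq_mul, fullChain,
        chainPoly_add_single, deriv_fullChain k D hA hG, deriv_fullChain k D hA hH]
  have := congrArg (aeval (R := k) (Sum.elim a (Sum.elim g (Sum.elim h fun _ => c))))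
    (congrFun key p)
  rw [map_fullChain, map_add, map_mul, map_fullChain, map_fullChain] at this
  simpa only [A, G, H, c', map_add, map_mul, aeval_X, Sum.elim_inl, Sum.elim_inr] using this

open Classical in
/-- The jet of the identity at the point `s`. -/
noncomputable def fullId (s : Fin m → B) (p : Fin m × (Fin m →₀ ℕ)) : B :=
  if p.2 = 0 then s p.1 else if p.2 = Finsupp.single p.1 1 then 1 else 0

theorem fullId_zero (s : Fin m → B) (u : Fin m) : fullId s (u, 0) = s u := by
  simp [fullId]

theorem fullId_single (s : Fin m → B) (u r : Fin m) :
    fullId s (u, Finsupp.single r 1) = if r = u then 1 else 0 := by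
  classical
  simp [fullId, Finsupp.single_left_inj]

theorem fullId_add_single (s : Fin m → B) (u r : Fin m) {ν : Fin m →₀ ℕ} (hν : ν ≠ 0) :
    fullId s (u, ν + Finsupp.single r 1) = 0 := by
  have h : 2 ≤ (ν + Finsupp.single r 1).degree := by
    have : ν.degree ≠ 0 := fun h => hν ((Finsupp.degree_eq_zero_iff _).1 h)
    rw [map_add, Finsupp.degree_single]
    omega
  rw [fullId, if_neg, if_neg]
  · intro h'
    have h' : ν + Finsupp.single r 1 = Finsupp.single u 1 := h'
    rw [h', Finsupp.degree_single] at h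
    omega
  · intro h'
    have h' : ν + Finsupp.single r 1 = 0 := h'
    rw [h', map_zero] at h
    omega

theorem map_fullId {C : Type*} [CommRing C] (φ : B →+* C) (s : Fin m → B)
    (p : Fin m × (Fin m →₀ ℕ)) : φ (fullId s p) = fullId (fun u => φ (s u)) p := by
  unfold fullId
  split_ifs <;> simp

open MvPolynomial in
/-- The jet of the identity is neutral on the left of a composite `id ∘ f`. -/
theorem fullChain_id (a : Fin m × (Fin n →₀ ℕ) → B) (s : Fin m → B) (hs : ∀ u, s u = a (u, 0)) :
    fullChain k a (fullId s) = a := by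
  -- For indeterminate jets `A` both sides are the iterated derivatives of `A (u, 0)`.
  let A : Fin m × (Fin n →₀ ℕ) → MvPolynomial (Fin m × (Fin n →₀ ℕ)) k := X
  let D : Fin n → Derivation k (MvPolynomial (Fin m × (Fin n →₀ ℕ)) k) _ := fun i =>
    mkDerivation k fun p => A (p.1, p.2 + Finsupp.single i 1)
  have hA : ∀ i u μ, D i (A (u, μ)) = A (u, μ + Finsupp.single i 1) := fun i u μ => by
    simp only [D, A, mkDerivation_X]
  have key : fullChain k A (fullId fun u => A (u, 0)) = A := by
    apply eq_fullChain k D hA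
    · intro i u ν
      by_cases hν : ν = 0
      · subst hν
        rw [fullId_zero, hA]
        simp [fullId_single]
      · rw [Finset.sum_eq_zero fun r _ => by rw [fullId_add_single _ _ _ hν, mul_zero], fullId,
          if_neg hν]
        split_ifs
        · exact Derivation.map_one_eq_zero _
        · exact map_zero _
    · intro u
      rw [fullId_zero]
    · exact hA
  funext p
  have := congrArg (aeval (R := k) a) (congrFun key p)
  rw [map_fullChain] at this
  convert this using 2
  · funext r
    simp only [A, aeval_X]
  · funext r
    rw [← AlgHom.coe_toRingHom, map_fullId]
    simp [A, ← hs]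
  · simp only [A, aeval_X]

open MvPolynomial in
/-- The jet of the identity is neutral on the right of a composite `g ∘ id`. -/
theorem fullId_chain (g : Fin m × (Fin m →₀ ℕ) → B) (s : Fin m → B) :
    fullChain k (fullId s) g = g := by
  -- For indeterminate jets, the derivations `∂_r` of the jet groupoid ring see the identity as a
  -- map of the space of the `y` to itself.
  let S : Fin m → GroupoidPoly k m := fun u => X (Sum.inl u)
  let G : Fin m × (Fin m →₀ ℕ) → GroupoidPoly k m := fun p => X (Sum.inr p)
  have hG : ∀ i u ν, groupoidDeriv k m i (G (u, ν)) = G (u, ν + Finsupp.single i 1) :=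
    fun i u μ => by simp only [G, groupoidDeriv, mkDerivation_X, Sum.elim_inr]
  have key : fullChain k (fullId S) G = G := by
    apply eq_fullChain k (groupoidDeriv k m)
    · intro i u μ
      by_cases hμ : μ = 0
      · subst hμ
        rw [fullId_zero, zero_add, fullId_single]
        simp only [S, groupoidDeriv, mkDerivation_X, Sum.elim_inl, eq_comm]
      · rw [fullId_add_single _ _ _ hμ, fullId, if_neg hμ]
        split_ifs
        · exact Derivation.map_one_eq_zero _
        · exact map_zero _
    · intro i u ν
      rw [hG]
      simp [fullId_single]
    · intro u
      rfl
    · exact hG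
  funext p
  have := congrArg (aeval (R := k) (Sum.elim s g)) (congrFun key p)
  rw [map_fullChain] at this
  convert this using 2
  · funext r
    rw [← AlgHom.coe_toRingHom, map_fullId]
    simp [S]
  · simp only [G, aeval_X, Sum.elim_inr]
  · simp only [G, aeval_X, Sum.elim_inr]

end Chain

/-! ### Orders in the chain rule, inverse jets -/

section ChainOrder

open MvPolynomial

variable (k : Type u) [Field k] {n m : ℕ} {B : Type*} [CommRing B] [Algebra k B]

theorem derivation_mem_supported {σ : Type*}
    (d : Derivation k (MvPolynomial σ k) (MvPolynomial σ k)) {s t : Set σ} (hst : s ⊆ t)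
    (hd : ∀ i ∈ s, d (X i) ∈ supported k t) {f : MvPolynomial σ k}
    (hf : f ∈ supported k s) : d f ∈ supported k t := by
  rw [supported_eq_adjoin_X] at hf
  induction hf using Algebra.adjoin_induction with
  | mem x hx =>
    obtain ⟨i, hi, rfl⟩ := hx
    exact hd i hi
  | algebraMap r => simp
  | add x y _ _ hx hy => rw [map_add]; exact add_mem hx hy
  | mul x y hx' hy' hx hy =>
    rw [← supported_eq_adjoin_X] at hx' hy'
    rw [Derivation.leibniz]
    exact add_mem (mul_mem (supported_mono hst hx') hy) (mul_mem (supported_mono hst hy') hx)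

/-- The variables of the chain rule: jets of the first map of order positive and less than `N`,
and jets of the second map of order at most `M`. -/
def chainVars (n m N M : ℕ) : Set ((Fin m × (Fin n →₀ ℕ)) ⊕ (Fin m × (Fin m →₀ ℕ))) :=
  {s | (∀ p, s = Sum.inl p → p.2 ≠ 0 ∧ p.2.degree < N) ∧ ∀ p, s = Sum.inr p → p.2.degree ≤ M}

theorem inl_mem_chainVars {N M : ℕ} {p : Fin m × (Fin n →₀ ℕ)} :
    Sum.inl p ∈ chainVars n m N M ↔ p.2 ≠ 0 ∧ p.2.degree < N :=
  ⟨fun h => h.1 p rfl, fun h => ⟨fun _ hp => Sum.inl_injective hp ▸ h, fun _ hp => by simp at hp⟩⟩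

theorem inr_mem_chainVars {N M : ℕ} {p : Fin m × (Fin m →₀ ℕ)} :
    Sum.inr p ∈ chainVars n m N M ↔ p.2.degree ≤ M :=
  ⟨fun h => h.2 p rfl, fun h => ⟨fun _ hp => by simp at hp, fun _ hp => Sum.inr_injective hp ▸ h⟩⟩

theorem chainVars_mono {N M N' M' : ℕ} (hN : N ≤ N') (hM : M ≤ M') :
    chainVars n m N M ⊆ chainVars n m N' M' := fun _ hs =>
  ⟨fun p hp => ⟨(hs.1 p hp).1, (hs.1 p hp).2.trans_le hN⟩, fun p hp => (hs.2 p hp).trans hM⟩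

theorem add_single_ne_zero {d : ℕ} (μ : Fin d →₀ ℕ) (i : Fin d) : μ + Finsupp.single i 1 ≠ 0 := by
  intro h
  have := congrArg Finsupp.degree h
  simp at this

theorem degree_add_single {d : ℕ} (μ : Fin d →₀ ℕ) (i : Fin d) :
    (μ + Finsupp.single i 1).degree = μ.degree + 1 := by
  simp

theorem X_mem_supported' {σ : Type*} {s : Set σ} {i : σ} (h : i ∈ s) :
    (X i : MvPolynomial σ k) ∈ supported k s := X_mem_supported.2 h

theorem chainDeriv_mem_supported {N M : ℕ} (hN : 1 ≤ N) (i : Fin n) {f : ChainRing k n m}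
    (hf : f ∈ supported k (chainVars n m N M)) :
    chainDeriv k n m i f ∈ supported k (chainVars n m (N + 1) (M + 1)) := by
  refine derivation_mem_supported k _ (chainVars_mono N.le_succ M.le_succ) ?_ hf
  rintro (p | p) hp
  · rw [inl_mem_chainVars] at hp
    rw [chainDeriv_X_inl]
    refine X_mem_supported' k (inl_mem_chainVars.2 ⟨add_single_ne_zero _ _, ?_⟩)
    rw [degree_add_single]
    omega
  · rw [inr_mem_chainVars] at hp
    rw [chainDeriv_X_inr]
    refine sum_mem fun r _ => mul_mem (X_mem_supported' k (inl_mem_chainVars.2 ⟨?_, ?_⟩))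
      (X_mem_supported' k (inr_mem_chainVars.2 ?_))
    · simp
    · simp; omega
    · rw [degree_add_single]; omega

/-- The chain rule, up to terms of lower order in the first map. -/
theorem chainPoly_top (u : Fin m) (μ : Fin n →₀ ℕ) (hμ : μ ≠ 0) :
    chainPoly k n m (u, μ) - ∑ r, X (Sum.inl (r, μ)) * X (Sum.inr (u, Finsupp.single r 1)) ∈
      supported k (chainVars n m μ.degree μ.degree) := by
  induction μ using multiIndex_induction with
  | zero => exact absurd rfl hμ
  | add_single μ i ih =>
    rw [chainPoly_add_single]
    by_cases h : μ = 0
    · subst h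
      rw [chainPoly_zero, chainDeriv_X_inr]
      simp
    · have hdeg : μ.degree ≠ 0 := fun h' => h ((Finsupp.degree_eq_zero_iff _).1 h')
      have h2 := chainDeriv_mem_supported k (by omega) i (ih h)
      rw [degree_add_single]
      have h3 : chainDeriv k n m i (chainPoly k n m (u, μ)) -
          ∑ r, X (Sum.inl (r, μ + Finsupp.single i 1)) * X (Sum.inr (u, Finsupp.single r 1)) =
          chainDeriv k n m i (chainPoly k n m (u, μ) -
          ∑ r, X (Sum.inl (r, μ)) * X (Sum.inr (u, Finsupp.single r 1))) +
          ∑ r, X (Sum.inl (r, μ)) * ∑ s, X (Sum.inl (s, Finsupp.single i 1)) *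
            X (Sum.inr (u, Finsupp.single r 1 + Finsupp.single s 1)) := by
        rw [map_sub, map_sum]
        simp only [Derivation.leibniz, chainDeriv_X_inl, chainDeriv_X_inr, smul_eq_mul,
          Finset.sum_add_distrib]
        simp only [mul_comm (X (Sum.inr _) : ChainRing k n m) (X (Sum.inl (_, μ + _)))]
        ring
      rw [h3]
      refine add_mem h2 (sum_mem fun r _ => mul_mem (X_mem_supported' k (inl_mem_chainVars.2
        ⟨h, Nat.lt_succ_self _⟩)) (sum_mem fun s _ => mul_mem (X_mem_supported' k
          (inl_mem_chainVars.2 ⟨?_, ?_⟩)) (X_mem_supported' k (inr_mem_chainVars.2 ?_))))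
      · simp
      · simp; omega
      · simp; omega

theorem chainPoly_mem_supported (p : Fin m × (Fin n →₀ ℕ)) :
    chainPoly k n m p ∈ supported k (chainVars n m (p.2.degree + 1) p.2.degree) := by
  obtain ⟨u, μ⟩ := p
  by_cases h : μ = 0
  · subst h
    rw [chainPoly_zero]
    exact X_mem_supported' k (inr_mem_chainVars.2 le_rfl)
  · rw [← sub_add_cancel (chainPoly k n m (u, μ))
      (∑ r, X (Sum.inl (r, μ)) * X (Sum.inr (u, Finsupp.single r 1)))]
    refine add_mem (supported_mono (chainVars_mono (Nat.le_succ _) le_rfl) (chainPoly_top k u μ h))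
      (sum_mem fun r _ => mul_mem (X_mem_supported' k (inl_mem_chainVars.2
        ⟨h, Nat.lt_succ_self _⟩)) (X_mem_supported' k (inr_mem_chainVars.2 ?_)))
    have : μ.degree ≠ 0 := fun h' => h ((Finsupp.degree_eq_zero_iff _).1 h')
    simp; omega

theorem aeval_congr_of_mem_supported {σ : Type*} {s : Set σ} {f : MvPolynomial σ k}
    (hf : f ∈ supported k s) {x y : σ → B} (h : ∀ i ∈ s, x i = y i) :
    aeval x f = aeval y f :=
  eval₂Hom_congr' rfl (fun i hi _ => h i (mem_supported.1 hf hi)) rfl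

/-- A composite jet depends only on the jets of the first map of positive order and on the jets
of the second map, up to the same order. -/
theorem fullChain_congr {a a' : Fin m × (Fin n →₀ ℕ) → B} {g g' : Fin m × (Fin m →₀ ℕ) → B}
    (p : Fin m × (Fin n →₀ ℕ)) (ha : ∀ r, r.2 ≠ 0 → r.2.degree ≤ p.2.degree → a r = a' r)
    (hg : ∀ r, r.2.degree ≤ p.2.degree → g r = g' r) :
    fullChain k a g p = fullChain k a' g' p := by
  refine aeval_congr_of_mem_supported k (chainPoly_mem_supported k p) ?_
  rintro (r | r) hr
  · rw [inl_mem_chainVars] at hr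
    exact ha r hr.1 (by omega)
  · rw [inr_mem_chainVars] at hr
    exact hg r hr

/-- The terms of the chain rule of lower order in the first map. -/
noncomputable def chainRest (n m : ℕ) (p : Fin m × (Fin n →₀ ℕ)) : ChainRing k n m :=
  chainPoly k n m p - ∑ r, X (Sum.inl (r, p.2)) * X (Sum.inr (p.1, Finsupp.single r 1))

theorem fullChain_top (a : Fin m × (Fin n →₀ ℕ) → B) (g : Fin m × (Fin m →₀ ℕ) → B)
    (p : Fin m × (Fin n →₀ ℕ)) :
    fullChain k a g p = ∑ r, a (r, p.2) * g (p.1, Finsupp.single r 1) +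
      aeval (Sum.elim a g) (chainRest k n m p) := by
  simp [fullChain, chainRest]

/-- The remaining terms of the chain rule involve the first map only in lower order. -/
theorem aeval_chainRest_congr {a a' : Fin m × (Fin n →₀ ℕ) → B}
    {g : Fin m × (Fin m →₀ ℕ) → B} (p : Fin m × (Fin n →₀ ℕ)) (hp : p.2 ≠ 0)
    (ha : ∀ r, r.2 ≠ 0 → r.2.degree < p.2.degree → a r = a' r) :
    aeval (Sum.elim a g) (chainRest k n m p) = aeval (Sum.elim a' g) (chainRest k n m p) := by
  refine aeval_congr_of_mem_supported k (chainPoly_top k p.1 p.2 hp) ?_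
  rintro (r | r) hr
  · rw [inl_mem_chainVars] at hr
    exact ha r hr.1 hr.2
  · rfl

open Classical in
/-- The jet `h` at `g(s)` with value `s` and with `g ∘ h = id`; it is the left inverse of `g` in the
order of the arguments of `fullChain`. The equations for `h` are triangular, so that they are solved
by recursion on the order: those of a given order are linear in the coordinates of `h` of that
order, with the jacobian of `g` as matrix. -/
noncomputable def leftInverse (g : Fin m × (Fin m →₀ ℕ) → B) (s : Fin m → B)
    (p : Fin m × (Fin m →₀ ℕ)) : B :=
  if p.2 = 0 then s p.1
  else ∑ u, (jacobian g)⁻¹ p.1 u * (fullId (fun u => g (u, 0)) (u, p.2) -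
    aeval (Sum.elim (fun r => if _h : r.2.degree < p.2.degree then leftInverse g s r else 0) g)
      (chainRest (k := k) m m (u, p.2)))
termination_by p.2.degree

open Matrix in
theorem fullChain_leftInverse (g : Fin m × (Fin m →₀ ℕ) → B) (hg : IsUnit (jacobian g).det)
    (s : Fin m → B) :
    fullChain k (leftInverse k g s) g = fullId (fun u => g (u, 0)) := by
  funext ⟨u, μ⟩
  by_cases hμ : μ = 0
  · subst hμ
    rw [fullChain_zero, fullId_zero]
  · rw [fullChain_top]
    have h1 : ∀ r, leftInverse k g s (r, μ) = ((jacobian g)⁻¹ *ᵥ fun u =>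
        fullId (fun u => g (u, 0)) (u, μ) -
          aeval (Sum.elim (leftInverse k g s) g) (chainRest (k := k) m m (u, μ))) r := by
      intro r
      rw [leftInverse, if_neg hμ]
      refine Finset.sum_congr rfl fun u _ => ?_
      congr 2
      refine aeval_chainRest_congr k (u, μ) hμ fun r _ hr => ?_
      rw [dif_pos hr]
    have h2 : ∑ r, leftInverse k g s (r, μ) * g (u, Finsupp.single r 1) =
        (jacobian g *ᵥ fun r => leftInverse k g s (r, μ)) u :=
      Finset.sum_congr rfl fun r _ => mul_comm _ _
    rw [h2, funext h1, mulVec_mulVec, mul_nonsing_inv _ hg, one_mulVec]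
    simp

theorem leftInverse_zero (g : Fin m × (Fin m →₀ ℕ) → B) (s : Fin m → B) (u : Fin m) :
    leftInverse k g s (u, 0) = s u := by
  rw [leftInverse, if_pos rfl]

theorem jacobian_fullChain (g h : Fin m × (Fin m →₀ ℕ) → B) :
    jacobian (fullChain k g h) = jacobian h * jacobian g := by
  ext u r
  have h1 := chainPoly_add_single k (n := m) u 0 r
  rw [zero_add, chainPoly_zero, chainDeriv_X_inr] at h1
  simp [jacobian, Matrix.mul_apply, fullChain, h1, mul_comm]

theorem jacobian_fullId (s : Fin m → B) : jacobian (fullId s) = 1 := by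
  ext u r
  simp [jacobian, fullId_single, Matrix.one_apply, eq_comm]

theorem isUnit_jacobian_leftInverse (g : Fin m × (Fin m →₀ ℕ) → B)
    (hg : IsUnit (jacobian g).det) (s : Fin m → B) :
    IsUnit (jacobian (leftInverse k g s)).det := by
  have h := congrArg (fun g => (jacobian g).det) (fullChain_leftInverse k g hg s)
  simp only [jacobian_fullChain, jacobian_fullId, Matrix.det_mul, Matrix.det_one] at h
  exact IsUnit.of_mul_eq_one_right _ h

/-- The inverse jet is inverse on both sides. -/
theorem fullChain_leftInverse' (g : Fin m × (Fin m →₀ ℕ) → B) (hg : IsUnit (jacobian g).det)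
    (s : Fin m → B) :
    fullChain k g (leftInverse k g s) = fullId s := by
  -- The left inverse `f` of the left inverse `h` of `g` is `g`.
  set h := leftInverse k g s
  set f := leftInverse k h (fun u => g (u, 0))
  have h1 : fullChain k h g = fullId (fun u => g (u, 0)) := fullChain_leftInverse k g hg s
  have h2 : fullChain k f h = fullId (fun u => h (u, 0)) :=
    fullChain_leftInverse k h (isUnit_jacobian_leftInverse k g hg s) _
  have h3 : f = g := by
    have := fullChain_assoc k f h g
    rw [h1, h2, fullId_chain, fullChain_id _ f _ fun u => (leftInverse_zero k h _ u).symm] at this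
    exact this.symm
  rw [h3] at h2
  rw [h2]
  congr 1
  funext u
  exact leftInverse_zero k g s u

end ChainOrder

/-! ### Jets of bounded order -/

section JetOrder

variable (k : Type u) [Field k] {n m : ℕ} {B : Type*} [CommRing B] [Algebra k B]

theorem extendJet_apply {d : ℕ} {q : ℕ∞} (v : JetIdx d m q → B) (p : JetIdx d m q) :
    extendJet v p.1 = v p := by
  rw [extendJet, dif_pos p.2]

theorem map_extendJet {d : ℕ} {q : ℕ∞} {C : Type*} [CommRing C] (φ : B →+* C)
    (v : JetIdx d m q → B) (p) : φ (extendJet v p) = extendJet (fun r => φ (v r)) p := by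
  unfold extendJet
  split_ifs
  · rfl
  · exact map_zero φ

/-- The truncation of a jet to a lower order. -/
def truncJet {d : ℕ} {q q' : ℕ∞} (h : q ≤ q') (v : JetIdx d m q' → B) : JetIdx d m q → B :=
  fun p => v ⟨p.1, p.2.trans h⟩

/-- Jets of order `q` may be extended arbitrarily before composing them. -/
theorem chain_eq_fullChain {q : ℕ∞} {a : JetIdx n m q → B} {g : JetIdx m m q → B}
    {a' : Fin m × (Fin n →₀ ℕ) → B} {g' : Fin m × (Fin m →₀ ℕ) → B}
    (ha : ∀ r : JetIdx n m q, a r = a' r.1) (hg : ∀ r : JetIdx m m q, g r = g' r.1)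
    (p : JetIdx n m q) : chain k a g p = fullChain k a' g' p.1 := by
  refine fullChain_congr k p.1 (fun r _ hr => ?_) (fun r hr => ?_)
  · have h : ((r.2.degree : ℕ) : ℕ∞) ≤ q := (Nat.cast_le.2 hr).trans p.2
    rw [extendJet_apply a ⟨r, h⟩, ha]
  · have h : ((r.2.degree : ℕ) : ℕ∞) ≤ q := (Nat.cast_le.2 hr).trans p.2
    rw [extendJet_apply g ⟨r, h⟩, hg]

theorem chain_assoc {q : ℕ∞} (a : JetIdx n m q → B) (g h : JetIdx m m q → B) :
    chain k (chain k a g) h = chain k a (chain k g h) := by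
  funext p
  have h1 := chain_eq_fullChain k (a := chain k a g) (g := h)
    (a' := fullChain k (extendJet a) (extendJet g)) (g' := extendJet h)
    (fun r => rfl) (fun r => (extendJet_apply h r).symm) p
  have h2 := chain_eq_fullChain k (a := a) (g := chain k g h)
    (a' := extendJet a) (g' := fullChain k (extendJet g) (extendJet h))
    (fun r => (extendJet_apply a r).symm) (fun r => rfl) p
  rw [h1, h2, fullChain_assoc]

theorem map_chain {q : ℕ∞} {C : Type*} [CommRing C] [Algebra k C] (φ : B →ₐ[k] C)
    (a : JetIdx n m q → B) (g : JetIdx m m q → B) (p : JetIdx n m q) :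
    φ (chain k a g p) = chain k (fun r => φ (a r)) (fun r => φ (g r)) p := by
  change φ (fullChain k (extendJet a) (extendJet g) p.1) = _
  rw [map_fullChain]
  exact fullChain_eq_of_eq k (funext fun r => map_extendJet (φ : B →+* C) a r)
    (funext fun r => map_extendJet (φ : B →+* C) g r) _

theorem chain_add_mul {q : ℕ∞} (a : JetIdx n m q → B) (g h : JetIdx m m q → B) (c : B)
    (p : JetIdx n m q) :
    chain k a (fun r => g r + c * h r) p = chain k a g p + c * chain k a h p := by
  rw [chain_eq_fullChain k (a' := extendJet a) (g' := fun r => extendJet g r + c * extendJet h r)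
    (fun r => (extendJet_apply a r).symm)
    (fun r => by rw [extendJet_apply, extendJet_apply]), fullChain_add_mul]
  rfl

/-- The composite with a jet `g` has the target of `g` as its value. -/
theorem chain_zero_order {q : ℕ∞} (a : JetIdx n m q → B) (g : JetIdx m m q → B) (u : Fin m) :
    chain k a g (JetIdx.zero u) = g (JetIdx.zero u) := by
  change fullChain k (extendJet a) (extendJet g) (u, 0) = _
  rw [fullChain_zero]
  exact extendJet_apply g (JetIdx.zero u)

theorem truncJet_chain {q q' : ℕ∞} (hq : q ≤ q') (a : JetIdx n m q' → B)
    (g : JetIdx m m q' → B) :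
    truncJet hq (chain k a g) = chain k (truncJet hq a) (truncJet hq g) := by
  funext p
  rw [chain_eq_fullChain k (a' := extendJet a) (g' := extendJet g)]
  · rfl
  · intro r
    exact (extendJet_apply a ⟨r.1, _⟩).symm
  · intro r
    exact (extendJet_apply g ⟨r.1, _⟩).symm

theorem idJet_eq_fullId {q : ℕ∞} (s : BaseField k m →ₐ[k] B) (p : JetIdx m m q) :
    idJet q s p = fullId (fun u => s (baseCoord k m u)) p.1 := rfl

theorem truncJet_idJet {q q' : ℕ∞} (hq : q ≤ q') (s : BaseField k m →ₐ[k] B) :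
    truncJet hq (idJet q' s) = idJet q s := rfl

theorem map_idJet {q : ℕ∞} {C : Type*} [CommRing C] [Algebra k C] (φ : B →ₐ[k] C)
    (s : BaseField k m →ₐ[k] B) (p : JetIdx m m q) :
    φ (idJet q s p) = idJet q (φ.comp s) p := by
  rw [idJet_eq_fullId, idJet_eq_fullId, ← AlgHom.coe_toRingHom, map_fullId]
  rfl

theorem chain_idJet {q : ℕ∞} (a : JetIdx n m q → B) (s : BaseField k m →ₐ[k] B)
    (hs : ∀ u, s (baseCoord k m u) = a (JetIdx.zero u)) : chain k a (idJet q s) = a := by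
  funext p
  rw [chain_eq_fullChain k (fun r => (extendJet_apply a r).symm) (idJet_eq_fullId k s),
    fullChain_id, extendJet_apply]
  intro u
  rw [hs]
  exact (extendJet_apply a (JetIdx.zero u)).symm

theorem idJet_chain {q : ℕ∞} (g : JetIdx m m q → B) (s : BaseField k m →ₐ[k] B) :
    chain k (idJet q s) g = g := by
  funext p
  rw [chain_eq_fullChain k (idJet_eq_fullId k s) (fun r => (extendJet_apply g r).symm),
    fullId_chain, extendJet_apply]

omit [CommRing B] in
theorem jacobian_congr {v w : Fin m × (Fin m →₀ ℕ) → B}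
    (h : ∀ u r, v (u, Finsupp.single r 1) = w (u, Finsupp.single r 1)) :
    jacobian v = jacobian w :=
  Matrix.ext fun u r => h u r

/-- The index of a jet coordinate of order one. -/
noncomputable def JetIdx.one {d : ℕ} {q : ℕ∞} (hq : 1 ≤ q) (u : Fin m) (r : Fin d) : JetIdx d m q :=
  ⟨(u, Finsupp.single r 1), by simpa using hq⟩

theorem jacobian_extendJet {q : ℕ∞} (hq : 1 ≤ q) (g : JetIdx m m q → B) :
    jacobian (extendJet g) = Matrix.of fun u r => g (JetIdx.one hq u r) :=
  Matrix.ext fun u r => extendJet_apply g (JetIdx.one hq u r)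

end JetOrder

/-! ### Points of jet fields -/

section JetHom

variable {k : Type u} [Field k] {n m : ℕ} {q : ℕ∞} {B : Type*} [CommRing B] [Algebra k B]

theorem baseHom_ext {s t : BaseField k m →ₐ[k] B}
    (h : ∀ u, s (baseCoord k m u) = t (baseCoord k m u)) : s = t := by
  apply AlgHom.coe_ringHom_injective
  apply IsLocalization.ringHom_ext (nonZeroDivisors (MvPolynomial (Fin m) k))
  apply congrArg (AlgHom.toRingHom (R := k)) (a₁ := s.comp (IsScalarTower.toAlgHom k _ _))
    (a₂ := t.comp (IsScalarTower.toAlgHom k _ _))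
  exact MvPolynomial.algHom_ext fun u => h u

theorem jetHom_ext {a b : JetField k n m q →ₐ[k] B}
    (h : ∀ p, a (jetCoord k n m q p) = b (jetCoord k n m q p)) : a = b := by
  apply AlgHom.coe_ringHom_injective
  apply IsLocalization.ringHom_ext (nonZeroDivisors (MvPolynomial (JetIdx n m q) k))
  apply congrArg (AlgHom.toRingHom (R := k)) (a₁ := a.comp (IsScalarTower.toAlgHom k _ _))
    (a₂ := b.comp (IsScalarTower.toAlgHom k _ _))
  exact MvPolynomial.algHom_ext fun u => h u

theorem baseIncl_baseCoord (u : Fin m) :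
    baseIncl k n m q (baseCoord k m u) = jetCoord k n m q (JetIdx.zero u) := by
  have h : Function.Injective
      ((IsScalarTower.toAlgHom k (MvPolynomial (JetIdx n m q) k) (JetField k n m q)).comp
        (MvPolynomial.rename JetIdx.zero)).toRingHom :=
    (IsFractionRing.injective (MvPolynomial (JetIdx n m q) k) (JetField k n m q)).comp
      (MvPolynomial.rename_injective _ JetIdx.zero_injective)
  refine (IsFractionRing.lift_algebraMap (A := MvPolynomial (Fin m) k) h _).trans ?_
  simp [jetCoord]

theorem jetIncl_jetCoord (p : JetIdx n m q) :
    jetIncl k n m q (jetCoord k n m q p) = jetCoord k n m ⊤ ⟨p.1, le_top⟩ := by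
  have h : Function.Injective
      ((IsScalarTower.toAlgHom k (MvPolynomial (JetIdx n m ⊤) k) (JetField k n m ⊤)).comp
        (MvPolynomial.rename fun p : JetIdx n m q => ⟨p.1, le_top⟩)).toRingHom :=
    (IsFractionRing.injective (MvPolynomial (JetIdx n m ⊤) k) (JetField k n m ⊤)).comp
      (MvPolynomial.rename_injective _ fun _ _ h => Subtype.ext (congrArg (fun p => p.1) h))
  refine (IsFractionRing.lift_algebraMap (A := MvPolynomial (JetIdx n m q) k) h _).trans ?_
  simp [jetCoord]

theorem jetIncl_comp_baseIncl :
    (jetIncl k n m q).comp (baseIncl k n m q) = baseIncl k n m ⊤ := by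
  apply baseHom_ext
  intro u
  rw [AlgHom.comp_apply, baseIncl_baseCoord, baseIncl_baseCoord, jetIncl_jetCoord]
  rfl

theorem jetIncl_top : jetIncl k n m ⊤ = AlgHom.id k _ :=
  jetHom_ext fun p => by rw [jetIncl_jetCoord]; rfl

theorem aeval_jetCoord (f : MvPolynomial (JetIdx n m q) k) :
    MvPolynomial.aeval (jetCoord k n m q) f = algebraMap _ (JetField k n m q) f := by
  have : MvPolynomial.aeval (jetCoord k n m q) =
      IsScalarTower.toAlgHom k (MvPolynomial (JetIdx n m q) k) (JetField k n m q) :=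
    MvPolynomial.algHom_ext fun p => by simp [jetCoord]
  exact DFunLike.congr_fun this f

theorem aeval_jetCoord_ne_zero {f : MvPolynomial (JetIdx n m q) k} (hf : f ≠ 0) :
    MvPolynomial.aeval (jetCoord k n m q) f ≠ 0 := by
  rw [aeval_jetCoord]
  simpa using hf

/-- Every element of the jet field is a quotient of polynomials in the jet coordinates. -/
theorem exists_jetField_eq_div (x : JetField k n m q) :
    ∃ f h : MvPolynomial (JetIdx n m q) k, h ≠ 0 ∧
      x * MvPolynomial.aeval (jetCoord k n m q) h = MvPolynomial.aeval (jetCoord k n m q) f := by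
  obtain ⟨f, h, hh, rfl⟩ := IsFractionRing.div_surjective (A := MvPolynomial (JetIdx n m q) k) x
  refine ⟨f, h, nonZeroDivisors.ne_zero hh, ?_⟩
  rw [aeval_jetCoord, aeval_jetCoord, div_mul_cancel₀]
  simpa using nonZeroDivisors.ne_zero hh

theorem jetHom_aeval (a : JetField k n m q →ₐ[k] B) (f : MvPolynomial (JetIdx n m q) k) :
    a (MvPolynomial.aeval (jetCoord k n m q) f) =
      MvPolynomial.aeval (fun p => a (jetCoord k n m q p)) f := by
  rw [← AlgHom.comp_apply, MvPolynomial.comp_aeval]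

/-- A jet whose coordinates make all nonzero polynomials invertible is a point of the jet field. -/
theorem exists_jetHom (c : JetIdx n m q → B)
    (hc : ∀ f : MvPolynomial (JetIdx n m q) k, f ≠ 0 → IsUnit (MvPolynomial.aeval c f)) :
    ∃ b : JetField k n m q →ₐ[k] B, ∀ p, b (jetCoord k n m q p) = c p := by
  refine ⟨IsLocalization.liftAlgHom (M := nonZeroDivisors (MvPolynomial (JetIdx n m q) k))
    (f := MvPolynomial.aeval c) (fun f => hc f (nonZeroDivisors.ne_zero f.2)), fun p => ?_⟩
  rw [jetCoord, IsLocalization.liftAlgHom_apply, IsLocalization.lift_eq]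
  simp

theorem exists_baseHom (c : Fin m → B)
    (hc : ∀ f : MvPolynomial (Fin m) k, f ≠ 0 → IsUnit (MvPolynomial.aeval c f)) :
    ∃ b : BaseField k m →ₐ[k] B, ∀ p, b (baseCoord k m p) = c p := by
  refine ⟨IsLocalization.liftAlgHom (M := nonZeroDivisors (MvPolynomial (Fin m) k))
    (f := MvPolynomial.aeval c) (fun f => hc f (nonZeroDivisors.ne_zero f.2)), fun p => ?_⟩
  rw [baseCoord, IsLocalization.liftAlgHom_apply, IsLocalization.lift_eq]
  simp

/-- Points of the jet field deform together with their coordinates, along homomorphisms which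
reflect units. -/
theorem exists_jetHom_of_isLocalHom {C : Type*} [CommRing C] [Algebra k C] (π : C →ₐ[k] B)
    (hπ : ∀ x, IsUnit (π x) → IsUnit x) (a : JetField k n m q →ₐ[k] B) (c : JetIdx n m q → C)
    (hc : ∀ p, π (c p) = a (jetCoord k n m q p)) :
    ∃ b : JetField k n m q →ₐ[k] C, (∀ p, b (jetCoord k n m q p) = c p) ∧ π.comp b = a := by
  obtain ⟨b, hb⟩ := exists_jetHom c (fun f hf => by
    apply hπ
    rw [← AlgHom.comp_apply, MvPolynomial.comp_aeval]
    simp only [hc, ← jetHom_aeval]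
    exact (aeval_jetCoord_ne_zero hf).isUnit.map a)
  exact ⟨b, hb, jetHom_ext fun p => by rw [AlgHom.comp_apply, hb, hc]⟩

theorem aeval_baseCoord_ne_zero {f : MvPolynomial (Fin m) k} (hf : f ≠ 0) :
    MvPolynomial.aeval (baseCoord k m) f ≠ 0 := by
  have : MvPolynomial.aeval (baseCoord k m) =
      IsScalarTower.toAlgHom k (MvPolynomial (Fin m) k) (BaseField k m) :=
    MvPolynomial.algHom_ext fun p => by simp [baseCoord]
  rw [this]
  simpa using hf

theorem exists_baseHom_of_isLocalHom {C : Type*} [CommRing C] [Algebra k C] (π : C →ₐ[k] B)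
    (hπ : ∀ x, IsUnit (π x) → IsUnit x) (a : BaseField k m →ₐ[k] B) (c : Fin m → C)
    (hc : ∀ p, π (c p) = a (baseCoord k m p)) :
    ∃ b : BaseField k m →ₐ[k] C, ∀ p, b (baseCoord k m p) = c p :=
  exists_baseHom c (fun f hf => by
    apply hπ
    rw [← AlgHom.comp_apply, MvPolynomial.comp_aeval]
    simp only [hc]
    have h := MvPolynomial.comp_aeval (baseCoord k m) a
    rw [← h, AlgHom.comp_apply]
    exact (aeval_baseCoord_ne_zero hf).isUnit.map a)

end JetHom

/-! ### Derivations and dual numbers -/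

section Dual

variable {k : Type*} [Field k] {A B : Type*} [CommRing A] [CommRing B] [Algebra k A]
  [Algebra k B]

/-- The homomorphism `x ↦ f x + ε f (d x)` defined by a derivation `d`. -/
noncomputable def dualLift (f : A →ₐ[k] B) (d : Derivation k A A) : A →ₐ[k] DualNumber B where
  toFun x := TrivSqZeroExt.inl (f x) + TrivSqZeroExt.inr (f (d x))
  map_one' := by simp
  map_mul' x y := by
    ext
    · simp
    · simp [mul_comm]
  map_zero' := by simp
  map_add' x y := by ext <;> simp
  commutes' c := by
    ext
    · simp [TrivSqZeroExt.algebraMap_eq_inl']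
    · simp [TrivSqZeroExt.algebraMap_eq_inl']

theorem dualLift_apply (f : A →ₐ[k] B) (d : Derivation k A A) (x : A) :
    dualLift f d x = TrivSqZeroExt.inl (f x) + TrivSqZeroExt.inr (f (d x)) := rfl

theorem fst_dualLift (f : A →ₐ[k] B) (d : Derivation k A A) (x : A) :
    (dualLift f d x).fst = f x := by simp [dualLift_apply]

theorem snd_dualLift (f : A →ₐ[k] B) (d : Derivation k A A) (x : A) :
    (dualLift f d x).snd = f (d x) := by simp [dualLift_apply]

/-- The derivation `d` such that the given homomorphism is `x ↦ x + ε d x`. -/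
noncomputable def derivOfDual (φ : A →ₐ[k] DualNumber A) (hφ : ∀ x, (φ x).fst = x) :
    Derivation k A A :=
  Derivation.mk' ((TrivSqZeroExt.sndHom A A).restrictScalars k ∘ₗ φ.toLinearMap)
    (fun x y => by
      change (φ (x * y)).snd = x • (φ y).snd + y • (φ x).snd
      rw [map_mul, TrivSqZeroExt.snd_mul, hφ, hφ]
      simp [mul_comm])

theorem derivOfDual_apply (φ : A →ₐ[k] DualNumber A) (hφ : ∀ x, (φ x).fst = x) (x : A) :
    derivOfDual φ hφ x = (φ x).snd := rfl

theorem isUnit_of_isUnit_fst (x : DualNumber B)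
    (h : IsUnit (TrivSqZeroExt.fstHom k B B x)) : IsUnit x :=
  TrivSqZeroExt.isUnit_iff_isUnit_fst.2 h

omit [CommRing B] in
theorem dual_ext {x y : DualNumber B} (h1 : x.fst = y.fst) (h2 : x.snd = y.snd) : x = y :=
  TrivSqZeroExt.ext h1 h2

end Dual

section JetDeriv

variable {k : Type u} [Field k] {n m : ℕ} {q : ℕ∞}

theorem jetDerivation_ext {d e : Derivation k (JetField k n m q) (JetField k n m q)}
    (h : ∀ p, d (jetCoord k n m q p) = e (jetCoord k n m q p)) : d = e := by
  have : dualLift (AlgHom.id k _) d = dualLift (AlgHom.id k _) e :=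
    jetHom_ext fun p => by simp [dualLift_apply, h]
  ext x
  have := congrArg TrivSqZeroExt.snd (DFunLike.congr_fun this x)
  simpa [dualLift_apply] using this

/-- Derivations of the jet field have arbitrary values on the jet coordinates. -/
theorem exists_jetDerivation (x : JetIdx n m q → JetField k n m q) :
    ∃ d : Derivation k (JetField k n m q) (JetField k n m q),
      ∀ p, d (jetCoord k n m q p) = x p := by
  obtain ⟨b, hb, hb'⟩ := exists_jetHom_of_isLocalHom (TrivSqZeroExt.fstHom k _ _)
    isUnit_of_isUnit_fst (AlgHom.id k (JetField k n m q))
    (fun p => TrivSqZeroExt.inl (jetCoord k n m q p) + TrivSqZeroExt.inr (x p))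
    (fun p => by simp)
  have hfst : ∀ x, (b x).fst = x := fun x => DFunLike.congr_fun hb' x
  refine ⟨derivOfDual b hfst, fun p => ?_⟩
  rw [derivOfDual_apply, hb]
  simp

end JetDeriv

/-! ### The groupoids of solution jets -/

section Solution

variable {k : Type u} [Field k] {m : ℕ} {B : Type*} [CommRing B] [Algebra k B]
  {C : Type*} [CommRing C] [Algebra k C]

theorem IsInvertibleJet.map {q : ℕ∞} {t : BaseField k m →ₐ[k] B} {g : JetIdx m m q → B}
    (h : IsInvertibleJet q t g) (φ : B →ₐ[k] C) :
    IsInvertibleJet q (φ.comp t) (fun p => φ (g p)) := by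
  refine ⟨fun u => congrArg φ (h.1 u), ?_⟩
  have h1 : jacobian (extendJet fun p => φ (g p)) =
      (φ : B →+* C).mapMatrix (jacobian (extendJet g)) := by
    ext u r
    exact (map_extendJet (φ : B →+* C) g _).symm
  rw [h1, ← RingHom.map_det]
  exact h.2.map (φ : B →+* C)

theorem IsSolutionJet.map {I : Ideal (JetGroupoidRing k m)} {q : ℕ∞}
    {s t : BaseField k m →ₐ[k] B} {g : JetIdx m m q → B} (h : IsSolutionJet I q s t g)
    (φ : B →ₐ[k] C) : IsSolutionJet I q (φ.comp s) (φ.comp t) (fun p => φ (g p)) := by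
  refine ⟨h.1.map φ, fun f hf hfI => ?_⟩
  have h1 := congrArg φ (h.2 f hf hfI)
  rw [map_zero, ← AlgHom.comp_apply, MvPolynomial.comp_aeval] at h1
  rw [← h1]
  congr 2
  funext v
  rcases v with v | v
  · rfl
  · exact (map_extendJet (φ : B →+* C) g v).symm

theorem groupoidPolyUpTo_mono {q q' : ℕ∞} (h : q ≤ q') :
    groupoidPolyUpTo k m q ≤ groupoidPolyUpTo k m q' :=
  MvPolynomial.supported_mono fun _ hv p hp => (hv p hp).trans h

theorem mem_groupoidPolyUpTo_top (f : GroupoidPoly k m) : f ∈ groupoidPolyUpTo k m ⊤ :=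
  MvPolynomial.mem_supported.2 fun _ _ _ _ => le_top

/-- Every polynomial on the jet groupoid has finite order. -/
theorem exists_mem_groupoidPolyUpTo (f : GroupoidPoly k m) (N : ℕ) :
    ∃ q : ℕ, N ≤ q ∧ f ∈ groupoidPolyUpTo k m q := by
  classical
  refine ⟨N + ∑ v ∈ f.vars, Sum.elim (fun _ => 0) (fun p => p.2.degree) v, by omega,
    MvPolynomial.mem_supported.2 fun v hv p hp => ?_⟩
  have := Finset.single_le_sum
    (f := fun v : Fin m ⊕ (Fin m × (Fin m →₀ ℕ)) => Sum.elim (fun _ => 0) (fun p => p.2.degree) v)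
    (fun _ _ => Nat.zero_le _) hv
  subst hp
  simp only [Sum.elim_inr] at this
  exact Nat.cast_le.2 (this.trans (Nat.le_add_left _ _))

theorem aeval_truncJet {q q' : ℕ∞} (hq : q ≤ q') (x : Fin m → B) (g : JetIdx m m q' → B)
    {f : GroupoidPoly k m} (hf : f ∈ groupoidPolyUpTo k m q) :
    MvPolynomial.aeval (Sum.elim x (extendJet (truncJet hq g))) f =
      MvPolynomial.aeval (Sum.elim x (extendJet g)) f := by
  refine aeval_congr_of_mem_supported k hf ?_
  rintro (v | v) hv
  · rfl
  · have h : ((v.2.degree : ℕ) : ℕ∞) ≤ q := hv v rfl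
    exact (extendJet_apply (truncJet hq g) ⟨v, h⟩).trans (extendJet_apply g ⟨v, h.trans hq⟩).symm

theorem isInvertibleJet_truncJet {q q' : ℕ∞} (hq : q ≤ q') (h1 : 1 ≤ q)
    {t : BaseField k m →ₐ[k] B} {g : JetIdx m m q' → B} :
    IsInvertibleJet q t (truncJet hq g) ↔ IsInvertibleJet q' t g := by
  unfold IsInvertibleJet
  rw [jacobian_extendJet h1, jacobian_extendJet (h1.trans hq)]
  rfl

theorem IsSolutionJet.trunc {I : Ideal (JetGroupoidRing k m)} {q q' : ℕ∞} (hq : q ≤ q')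
    (h1 : 1 ≤ q) {s t : BaseField k m →ₐ[k] B} {g : JetIdx m m q' → B}
    (h : IsSolutionJet I q' s t g) : IsSolutionJet I q s t (truncJet hq g) :=
  ⟨(isInvertibleJet_truncJet hq h1).2 h.1, fun f hf hfI => by
    rw [aeval_truncJet hq _ _ hf]
    exact h.2 f (groupoidPolyUpTo_mono hq hf) hfI⟩

/-- A jet of infinite order is a solution if its truncations are. -/
theorem isSolutionJet_top {I : Ideal (JetGroupoidRing k m)} {N : ℕ} (hN : 1 ≤ N)
    {s t : BaseField k m →ₐ[k] B} {g : JetIdx m m ⊤ → B}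
    (h : ∀ q : ℕ, N ≤ q → IsSolutionJet I q s t (truncJet le_top g)) :
    IsSolutionJet I ⊤ s t g :=
  ⟨(isInvertibleJet_truncJet le_top (by exact_mod_cast hN)).1 (h N le_rfl).1, fun f _ hfI => by
    obtain ⟨q, hq, hf⟩ := exists_mem_groupoidPolyUpTo f N
    rw [← aeval_truncJet (q := q) le_top _ _ hf]
    exact (h q hq).2 f hf hfI⟩

end Solution

namespace AlgebraicPseudogroup

variable {k : Type u} [Field k] {m : ℕ} (Γ : AlgebraicPseudogroup k m)
  {B : Type u} [CommRing B] [Algebra k B]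

theorem one_le_of_order_le {q : ℕ∞} (hq : (Γ.order : ℕ∞) ≤ q) : 1 ≤ q :=
  le_trans (by exact_mod_cast Γ.one_le_order) hq

theorem isSolutionJet_id {q : ℕ∞} (hq : (Γ.order : ℕ∞) ≤ q) (s : BaseField k m →ₐ[k] B) :
    IsSolutionJet Γ.ideal q s s (idJet q s) := by
  induction q using ENat.recTopCoe with
  | top => exact isSolutionJet_top Γ.one_le_order fun q hq => Γ.id_mem q hq B s
  | coe q => exact Γ.id_mem q (by exact_mod_cast hq) B s

theorem isSolutionJet_chain {q : ℕ∞} (hq : (Γ.order : ℕ∞) ≤ q) {s t r : BaseField k m →ₐ[k] B}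
    {g h : JetIdx m m q → B} (hg : IsSolutionJet Γ.ideal q s t g)
    (hh : IsSolutionJet Γ.ideal q t r h) : IsSolutionJet Γ.ideal q s r (chain k g h) := by
  induction q using ENat.recTopCoe with
  | top =>
    refine isSolutionJet_top Γ.one_le_order fun q hq' => ?_
    have h1 : (1 : ℕ∞) ≤ q := by exact_mod_cast Γ.one_le_order.trans hq'
    rw [truncJet_chain]
    exact Γ.comp_mem q hq' B s t r _ _ (hg.trunc le_top h1) (hh.trunc le_top h1)
  | coe q => exact Γ.comp_mem q (by exact_mod_cast hq) B s t r g h hg hh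

/-- The inverse of a solution jet of infinite order is a solution jet. -/
theorem exists_inverse {s t : BaseField k m →ₐ[k] B} {g : JetIdx m m ⊤ → B}
    (hg : IsSolutionJet Γ.ideal ⊤ s t g) :
    ∃ h, IsSolutionJet Γ.ideal ⊤ t s h ∧ chain k g h = idJet ⊤ s ∧ chain k h g = idJet ⊤ t := by
  set h : JetIdx m m ⊤ → B :=
    fun p => leftInverse k (extendJet g) (fun u => s (baseCoord k m u)) p.1
  have hext : ∀ p, h p = leftInverse k (extendJet g) (fun u => s (baseCoord k m u)) p.1 :=
    fun p => rfl
  have hgt : ∀ u, extendJet g (u, 0) = t (baseCoord k m u) := fun u =>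
    (extendJet_apply g (JetIdx.zero u)).trans (hg.1.1 u)
  have h1 : chain k g h = idJet ⊤ s := by
    funext p
    rw [chain_eq_fullChain k (fun r => (extendJet_apply g r).symm) hext,
      fullChain_leftInverse' k _ hg.1.2]
    rfl
  have h2 : chain k h g = idJet ⊤ t := by
    funext p
    rw [chain_eq_fullChain k hext (fun r => (extendJet_apply g r).symm),
      fullChain_leftInverse k _ hg.1.2, idJet_eq_fullId]
    congr 1
    exact funext hgt
  have hinv : IsInvertibleJet ⊤ s h := by
    refine ⟨fun u => leftInverse_zero k _ _ u, ?_⟩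
    have : jacobian (extendJet h) =
        jacobian (leftInverse k (extendJet g) (fun u => s (baseCoord k m u))) :=
      jacobian_congr fun u r => extendJet_apply h ⟨_, le_top⟩
    rw [this]
    exact isUnit_jacobian_leftInverse k _ hg.1.2 _
  refine ⟨h, ?_, h1, h2⟩
  refine isSolutionJet_top Γ.one_le_order fun q hq => ?_
  have hq1 : (1 : ℕ∞) ≤ q := by exact_mod_cast Γ.one_le_order.trans hq
  refine Γ.inv_mem q hq B s t _ _ (hg.trunc le_top hq1)
    ((isInvertibleJet_truncJet le_top hq1).2 hinv) ?_
  rw [← truncJet_chain, h1, truncJet_idJet]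

/-! ### Points of the ring `k[Γ]` -/

theorem source_baseCoord (u : Fin m) :
    Γ.source (baseCoord k m u) = Γ.toCoordRing (MvPolynomial.X (Sum.inl u)) := by
  refine (IsLocalization.lift_eq (M := nonZeroDivisors (MvPolynomial (Fin m) k)) _ _).trans ?_
  simp

theorem target_baseCoord (u : Fin m) : Γ.target (baseCoord k m u) = Γ.jet (u, 0) := by
  refine (IsLocalization.lift_eq (M := nonZeroDivisors (MvPolynomial (Fin m) k)) _ _).trans ?_
  simp [jet]

theorem coordHom_toCoordRing (x : Γ.CoordRing →ₐ[k] B) (f : GroupoidPoly k m) :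
    x (Γ.toCoordRing f) = MvPolynomial.aeval
      (Sum.elim (fun u => x (Γ.source (baseCoord k m u))) (fun p => x (Γ.jet p))) f := by
  have : x.comp Γ.toCoordRing = MvPolynomial.aeval
      (Sum.elim (fun u => x (Γ.source (baseCoord k m u))) (fun p => x (Γ.jet p))) := by
    apply MvPolynomial.algHom_ext
    rintro (u | p)
    · simp [source_baseCoord]
    · simp [jet]
  exact DFunLike.congr_fun this f

/-- A point of `k[Γ]` is determined by its source and its jet. -/
theorem coordHom_ext {x y : Γ.CoordRing →ₐ[k] B}
    (hs : ∀ u, x (Γ.source (baseCoord k m u)) = y (Γ.source (baseCoord k m u)))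
    (hj : ∀ p, x (Γ.jet p) = y (Γ.jet p)) : x = y := by
  have h1 : x.comp Γ.toCoordRing = y.comp Γ.toCoordRing := by
    ext f
    rw [AlgHom.comp_apply, AlgHom.comp_apply, coordHom_toCoordRing, coordHom_toCoordRing]
    simp only [hs, hj]
  have h2 : x.comp (Ideal.Quotient.mkₐ k Γ.ideal) = y.comp (Ideal.Quotient.mkₐ k Γ.ideal) := by
    apply AlgHom.coe_ringHom_injective
    apply IsLocalization.ringHom_ext (groupoidDenominators k m)
    exact congrArg AlgHom.toRingHom h1
  exact Ideal.Quotient.algHom_ext k h2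

theorem toCoordRing_eq_zero {f : GroupoidPoly k m}
    (hf : algebraMap (GroupoidPoly k m) (JetGroupoidRing k m) f ∈ Γ.ideal) :
    Γ.toCoordRing f = 0 :=
  Ideal.Quotient.eq_zero_iff_mem.2 hf

/-- A point of `k[Γ]` is a solution jet of infinite order. -/
theorem isSolutionJet_coordHom (x : Γ.CoordRing →ₐ[k] B) :
    IsSolutionJet Γ.ideal ⊤ (x.comp Γ.source) (x.comp Γ.target) (fun p => x (Γ.jet p.1)) := by
  have hext : extendJet (fun p : JetIdx m m ⊤ => x (Γ.jet p.1)) = fun p => x (Γ.jet p) :=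
    funext fun p => extendJet_apply (fun p : JetIdx m m ⊤ => x (Γ.jet p.1)) ⟨p, le_top⟩
  refine ⟨⟨fun u => ?_, ?_⟩, fun f _ hf => ?_⟩
  · rw [AlgHom.comp_apply, target_baseCoord]
    rfl
  · have h1 : jacobian (extendJet fun p : JetIdx m m ⊤ => x (Γ.jet p.1)) =
        (x.comp Γ.toCoordRing : GroupoidPoly k m →+* B).mapMatrix
          (jacobian fun p => (MvPolynomial.X (Sum.inr p) : GroupoidPoly k m)) := by
      rw [hext]
      rfl
    rw [h1, ← RingHom.map_det]
    exact (Γ.isUnit_toCoordRing (Submonoid.subset_closure (Or.inr rfl))).map x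
  · rw [hext]
    exact (Γ.coordHom_toCoordRing x f).symm.trans (by rw [Γ.toCoordRing_eq_zero hf, map_zero])

/-- A solution jet of infinite order is a point of `k[Γ]`. -/
theorem exists_coordHom {s t : BaseField k m →ₐ[k] B} {g : JetIdx m m ⊤ → B}
    (hg : IsSolutionJet Γ.ideal ⊤ s t g) :
    ∃ x : Γ.CoordRing →ₐ[k] B, x.comp Γ.source = s ∧ x.comp Γ.target = t ∧
      ∀ p : JetIdx m m ⊤, x (Γ.jet p.1) = g p := by
  set y : GroupoidPoly k m →ₐ[k] B :=
    MvPolynomial.aeval (Sum.elim (fun u => s (baseCoord k m u)) (extendJet g))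
  -- The denominators become units: the nonzero polynomials in `y` or `ȳ` by the existence of the
  -- points `s` and `t` of `k(y)`, the jacobian determinant by the invertibility of `g`.
  have hy : ∀ f : groupoidDenominators k m, IsUnit (y f) := by
    rintro ⟨f, hf⟩
    induction hf using Submonoid.closure_induction with
    | mem f hf =>
      rcases hf with (⟨p, hp, rfl⟩ | ⟨p, hp, rfl⟩) | rfl
      · have h1 : y (MvPolynomial.rename Sum.inl p) =
            s (MvPolynomial.aeval (baseCoord k m) p) := by
          simp only [y, MvPolynomial.aeval_rename]
          rw [← AlgHom.comp_apply, MvPolynomial.comp_aeval]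
          rfl
        change IsUnit (y (MvPolynomial.rename Sum.inl p))
        rw [h1]
        exact (aeval_baseCoord_ne_zero hp).isUnit.map s
      · have h1 : y (MvPolynomial.rename (fun u => Sum.inr (u, 0)) p) =
            t (MvPolynomial.aeval (baseCoord k m) p) := by
          simp only [y, MvPolynomial.aeval_rename]
          rw [← AlgHom.comp_apply, MvPolynomial.comp_aeval]
          congr 2
          funext u
          exact (extendJet_apply g (JetIdx.zero u)).trans (hg.1.1 u)
        change IsUnit (y (MvPolynomial.rename (fun u => Sum.inr (u, 0)) p))
        rw [h1]
        exact (aeval_baseCoord_ne_zero hp).isUnit.map t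
      · change IsUnit ((y : GroupoidPoly k m →+* B) _)
        rw [RingHom.map_det]
        convert hg.1.2
        ext u r
        simp [y, jacobian]
    | one => simp
    | mul x z _ _ hx hz =>
      change IsUnit (y (x * z))
      rw [map_mul]
      exact hx.mul hz
  set z : JetGroupoidRing k m →ₐ[k] B := IsLocalization.liftAlgHom (f := y) hy
  have hz : ∀ f, z (algebraMap _ _ f) = y f := fun f => IsLocalization.lift_eq _ f
  -- Up to a denominator the elements of the ideal of `Γ` are polynomials, which vanish on `g`.
  have hzI : ∀ a ∈ Γ.ideal, z a = 0 := by
    intro a ha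
    obtain ⟨⟨f, d⟩, hfd⟩ := IsLocalization.surj (groupoidDenominators k m) a
    have h1 : y f = 0 := hg.2 f (mem_groupoidPolyUpTo_top f)
      (by rw [← hfd]; exact Ideal.mul_mem_right _ _ ha)
    have h2 := congrArg z hfd
    rw [map_mul, hz, hz, h1] at h2
    exact (hy d).mul_left_eq_zero.1 h2
  let x : Γ.CoordRing →ₐ[k] B := Ideal.Quotient.liftₐ Γ.ideal z hzI
  have hx : ∀ f, x (Γ.toCoordRing f) = y f := fun f => hz f
  have hxj : ∀ p : JetIdx m m ⊤, x (Γ.jet p.1) = g p := fun p => by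
    rw [jet, hx]
    simp only [y, MvPolynomial.aeval_X, Sum.elim_inr]
    exact extendJet_apply g p
  refine ⟨x, baseHom_ext fun u => ?_, baseHom_ext fun u => ?_, hxj⟩
  · rw [AlgHom.comp_apply, source_baseCoord, hx]
    simp [y]
  · rw [AlgHom.comp_apply, target_baseCoord]
    exact (hxj (JetIdx.zero u)).trans (hg.1.1 u)

/-! ### Related points of jet fields -/

variable {n : ℕ} {q : ℕ∞} {Γ}

theorem Relates.map {C : Type*} [CommRing C] [Algebra k C]
    {a b : JetField k n m q →ₐ[k] B} {g : JetIdx m m q → B} (h : Γ.Relates q a b g)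
    (φ : B →ₐ[k] C) : Γ.Relates q (φ.comp a) (φ.comp b) (fun p => φ (g p)) :=
  ⟨h.1.map φ, fun p => by rw [AlgHom.comp_apply, h.2, map_chain]; rfl⟩

theorem Relates.comp (hq : (Γ.order : ℕ∞) ≤ q) {a b c : JetField k n m q →ₐ[k] B}
    {g h : JetIdx m m q → B} (hg : Γ.Relates q a b g) (hh : Γ.Relates q b c h) :
    Γ.Relates q a c (chain k g h) :=
  ⟨Γ.isSolutionJet_chain hq hg.1 hh.1, fun p => by
    rw [hh.2, funext hg.2, chain_assoc]⟩

theorem relates_id (hq : (Γ.order : ℕ∞) ≤ q) (a : JetField k n m q →ₐ[k] B) :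
    Γ.Relates q a a (idJet q (a.comp (baseIncl k n m q))) :=
  ⟨Γ.isSolutionJet_id hq _, fun p => by
    rw [chain_idJet]
    intro u
    rw [AlgHom.comp_apply, baseIncl_baseCoord]⟩

theorem Relates.trunc (hq : (Γ.order : ℕ∞) ≤ q) {q' : ℕ∞} (hqq' : q ≤ q')
    {a b : JetField k n m ⊤ →ₐ[k] B} {g : JetIdx m m q' → B}
    (h : Γ.Relates q' (a.comp (jetIncl k n m q')) (b.comp (jetIncl k n m q')) g) :
    Γ.Relates q (a.comp (jetIncl k n m q)) (b.comp (jetIncl k n m q)) (truncJet hqq' g) := by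
  refine ⟨?_, fun p => ?_⟩
  · have := h.1.trunc hqq' (Γ.one_le_of_order_le hq)
    rw [AlgHom.comp_assoc, AlgHom.comp_assoc, jetIncl_comp_baseIncl] at this ⊢
    exact this
  · have h1 := h.2 ⟨p.1, p.2.trans hqq'⟩
    have h2 := congrFun (truncJet_chain k hqq'
      (fun p => (a.comp (jetIncl k n m q')) (jetCoord k n m q' p)) g) p
    rw [AlgHom.comp_apply, jetIncl_jetCoord] at h1 ⊢
    rw [h1]
    refine h2.trans ?_
    congr 1
    funext r
    simp only [truncJet, AlgHom.comp_apply, jetIncl_jetCoord]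

/-- Points of `L` are related by a jet of infinite order if its truncations relate their
truncations. -/
theorem relates_top {a b : JetField k n m ⊤ →ₐ[k] B} {g : JetIdx m m ⊤ → B}
    (h : ∀ q : ℕ, Γ.order ≤ q → Γ.Relates q (a.comp (jetIncl k n m q))
      (b.comp (jetIncl k n m q)) (truncJet le_top g)) : Γ.Relates ⊤ a b g := by
  refine ⟨isSolutionJet_top Γ.one_le_order fun q hq => ?_, fun p => ?_⟩
  · have := (h q hq).1
    rwa [AlgHom.comp_assoc, AlgHom.comp_assoc, jetIncl_comp_baseIncl] at this
  · have hp : ((p.1.2.degree : ℕ) : ℕ∞) ≤ ((Γ.order + p.1.2.degree : ℕ) : ℕ∞) :=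
      Nat.cast_le.2 (Nat.le_add_left _ _)
    have h1 := (h (Γ.order + p.1.2.degree) (Nat.le_add_right _ _)).2 ⟨p.1, hp⟩
    have h2 := congrFun (truncJet_chain k (q := (Γ.order + p.1.2.degree : ℕ)) le_top
      (fun p => a (jetCoord k n m ⊤ p)) g) ⟨p.1, hp⟩
    rw [AlgHom.comp_apply, jetIncl_jetCoord] at h1
    rw [h1]
    refine Eq.trans ?_ h2.symm
    congr 1
    funext r
    simp only [truncJet, AlgHom.comp_apply, jetIncl_jetCoord]

/-- Every element of `L` has finite order. -/
theorem _root_.DiffGalois.exists_jetIncl_eq (x : JetField k n m ⊤) (N : ℕ) :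
    ∃ q : ℕ, N ≤ q ∧ ∃ y, jetIncl k n m q y = x := by
  obtain ⟨f, h, hh, hx⟩ := exists_jetField_eq_div x
  -- `q` bounds the orders of all the coordinates in a numerator and a denominator.
  set q : ℕ := N + (∑ v ∈ f.vars, v.1.2.degree + ∑ v ∈ h.vars, v.1.2.degree) with hq
  let i : JetIdx n m q → JetIdx n m ⊤ := fun p => ⟨p.1, le_top⟩
  have hi : Function.Injective i := fun _ _ h => Subtype.ext (congrArg (fun p => p.1) h)
  have key : ∀ f : MvPolynomial (JetIdx n m ⊤) k, (∀ v ∈ f.vars, v.1.2.degree ≤ q) →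
      ∃ f', MvPolynomial.rename i f' = f ∧ jetIncl k n m q (MvPolynomial.aeval
        (jetCoord k n m q) f') = MvPolynomial.aeval (jetCoord k n m ⊤) f := by
    intro f hf
    obtain ⟨f', rfl⟩ := MvPolynomial.exists_rename_eq_of_vars_subset_range f i hi
      (fun v hv => ⟨⟨v.1, Nat.cast_le.2 (hf v hv)⟩, rfl⟩)
    refine ⟨f', rfl, ?_⟩
    rw [jetHom_aeval, MvPolynomial.aeval_rename]
    congr 2
    exact funext fun p => jetIncl_jetCoord p
  have hle : ∀ f : MvPolynomial (JetIdx n m ⊤) k, ∀ v ∈ f.vars,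
      v.1.2.degree ≤ ∑ v ∈ f.vars, v.1.2.degree := fun f v hv =>
    Finset.single_le_sum (f := fun v : JetIdx n m ⊤ => v.1.2.degree) (fun _ _ => Nat.zero_le _) hv
  obtain ⟨f', -, hf'⟩ := key f fun v hv => by have := hle f v hv; omega
  obtain ⟨h', hrh', hh'⟩ := key h fun v hv => by have := hle h v hv; omega
  have hne : h' ≠ 0 := by
    rintro rfl
    exact hh (by rw [← hrh', map_zero])
  refine ⟨q, by omega, MvPolynomial.aeval (jetCoord k n m q) f' /
    MvPolynomial.aeval (jetCoord k n m q) h', ?_⟩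
  rw [map_div₀, hf', hh', div_eq_iff (aeval_jetCoord_ne_zero hh), hx]

/-! ### Principal homogeneous spaces -/

theorem _root_.DiffGalois.truncate_top (K : IntermediateField k (JetField k n m ⊤)) :
    truncate K ⊤ = K := by
  ext x
  change jetIncl k n m ⊤ x ∈ K ↔ _
  rw [jetIncl_top]
  rfl

/-- The action is principal homogeneous in the limit of infinite order as well: by uniqueness the
transformations of finite order are compatible. -/
theorem IsAutomorphic.isPHS {K : IntermediateField k (JetField k n m ⊤)}
    (hK : Γ.IsAutomorphic K) (hq : (Γ.order : ℕ∞) ≤ q) : Γ.IsPHS q (truncate K q) := by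
  induction q using ENat.recTopCoe with
  | coe q => exact hK.2 q (by exact_mod_cast hq)
  | top =>
    rw [truncate_top]
    intro B _ _ a b
    have hmem : ∀ q : ℕ, (∀ x ∈ K, a x = b x) → ∀ x ∈ truncate K (q : ℕ∞),
        a.comp (jetIncl k n m q) x = b.comp (jetIncl k n m q) x := fun q h x hx => h _ hx
    constructor
    · intro hab
      have hex : ∀ q : ℕ, Γ.order ≤ q → ∃! g, Γ.Relates q (a.comp (jetIncl k n m q))
          (b.comp (jetIncl k n m q)) g := fun q hq => (hK.2 q hq B _ _).1 (hmem q hab)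
      choose g hg hg' using hex
      -- The coordinate `p` of the limit is read off in an order `N p` which contains it.
      let N : JetIdx m m ⊤ → ℕ := fun p => Γ.order + p.1.2.degree
      have hN : ∀ p, Γ.order ≤ N p := fun p => Nat.le_add_right _ _
      have hNp : ∀ p : JetIdx m m ⊤, ((p.1.2.degree : ℕ) : ℕ∞) ≤ N p := fun p =>
        Nat.cast_le.2 (Nat.le_add_left _ _)
      have hcompat : ∀ (q q' : ℕ) (hq : Γ.order ≤ q) (hq' : Γ.order ≤ q') (h : q ≤ q'),
          truncJet (Nat.cast_le.2 h) (g q' hq') = g q hq := fun q q' hq hq' h =>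
        hg' q hq _ ((hg q' hq').trunc (Nat.cast_le.2 hq) (Nat.cast_le.2 h))
      let G : JetIdx m m ⊤ → B := fun p => g (N p) (hN p) ⟨p.1, hNp p⟩
      have hG : ∀ (q : ℕ) (hq : Γ.order ≤ q), truncJet le_top G = g q hq := by
        intro q hq
        funext p
        have h1 := congrFun (hcompat (N ⟨p.1, le_top⟩) (max q (N ⟨p.1, le_top⟩)) (hN _)
          (hq.trans (le_max_left _ _)) (le_max_right _ _)) ⟨p.1, hNp ⟨p.1, le_top⟩⟩
        have h2 := congrFun (hcompat q (max q (N ⟨p.1, le_top⟩)) hq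
          (hq.trans (le_max_left _ _)) (le_max_left _ _)) p
        exact h1.symm.trans h2
      refine ⟨G, relates_top fun q hq => by rw [hG q hq]; exact hg q hq, fun G' hG' => ?_⟩
      funext p
      have h1 : truncJet le_top G' = g (N p) (hN p) := by
        refine hg' _ _ _ (Relates.trunc (q' := ⊤) (Nat.cast_le.2 (hN p)) le_top ?_)
        rwa [jetIncl_top, AlgHom.comp_id, AlgHom.comp_id]
      exact congrFun h1 ⟨p.1, hNp p⟩
    · rintro ⟨g, hg⟩ x hx
      obtain ⟨q, hq, y, rfl⟩ := exists_jetIncl_eq x Γ.order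
      refine (hK.2 q hq B _ _).2 ⟨truncJet le_top g, Relates.trunc (q' := ⊤)
        (Nat.cast_le.2 hq) le_top ?_⟩ y hx
      rwa [jetIncl_top, AlgHom.comp_id, AlgHom.comp_id]

end AlgebraicPseudogroup

/-! ### Tensor products of fields and derivations -/

section Dual

variable {k A B : Type*} [Field k] [CommRing A] [Algebra k A] [CommRing B] [Algebra k B]

/-- A homomorphism to the dual numbers which lifts the identity is `x ↦ x + ε D x`. -/
theorem exists_derivation_of_dual (φ : A →ₐ[k] DualNumber A)
    (hφ : (TrivSqZeroExt.fstHom k A A).comp φ = AlgHom.id k A) :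
    ∃ D : Derivation k A A, ∀ z, φ z = dualLift (AlgHom.id k A) D z := by
  have hφ' : ∀ z, (φ z).fst = z := fun z => DFunLike.congr_fun hφ z
  refine ⟨derivOfDual φ hφ', fun z => dual_ext ?_ ?_⟩
  · rw [hφ', fst_dualLift]; rfl
  · rw [snd_dualLift]; rfl

theorem fstHom_comp_dualLift (f : A →ₐ[k] B) (d : Derivation k A A) :
    (TrivSqZeroExt.fstHom k B B).comp (dualLift f d) = f :=
  AlgHom.ext fun x => fst_dualLift f d x

theorem snd_eq_of_dualLift_eq {D : Derivation k B B} {f : A →ₐ[k] B} {d : Derivation k A A}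
    {x : A} {z : B} (h : dualLift (AlgHom.id k B) D z = dualLift f d x) : D z = f (d x) := by
  have := congrArg TrivSqZeroExt.snd h
  rwa [snd_dualLift, snd_dualLift] at this

end Dual

section TensorLift

variable {k F : Type*} [Field k] [Field F] [Algebra k F] (E : IntermediateField k F)
  {B : Type*} [CommRing B] [Algebra k B]

theorem leftMap_apply (x : F) : leftMap E x = x ⊗ₜ 1 := rfl

theorem rightMap_apply (x : F) : rightMap E x = 1 ⊗ₜ x := rfl

theorem leftMap_eq_rightMap {x : F} (hx : x ∈ E) : leftMap E x = rightMap E x := by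
  have h : algebraMap E F ⟨x, hx⟩ = x := rfl
  rw [leftMap_apply, rightMap_apply, ← h, Algebra.algebraMap_eq_smul_one, TensorProduct.smul_tmul]

theorem leftMap_mul_rightMap (x y : F) : leftMap E x * rightMap E y = x ⊗ₜ y := by
  rw [leftMap_apply, rightMap_apply, Algebra.TensorProduct.tmul_mul_tmul, mul_one, one_mul]

variable {E}

/-- Two points of `F` which agree on `E` are a point of `F ⊗_E F`. -/
theorem exists_tensorHom {a b : F →ₐ[k] B} (h : ∀ x ∈ E, a x = b x) :
    ∃ φ : F ⊗[E] F →ₐ[k] B, (∀ x, φ (leftMap E x) = a x) ∧ ∀ x, φ (rightMap E x) = b x := by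
  let _ : Algebra E B := (a.comp E.val).toRingHom.toAlgebra
  have halg : ∀ c : E, algebraMap E B c = a c := fun c => rfl
  have : IsScalarTower k E B := IsScalarTower.of_algebraMap_eq fun c => by
    rw [halg]
    exact (a.commutes c).symm
  let a' : F →ₐ[E] B := { a.toRingHom with commutes' := fun c => rfl }
  let b' : F →ₐ[E] B := { b.toRingHom with commutes' := fun c => (h c c.2).symm }
  let φ : F ⊗[E] F →ₐ[E] B := Algebra.TensorProduct.lift a' b' fun _ _ => Commute.all _ _
  refine ⟨φ.restrictScalars k, fun x => ?_, fun x => ?_⟩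
  · change φ (x ⊗ₜ 1) = a x
    refine (Algebra.TensorProduct.lift_tmul a' b' _ x 1).trans ?_
    rw [map_one, mul_one]
    rfl
  · change φ (1 ⊗ₜ x) = b x
    refine (Algebra.TensorProduct.lift_tmul a' b' _ 1 x).trans ?_
    rw [map_one, one_mul]
    rfl

end TensorLift

/-- The ring `T` is `F ⊗_E F`, as an algebra over `k`, with the inclusions `l` and `r`: its points
are the pairs of points of `F` which agree on `E`. Uniqueness of the homomorphism is expressed by
the generators, which gives it for values in any universe. -/
structure IsTensorSquare {k F T : Type u} [Field k] [Field F] [Algebra k F] [CommRing T]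
    [Algebra k T] (E : IntermediateField k F) (l r : F →ₐ[k] T) : Prop where
  eq_of_mem : ∀ x ∈ E, l x = r x
  exists_hom : ∀ {B : Type u} [CommRing B] [Algebra k B] (a b : F →ₐ[k] B),
    (∀ x ∈ E, a x = b x) → ∃ φ : T →ₐ[k] B, φ.comp l = a ∧ φ.comp r = b
  adjoin_eq_top : Algebra.adjoin k (Set.range l ∪ Set.range r) = ⊤

theorem isTensorSquare {k F : Type u} [Field k] [Field F] [Algebra k F]
    (E : IntermediateField k F) : IsTensorSquare E (leftMap E) (rightMap E) where
  eq_of_mem _ := leftMap_eq_rightMap E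
  exists_hom a b h := by
    obtain ⟨φ, h1, h2⟩ := exists_tensorHom h
    exact ⟨φ, AlgHom.ext h1, AlgHom.ext h2⟩
  adjoin_eq_top := by
    rw [eq_top_iff]
    rintro z -
    induction z using TensorProduct.induction_on with
    | zero => exact zero_mem _
    | tmul x y =>
      rw [← leftMap_mul_rightMap]
      exact mul_mem (Algebra.subset_adjoin (Or.inl ⟨x, rfl⟩))
        (Algebra.subset_adjoin (Or.inr ⟨y, rfl⟩))
    | add x y hx hy => exact add_mem hx hy

namespace IsTensorSquare

variable {k F T : Type u} [Field k] [Field F] [Algebra k F] [CommRing T] [Algebra k T]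
  {E : IntermediateField k F} {l r : F →ₐ[k] T} (h : IsTensorSquare E l r)

include h

theorem hom_ext {B : Type*} [CommRing B] [Algebra k B] {φ ψ : T →ₐ[k] B}
    (hl : ∀ x, φ (l x) = ψ (l x)) (hr : ∀ x, φ (r x) = ψ (r x)) : φ = ψ := by
  apply AlgHom.ext_of_adjoin_eq_top h.adjoin_eq_top
  rintro _ (⟨x, rfl⟩ | ⟨x, rfl⟩)
  · exact hl x
  · exact hr x

theorem derivation_ext {D D' : Derivation k T T} (hl : ∀ x, D (l x) = D' (l x))
    (hr : ∀ x, D (r x) = D' (r x)) : D = D' := by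
  have : dualLift (AlgHom.id k T) D = dualLift (AlgHom.id k T) D' :=
    h.hom_ext (fun x => by simp [dualLift_apply, hl]) (fun x => by simp [dualLift_apply, hr])
  ext x
  have := congrArg TrivSqZeroExt.snd (DFunLike.congr_fun this x)
  simpa [dualLift_apply] using this

/-- A pair of tangent vectors along the two inclusions of `F` in `F ⊗_E F`, which agree on `E`,
is a derivation of `F ⊗_E F`. -/
theorem exists_derivation (a b : F →ₐ[k] DualNumber T)
    (ha : (TrivSqZeroExt.fstHom k T T).comp a = l)
    (hb : (TrivSqZeroExt.fstHom k T T).comp b = r) (hab : ∀ x ∈ E, a x = b x) :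
    ∃ D : Derivation k T T, (dualLift (AlgHom.id k T) D).comp l = a ∧
      (dualLift (AlgHom.id k T) D).comp r = b := by
  obtain ⟨φ, rfl, rfl⟩ := h.exists_hom a b hab
  obtain ⟨D, hD⟩ := exists_derivation_of_dual φ
    (h.hom_ext (fun x => DFunLike.congr_fun ha x) (fun x => DFunLike.congr_fun hb x))
  exact ⟨D, AlgHom.ext fun x => (hD _).symm, AlgHom.ext fun x => (hD _).symm⟩

/-- A derivation of `F` preserving `E` acts on `F ⊗_E F`. -/
theorem exists_derivation_of_mapsTo (d : Derivation k F F) (hd : ∀ x ∈ E, d x ∈ E) :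
    ∃ D : Derivation k T T, (∀ x, D (l x) = l (d x)) ∧ ∀ x, D (r x) = r (d x) := by
  obtain ⟨D, h1, h2⟩ := h.exists_derivation (dualLift l d) (dualLift r d)
    (fstHom_comp_dualLift _ _) (fstHom_comp_dualLift _ _)
    (fun x hx => by
      rw [dualLift_apply, dualLift_apply, h.eq_of_mem x hx, h.eq_of_mem _ (hd x hx)])
  exact ⟨D, fun x => snd_eq_of_dualLift_eq (DFunLike.congr_fun h1 x),
    fun x => snd_eq_of_dualLift_eq (DFunLike.congr_fun h2 x)⟩

end IsTensorSquare

section LocalizationDerivation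

variable {k A S : Type*} [Field k] [CommRing A] [CommRing S] [Algebra k A] [Algebra k S]
  [Algebra A S] [IsScalarTower k A S] (M : Submonoid A) [IsLocalization M S]

include M in
omit [Algebra k A] [IsScalarTower k A S] in
theorem localizationDerivation_ext {D D' : Derivation k S S}
    (h : ∀ x, D (algebraMap A S x) = D' (algebraMap A S x)) : D = D' := by
  have : dualLift (AlgHom.id k _) D = dualLift (AlgHom.id k _) D' := by
    apply AlgHom.coe_ringHom_injective
    apply IsLocalization.ringHom_ext M
    ext x <;> simp [dualLift_apply, h]
  ext x
  have := congrArg TrivSqZeroExt.snd (DFunLike.congr_fun this x)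
  simpa [dualLift_apply] using this

include M in
/-- A derivation extends to localizations. -/
theorem exists_localizationDerivation (d : Derivation k A A) :
    ∃ D : Derivation k S S, ∀ x, D (algebraMap A S x) = algebraMap A S (d x) := by
  let φ : S →ₐ[k] DualNumber S :=
    IsLocalization.liftAlgHom (M := M) (f := dualLift (IsScalarTower.toAlgHom k A S) d)
      (fun y => by
        rw [TrivSqZeroExt.isUnit_iff_isUnit_fst, fst_dualLift]
        exact IsLocalization.map_units S y)
  have hφ : ∀ x, φ (algebraMap A S x) = dualLift (IsScalarTower.toAlgHom k A S) d x := fun x =>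
    IsLocalization.lift_eq (M := M) _ x
  have hfst : (TrivSqZeroExt.fstHom k _ _).comp φ = AlgHom.id k _ := by
    apply AlgHom.coe_ringHom_injective
    apply IsLocalization.ringHom_ext M
    ext x
    change (φ (algebraMap A S x)).fst = _
    rw [hφ, fst_dualLift]
    rfl
  have hfst' : ∀ z, (φ z).fst = z := fun z => DFunLike.congr_fun hfst z
  refine ⟨derivOfDual φ hfst', fun x => ?_⟩
  rw [derivOfDual_apply, hφ, snd_dualLift]
  rfl

end LocalizationDerivation

/-! ### Subspaces stable under derivations -/

section Stable

variable {F : Type*} [Field F]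

/-- Let `Θ` be a set of derivations of the field `F`. A subspace of `F^(ι)` which is stable under
`Θ`, acting on coordinates, is spanned by its vectors with constant coordinates. -/
theorem le_span_constants {ι : Type*} {k : Type*} [CommRing k] [Algebra k F]
    (Θ : Set (Derivation k F F)) (N : Submodule F (ι →₀ F))
    (hN : ∀ θ ∈ Θ, ∀ v ∈ N, v.mapRange θ (map_zero θ) ∈ N) :
    N ≤ Submodule.span F {v | v ∈ N ∧ ∀ i, ∀ θ ∈ Θ, θ (v i) = 0} := by
  classical
  intro v hv
  induction hc : v.support.card using Nat.strong_induction_on generalizing v with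
  | _ c ih =>
  by_cases hv0 : v = 0
  · rw [hv0]
    exact zero_mem _
  -- Let `w` be nonzero of minimal support contained in that of `v`, with some coordinate `1`.
  let P : ℕ → Prop := fun d => ∃ w ∈ N, w ≠ 0 ∧ w.support ⊆ v.support ∧ w.support.card = d
  have hP : ∃ d, P d := ⟨_, v, hv, hv0, subset_rfl, rfl⟩
  obtain ⟨w₀, hw₀, hw₀0, hw₀s, hw₀c⟩ := Nat.find_spec hP
  obtain ⟨i, hi⟩ := Finsupp.support_nonempty_iff.2 hw₀0
  set w := (w₀ i)⁻¹ • w₀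
  have hi' : w₀ i ≠ 0 := Finsupp.mem_support_iff.1 hi
  have hwN : w ∈ N := N.smul_mem _ hw₀
  have hws : w.support = w₀.support := Finsupp.support_smul_eq (inv_ne_zero hi')
  have hwi : w i = 1 := by simp [w, hi']
  have hwc : ∀ j, ∀ θ ∈ Θ, θ (w j) = 0 := by
    intro j θ hθ
    by_contra hne
    have hsub : (w.mapRange θ (map_zero θ)).support ⊆ w.support.erase i := by
      intro l hl
      rw [Finsupp.mem_support_iff, Finsupp.mapRange_apply] at hl
      refine Finset.mem_erase.2 ⟨?_, Finsupp.mem_support_iff.2 ?_⟩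
      · rintro rfl
        rw [hwi] at hl
        exact hl (Derivation.map_one_eq_zero θ)
      · intro h0
        rw [h0, map_zero] at hl
        exact hl rfl
    have hlt : (w.mapRange θ (map_zero θ)).support.card < Nat.find hP := by
      refine (Finset.card_le_card hsub).trans_lt ?_
      rw [← hw₀c, ← hws]
      exact Finset.card_erase_lt_of_mem (by rw [hws]; exact hi)
    refine Nat.find_min hP hlt ⟨_, hN θ hθ w hwN, ?_,
      hsub.trans ((Finset.erase_subset _ _).trans (hws ▸ hw₀s)), rfl⟩
    intro h0
    exact hne (by simpa using DFunLike.congr_fun h0 j)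
  have hlt : (v - v i • w).support.card < c := by
    rw [← hc]
    refine Finset.card_lt_card (Finset.ssubset_iff_of_subset ?_ |>.2 ⟨i, hw₀s hi, ?_⟩)
    · intro l hl
      rw [Finsupp.mem_support_iff] at hl ⊢
      intro h0
      apply hl
      have : w l = 0 := by
        by_contra hne
        exact (Finsupp.mem_support_iff.1 (hw₀s (hws ▸ Finsupp.mem_support_iff.2 hne))) h0
      simp [h0, this]
    · simp [hwi]
  have h1 := ih _ hlt (N.sub_mem hv (N.smul_mem _ hwN)) rfl
  have h2 := Submodule.smul_mem _ (v i)
    (Submodule.subset_span (R := F) (s := {v | v ∈ N ∧ ∀ i, ∀ θ ∈ Θ, θ (v i) = 0}) ⟨hwN, hwc⟩)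
  have := add_mem h1 h2
  rwa [sub_add_cancel] at this

variable {E A : Type*} [Field E] [Algebra E F] [AddCommGroup A] [Module E A]

/-- A subspace of `F ⊗_E A` which is stable under a set of `E`-derivations of `F` is spanned by
its elements with coefficients in the field of constants `C`. -/
theorem le_span_range_rTensor (Θ : Set (Derivation E F F)) (C : Submodule E F)
    (hC : ∀ x, (∀ θ ∈ Θ, θ x = 0) → x ∈ C) (N : Submodule F (F ⊗[E] A))
    (hN : ∀ θ ∈ Θ, ∀ z ∈ N, LinearMap.rTensor A (θ : F →ₗ[E] F) z ∈ N) :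
    N ≤ Submodule.span F {z | z ∈ N ∧ z ∈ LinearMap.range (LinearMap.rTensor A C.subtype)} := by
  let b := Module.Free.chooseBasis E A
  let β := b.baseChange F
  have hβ : ∀ (θ : Derivation E F F) (z : F ⊗[E] A),
      β.repr (LinearMap.rTensor A (θ : F →ₗ[E] F) z) = (β.repr z).mapRange θ (map_zero θ) := by
    intro θ z
    induction z using TensorProduct.induction_on with
    | zero => simp
    | tmul x a =>
      ext i
      simp [β]
    | add x y hx hy => rw [map_add, map_add, hx, hy, map_add, Finsupp.mapRange_add (map_add θ)]
  have h := le_span_constants Θ (N.map β.repr.toLinearMap) (by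
    rintro θ hθ _ ⟨z, hz, rfl⟩
    exact ⟨_, hN θ hθ z hz, hβ θ z⟩)
  intro z hz
  have h1 := h ⟨z, hz, rfl⟩
  have h2 := Submodule.mem_map_of_mem (f := β.repr.symm.toLinearMap) h1
  rw [Submodule.map_span] at h2
  have h3 : β.repr.symm.toLinearMap (β.repr.toLinearMap z) = z :=
    β.repr.symm_apply_apply z
  rw [h3] at h2
  refine Submodule.span_mono ?_ h2
  rintro _ ⟨v, ⟨⟨w, hw, rfl⟩, hv⟩, rfl⟩
  have h4 : β.repr.symm.toLinearMap (β.repr.toLinearMap w) = w :=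
    β.repr.symm_apply_apply w
  rw [h4]
  refine ⟨hw, ?_⟩
  rw [← β.linearCombination_repr w, Finsupp.linearCombination_apply]
  refine Submodule.sum_mem _ fun i _ => ⟨(⟨β.repr w i, hC _ (hv i)⟩ : C) ⊗ₜ b i, ?_⟩
  simp [β, TensorProduct.smul_tmul']

/-- The case where all the constants are in `E`. -/
theorem le_span_one_tmul (Θ : Set (Derivation E F F))
    (hC : ∀ x, (∀ θ ∈ Θ, θ x = 0) → x ∈ (algebraMap E F).range) (N : Submodule F (F ⊗[E] A))
    (hN : ∀ θ ∈ Θ, ∀ z ∈ N, LinearMap.rTensor A (θ : F →ₗ[E] F) z ∈ N) :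
    N ≤ Submodule.span F {z | z ∈ N ∧ ∃ a : A, z = 1 ⊗ₜ a} := by
  refine (le_span_range_rTensor Θ (LinearMap.range (Algebra.linearMap E F))
    (fun x hx => hC x hx) N hN).trans (Submodule.span_mono ?_)
  rintro z ⟨hz, ⟨w, rfl⟩⟩
  refine ⟨hz, ?_⟩
  clear hz
  induction w using TensorProduct.induction_on with
  | zero => exact ⟨0, by simp⟩
  | tmul x a =>
    obtain ⟨_, c, rfl⟩ := x
    refine ⟨c • a, ?_⟩
    simp [TensorProduct.tmul_smul, TensorProduct.smul_tmul', Algebra.algebraMap_eq_smul_one]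
  | add x y hx hy =>
    obtain ⟨a, ha⟩ := hx
    obtain ⟨b, hb⟩ := hy
    exact ⟨a + b, by rw [map_add, ha, hb, TensorProduct.tmul_add]⟩

/-- An element of `F ⊗_E A` killed by a set of derivations of `F` with constants `E` is in `A`. -/
theorem exists_eq_one_tmul (Θ : Set (Derivation E F F))
    (hC : ∀ x, (∀ θ ∈ Θ, θ x = 0) → x ∈ (algebraMap E F).range) (z : F ⊗[E] A)
    (hz : ∀ θ ∈ Θ, LinearMap.rTensor A (θ : F →ₗ[E] F) z = 0) : ∃ a : A, z = 1 ⊗ₜ a := by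
  let b := Module.Free.chooseBasis E A
  let β := b.baseChange F
  have hβ : ∀ (θ : Derivation E F F) (z : F ⊗[E] A),
      β.repr (LinearMap.rTensor A (θ : F →ₗ[E] F) z) = (β.repr z).mapRange θ (map_zero θ) := by
    intro θ z
    induction z using TensorProduct.induction_on with
    | zero => simp
    | tmul x a =>
      ext i
      simp [β]
    | add x y hx hy => rw [map_add, map_add, hx, hy, map_add, Finsupp.mapRange_add (map_add θ)]
  have h : ∀ i, ∃ e : E, algebraMap E F e = β.repr z i := fun i => hC _ fun θ hθ => by
    have h1 := DFunLike.congr_fun (hβ θ z) i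
    rw [hz θ hθ, map_zero] at h1
    simpa using h1.symm
  choose e he using h
  refine ⟨∑ i ∈ (β.repr z).support, e i • b i, ?_⟩
  conv_lhs => rw [← β.linearCombination_repr z, Finsupp.linearCombination_apply]
  rw [TensorProduct.tmul_sum]
  refine Finset.sum_congr rfl fun i _ => ?_
  simp [β, ← he, TensorProduct.smul_tmul', TensorProduct.tmul_smul, Algebra.algebraMap_eq_smul_one]

end Stable

/-! ### Invariant derivations -/

namespace AlgebraicPseudogroup

variable {k : Type u} [Field k] {n m : ℕ} {q : ℕ∞} {Γ : AlgebraicPseudogroup k m}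
  {B : Type u} [CommRing B] [Algebra k B]

/-- A displacement along a derivation which is zero on `k(y)` does not move the point `y`. -/
theorem dualLift_comp_baseIncl {δ : Derivation k (JetField k n m q) (JetField k n m q)}
    (hδ : KillsBase δ) (a : JetField k n m q →ₐ[k] B) :
    (dualLift a δ).comp (baseIncl k n m q) =
      (TrivSqZeroExt.inlAlgHom k B B).comp (a.comp (baseIncl k n m q)) :=
  AlgHom.ext fun c => by simp [dualLift_apply, hδ c]

theorem killsBase_iff {δ : Derivation k (JetField k n m q) (JetField k n m q)} :
    KillsBase δ ↔ ∀ u, δ (jetCoord k n m q (JetIdx.zero u)) = 0 := by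
  refine ⟨fun h u => by rw [← baseIncl_baseCoord]; exact h _, fun h c => ?_⟩
  have : (dualLift (AlgHom.id k _) δ).comp (baseIncl k n m q) =
      (TrivSqZeroExt.inlAlgHom k _ _).comp (baseIncl k n m q) :=
    baseHom_ext fun u => by simp [dualLift_apply, baseIncl_baseCoord, h]
  have := congrArg TrivSqZeroExt.snd (DFunLike.congr_fun this c)
  simpa [dualLift_apply] using this

/-- The displacements of related points along an element of the reciprocal distribution are related
by the same transformation. -/
theorem Relates.dual {δ : Derivation k (JetField k n m q) (JetField k n m q)}
    (hδ : δ ∈ Γ.Delta n q) {a b : JetField k n m q →ₐ[k] B} {g : JetIdx m m q → B}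
    (h : Γ.Relates q a b g) :
    Γ.Relates q (dualLift a δ) (dualLift b δ) (fun p => TrivSqZeroExt.inl (g p)) := by
  refine ⟨?_, fun p => hδ.2 B a b g h p⟩
  rw [dualLift_comp_baseIncl hδ.1, dualLift_comp_baseIncl hδ.1]
  exact h.1.map (TrivSqZeroExt.inlAlgHom k B B)

/-- If the first of two related points is displaced along a derivation which is zero on `k(y)`, the
same transformation relates it to a displacement of the second point, in some direction. -/
theorem Relates.exists_dual {δ : Derivation k (JetField k n m q) (JetField k n m q)}
    (hδ : KillsBase δ) {a b : JetField k n m q →ₐ[k] B} {g : JetIdx m m q → B}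
    (h : Γ.Relates q a b g) :
    ∃ b' : JetField k n m q →ₐ[k] DualNumber B, (TrivSqZeroExt.fstHom k B B).comp b' = b ∧
      Γ.Relates q (dualLift a δ) b' (fun p => TrivSqZeroExt.inl (g p)) := by
  obtain ⟨b', hb', hfst⟩ := exists_jetHom_of_isLocalHom (TrivSqZeroExt.fstHom k B B)
    isUnit_of_isUnit_fst b
    (chain k (fun p => dualLift a δ (jetCoord k n m q p)) fun p => TrivSqZeroExt.inl (g p))
    (fun p => by
      rw [h.2, map_chain]
      congr 1
      funext r
      exact fst_dualLift _ _ _)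
  refine ⟨b', hfst, ?_, hb'⟩
  rw [dualLift_comp_baseIncl hδ]
  have : b'.comp (baseIncl k n m q) =
      (TrivSqZeroExt.inlAlgHom k B B).comp (b.comp (baseIncl k n m q)) :=
    baseHom_ext fun u => by
      simp only [AlgHom.comp_apply, baseIncl_baseCoord]
      rw [hb', chain_zero_order, h.2, chain_zero_order]
      rfl
  rw [this]
  exact h.1.map (TrivSqZeroExt.inlAlgHom k B B)

section Universal

variable {E : IntermediateField k (JetField k n m q)} (hE : Γ.IsPHS q E)
  {T : Type u} [CommRing T] [Algebra k T] {l r : JetField k n m q →ₐ[k] T}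
  (hT : IsTensorSquare E l r)

include hE

theorem IsPHS.eq_of_relates {a b : JetField k n m q →ₐ[k] B} {g g' : JetIdx m m q → B}
    (h : Γ.Relates q a b g) (h' : Γ.Relates q a b g') : g = g' :=
  ((hE B a b).1 ((hE B a b).2 ⟨g, h⟩)).unique h h'

/-- Related points agree on the differential invariants. -/
theorem IsPHS.eq_on {a b : JetField k n m q →ₐ[k] B} {g : JetIdx m m q → B}
    (h : Γ.Relates q a b g) {x : JetField k n m q} (hx : x ∈ E) : a x = b x :=
  (hE B a b).2 ⟨g, h⟩ x hx

include hT

theorem IsPHS.exists_relates : ∃ g, Γ.Relates q l r g :=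
  ((hE T l r).1 hT.eq_of_mem).exists

/-- The elements of the reciprocal distribution act on `L_q ⊗ L_q`: the displacements of the two
universal points are related, and therefore agree on the invariants. -/
theorem IsPHS.exists_extension {δ : Derivation k (JetField k n m q) (JetField k n m q)}
    (hδ : δ ∈ Γ.Delta n q) :
    ∃ D : Derivation k T T, (∀ x, D (l x) = l (δ x)) ∧ ∀ x, D (r x) = r (δ x) := by
  obtain ⟨g, hg⟩ := hE.exists_relates hT
  obtain ⟨D, h1, h2⟩ := hT.exists_derivation (dualLift l δ) (dualLift r δ)
    (fstHom_comp_dualLift _ _) (fstHom_comp_dualLift _ _)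
    (fun x hx => hE.eq_on (hg.dual hδ) hx)
  exact ⟨D, fun x => snd_eq_of_dualLift_eq (DFunLike.congr_fun h1 x),
    fun x => snd_eq_of_dualLift_eq (DFunLike.congr_fun h2 x)⟩

omit hT in
/-- A derivation of `L_q ⊗ L_q` which displaces related points in such a way that they remain
related by the same transformation kills the components of the transformation. -/
theorem IsPHS.derivation_eq_zero {D : Derivation k T T} {a b : JetField k n m q →ₐ[k] DualNumber T}
    (ha : (dualLift (AlgHom.id k T) D).comp l = a) (hb : (dualLift (AlgHom.id k T) D).comp r = b)
    {g : JetIdx m m q → T} (hg : Γ.Relates q l r g)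
    (hab : Γ.Relates q a b (fun p => TrivSqZeroExt.inl (g p))) (p : JetIdx m m q) :
    D (g p) = 0 := by
  have h1 := hg.map (dualLift (AlgHom.id k T) D)
  rw [ha, hb] at h1
  have h2 := congrFun (hE.eq_of_relates h1 hab) p
  have h3 := congrArg TrivSqZeroExt.snd h2
  rwa [snd_dualLift, TrivSqZeroExt.snd_inl] at h3

omit hT in
/-- The components of the universal transformation are constants of the reciprocal distribution. -/
theorem IsPHS.extension_eq_zero {δ : Derivation k (JetField k n m q) (JetField k n m q)}
    (hδ : δ ∈ Γ.Delta n q) {D : Derivation k T T} (hl : ∀ x, D (l x) = l (δ x))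
    (hr : ∀ x, D (r x) = r (δ x)) {g : JetIdx m m q → T} (hg : Γ.Relates q l r g)
    (p : JetIdx m m q) : D (g p) = 0 :=
  hE.derivation_eq_zero (a := dualLift l δ) (b := dualLift r δ)
    (AlgHom.ext fun x => by simp [dualLift_apply, hl])
    (AlgHom.ext fun x => by simp [dualLift_apply, hr]) hg (hg.dual hδ) p

end Universal

/-! ### Infinitesimal transformations -/

theorem inr_eq_mul (x : B) :
    (TrivSqZeroExt.inr x : DualNumber B) = TrivSqZeroExt.inr 1 * TrivSqZeroExt.inl x := by
  ext <;> simp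

/-- The composition of a jet with an infinitesimal displacement `g + ε h` of a jet of
transformations. -/
theorem chain_inl_add_inr (a : JetIdx n m q → B) (g h : JetIdx m m q → B) (p : JetIdx n m q) :
    chain k (fun r => (TrivSqZeroExt.inl (a r) : DualNumber B))
      (fun r => TrivSqZeroExt.inl (g r) + TrivSqZeroExt.inr (h r)) p =
      TrivSqZeroExt.inl (chain k a g p) + TrivSqZeroExt.inr (chain k a h p) := by
  have h1 : (fun r => (TrivSqZeroExt.inl (g r) + TrivSqZeroExt.inr (h r) : DualNumber B)) =
      fun r => TrivSqZeroExt.inlAlgHom k B B (g r) +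
        TrivSqZeroExt.inr 1 * TrivSqZeroExt.inlAlgHom k B B (h r) :=
    funext fun r => by rw [inr_eq_mul]; rfl
  have h2 : (fun r => (TrivSqZeroExt.inl (a r) : DualNumber B)) =
      fun r => TrivSqZeroExt.inlAlgHom k B B (a r) := rfl
  rw [h1, h2, chain_add_mul, ← map_chain, ← map_chain, inr_eq_mul (chain k a h p)]
  rfl

/-- The homomorphism of dual numbers induced by a homomorphism. -/
noncomputable def dualMap {A B : Type*} [CommRing A] [CommRing B] [Algebra k A] [Algebra k B]
    (f : A →ₐ[k] B) : DualNumber A →ₐ[k] DualNumber B where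
  toFun x := TrivSqZeroExt.inl (f x.fst) + TrivSqZeroExt.inr (f x.snd)
  map_one' := by simp
  map_mul' x y := by
    ext
    · simp
    · simp [mul_comm]
  map_zero' := by simp
  map_add' x y := by ext <;> simp
  commutes' c := by
    ext
    · simp [TrivSqZeroExt.algebraMap_eq_inl']
    · simp [TrivSqZeroExt.algebraMap_eq_inl']

theorem dualMap_inl {A : Type*} [CommRing A] [Algebra k A] (f : A →ₐ[k] B) (x : A) :
    dualMap f (TrivSqZeroExt.inl x) = TrivSqZeroExt.inl (f x) := by
  ext <;> simp [dualMap]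

theorem dualMap_inr {A : Type*} [CommRing A] [Algebra k A] (f : A →ₐ[k] B) (x : A) :
    dualMap f (TrivSqZeroExt.inr x) = TrivSqZeroExt.inr (f x) := by
  ext <;> simp [dualMap]

/-- An infinitesimal transformation relates each point to the point displaced along it. -/
theorem relates_theta {θ : Derivation k (JetField k n m q) (JetField k n m q)}
    {η : JetIdx m m q → BaseField k m} (hη : Γ.IsInfinitesimal q η)
    (hθ : ∀ p, θ (jetCoord k n m q p) =
      chain k (jetCoord k n m q) (fun r => baseIncl k n m q (η r)) p)
    (a : JetField k n m q →ₐ[k] B) :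
    Γ.Relates q ((TrivSqZeroExt.inlAlgHom k B B).comp a) (dualLift a θ)
      (fun p => TrivSqZeroExt.inl (idJet q (a.comp (baseIncl k n m q)) p) +
        TrivSqZeroExt.inr (a (baseIncl k n m q (η p)))) := by
  obtain ⟨t, ht⟩ := hη
  have h0 := ht.map (dualMap (a.comp (baseIncl k n m q)))
  have hs : (dualMap (a.comp (baseIncl k n m q))).comp (TrivSqZeroExt.inlAlgHom k _ _) =
      ((TrivSqZeroExt.inlAlgHom k B B).comp a).comp (baseIncl k n m q) :=
    AlgHom.ext fun x => dualMap_inl _ _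
  have hu : ∀ u : Fin m, idJet q (AlgHom.id k (BaseField k m)) (JetIdx.zero u) =
      baseCoord k m u := fun u => by simp [idJet, JetIdx.zero]
  have hc : ∀ x, ((dualLift a θ).comp (baseIncl k n m q)) x =
      dualLift a θ (baseIncl k n m q x) := fun _ => rfl
  have ht' : (dualMap (a.comp (baseIncl k n m q))).comp t =
      (dualLift a θ).comp (baseIncl k n m q) := baseHom_ext fun u => by
    rw [AlgHom.comp_apply, ← ht.1.1, map_add, dualMap_inl, dualMap_inr, hc,
      baseIncl_baseCoord, dualLift_apply, hθ, chain_zero_order, hu, AlgHom.comp_apply,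
      AlgHom.comp_apply, baseIncl_baseCoord]
  rw [hs, ht'] at h0
  have hg : (fun p => dualMap (a.comp (baseIncl k n m q))
      (TrivSqZeroExt.inl (idJet q (AlgHom.id k (BaseField k m)) p) +
        TrivSqZeroExt.inr (η p))) = fun p => TrivSqZeroExt.inl
          (idJet q (a.comp (baseIncl k n m q)) p) +
        TrivSqZeroExt.inr (a (baseIncl k n m q (η p))) := funext fun p => by
    rw [map_add, dualMap_inl, dualMap_inr, map_idJet]
    rfl
  rw [hg] at h0
  refine ⟨h0, fun p => ?_⟩
  have h1 := chain_inl_add_inr (k := k) (fun p => a (jetCoord k n m q p))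
    (idJet q (a.comp (baseIncl k n m q))) (fun p => a (baseIncl k n m q (η p))) p
  have h2 : chain k (fun p => a (jetCoord k n m q p)) (idJet q (a.comp (baseIncl k n m q))) =
      fun p => a (jetCoord k n m q p) :=
    chain_idJet k _ _ fun u => by rw [AlgHom.comp_apply, baseIncl_baseCoord]
  have h3 : chain k (fun p => a (jetCoord k n m q p)) (fun p => a (baseIncl k n m q (η p))) p =
      a (θ (jetCoord k n m q p)) := by rw [hθ, map_chain]
  rw [h2, h3] at h1
  rw [dualLift_apply]
  exact h1.symm

/-- The reciprocal distribution commutes with the infinitesimal transformations. -/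
theorem commutator_eq_zero
    {δ θ : Derivation k (JetField k n m q) (JetField k n m q)} (hδ : δ ∈ Γ.Delta n q)
    (hθ : θ ∈ Γ.Theta n q) : ⁅θ, δ⁆ = 0 := by
  obtain ⟨η, hη, hθη⟩ := hθ
  refine jetDerivation_ext fun p => ?_
  rw [Derivation.commutator_apply, Derivation.coe_zero, Pi.zero_apply, sub_eq_zero]
  -- Compare the components in `ε ε'` of the points `y + ε θ y`, displaced along `ε' δ`.
  have h := hδ.2 (DualNumber (JetField k n m q)) _ _ _
    (relates_theta hη hθη (AlgHom.id k (JetField k n m q))) p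
  let Φ : JetField k n m q →ₐ[k] DualNumber (DualNumber (JetField k n m q)) :=
    (dualMap (TrivSqZeroExt.inlAlgHom k _ _)).comp (dualLift (AlgHom.id k _) δ)
  have hΦ' : ∀ x, Φ x = TrivSqZeroExt.inl (TrivSqZeroExt.inl x) +
      TrivSqZeroExt.inr (TrivSqZeroExt.inl (δ x)) := fun x => by
    change dualMap _ (dualLift (AlgHom.id k _) δ x) = _
    rw [dualLift_apply, map_add, dualMap_inl, dualMap_inr]
    rfl
  have hΦ : ∀ c, Φ (baseIncl k n m q c) =
      TrivSqZeroExt.inl (TrivSqZeroExt.inl (baseIncl k n m q c)) := fun c => by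
    rw [hΦ', hδ.1 c, TrivSqZeroExt.inl_zero, TrivSqZeroExt.inr_zero, add_zero]
  have hg : (fun r => (TrivSqZeroExt.inl (TrivSqZeroExt.inl
      (idJet q ((AlgHom.id k (JetField k n m q)).comp (baseIncl k n m q)) r) + TrivSqZeroExt.inr
        (AlgHom.id k (JetField k n m q) (baseIncl k n m q (η r)))) :
          DualNumber (DualNumber (JetField k n m q)))) =
      fun r => Φ (idJet q (baseIncl k n m q) r) +
        TrivSqZeroExt.inl (TrivSqZeroExt.inr 1) * Φ (baseIncl k n m q (η r)) := by
    funext r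
    have h1 : Φ (idJet q (baseIncl k n m q) r) =
        TrivSqZeroExt.inl (TrivSqZeroExt.inl (idJet q (baseIncl k n m q) r)) := by
      have h2 : Φ.comp (baseIncl k n m q) = ((TrivSqZeroExt.inlAlgHom k _ _).comp
          (TrivSqZeroExt.inlAlgHom k _ _)).comp (baseIncl k n m q) := AlgHom.ext hΦ
      refine (map_idJet (C := DualNumber (DualNumber (JetField k n m q))) k Φ
        (baseIncl k n m q) r).trans ?_
      rw [h2]
      exact (map_idJet (C := DualNumber (DualNumber (JetField k n m q))) k
        ((TrivSqZeroExt.inlAlgHom k _ _).comp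
          (TrivSqZeroExt.inlAlgHom k _ _)) (baseIncl k n m q) r).symm
    rw [h1, hΦ, AlgHom.id_comp, AlgHom.id_apply, inr_eq_mul (baseIncl k n m q (η r)),
      TrivSqZeroExt.inl_add, TrivSqZeroExt.inl_mul]
  rw [hg, chain_add_mul] at h
  have hA : (fun r => (TrivSqZeroExt.inl ((TrivSqZeroExt.inlAlgHom k (JetField k n m q)
      (JetField k n m q)).comp (AlgHom.id k (JetField k n m q))
      (jetCoord k n m q r)) + TrivSqZeroExt.inr ((TrivSqZeroExt.inlAlgHom k (JetField k n m q)
        (JetField k n m q)).comp (AlgHom.id k (JetField k n m q))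
          (δ (jetCoord k n m q r))) : DualNumber (DualNumber (JetField k n m q)))) =
      fun r => Φ (jetCoord k n m q r) := funext fun r => (hΦ' _).symm
  have hc : chain k (jetCoord k n m q) (idJet q (baseIncl k n m q)) = jetCoord k n m q :=
    chain_idJet k _ _ fun u => baseIncl_baseCoord u
  rw [hA, ← map_chain, ← map_chain, ← hθη, hc] at h
  have h2 := congrArg (fun z => (TrivSqZeroExt.snd z).snd) h
  rw [hΦ', hΦ'] at h2
  simpa [dualLift_apply] using h2

end AlgebraicPseudogroup

/-! ### Derivations of fields of characteristic zero -/

/-- In characteristic zero every field extension `F / S` is formally smooth, being separable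
algebraic over a purely transcendental extension: a homomorphism on `S` extends to `F` through a
nilpotent thickening of `F`. -/
theorem exists_section_of_nilpotent {S F B : Type u} [Field S] [CharZero S] [Field F] [CommRing B]
    (i : S →+* F) (φ : S →+* B) (π : B →+* F) (hπ : Function.Surjective π)
    (hker : IsNilpotent (RingHom.ker π)) (h : π.comp φ = i) :
    ∃ s : F →+* B, π.comp s = RingHom.id F ∧ s.comp i = φ := by
  let _ : Algebra S F := i.toAlgebra
  let _ : Algebra S B := φ.toAlgebra
  obtain ⟨s, hs⟩ := exists_isTranscendenceBasis' S F
  have : Algebra.IsAlgebraic (IntermediateField.adjoin S (Set.range hs.choose)) F :=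
    hs.choose_spec.isAlgebraic_field
  have := Algebra.FormallySmooth.of_algebraicIndependent_of_isSeparable hs.choose_spec.1
  let π' : B →ₐ[S] F := { π with commutes' := fun c => DFunLike.congr_fun h c }
  refine ⟨(Algebra.FormallySmooth.liftOfSurjective (AlgHom.id S F) π' hπ hker).toRingHom, ?_, ?_⟩
  · ext x
    exact Algebra.FormallySmooth.liftOfSurjective_apply (AlgHom.id S F) π' hπ hker x
  · ext x
    exact (Algebra.FormallySmooth.liftOfSurjective (AlgHom.id S F) π' hπ hker).commutes x

/-- In characteristic zero a transcendental element `x` is moved by some derivation: extend the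
displacement `x ↦ x + ε` of `E(x)` to `F` by formal smoothness. -/
theorem exists_derivation_ne_zero {E F : Type u} [Field E] [CharZero E] [Field F] [Algebra E F]
    {x : F} (hx : Transcendental E x) : ∃ d : Derivation E F F, d x ≠ 0 := by
  have hinj : Function.Injective (Polynomial.aeval (R := E) x) :=
    transcendental_iff_injective.1 hx
  have hu : ∀ f : nonZeroDivisors (Polynomial E), IsUnit
      (Polynomial.aeval (R := E)
        (TrivSqZeroExt.inl x + TrivSqZeroExt.inr 1 : DualNumber F) f.1) := by
    intro f
    rw [TrivSqZeroExt.isUnit_iff_isUnit_fst]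
    have : (Polynomial.aeval (R := E)
        (TrivSqZeroExt.inl x + TrivSqZeroExt.inr 1 : DualNumber F) f.1).fst =
        Polynomial.aeval x f.1 := by
      refine (Polynomial.aeval_algHom_apply (TrivSqZeroExt.fstHom E F F) _ f.1).symm.trans ?_
      have h1 : (TrivSqZeroExt.fstHom E F F) (TrivSqZeroExt.inl x + TrivSqZeroExt.inr 1) = x := by
        rw [TrivSqZeroExt.fstHom_apply, TrivSqZeroExt.fst_add, TrivSqZeroExt.fst_inl,
          TrivSqZeroExt.fst_inr, add_zero]
      rw [h1]
    rw [this, isUnit_iff_ne_zero, Ne, map_eq_zero_iff _ hinj]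
    exact nonZeroDivisors.ne_zero f.2
  -- The displacement `x ↦ x + ε`, on the rational functions of an indeterminate.
  let φ : FractionRing (Polynomial E) →ₐ[E] DualNumber F :=
    IsLocalization.liftAlgHom (M := nonZeroDivisors (Polynomial E)) hu
  have hφ : ∀ f, φ (algebraMap _ _ f) = Polynomial.aeval (R := E)
      (TrivSqZeroExt.inl x + TrivSqZeroExt.inr 1 : DualNumber F) f := fun f =>
    IsLocalization.lift_eq _ f
  have hcz : CharZero (FractionRing (Polynomial E)) :=
    charZero_of_injective_algebraMap (IsFractionRing.injective (Polynomial E) _)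
  obtain ⟨s, hs1, hs2⟩ := exists_section_of_nilpotent
    ((TrivSqZeroExt.fstHom E F F : DualNumber F →ₐ[E] F).comp φ).toRingHom φ.toRingHom
    (TrivSqZeroExt.fstHom E F F : DualNumber F →ₐ[E] F).toRingHom
    (fun y => ⟨TrivSqZeroExt.inl y, rfl⟩) ⟨2, by
      rw [pow_two, Ideal.zero_eq_bot, ← le_bot_iff, Ideal.mul_le]
      intro a ha b hb
      have ha' : a.fst = 0 := ha
      have hb' : b.fst = 0 := hb
      rw [Ideal.mem_bot]
      ext <;> simp [ha', hb']⟩ rfl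
  have hfst : ∀ z, (s z).fst = z := fun z => DFunLike.congr_fun hs1 z
  have hsE : ∀ c : E, s (algebraMap E F c) = algebraMap E (DualNumber F) c := fun c => by
    have h1 := DFunLike.congr_fun hs2 (algebraMap E _ c)
    have h2 : ((TrivSqZeroExt.fstHom E F F : DualNumber F →ₐ[E] F).comp φ)
        (algebraMap E _ c) = algebraMap E F c := AlgHom.commutes _ _
    have h3 : φ (algebraMap E _ c) = algebraMap E _ c := AlgHom.commutes _ _
    rw [← h3, ← h2]
    exact h1
  let s' : F →ₐ[E] DualNumber F := { s with commutes' := hsE }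
  refine ⟨derivOfDual s' hfst, ?_⟩
  rw [derivOfDual_apply]
  have h1 := DFunLike.congr_fun hs2 (algebraMap (Polynomial E) _ Polynomial.X)
  have h2 : φ (algebraMap (Polynomial E) _ Polynomial.X) =
      TrivSqZeroExt.inl x + TrivSqZeroExt.inr 1 := by rw [hφ, Polynomial.aeval_X]
  have h3 : s (φ (algebraMap (Polynomial E) _ Polynomial.X)).fst =
      φ (algebraMap (Polynomial E) _ Polynomial.X) := h1
  rw [h2] at h3
  have h4 : (TrivSqZeroExt.inl x + TrivSqZeroExt.inr 1 : DualNumber F).fst = x := by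
    rw [TrivSqZeroExt.fst_add, TrivSqZeroExt.fst_inl, TrivSqZeroExt.fst_inr, add_zero]
  rw [h4] at h3
  have h5 := congrArg TrivSqZeroExt.snd h3
  rw [TrivSqZeroExt.snd_add, TrivSqZeroExt.snd_inl, TrivSqZeroExt.snd_inr, zero_add] at h5
  change (s x).snd ≠ 0
  rw [h5]
  exact one_ne_zero

theorem isAlgebraic_of_derivation_eq_zero {E F : Type u} [Field E] [CharZero E] [Field F]
    [Algebra E F] {x : F} (hx : ∀ d : Derivation E F F, d x = 0) : IsAlgebraic E x := by
  by_contra h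
  obtain ⟨d, hd⟩ := exists_derivation_ne_zero h
  exact hd (hx d)

theorem derivation_sum_apply {k A ι : Type*} [CommRing k] [CommRing A] [Algebra k A]
    (s : Finset ι) (d : ι → Derivation k A A) (x : A) : (∑ i ∈ s, d i) x = ∑ i ∈ s, d i x := by
  have := map_sum (Derivation.coeFnAddMonoidHom : Derivation k A A →+ (A → A)) d s
  have h := congrFun this x
  rwa [Finset.sum_apply] at h

/-! ### The constants of the infinitesimal transformations -/

section Finiteness

variable {k : Type u} [Field k] {n m : ℕ} {q : ℕ∞}

/-- A rational function of the jets depends on finitely many coordinates. -/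
theorem exists_finset_derivation (x : JetField k n m q) :
    ∃ S : Finset (JetIdx n m q), ∀ d e : Derivation k (JetField k n m q) (JetField k n m q),
      (∀ p ∈ S, d (jetCoord k n m q p) = e (jetCoord k n m q p)) → d x = e x := by
  classical
  obtain ⟨f, h, hh, hx⟩ := exists_jetField_eq_div x
  refine ⟨f.vars ∪ h.vars, fun d e hde => ?_⟩
  have key : ∀ g : MvPolynomial (JetIdx n m q) k, g.vars ⊆ f.vars ∪ h.vars →
      d (algebraMap _ (JetField k n m q) g) = e (algebraMap _ (JetField k n m q) g) := by
    intro g hg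
    exact MvPolynomial.derivation_eq_of_forall_mem_vars
      (D₁ := d.compAlgebraMap (MvPolynomial (JetIdx n m q) k))
      (D₂ := e.compAlgebraMap (MvPolynomial (JetIdx n m q) k)) fun i hi => hde i (hg hi)
  have h1 := congrArg d hx
  have h2 := congrArg e hx
  have h0 := aeval_jetCoord_ne_zero (q := q) (n := n) (m := m) hh
  rw [aeval_jetCoord, aeval_jetCoord] at hx h1 h2
  rw [aeval_jetCoord] at h0
  rw [Derivation.leibniz, key f Finset.subset_union_left, key h Finset.subset_union_right] at h1
  rw [Derivation.leibniz, ← h1, smul_eq_mul, smul_eq_mul, smul_eq_mul, add_right_inj] at h2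
  exact (mul_left_cancel₀ h0 h2).symm

/-- A component of a composite jet involves finitely many coordinates of the transformation,
whatever the order. -/
theorem exists_finset_chain (p : JetIdx n m q) : ∃ S : Finset (JetIdx m m q),
    ∀ (a : JetIdx n m q → JetField k n m q) (g h : JetIdx m m q → JetField k n m q),
      (∀ r ∈ S, g r = h r) → chain k a g p = chain k a h p := by
  classical
  have hinj : Function.Injective fun r : JetIdx m m q =>
      (Sum.inr r.1 : (Fin m × (Fin n →₀ ℕ)) ⊕ (Fin m × (Fin m →₀ ℕ))) :=
    fun _ _ h => Subtype.ext (Sum.inr_injective h)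
  refine ⟨(chainPoly k n m p.1).vars.preimage _ hinj.injOn, fun a g h hgh => ?_⟩
  refine MvPolynomial.eval₂Hom_congr' rfl (fun i hi _ => ?_) rfl
  rcases i with i | i
  · rfl
  · by_cases hd : ((i.2.degree : ℕ) : ℕ∞) ≤ q
    · simp only [Sum.elim_inr, extendJet, hd, dif_pos]
      exact hgh _ (Finset.mem_preimage.2 hi)
    · simp [extendJet, hd]

/-- The composite jet is linear in the transformation, for finite sums. -/
theorem chain_finset_sum {ι : Type*} (s : Finset ι) (a : JetIdx n m q → JetField k n m q)
    (c : ι → JetField k n m q) (g : ι → JetIdx m m q → JetField k n m q) (p : JetIdx n m q) :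
    chain k a (fun r => ∑ i ∈ s, c i * g i r) p = ∑ i ∈ s, c i * chain k a (g i) p := by
  classical
  induction s using Finset.induction_on with
  | empty =>
    have h := chain_add_mul k a (0 : JetIdx m m q → JetField k n m q) 0 1 p
    simp only [Pi.zero_apply, mul_zero, add_zero, one_mul] at h
    exact add_eq_left.1 h.symm
  | insert i s hi ih =>
    simp only [Finset.sum_insert hi]
    have h := chain_add_mul k a (fun r => ∑ i ∈ s, c i * g i r) (g i) (c i) p
    rw [add_comm (c i * _), ← ih, ← h]
    congr 1
    funext r
    exact add_comm _ _

end Finiteness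

/-- Let `x` be points with values in `F[ε]` whose part of order zero is in `R`. A polynomial is
evaluated at the points obtained by applying an `R`-linear form to the infinitesimal parts of `x`,
by applying the form to its value at `x`. -/
theorem aeval_dual_linear {k R F σ : Type*} [Field k] [CommRing R] [CommRing F] [Algebra k R]
    [Algebra k F] [Algebra R F] [IsScalarTower k R F] (lam : F →ₗ[R] R) {x : σ → DualNumber F}
    {y : σ → DualNumber R} (h1 : ∀ i, (x i).fst = algebraMap R F (y i).fst)
    (h2 : ∀ i, (y i).snd = lam (x i).snd) (f : MvPolynomial σ k) :
    (MvPolynomial.aeval x f).fst = algebraMap R F (MvPolynomial.aeval y f).fst ∧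
      (MvPolynomial.aeval y f).snd = lam (MvPolynomial.aeval x f).snd := by
  induction f using MvPolynomial.induction_on with
  | C c =>
    rw [MvPolynomial.algHom_C, MvPolynomial.algHom_C, TrivSqZeroExt.algebraMap_eq_inl',
      TrivSqZeroExt.algebraMap_eq_inl']
    simp [IsScalarTower.algebraMap_apply k R F]
  | add f g hf hg =>
    rw [map_add, map_add]
    simp [hf.1, hf.2, hg.1, hg.2]
  | mul_X f i hf =>
    rw [map_mul, map_mul, MvPolynomial.aeval_X, MvPolynomial.aeval_X]
    constructor
    · simp [hf.1, h1]
    · rw [TrivSqZeroExt.snd_mul, TrivSqZeroExt.snd_mul, hf.1, h1, hf.2, h2]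
      simp only [smul_eq_mul, MulOpposite.smul_eq_mul_unop, MulOpposite.unop_op, map_add]
      rw [← Algebra.smul_def, map_smul, mul_comm _ (algebraMap R F _), ← Algebra.smul_def,
        map_smul, smul_eq_mul, smul_eq_mul, mul_comm (lam _)]

namespace AlgebraicPseudogroup

variable {k : Type u} [Field k] {n m : ℕ} {q : ℕ∞} {Γ : AlgebraicPseudogroup k m}
  {E : IntermediateField k (JetField k n m q)} (hE : Γ.IsPHS q E) (hq : (Γ.order : ℕ∞) ≤ q)

instance : IsScalarTower k (BaseField k m) (JetField k n m q) :=
  IsScalarTower.of_algebraMap_eq fun c => ((baseIncl k n m q).commutes c).symm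

include hE hq

/-- A derivation which is zero on the differential invariants is an infinitesimal transformation `ξ`
with coefficients in `L_q`. The contraction of its coefficients by a linear form over `k(y)` is an
infinitesimal transformation of `Γ`, as the equations of these are linear over `k(y)`. -/
theorem IsPHS.exists_infinitesimal {d : Derivation k (JetField k n m q) (JetField k n m q)}
    (hd : ∀ x ∈ E, d x = 0) : ∃ ξ : JetIdx m m q → JetField k n m q,
      (∀ p, d (jetCoord k n m q p) = chain k (jetCoord k n m q) ξ p) ∧
      ∀ lam : JetField k n m q →ₗ[BaseField k m] BaseField k m,
        Γ.IsInfinitesimal q fun p => lam (ξ p) := by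
  -- The points `y` and `y + ε d y` agree on the invariants, so that they are related by a jet `g`,
  -- which reduces to the identity for `ε = 0`.
  obtain ⟨g, hg⟩ := ((hE (DualNumber (JetField k n m q)) (TrivSqZeroExt.inlAlgHom k _ _)
    (dualLift (AlgHom.id k _) d)).1 fun x hx => by
      rw [dualLift_apply, hd x hx]
      simp).exists
  have hfst : (fun p => (g p).fst) = idJet q (baseIncl k n m q) := by
    have h1 := hg.map (TrivSqZeroExt.fstHom k _ _)
    rw [fstHom_comp_dualLift] at h1
    exact hE.eq_of_relates h1 (relates_id hq (AlgHom.id k (JetField k n m q)))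
  have hfst' : ∀ p, (g p).fst = idJet q (baseIncl k n m q) p := fun p => congrFun hfst p
  refine ⟨fun p => (g p).snd, fun p => ?_, fun lam => ?_⟩
  · have h1 := hg.2 p
    have h2 : g = fun p => TrivSqZeroExt.inl (idJet q (baseIncl k n m q) p) +
        TrivSqZeroExt.inr (g p).snd := funext fun p => by
      rw [← hfst']
      exact (TrivSqZeroExt.inl_fst_add_inr_snd_eq _).symm
    rw [h2] at h1
    have h3 := h1.trans (chain_inl_add_inr (k := k) (fun p => jetCoord k n m q p) _ _ p)
    have h4 := congrArg TrivSqZeroExt.snd h3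
    rw [snd_dualLift] at h4
    simpa using h4
  · have hbase : ∀ p : JetIdx m m q, (g p).fst =
        algebraMap (BaseField k m) (JetField k n m q) (idJet q (AlgHom.id k _) p) := fun p => by
      rw [hfst']
      exact (map_idJet k (baseIncl k n m q) (AlgHom.id k _) p).symm
    obtain ⟨t, ht⟩ := exists_baseHom_of_isLocalHom
      (TrivSqZeroExt.fstHom k (BaseField k m) (BaseField k m))
      isUnit_of_isUnit_fst (AlgHom.id k (BaseField k m))
      (fun u => TrivSqZeroExt.inl (baseCoord k m u) +
        TrivSqZeroExt.inr (lam (g (JetIdx.zero u)).snd)) (fun u => by simp)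
    refine ⟨t, ⟨⟨fun u => ?_, ?_⟩, fun f hf hfI => ?_⟩⟩
    · rw [ht]
      simp [idJet, JetIdx.zero]
    · refine isUnit_of_isUnit_fst (k := k) _ ?_
      have h1 := (Γ.isSolutionJet_id hq (AlgHom.id k (BaseField k m))).1.2
      have h2 : (AlgHom.mapMatrix (TrivSqZeroExt.fstHom k (BaseField k m) (BaseField k m)))
          (jacobian (extendJet fun p : JetIdx m m q => (TrivSqZeroExt.inl
            (idJet q (AlgHom.id k (BaseField k m)) p) + TrivSqZeroExt.inr (lam (g p).snd) :
              DualNumber (BaseField k m)))) =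
          jacobian (extendJet (idJet q (AlgHom.id k (BaseField k m)))) := by
        ext u r
        change (TrivSqZeroExt.fstHom k (BaseField k m) (BaseField k m)).toRingHom
          (extendJet (fun p : JetIdx m m q => (TrivSqZeroExt.inl
            (idJet q (AlgHom.id k (BaseField k m)) p) + TrivSqZeroExt.inr (lam (g p).snd) :
              DualNumber (BaseField k m))) (u, Finsupp.single r 1)) =
          extendJet (idJet q (AlgHom.id k (BaseField k m))) (u, Finsupp.single r 1)
        rw [map_extendJet]
        congr 1
        funext p
        change TrivSqZeroExt.fst _ = _
        simp
      rw [AlgHom.map_det, h2]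
      exact h1
    · have h0 := hg.1.2 f hf hfI
      have h1 := aeval_dual_linear lam (k := k)
        (x := Sum.elim (fun u => ((TrivSqZeroExt.inlAlgHom k _ _).comp (baseIncl k n m q))
          (baseCoord k m u)) (extendJet g))
        (y := Sum.elim (fun u => TrivSqZeroExt.inlAlgHom k (BaseField k m) (BaseField k m)
          (baseCoord k m u)) (extendJet fun p => TrivSqZeroExt.inl
            (idJet q (AlgHom.id k (BaseField k m)) p) + TrivSqZeroExt.inr (lam (g p).snd)))
        (by
          rintro (u | p)
          · rfl
          · by_cases hp : ((p.2.degree : ℕ) : ℕ∞) ≤ q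
            · simp [extendJet, hp, hbase]
            · simp [extendJet, hp])
        (by
          rintro (u | p)
          · simp
          · by_cases hp : ((p.2.degree : ℕ) : ℕ∞) ≤ q
            · simp [extendJet, hp]
            · simp [extendJet, hp]) f
      refine dual_ext ?_ ?_
      · apply (algebraMap (BaseField k m) (JetField k n m q)).injective
        refine h1.1.symm.trans ?_
        rw [h0]
        simp
      · refine h1.2.trans ?_
        rw [h0]
        simp

/-- Derivations over the field of differential invariants kill the constants of `Θ(q)`. -/
theorem IsPHS.derivation_eq_zero_of_theta
    {d : Derivation k (JetField k n m q) (JetField k n m q)} (hd : ∀ x ∈ E, d x = 0)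
    {x : JetField k n m q} (hx : ∀ θ ∈ Γ.Theta n q, θ x = 0) : d x = 0 := by
  classical
  obtain ⟨ξ, hξ, hinf⟩ := hE.exists_infinitesimal hq hd
  obtain ⟨S, hS⟩ := exists_finset_derivation x
  choose S' hS' using fun p : JetIdx n m q => exists_finset_chain (k := k) p
  -- In a basis `e` of `L_q` over `k(y)`, the derivation `d` is locally a combination of the
  -- infinitesimal transformations `θ i` given by the coordinates of `ξ`.
  let e := Module.Free.chooseBasis (BaseField k m) (JetField k n m q)
  let I := (S.biUnion S').biUnion fun r => (e.repr (ξ r)).support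
  choose θ hθ using fun i => exists_jetDerivation
    (chain k (jetCoord k n m q) fun r => baseIncl k n m q (e.coord i (ξ r)))
  have hθ0 : ∀ i, θ i x = 0 := fun i => hx _ ⟨_, hinf (e.coord i), hθ i⟩
  have h1 : d x = (∑ i ∈ I, e i • θ i) x := hS _ _ fun p hp => by
    rw [hξ, derivation_sum_apply]
    have h2 : ∀ r ∈ S' p, ξ r = ∑ i ∈ I, e i * baseIncl k n m q (e.coord i (ξ r)) := by
      intro r hr
      have hsub : (e.repr (ξ r)).support ⊆ I := fun i hi =>
        Finset.mem_biUnion.2 ⟨r, Finset.mem_biUnion.2 ⟨p, hp, hr⟩, hi⟩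
      conv_lhs => rw [← e.linearCombination_repr (ξ r), Finsupp.linearCombination_apply,
        Finsupp.sum_of_support_subset _ hsub (fun i a => a • e i)
          (fun i _ => zero_smul _ _)]
      refine Finset.sum_congr rfl fun i _ => ?_
      rw [Algebra.smul_def, mul_comm]
      rfl
    rw [hS' p _ _ _ h2, chain_finset_sum]
    refine Finset.sum_congr rfl fun i _ => ?_
    rw [Derivation.smul_apply, hθ, smul_eq_mul]
  rw [h1, derivation_sum_apply]
  exact Finset.sum_eq_zero fun i _ => by rw [Derivation.smul_apply, hθ0, smul_zero]

/-- The constants of `Θ(q)` are algebraic over the field of differential invariants. -/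
theorem IsPHS.isAlgebraic_of_theta [CharZero k] {x : JetField k n m q}
    (hx : ∀ θ ∈ Γ.Theta n q, θ x = 0) : IsAlgebraic E x :=
  isAlgebraic_of_derivation_eq_zero fun d =>
    hE.derivation_eq_zero_of_theta hq (d := d.restrictScalars k)
      (fun y hy => d.map_algebraMap ⟨y, hy⟩) hx

end AlgebraicPseudogroup

/-! ### Derivations commuting with the infinitesimal transformations -/

section Kill

variable {k : Type u} [Field k] {n m : ℕ} {q : ℕ∞} {B : Type*} [CommRing B] [Algebra k B]

theorem dualLift_id_eq_inl {D : Derivation k B B} {x : B} (h : D x = 0) :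
    dualLift (AlgHom.id k B) D x = TrivSqZeroExt.inlAlgHom k B B x := by
  rw [dualLift_apply]
  simp [h]

/-- A composite of constant jets is constant. -/
theorem derivation_chain_eq_zero (D : Derivation k B B) {a : JetIdx n m q → B}
    {g : JetIdx m m q → B} (ha : ∀ p, D (a p) = 0) (hg : ∀ p, D (g p) = 0) (p : JetIdx n m q) :
    D (chain k a g p) = 0 := by
  have h1 := map_chain k (dualLift (AlgHom.id k B) D) a g p
  rw [funext fun r => dualLift_id_eq_inl (ha r), funext fun r => dualLift_id_eq_inl (hg r),
    ← map_chain] at h1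
  have h2 := congrArg TrivSqZeroExt.snd h1
  rw [snd_dualLift] at h2
  simpa using h2

theorem derivation_jetHom_eq_zero (D : Derivation k B B) {a : JetField k n m q →ₐ[k] B}
    (ha : ∀ p, D (a (jetCoord k n m q p)) = 0) (x : JetField k n m q) : D (a x) = 0 := by
  have h1 : (dualLift (AlgHom.id k B) D).comp a = (TrivSqZeroExt.inlAlgHom k B B).comp a :=
    jetHom_ext fun p => dualLift_id_eq_inl (ha p)
  have h2 := congrArg TrivSqZeroExt.snd (DFunLike.congr_fun h1 x)
  rw [AlgHom.comp_apply, snd_dualLift] at h2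
  simpa using h2

theorem derivation_baseHom_eq_zero (D : Derivation k B B) {s : BaseField k m →ₐ[k] B}
    (hs : ∀ u, D (s (baseCoord k m u)) = 0) (x : BaseField k m) : D (s x) = 0 := by
  have h1 : (dualLift (AlgHom.id k B) D).comp s = (TrivSqZeroExt.inlAlgHom k B B).comp s :=
    baseHom_ext fun p => dualLift_id_eq_inl (hs p)
  have h2 := congrArg TrivSqZeroExt.snd (DFunLike.congr_fun h1 x)
  rw [AlgHom.comp_apply, snd_dualLift] at h2
  simpa using h2

end Kill

/-- A derivation which is zero on the subfield `E`, as a derivation over `E`. -/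
noncomputable def derivationOver {k F : Type*} [Field k] [Field F] [Algebra k F]
    (E : IntermediateField k F) (d : Derivation k F F) (hd : ∀ x ∈ E, d x = 0) :
    Derivation E F F :=
  Derivation.mk'
    { toFun := d
      map_add' := map_add d
      map_smul' := fun c x => by
        have h : c • x = (c : F) * x := rfl
        rw [h, d.leibniz, hd c c.2, smul_zero, add_zero]
        rfl }
    d.leibniz

theorem IsTensorSquare.symm {k F T : Type u} [Field k] [Field F] [Algebra k F] [CommRing T]
    [Algebra k T] {E : IntermediateField k F} {l r : F →ₐ[k] T} (h : IsTensorSquare E l r) :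
    IsTensorSquare E r l where
  eq_of_mem x hx := (h.eq_of_mem x hx).symm
  exists_hom a b hab := by
    obtain ⟨φ, h1, h2⟩ := h.exists_hom b a fun x hx => (hab x hx).symm
    exact ⟨φ, h2, h1⟩
  adjoin_eq_top := by rw [Set.union_comm]; exact h.adjoin_eq_top

section TensorStable

variable {k F : Type u} [Field k] [Field F] [Algebra k F] (E : IntermediateField k F)

theorem smul_eq_leftMap_mul (c : F) (z : F ⊗[E] F) : c • z = leftMap E c * z := by
  induction z using TensorProduct.induction_on with
  | zero => rw [smul_zero, mul_zero]
  | tmul x y =>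
    rw [leftMap_apply, Algebra.TensorProduct.tmul_mul_tmul, one_mul, TensorProduct.smul_tmul',
      smul_eq_mul]
  | add x y hx hy => rw [smul_add, mul_add, hx, hy]

variable {E}

theorem rTensor_derivation_eq {d : Derivation E F F} {D : Derivation k (F ⊗[E] F) (F ⊗[E] F)}
    (hl : ∀ x, D (leftMap E x) = leftMap E (d x)) (hr : ∀ x, D (rightMap E x) = 0)
    (z : F ⊗[E] F) : LinearMap.rTensor F (d : F →ₗ[E] F) z = D z := by
  induction z using TensorProduct.induction_on with
  | zero => rw [map_zero, map_zero]
  | tmul x y =>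
    rw [LinearMap.rTensor_tmul, ← leftMap_mul_rightMap, ← leftMap_mul_rightMap, D.leibniz,
      hr, hl, smul_zero, zero_add, smul_eq_mul, mul_comm]
    rfl
  | add x y hx hy => rw [map_add, map_add, hx, hy]

/-- The kernel of the multiplication `F ⊗_E F → F` contains no nonzero `F`-subspace which is stable
under a set of derivations of the first factor with constants `E`. -/
theorem eq_bot_of_stable (Θ : Set (Derivation E F F))
    (hC : ∀ x, (∀ θ ∈ Θ, θ x = 0) → x ∈ (algebraMap E F).range) (N : Submodule F (F ⊗[E] F))
    (hN : ∀ θ ∈ Θ, ∀ z ∈ N, LinearMap.rTensor F (θ : F →ₗ[E] F) z ∈ N)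
    (μ : F ⊗[E] F →ₐ[k] F) (hμ : ∀ x, μ (rightMap E x) = x) (h : ∀ z ∈ N, μ z = 0) : N = ⊥ := by
  rw [eq_bot_iff]
  refine (le_span_one_tmul Θ hC N hN).trans ?_
  rw [Submodule.span_le]
  rintro z ⟨hz, a, rfl⟩
  have h1 : a = 0 := (hμ a).symm.trans (h _ hz)
  rw [h1, TensorProduct.tmul_zero]
  exact zero_mem _

end TensorStable

namespace AlgebraicPseudogroup

variable {k : Type u} [Field k] {n m : ℕ} {q : ℕ∞} {Γ : AlgebraicPseudogroup k m}
  {E : IntermediateField k (JetField k n m q)} (hE : Γ.IsPHS q E) (hq : (Γ.order : ℕ∞) ≤ q)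

include hE in
/-- The infinitesimal transformations kill the differential invariants. -/
theorem IsPHS.theta_eq_zero {θ : Derivation k (JetField k n m q) (JetField k n m q)}
    (hθ : θ ∈ Γ.Theta n q) {x : JetField k n m q} (hx : x ∈ E) : θ x = 0 := by
  obtain ⟨η, hη, hθη⟩ := hθ
  have h := hE.eq_on (relates_theta hη hθη (AlgHom.id k _)) hx
  have h2 := congrArg TrivSqZeroExt.snd h
  rw [snd_dualLift] at h2
  simpa using h2.symm

section Universal

variable {T : Type u} [CommRing T] [Algebra k T] {l r : JetField k n m q →ₐ[k] T}
  (hT : IsTensorSquare E l r)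

include hE

include hT in
/-- It suffices to check invariance at the universal pair of related points. -/
theorem IsPHS.isInvariant_of_universal {g : JetIdx m m q → T} (hg : Γ.Relates q l r g)
    {δ : Derivation k (JetField k n m q) (JetField k n m q)}
    (h : ∀ p, dualLift r δ (jetCoord k n m q p) =
      chain k (fun p => dualLift l δ (jetCoord k n m q p)) (fun p => TrivSqZeroExt.inl (g p)) p) :
    IsInvariant (Γ := Γ) δ := by
  intro B _ _ a b g' hg' p
  obtain ⟨φ, rfl, rfl⟩ := hT.exists_hom a b fun x hx => hE.eq_on hg' hx
  have hgg : (fun p => φ (g p)) = g' := hE.eq_of_relates (hg.map φ) hg'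
  have h1 := congrArg (dualMap φ) (h p)
  rw [map_chain] at h1
  simp only [dualLift_apply, map_add, dualMap_inl, dualMap_inr] at h1
  subst hgg
  exact h1

/-- The infinitesimal transformation `θ` of the second factor moves the groupoid components
along `θ`. -/
theorem IsPHS.theta_groupoid (hq : (Γ.order : ℕ∞) ≤ q) {g : JetIdx m m q → T}
    (hg : Γ.Relates q l r g) {θ : Derivation k (JetField k n m q) (JetField k n m q)}
    {η : JetIdx m m q → BaseField k m} (hη : Γ.IsInfinitesimal q η)
    (hθ : ∀ p, θ (jetCoord k n m q p) =
      chain k (jetCoord k n m q) (fun r => baseIncl k n m q (η r)) p)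
    {D : Derivation k T T} (hl : ∀ x, D (l x) = 0) (hr : ∀ x, D (r x) = r (θ x))
    (p : JetIdx m m q) :
    D (g p) = chain k g (fun p => r (baseIncl k n m q (η p))) p := by
  have h1 := hg.map (dualLift (AlgHom.id k T) D)
  have e1 : (dualLift (AlgHom.id k T) D).comp l = (TrivSqZeroExt.inlAlgHom k T T).comp l :=
    AlgHom.ext fun x => dualLift_id_eq_inl (hl x)
  have e2 : (dualLift (AlgHom.id k T) D).comp r = dualLift r θ :=
    AlgHom.ext fun x => by simp [dualLift_apply, hr]
  rw [e1, e2] at h1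
  have h2 := (hg.map (TrivSqZeroExt.inlAlgHom k T T)).comp hq (relates_theta hη hθ r)
  have h3 := congrFun (hE.eq_of_relates h1 h2) p
  have h4 := h3.trans (chain_inl_add_inr (k := k) g _ _ p)
  have h5 := congrArg TrivSqZeroExt.snd h4
  rw [snd_dualLift] at h5
  simpa using h5

include hT in
/-- A derivation `δ` which is zero on `k(y)` displaces the first of the universal pair of related
points, and the universal transformation carries this over to a displacement `D` of the pair. It
commutes with the action of `Θ(q)` on the second point, restricts to `δ` on the diagonal, and `δ` is
invariant if `D` displaces the second point along `δ` as well. -/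
theorem IsPHS.exists_displacement (hq : (Γ.order : ℕ∞) ≤ q)
    {δ : Derivation k (JetField k n m q) (JetField k n m q)} (hδ : KillsBase δ) :
    ∃ D : Derivation k T T, (∀ x, D (l x) = l (δ x)) ∧
      (∀ θ ∈ Γ.Theta n q, ∀ D' : Derivation k T T, (∀ x, D' (l x) = 0) →
        (∀ x, D' (r x) = r (θ x)) → ∀ x, D (r (θ x)) = D' (D (r x))) ∧
      (∀ μ : T →ₐ[k] JetField k n m q, μ.comp l = AlgHom.id k _ → μ.comp r = AlgHom.id k _ →
        ∀ x, μ (D (r x)) = δ x) ∧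
      ((∀ x, D (r x) = r (δ x)) → IsInvariant (Γ := Γ) δ) := by
  obtain ⟨g, hg⟩ := hE.exists_relates hT
  obtain ⟨b', hb', hrel⟩ := hg.exists_dual hδ
  obtain ⟨D, hD1, hD2⟩ := hT.exists_derivation (dualLift l δ) b'
    (fstHom_comp_dualLift _ _) hb' (fun x hx => hE.eq_on hrel hx)
  have hDg : ∀ p, D (g p) = 0 := hE.derivation_eq_zero hD1 hD2 hg hrel
  have hDl : ∀ x, D (l x) = l (δ x) := fun x =>
    snd_eq_of_dualLift_eq (DFunLike.congr_fun hD1 x)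
  have hDb : ∀ x, b' x = TrivSqZeroExt.inl (r x) + TrivSqZeroExt.inr (D (r x)) := fun x => by
    rw [← hD2, AlgHom.comp_apply, dualLift_apply]
    rfl
  -- The transformation is not displaced, hence neither is the target `ȳ`.
  have hDbase : ∀ c, D (r (baseIncl k n m q c)) = 0 :=
    derivation_baseHom_eq_zero (s := r.comp (baseIncl k n m q)) D fun u => by
      rw [AlgHom.comp_apply, baseIncl_baseCoord, hg.2, chain_zero_order]
      exact hDg _
  refine ⟨D, hDl, ?_, ?_, ?_⟩
  · rintro θ ⟨η, hη, hθη⟩ D' hD'l hD'r x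
    -- `⁅D, D'⁆` is zero on the first point and on the transformation, hence on the second point.
    have hcg : ∀ p, ⁅D, D'⁆ (g p) = 0 := fun p => by
      rw [Derivation.commutator_apply, hDg, map_zero, sub_zero,
        hE.theta_groupoid hq hg hη hθη hD'l hD'r]
      exact derivation_chain_eq_zero D hDg (fun p => hDbase _) p
    have hcl : ∀ x, ⁅D, D'⁆ (l x) = 0 := fun x => by
      rw [Derivation.commutator_apply, hDl, hD'l, hD'l, map_zero, sub_zero]
    have hcr := derivation_jetHom_eq_zero (a := r) ⁅D, D'⁆ (fun p => by
      rw [hg.2]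
      exact derivation_chain_eq_zero _ (fun p => hcl _) hcg p) x
    rw [Derivation.commutator_apply, sub_eq_zero, hD'r] at hcr
    exact hcr
  · intro μ hl hr x
    have h1 := hrel.map (dualMap μ)
    have e1 : (dualMap μ).comp (dualLift l δ) = dualLift (AlgHom.id k _) δ := AlgHom.ext fun x => by
      have h2 : ∀ y, μ (l y) = y := fun y => DFunLike.congr_fun hl y
      rw [AlgHom.comp_apply, dualLift_apply, map_add, dualMap_inl, dualMap_inr, h2, h2]
      rfl
    have e2 : (fun p => dualMap μ (TrivSqZeroExt.inl (g p))) =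
        idJet q ((dualLift (AlgHom.id k _) δ).comp (baseIncl k n m q)) := by
      have h3 := hg.map μ
      rw [hl, hr] at h3
      have h4 := hE.eq_of_relates h3 (relates_id hq (AlgHom.id k (JetField k n m q)))
      funext p
      rw [dualMap_inl, dualLift_comp_baseIncl hδ]
      refine (congrArg TrivSqZeroExt.inl (congrFun h4 p)).trans ?_
      exact map_idJet (C := DualNumber (JetField k n m q)) k (TrivSqZeroExt.inlAlgHom k _ _) _ p
    rw [e1, e2] at h1
    have e3 : (dualMap μ).comp b' = dualLift (AlgHom.id k _) δ := jetHom_ext fun p => by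
      rw [h1.2]
      exact congrFun (chain_idJet k _ _ fun u => by
        rw [AlgHom.comp_apply, baseIncl_baseCoord]) p
    have h5 := congrArg TrivSqZeroExt.snd (DFunLike.congr_fun e3 x)
    rw [AlgHom.comp_apply, hDb, map_add, dualMap_inl, dualMap_inr, snd_dualLift] at h5
    simpa using h5
  · intro h
    refine hE.isInvariant_of_universal hT hg fun p => ?_
    rw [← hrel.2, hDb, h, dualLift_apply]

end Universal

include hE in
/-- If the field of differential invariants is algebraically closed in `L_q`, the derivations
over `k(y)` commuting with `Θ(q)` are in the reciprocal distribution. The deviation from invariance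
of `δ` spans a subspace of `L_q ⊗ L_q` stable under `Θ(q)` and contained in the kernel of the
multiplication; such a subspace is zero. -/
theorem IsPHS.mem_delta_of_commutator_eq_zero [CharZero k] (hq : (Γ.order : ℕ∞) ≤ q)
    (hcl : ∀ x : JetField k n m q, IsAlgebraic E x → x ∈ E)
    {δ : Derivation k (JetField k n m q) (JetField k n m q)} (hδ : KillsBase δ)
    (hcomm : ∀ θ ∈ Γ.Theta n q, ⁅θ, δ⁆ = 0) : δ ∈ Γ.Delta n q := by
  obtain ⟨D, -, hDθ, hDμ, hDinv⟩ := hE.exists_displacement (isTensorSquare E).symm hq hδ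
  refine ⟨hδ, hDinv ?_⟩
  -- The first factor takes the place of the second of the related points, as the derivations in
  -- `eq_bot_of_stable` act on it. `dev` is the deviation of `δ` from invariance.
  let dev : JetField k n m q → JetField k n m q ⊗[E] JetField k n m q :=
    fun x => D (leftMap E x) - leftMap E (δ x)
  let N : Submodule (JetField k n m q) (JetField k n m q ⊗[E] JetField k n m q) :=
    Submodule.span _ (Set.range dev)
  let Θ : Set (Derivation E (JetField k n m q) (JetField k n m q)) :=
    {d | ∃ θ, ∃ h : θ ∈ Γ.Theta n q, d = derivationOver E θ fun _ hx => hE.theta_eq_zero h hx}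
  have hC : ∀ x, (∀ θ ∈ Θ, θ x = 0) → x ∈ (algebraMap E (JetField k n m q)).range := by
    intro x hx
    exact ⟨⟨x, hcl x (hE.isAlgebraic_of_theta hq fun θ hθ => hx _ ⟨θ, hθ, rfl⟩)⟩, rfl⟩
  have hstable : ∀ θ ∈ Θ, ∀ z ∈ N,
      LinearMap.rTensor (JetField k n m q) (θ : JetField k n m q →ₗ[E] JetField k n m q) z ∈ N := by
    rintro _ ⟨θ, hθ, rfl⟩ z hz
    -- `D'` is the derivation `θ ⊗ 1`.
    obtain ⟨D', hD'1, hD'2⟩ := (isTensorSquare E).symm.exists_derivation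
      ((TrivSqZeroExt.inlAlgHom k _ _).comp (rightMap E)) (dualLift (leftMap E) θ)
      rfl (fstHom_comp_dualLift _ _) (fun x hx => by
        rw [dualLift_apply, hE.theta_eq_zero hθ hx, map_zero, TrivSqZeroExt.inr_zero, add_zero,
          leftMap_eq_rightMap E hx]
        rfl)
    have hr : ∀ x, D' (rightMap E x) = 0 := fun x => by
      have h1 := congrArg TrivSqZeroExt.snd (DFunLike.congr_fun hD'1 x)
      rw [AlgHom.comp_apply, snd_dualLift] at h1
      simpa using h1
    have hl : ∀ x, D' (leftMap E x) = leftMap E (θ x) := fun x =>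
      snd_eq_of_dualLift_eq (DFunLike.congr_fun hD'2 x)
    rw [rTensor_derivation_eq (D := D') hl hr]
    have hdev : ∀ x, D' (dev x) = dev (θ x) := fun x => by
      have h1 : δ (θ x) = θ (δ x) := by
        have := DFunLike.congr_fun (hcomm θ hθ) x
        rw [Derivation.commutator_apply] at this
        exact (sub_eq_zero.1 this).symm
      change D' (D (leftMap E x) - leftMap E (δ x)) =
        D (leftMap E (θ x)) - leftMap E (δ (θ x))
      rw [map_sub, hl, hDθ θ hθ D' hr hl, h1]
    refine Submodule.span_induction ?_ ?_ ?_ ?_ hz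
    · rintro _ ⟨x, rfl⟩
      rw [hdev]
      exact Submodule.subset_span ⟨_, rfl⟩
    · rw [map_zero]
      exact zero_mem _
    · intro x y _ _ hx hy
      rw [map_add]
      exact add_mem hx hy
    · intro c x hxN hx
      rw [smul_eq_leftMap_mul, D'.leibniz, hl, smul_eq_mul, smul_eq_mul, ← smul_eq_leftMap_mul,
        mul_comm, ← smul_eq_leftMap_mul]
      exact add_mem (N.smul_mem _ hx) (N.smul_mem _ hxN)
  obtain ⟨μ, hμ1, hμ2⟩ := (isTensorSquare E).symm.exists_hom (AlgHom.id k (JetField k n m q))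
    (AlgHom.id k _) fun _ _ => rfl
  have hμ : ∀ z ∈ N, μ z = 0 := by
    intro z hz
    have hμl : ∀ x, μ (leftMap E x) = x := fun x => DFunLike.congr_fun hμ2 x
    refine Submodule.span_induction ?_ ?_ ?_ ?_ hz
    · rintro _ ⟨x, rfl⟩
      change μ (D (leftMap E x) - leftMap E (δ x)) = 0
      rw [map_sub, hDμ μ hμ1 hμ2, hμl, sub_self]
    · exact map_zero μ
    · intro x y _ _ hx hy
      rw [map_add, hx, hy, add_zero]
    · intro c x _ hx
      rw [smul_eq_leftMap_mul, map_mul, hx, mul_zero]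
  have hN := eq_bot_of_stable Θ hC N hstable μ (fun x => DFunLike.congr_fun hμ1 x) hμ
  intro x
  have h1 : dev x ∈ N := Submodule.subset_span ⟨x, rfl⟩
  rw [hN, Submodule.mem_bot] at h1
  exact sub_eq_zero.1 h1

end AlgebraicPseudogroup

/-! ### The tangent map of the action -/

open AlgebraicPseudogroup

section Tangent

/-- The jet coordinates of positive order. -/
abbrev PosJetIdx (n m : ℕ) (q : ℕ∞) : Type := {p : JetIdx n m q // p.1.2 ≠ 0}

variable (k : Type u) [Field k] {n m : ℕ} {q : ℕ∞} {B : Type u} [CommRing B] [Algebra k B]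

open Classical in
/-- A tangent vector to the jet space, over a fixed point of the space of the `y`. -/
noncomputable def extendPos (v : PosJetIdx n m q → B) (p : JetIdx n m q) : B :=
  if h : p.1.2 ≠ 0 then v ⟨p, h⟩ else 0

theorem extendPos_apply (v : PosJetIdx n m q → B) (p : PosJetIdx n m q) :
    extendPos v p.1 = v p := by
  rw [extendPos, dif_pos p.2]

theorem extendPos_zero (v : PosJetIdx n m q → B) (p : JetIdx n m q) (hp : p.1.2 = 0) :
    extendPos v p = 0 := by
  rw [extendPos, dif_neg (not_not.2 hp)]

/-- If the components of a displacement are finite linear forms in a parameter `v`, so is the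
displacement of the values of a polynomial. -/
theorem exists_aeval_tangent {σ ι : Type*} (x : σ → B) (M : σ → ι →₀ B) (f : MvPolynomial σ k) :
    ∃ N : ι →₀ B, ∀ v : ι → B,
      MvPolynomial.aeval (fun i => (TrivSqZeroExt.inl (x i) +
          TrivSqZeroExt.inr (Finsupp.linearCombination B v (M i)) : DualNumber B)) f =
        TrivSqZeroExt.inl (MvPolynomial.aeval x f) +
          TrivSqZeroExt.inr (Finsupp.linearCombination B v N) := by
  induction f using MvPolynomial.induction_on with
  | C c =>
    refine ⟨0, fun v => ?_⟩
    rw [MvPolynomial.algHom_C, MvPolynomial.algHom_C, TrivSqZeroExt.algebraMap_eq_inl', map_zero,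
      TrivSqZeroExt.inr_zero, add_zero]
  | add f g hf hg =>
    obtain ⟨N, hN⟩ := hf
    obtain ⟨N', hN'⟩ := hg
    refine ⟨N + N', fun v => ?_⟩
    rw [map_add, map_add, map_add, hN, hN', TrivSqZeroExt.inl_add, TrivSqZeroExt.inr_add]
    abel
  | mul_X f i hf =>
    obtain ⟨N, hN⟩ := hf
    refine ⟨x i • N + MvPolynomial.aeval x f • M i, fun v => ?_⟩
    rw [map_mul, map_mul, hN, MvPolynomial.aeval_X, MvPolynomial.aeval_X, map_add, map_smul,
      map_smul]
    refine dual_ext ?_ ?_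
    · simp
    · simp [mul_comm, add_comm]

/-- The differential of a component of the action is a finite linear form. -/
theorem exists_chainTangent (a : JetIdx n m q → B) (g : JetIdx m m q → B) (p : JetIdx n m q) :
    ∃ N : PosJetIdx n m q →₀ B, ∀ v : PosJetIdx n m q → B,
      chain k (fun r => (TrivSqZeroExt.inl (a r) + TrivSqZeroExt.inr (extendPos v r) :
          DualNumber B)) (fun r => TrivSqZeroExt.inl (g r)) p =
        TrivSqZeroExt.inl (chain k a g p) +
          TrivSqZeroExt.inr (Finsupp.linearCombination B v N) := by
  classical
  let M : (Fin m × (Fin n →₀ ℕ)) ⊕ (Fin m × (Fin m →₀ ℕ)) → PosJetIdx n m q →₀ B :=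
    Sum.elim (fun r => if h : ((r.2.degree : ℕ) : ℕ∞) ≤ q ∧ r.2 ≠ 0 then
      Finsupp.single ⟨⟨r, h.1⟩, h.2⟩ 1 else 0) fun _ => 0
  obtain ⟨N, hN⟩ := exists_aeval_tangent k (Sum.elim (extendJet a) (extendJet g)) M
    (chainPoly k n m p.1)
  refine ⟨N, fun v => (Eq.trans ?_ (hN v))⟩
  refine congrArg (fun z => MvPolynomial.aeval z (chainPoly k n m p.1)) ?_
  funext i
  rcases i with i | i
  · by_cases h1 : ((i.2.degree : ℕ) : ℕ∞) ≤ q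
    · by_cases h2 : i.2 = 0
      · simp [M, extendJet, h2, extendPos]
      · simp [M, extendJet, h1, h2, extendPos]
    · simp [M, extendJet, h1]
  · by_cases h1 : ((i.2.degree : ℕ) : ℕ∞) ≤ q
    · simp [M, extendJet, h1]
    · simp [M, extendJet, h1]

/-- The differential at `a`, in the direction of the fibres over the space of the `y`, of the
coordinate `p` of the action of `g`, as a row vector with finitely many entries. -/
noncomputable def chainTangent (a : JetIdx n m q → B) (g : JetIdx m m q → B) (p : JetIdx n m q) :
    PosJetIdx n m q →₀ B :=
  (exists_chainTangent k a g p).choose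

theorem chain_tangent (a : JetIdx n m q → B) (g : JetIdx m m q → B) (p : JetIdx n m q)
    (v : PosJetIdx n m q → B) :
    chain k (fun r => (TrivSqZeroExt.inl (a r) + TrivSqZeroExt.inr (extendPos v r) :
        DualNumber B)) (fun r => TrivSqZeroExt.inl (g r)) p =
      TrivSqZeroExt.inl (chain k a g p) +
        TrivSqZeroExt.inr (Finsupp.linearCombination B v (chainTangent k a g p)) :=
  (exists_chainTangent k a g p).choose_spec v

theorem linearCombination_single_one {ι : Type*} [DecidableEq ι] (N : ι →₀ B) (s : ι) :
    Finsupp.linearCombination B (Pi.single s (1 : B)) N = N s := by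
  rw [Finsupp.linearCombination_apply, Finsupp.sum]
  rw [Finset.sum_eq_single s]
  · simp
  · intro t _ hts
    simp [hts]
  · intro hs
    simp [Finsupp.notMem_support_iff.1 hs]

open Classical in
theorem chainTangent_apply (a : JetIdx n m q → B) (g : JetIdx m m q → B) (p : JetIdx n m q)
    (s : PosJetIdx n m q) :
    chainTangent k a g p s = (chain k (fun r => (TrivSqZeroExt.inl (a r) +
        TrivSqZeroExt.inr (extendPos (Pi.single s (1 : B)) r) : DualNumber B))
        (fun r => TrivSqZeroExt.inl (g r)) p).snd := by
  rw [chain_tangent, TrivSqZeroExt.snd_add, TrivSqZeroExt.snd_inl, TrivSqZeroExt.snd_inr, zero_add,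
    linearCombination_single_one]

theorem map_chainTangent {C : Type u} [CommRing C] [Algebra k C] (φ : B →ₐ[k] C)
    (a : JetIdx n m q → B) (g : JetIdx m m q → B) (p : JetIdx n m q) :
    chainTangent k (fun r => φ (a r)) (fun r => φ (g r)) p =
      (chainTangent k a g p).mapRange φ (map_zero φ) := by
  classical
  ext s
  rw [Finsupp.mapRange_apply, chainTangent_apply, chainTangent_apply]
  have h1 := map_chain k (dualMap φ) (fun r => (TrivSqZeroExt.inl (a r) +
        TrivSqZeroExt.inr (extendPos (Pi.single s (1 : B)) r) : DualNumber B))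
        (fun r => TrivSqZeroExt.inl (g r)) p
  have h2 := congrArg TrivSqZeroExt.snd h1
  have h3 : ∀ z : DualNumber B, (dualMap φ z).snd = φ z.snd := fun z => by simp [dualMap]
  rw [h3] at h2
  rw [h2]
  congr 2
  · funext r
    rw [map_add, dualMap_inl, dualMap_inr]
    congr 2
    by_cases h : r.1.2 = 0
    · rw [extendPos_zero _ _ h, extendPos_zero _ _ h, map_zero]
    · rw [extendPos_apply _ ⟨r, h⟩, extendPos_apply _ ⟨r, h⟩]
      by_cases hs : s = ⟨r, h⟩
      · subst hs
        simp
      · rw [Pi.single_eq_of_ne' hs, Pi.single_eq_of_ne' hs, map_zero]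
  · funext r
    rw [dualMap_inl]

/-- The chain rule for the tangent maps. -/
theorem chainTangent_chain (a : JetIdx n m q → B) (g h : JetIdx m m q → B) (p : JetIdx n m q)
    (s : PosJetIdx n m q) :
    chainTangent k a (chain k g h) p s =
      (chainTangent k (chain k a g) h p).sum fun s' c => c * chainTangent k a g s'.1 s := by
  classical
  have h1 : (fun r => (TrivSqZeroExt.inl (chain k g h r) : DualNumber B)) =
      chain k (fun r => TrivSqZeroExt.inl (g r)) (fun r => TrivSqZeroExt.inl (h r)) :=
    funext fun r => map_chain k (TrivSqZeroExt.inlAlgHom k B B) g h r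
  have h2 : chain k (fun r => (TrivSqZeroExt.inl (a r) +
        TrivSqZeroExt.inr (extendPos (Pi.single s (1 : B)) r) : DualNumber B))
        (fun r => TrivSqZeroExt.inl (g r)) = fun r => TrivSqZeroExt.inl (chain k a g r) +
          TrivSqZeroExt.inr (extendPos (fun s' => chainTangent k a g s'.1 s) r) := by
    funext r
    rw [chain_tangent, linearCombination_single_one]
    congr 2
    by_cases hr : r.1.2 = 0
    · rw [extendPos_zero _ _ hr, chainTangent_apply]
      have : r = JetIdx.zero r.1.1 := Subtype.ext (Prod.ext rfl hr)
      rw [this, chain_zero_order, TrivSqZeroExt.snd_inl]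
    · rw [extendPos_apply _ ⟨r, hr⟩]
  rw [chainTangent_apply, h1, ← chain_assoc, h2, chain_tangent, TrivSqZeroExt.snd_add,
    TrivSqZeroExt.snd_inl, TrivSqZeroExt.snd_inr, zero_add, Finsupp.linearCombination_apply]
  rfl

theorem chainTangent_idJet (a : JetIdx n m q → B) (t : BaseField k m →ₐ[k] B)
    (ht : ∀ u, t (baseCoord k m u) = a (JetIdx.zero u)) (p : PosJetIdx n m q) :
    chainTangent k a (idJet q t) p.1 = Finsupp.single p 1 := by
  classical
  ext s
  rw [chainTangent_apply]
  have h1 : (fun r => (TrivSqZeroExt.inl (idJet q t r) : DualNumber B)) =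
      idJet q ((TrivSqZeroExt.inlAlgHom k B B).comp t) :=
    funext fun r => map_idJet (C := DualNumber B) k (TrivSqZeroExt.inlAlgHom k B B) t r
  rw [h1, chain_idJet]
  · rw [TrivSqZeroExt.snd_add, TrivSqZeroExt.snd_inl, TrivSqZeroExt.snd_inr, zero_add,
      extendPos_apply, Finsupp.single_apply, Pi.single_apply]
  · intro u
    rw [extendPos_zero _ _ rfl, TrivSqZeroExt.inr_zero, add_zero, ← ht]
    rfl

end Tangent

/-! ### Descent -/

section Descent

/-- The maps `l, r : F → T` and `p₁₂, p₂₃, p₁₃ : T → U` behave like the canonical maps between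
`F`, `F ⊗ F` and `F ⊗ F ⊗ F`, with multiplication `μ`, when `κ i` and `κ' i` are the contractions of
the last factor by the linear forms of a basis `b` of `F`. -/
structure IsContraction {F T U ι : Type u} [Field F] [CommRing T] [CommRing U]
    (l r : F →+* T) (p₁₂ p₂₃ p₁₃ : T →+* U) (μ : T →+* F) (b : ι → F) (κ : ι → T → F)
    (κ' : ι → U → T) : Prop where
  map_add : ∀ i z w, κ i (z + w) = κ i z + κ i w
  map_add' : ∀ i z w, κ' i (z + w) = κ' i z + κ' i w
  firstThird : ∀ i z, κ' i (p₁₃ z) = l (κ i z)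
  mul : ∀ i w z, κ' i (p₂₃ w * p₁₂ z) = r (κ i w) * z
  sum : ∀ z, ∃ I : Finset ι, ∀ J, I ⊆ J → μ z = ∑ i ∈ J, b i * κ i z

/-- Faithfully flat descent for vector spaces with a basis: a matrix over `T` which satisfies the
cocycle condition over `U` is a coboundary. The basis `β` consists of invariant vectors, and the
coordinates of the standard basis in it are compatible with the matrix. -/
theorem IsContraction.exists_basis {F T U ι' : Type u} [Field F] [CommRing T] [CommRing U]
    {l r : F →+* T} {p₁₂ p₂₃ p₁₃ : T →+* U} {μ : T →+* F} {b : ι' → F} {κ : ι' → T → F}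
    {κ' : ι' → U → T} (h : IsContraction l r p₁₂ p₂₃ p₁₃ μ b κ κ')
    {σ : Type} (M : σ → σ →₀ T)
    (hM : ∀ p s, p₁₃ (M p s) = (M p).sum fun s' c => p₂₃ c * p₁₂ (M s' s))
    (hμ : ∀ p, (M p).mapRange μ (map_zero μ) = Finsupp.single p 1) :
    ∃ (ι : Type u) (β : Module.Basis ι F (σ →₀ F)), ∀ p j,
      r (β.repr (Finsupp.single p 1) j) = Finsupp.linearCombination T
        (fun s => l (β.repr (Finsupp.single s 1) j)) (M p) := by
  classical
  -- The invariant vectors. The contractions of the rows of `M` are among them by the cocycle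
  -- condition; they span, as the combination of the contractions with coefficients `b i` is `μ`,
  -- which maps `M` to the identity.
  let V : Set (σ →₀ F) := {ω | Finsupp.linearCombination T M
    (ω.mapRange r (map_zero r)) = ω.mapRange l (map_zero l)}
  have hκ : ∀ i, κ i 0 = 0 := fun i => (AddMonoidHom.mk' (κ i) (h.map_add i)).map_zero
  have hV : ∀ i p, (M p).mapRange (κ i) (hκ i) ∈ V := by
    intro i p
    change Finsupp.linearCombination _ _ _ = _
    ext s
    have h3 : κ' i ((M p).sum fun s' c => p₂₃ c * p₁₂ (M s' s)) =
        (M p).sum fun s' c => κ' i (p₂₃ c * p₁₂ (M s' s)) :=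
      map_finsuppSum (AddMonoidHom.mk' (κ' i) (h.map_add' i)) _ _
    rw [Finsupp.mapRange_apply, Finsupp.mapRange_apply, ← h.firstThird, hM, h3,
      Finsupp.linearCombination_apply, Finsupp.sum_mapRange_index (h := fun i a => a • M i)
        (fun _ => zero_smul _ _), Finsupp.sum_mapRange_index (h := fun i a => r a • M i)
        (fun _ => by rw [map_zero, zero_smul]), Finsupp.sum_apply]
    exact Finsupp.sum_congr fun s' _ => (h.mul i _ _).symm
  have hspan : ⊤ ≤ Submodule.span F V := by
    choose I hI using h.sum
    have h1 : ∀ p, Finsupp.single p 1 ∈ Submodule.span F V := by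
      intro p
      have h2 : Finsupp.single p 1 = ∑ i ∈ (M p).support.biUnion fun s => I (M p s),
          b i • (M p).mapRange (κ i) (hκ i) := by
        ext s
        rw [← hμ, Finsupp.mapRange_apply, Finsupp.finsetSum_apply]
        by_cases hs : s ∈ (M p).support
        · rw [hI (M p s) _ (Finset.subset_biUnion_of_mem (fun s => I (M p s)) hs)]
          rfl
        · rw [Finsupp.notMem_support_iff.1 hs, map_zero]
          refine (Finset.sum_eq_zero fun i _ => ?_).symm
          rw [Finsupp.smul_apply, Finsupp.mapRange_apply, Finsupp.notMem_support_iff.1 hs,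
            hκ, smul_zero]
      rw [h2]
      exact Submodule.sum_mem _ fun i _ => Submodule.smul_mem _ _ (Submodule.subset_span (hV _ _))
    intro ω _
    rw [← Finsupp.sum_single ω]
    refine Submodule.sum_mem _ fun p _ => ?_
    rw [← mul_one (ω p), ← smul_eq_mul, ← Finsupp.smul_single]
    exact Submodule.smul_mem _ _ (h1 p)
  let β := Module.Basis.ofSpan hspan
  have hβ : ∀ i, β i ∈ V := fun i => Module.Basis.ofSpan_subset hspan ⟨i, rfl⟩
  refine ⟨_, β, fun p j => ?_⟩
  -- By definition of the invariant vectors, the `j`-th coordinate commutes with `M` on these; both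
  -- sides are semilinear.
  let X : (σ →₀ T) →ₗ[T] T := Finsupp.linearCombination T
    (fun s => l (β.repr (Finsupp.single s 1) j))
  have hX : ∀ ω : σ →₀ F, X (ω.mapRange l (map_zero l)) = l (β.repr ω j) := by
    intro ω
    induction ω using Finsupp.induction_linear with
    | zero => simp
    | add f g hf hg =>
      rw [Finsupp.mapRange_add (_root_.map_add l), _root_.map_add, hf, hg, _root_.map_add,
        Finsupp.add_apply, _root_.map_add]
    | single s c =>
      have h3 : Finsupp.single s c = c • Finsupp.single s (1 : F) := by
        rw [Finsupp.smul_single, smul_eq_mul, mul_one]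
      rw [Finsupp.mapRange_single, Finsupp.linearCombination_single, h3, map_smul,
        Finsupp.smul_apply, smul_eq_mul, smul_eq_mul, map_mul]
  have key : ∀ ω : σ →₀ F, X (Finsupp.linearCombination T M (ω.mapRange r (map_zero r))) =
      r (β.repr ω j) := by
    intro ω
    have hmem : ω ∈ Submodule.span F (Set.range β) := by rw [β.span_eq]; trivial
    refine Submodule.span_induction ?_ ?_ ?_ ?_ hmem
    · rintro _ ⟨i, rfl⟩
      rw [show Finsupp.linearCombination T M ((β i).mapRange r (map_zero r)) =
        (β i).mapRange l (map_zero l) from hβ i, hX, β.repr_self, Finsupp.single_apply]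
      split_ifs
      · rw [map_one, map_one]
      · rw [map_zero, map_zero]
    · simp
    · intro f g _ _ hf hg
      rw [Finsupp.mapRange_add (_root_.map_add r), _root_.map_add, _root_.map_add, hf, hg,
        _root_.map_add, Finsupp.add_apply, _root_.map_add]
    · intro c f _ hf
      have h4 : (c • f).mapRange r (map_zero r) = r c • f.mapRange r (map_zero r) := by
        ext s
        rw [Finsupp.mapRange_apply, Finsupp.smul_apply, Finsupp.smul_apply,
          Finsupp.mapRange_apply, smul_eq_mul, map_mul, smul_eq_mul]
      rw [h4, map_smul, map_smul, hf, map_smul, Finsupp.smul_apply, smul_eq_mul, smul_eq_mul,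
        map_mul]
  have h5 := key (Finsupp.single p 1)
  rw [Finsupp.mapRange_single, map_one, Finsupp.linearCombination_single, one_smul] at h5
  exact h5.symm

end Descent

section Contract

section General

variable {E F : Type*} [Field E] [Field F] [Algebra E F]

/-- The contraction `a ⊗ b ↦ λ(b) a` of the second factor by a linear form `λ`. -/
noncomputable def contract (lam : F →ₗ[E] E) : F ⊗[E] F →ₗ[E] F :=
  (TensorProduct.rid E F).toLinearMap ∘ₗ LinearMap.lTensor F lam

theorem contract_tmul (lam : F →ₗ[E] E) (x y : F) : contract lam (x ⊗ₜ y) = lam y • x := by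
  change TensorProduct.rid E F (LinearMap.lTensor F lam (x ⊗ₜ y)) = _
  rw [LinearMap.lTensor_tmul, TensorProduct.rid_tmul]

/-- Contracting the last factor of `z₁ ⊗ 1 ⊗ z₂`. -/
theorem lTensor_contract_map_includeRight (lam : F →ₗ[E] E) (z : F ⊗[E] F) :
    LinearMap.lTensor F (contract lam) (Algebra.TensorProduct.map (AlgHom.id E F)
      (Algebra.TensorProduct.includeRight : F →ₐ[E] F ⊗[E] F) z) = contract lam z ⊗ₜ 1 := by
  induction z using TensorProduct.induction_on with
  | zero => simp
  | tmul x y =>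
    change LinearMap.lTensor F (contract lam) (x ⊗ₜ (1 ⊗ₜ y)) = _
    rw [LinearMap.lTensor_tmul, contract_tmul, contract_tmul,
      TensorProduct.tmul_smul, TensorProduct.smul_tmul']
  | add x y hx hy => rw [map_add, map_add, map_add, TensorProduct.add_tmul, hx, hy]

/-- Contracting the last factor of `(1 ⊗ w) (z ⊗ 1)`. -/
theorem lTensor_contract_tmul_mul (lam : F →ₗ[E] E) (w z : F ⊗[E] F) :
    LinearMap.lTensor F (contract lam) ((1 ⊗ₜ w) * Algebra.TensorProduct.map (AlgHom.id E F)
      (Algebra.TensorProduct.includeLeft : F →ₐ[E] F ⊗[E] F) z) =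
      (1 ⊗ₜ contract lam w) * z := by
  induction z using TensorProduct.induction_on with
  | zero => simp
  | tmul a b =>
    induction w using TensorProduct.induction_on with
    | zero => simp
    | tmul c d =>
      change LinearMap.lTensor F (contract lam)
        (((1 : F) ⊗ₜ[E] (c ⊗ₜ[E] d)) * (a ⊗ₜ[E] (b ⊗ₜ[E] (1 : F)))) = _
      rw [Algebra.TensorProduct.tmul_mul_tmul, Algebra.TensorProduct.tmul_mul_tmul, one_mul,
        mul_one, LinearMap.lTensor_tmul, contract_tmul, contract_tmul,
        Algebra.TensorProduct.tmul_mul_tmul, one_mul, smul_mul_assoc]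
    | add x y hx hy =>
      rw [TensorProduct.tmul_add, add_mul, map_add, hx, hy, map_add, TensorProduct.tmul_add,
        add_mul]
  | add x y hx hy => rw [map_add, mul_add, map_add, hx, hy, mul_add]

/-- The product `F ⊗ F → F` in terms of the contractions by the coordinates in a basis. -/
theorem exists_finset_contract {ι : Type*} (b : Module.Basis ι E F)
    (z : F ⊗[E] F) :
    ∃ I : Finset ι, ∀ J, I ⊆ J →
      Algebra.TensorProduct.lmul' E z = ∑ i ∈ J, b i * contract (b.coord i) z := by
  classical
  induction z using TensorProduct.induction_on with
  | zero => exact ⟨∅, fun J _ => by simp⟩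
  | tmul x y =>
    refine ⟨(b.repr y).support, fun J hJ => ?_⟩
    rw [Algebra.TensorProduct.lmul'_apply_tmul]
    conv_lhs => rw [← b.linearCombination_repr y, Finsupp.linearCombination_apply,
      Finsupp.sum_of_support_subset _ hJ (fun i a => a • b i) (fun i _ => zero_smul _ _)]
    rw [Finset.mul_sum]
    refine Finset.sum_congr rfl fun i _ => ?_
    rw [contract_tmul, Module.Basis.coord_apply, mul_smul_comm, mul_smul_comm, mul_comm]
  | add x y hx hy =>
    obtain ⟨I, hI⟩ := hx
    obtain ⟨I', hI'⟩ := hy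
    refine ⟨I ∪ I', fun J hJ => ?_⟩
    rw [map_add, hI J (Finset.union_subset_left hJ), hI' J (Finset.union_subset_right hJ),
      ← Finset.sum_add_distrib]
    refine Finset.sum_congr rfl fun i _ => ?_
    rw [map_add, mul_add]

/-- The contractions by the coordinates in a basis of `F` over `E`. -/
theorem isContraction {E F ι : Type u} [Field E] [Field F] [Algebra E F]
    (b : Module.Basis ι E F) :
    IsContraction (T := F ⊗[E] F) (U := F ⊗[E] (F ⊗[E] F))
      (Algebra.TensorProduct.includeLeft : F →ₐ[E] F ⊗[E] F).toRingHom
      (Algebra.TensorProduct.includeRight : F →ₐ[E] F ⊗[E] F).toRingHom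
      (Algebra.TensorProduct.map (AlgHom.id E F)
        (Algebra.TensorProduct.includeLeft : F →ₐ[E] F ⊗[E] F)).toRingHom
      (Algebra.TensorProduct.includeRight : F ⊗[E] F →ₐ[E] F ⊗[E] (F ⊗[E] F)).toRingHom
      (Algebra.TensorProduct.map (AlgHom.id E F)
        (Algebra.TensorProduct.includeRight : F →ₐ[E] F ⊗[E] F)).toRingHom
      (Algebra.TensorProduct.lmul' E).toRingHom b (fun i z => contract (b.coord i) z)
      (fun i z => LinearMap.lTensor F (contract (b.coord i)) z) where
  map_add _ z w := _root_.map_add _ z w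
  map_add' _ z w := _root_.map_add _ z w
  firstThird i z := lTensor_contract_map_includeRight (b.coord i) z
  mul i w z := lTensor_contract_tmul_mul (b.coord i) w z
  sum z := exists_finset_contract b z

end General

set_option synthInstance.maxHeartbeats 400000 in
/-- The same contractions, for the maps as homomorphisms over `k`. -/
theorem isContraction_tensor {k F ι : Type u} [Field k] [Field F] [Algebra k F]
    (E : IntermediateField k F) (b : Module.Basis ι E F) :
    IsContraction (T := F ⊗[E] F) (U := F ⊗[E] (F ⊗[E] F)) (leftMap (k := k) E).toRingHom
      (rightMap (k := k) E).toRingHom (firstSecond (k := k) E).toRingHom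
      (secondThird (k := k) E).toRingHom (firstThird (k := k) E).toRingHom
      ((Algebra.TensorProduct.lmul' E (S := F)).restrictScalars k).toRingHom b
      (fun i z => contract (b.coord i) z)
      (fun i z => LinearMap.lTensor F (contract (b.coord i)) z) :=
  isContraction b

section Faces

variable {k F : Type u} [Field k] [Field F] [Algebra k F] (E : IntermediateField k F)

theorem firstSecond_comp_rightMap :
    (firstSecond (k := k) E).comp (rightMap E) = (secondThird E).comp (leftMap E) :=
  AlgHom.ext fun _ => rfl

theorem firstThird_comp_leftMap :
    (firstThird (k := k) E).comp (leftMap E) = (firstSecond E).comp (leftMap E) :=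
  AlgHom.ext fun _ => rfl

theorem firstThird_comp_rightMap :
    (firstThird (k := k) E).comp (rightMap E) = (secondThird E).comp (rightMap E) :=
  AlgHom.ext fun _ => rfl

end Faces

end Contract

/-! ### The rank of the reciprocal distribution -/

namespace AlgebraicPseudogroup

variable {k : Type u} [Field k] {n m : ℕ} {q : ℕ∞} {Γ : AlgebraicPseudogroup k m}
  {E : IntermediateField k (JetField k n m q)} (hE : Γ.IsPHS q E) (hq : (Γ.order : ℕ∞) ≤ q)
  {T U : Type u} [CommRing T] [Algebra k T] [CommRing U] [Algebra k U]
  {l r : JetField k n m q →ₐ[k] T} {p₁₂ p₂₃ p₁₃ : T →ₐ[k] U}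

include hE hq

/-- The groupoid components are multiplicative. -/
theorem IsPHS.chain_groupoid (h₁₂ : p₁₂.comp r = p₂₃.comp l) (hl : p₁₃.comp l = p₁₂.comp l)
    (hr : p₁₃.comp r = p₂₃.comp r) {g : JetIdx m m q → T} (hg : Γ.Relates q l r g) :
    (fun p => p₁₃ (g p)) = chain k (fun p => p₁₂ (g p)) (fun p => p₂₃ (g p)) := by
  have h1 := hg.map p₁₂
  rw [h₁₂] at h1
  have h2 := h1.comp hq (hg.map p₂₃)
  have h3 := hg.map p₁₃
  rw [hl, hr] at h3
  exact hE.eq_of_relates h3 h2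

/-- The universal transformation is the identity on the diagonal. -/
theorem IsPHS.groupoid_idJet {μ : T →ₐ[k] JetField k n m q} (hl : μ.comp l = AlgHom.id k _)
    (hr : μ.comp r = AlgHom.id k _) {g : JetIdx m m q → T} (hg : Γ.Relates q l r g) :
    (fun p => μ (g p)) = idJet q (baseIncl k n m q) := by
  have h3 := hg.map μ
  rw [hl, hr] at h3
  exact hE.eq_of_relates h3 (relates_id hq (AlgHom.id k (JetField k n m q)))

/-- The invariant forms are a basis of the differential forms along the fibres over the space of
the `y`; the elements of the dual basis are in the reciprocal distribution. -/
theorem IsPHS.exists_span_of_contract (hT : IsTensorSquare E l r)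
    (h₁₂ : p₁₂.comp r = p₂₃.comp l) (hl : p₁₃.comp l = p₁₂.comp l)
    (hr : p₁₃.comp r = p₂₃.comp r) {ι' : Type u} {μ : T →ₐ[k] JetField k n m q}
    (hμl : μ.comp l = AlgHom.id k _) (hμr : μ.comp r = AlgHom.id k _)
    {b : ι' → JetField k n m q} {κ : ι' → T → JetField k n m q} {κ' : ι' → U → T}
    (hκ : IsContraction l.toRingHom r.toRingHom p₁₂.toRingHom p₂₃.toRingHom p₁₃.toRingHom
      μ.toRingHom b κ κ')
    {D : Derivation k (JetField k n m q) (JetField k n m q)} (hD : KillsBase D)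
    (S : Finset (JetIdx n m q)) :
    ∃ w ∈ Submodule.span (JetField k n m q) (Γ.Delta n q),
      ∀ p ∈ S, D (jetCoord k n m q p) = w (jetCoord k n m q p) := by
  classical
  obtain ⟨g, hg⟩ := hE.exists_relates hT
  have hrc : chain k (fun p => l (jetCoord k n m q p)) g = fun p => r (jetCoord k n m q p) :=
    funext fun p => (hg.2 p).symm
  have hcoc := hE.chain_groupoid hq h₁₂ hl hr hg
  -- The tangent map of the universal transformation, which is a cocycle.
  let M : PosJetIdx n m q → PosJetIdx n m q →₀ T := fun p =>
    chainTangent k (fun r => l (jetCoord k n m q r)) g p.1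
  have hM : ∀ p s, p₁₃ (M p s) = (M p).sum fun s' c => p₂₃ c * p₁₂ (M s' s) := by
    intro p s
    have h12 : ∀ p : JetIdx n m q, chainTangent k (fun r => p₁₂ (l (jetCoord k n m q r)))
        (fun r => p₁₂ (g r)) p = (chainTangent k (fun r => l (jetCoord k n m q r)) g p).mapRange
          p₁₂ (map_zero p₁₂) := fun p => map_chainTangent k p₁₂ _ _ _
    have h13 : chainTangent k (fun r => p₁₂ (l (jetCoord k n m q r)))
        (fun r => p₁₃ (g r)) p.1 = (M p).mapRange p₁₃ (map_zero p₁₃) := by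
      rw [← map_chainTangent]
      congr 1
      funext r
      exact (DFunLike.congr_fun hl _).symm
    have h23 : chainTangent k (chain k (fun r => p₁₂ (l (jetCoord k n m q r)))
        fun r => p₁₂ (g r)) (fun r => p₂₃ (g r)) p.1 = (M p).mapRange p₂₃ (map_zero p₂₃) := by
      rw [← map_chainTangent]
      congr 1
      funext s
      refine (map_chain k p₁₂ _ _ _).symm.trans ?_
      rw [hrc]
      exact DFunLike.congr_fun h₁₂ _
    have h4 := chainTangent_chain k (fun r => p₁₂ (l (jetCoord k n m q r)))
      (fun r => p₁₂ (g r)) (fun r => p₂₃ (g r)) p.1 s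
    rw [← hcoc, h13, h23, Finsupp.mapRange_apply,
      Finsupp.sum_mapRange_index (fun _ => zero_mul _)] at h4
    rw [h4]
    refine Finsupp.sum_congr fun s' _ => ?_
    rw [h12, Finsupp.mapRange_apply]
  have hM1 : ∀ p, (M p).mapRange μ (map_zero μ) = Finsupp.single p 1 := by
    intro p
    rw [← map_chainTangent, hE.groupoid_idJet hq hμl hμr hg]
    refine chainTangent_idJet k _ _ (fun u => ?_) p
    rw [baseIncl_baseCoord]
    exact (DFunLike.congr_fun hμl _).symm
  obtain ⟨ι, β, hβ⟩ := hκ.exists_basis M hM hM1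
  -- The dual basis of the basis of invariant forms.
  choose δ hδ using fun j => exists_jetDerivation
    (extendPos fun p : PosJetIdx n m q => β.repr (Finsupp.single p 1) j)
  have hδbase : ∀ j, KillsBase (δ j) := fun j => killsBase_iff.2 fun u => by
    rw [hδ, extendPos_zero _ _ rfl]
  have hext : ∀ {D : Derivation k (JetField k n m q) (JetField k n m q)}, KillsBase D → ∀ p,
      l (D (jetCoord k n m q p)) = extendPos (fun s => l (D (jetCoord k n m q s.1))) p := by
    intro D hD p
    by_cases hp : p.1.2 = 0
    · rw [extendPos_zero _ _ hp]
      have h0 : p = JetIdx.zero p.1.1 := Subtype.ext (Prod.ext rfl hp)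
      rw [h0, killsBase_iff.1 hD, map_zero]
    · rw [extendPos_apply _ ⟨p, hp⟩]
  have hδmem : ∀ j, δ j ∈ Γ.Delta n q := by
    intro j
    refine ⟨hδbase j, hE.isInvariant_of_universal hT hg fun p => ?_⟩
    have h5 : (fun p => dualLift l (δ j) (jetCoord k n m q p)) = fun p =>
        TrivSqZeroExt.inl (l (jetCoord k n m q p)) + TrivSqZeroExt.inr
          (extendPos (fun s => l (δ j (jetCoord k n m q s.1))) p) := funext fun p => by
      rw [dualLift_apply, hext (hδbase j)]
    rw [h5, chain_tangent, dualLift_apply, hg.2]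
    congr 2
    by_cases hp : p.1.2 = 0
    · have h0 : p = JetIdx.zero p.1.1 := Subtype.ext (Prod.ext rfl hp)
      rw [h0, killsBase_iff.1 (hδbase j), map_zero]
      have h6 := congrArg TrivSqZeroExt.snd (chain_tangent k (fun r => l (jetCoord k n m q r)) g
        (JetIdx.zero p.1.1) (fun s => l (δ j (jetCoord k n m q s.1))))
      rw [chain_zero_order, TrivSqZeroExt.snd_inl, TrivSqZeroExt.snd_add, TrivSqZeroExt.snd_inl,
        TrivSqZeroExt.snd_inr, zero_add] at h6
      exact h6
    · have h7 := hβ ⟨p, hp⟩ j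
      have h8 : (fun s : PosJetIdx n m q => l (δ j (jetCoord k n m q s.1))) =
          fun s => l (β.repr (Finsupp.single s 1) j) := funext fun s => by
        rw [hδ, extendPos_apply]
      rw [hδ, extendPos_apply _ ⟨p, hp⟩, h8]
      exact h7
  -- `D` is the combination of the `δ j` with coefficients `ev (β j)`. As the sum may be infinite,
  -- it is restricted to the terms which matter for the coordinates in `S`.
  let ev : (PosJetIdx n m q →₀ JetField k n m q) →ₗ[JetField k n m q] JetField k n m q :=
    Finsupp.linearCombination (JetField k n m q) fun s => D (jetCoord k n m q s.1)
  let J : Finset ι := S.biUnion fun p => if h : p.1.2 ≠ 0 then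
    (β.repr (Finsupp.single (⟨p, h⟩ : PosJetIdx n m q) 1)).support else ∅
  refine ⟨∑ j ∈ J, ev (β j) • δ j, Submodule.sum_mem _ fun j _ => Submodule.smul_mem _ _
    (Submodule.subset_span (hδmem j)), fun p hp => ?_⟩
  rw [derivation_sum_apply]
  by_cases hp0 : p.1.2 = 0
  · have h0 : p = JetIdx.zero p.1.1 := Subtype.ext (Prod.ext rfl hp0)
    rw [h0, killsBase_iff.1 hD]
    refine (Finset.sum_eq_zero fun j _ => ?_).symm
    rw [Derivation.smul_apply, killsBase_iff.1 (hδbase j), smul_zero]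
  · have hsub : (β.repr (Finsupp.single (⟨p, hp0⟩ : PosJetIdx n m q) 1)).support ⊆ J := by
      intro j hj
      exact Finset.mem_biUnion.2 ⟨p, hp, by rw [dif_pos hp0]; exact hj⟩
    have h9 : D (jetCoord k n m q p) = ev (Finsupp.single (⟨p, hp0⟩ : PosJetIdx n m q) 1) := by
      change _ = Finsupp.linearCombination _ _ _
      rw [Finsupp.linearCombination_single, one_smul]
    have h10 : Finsupp.single (⟨p, hp0⟩ : PosJetIdx n m q) 1 = ∑ j ∈ J,
        β.repr (Finsupp.single (⟨p, hp0⟩ : PosJetIdx n m q) 1) j • β j := by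
      conv_lhs => rw [← β.linearCombination_repr (Finsupp.single (⟨p, hp0⟩ : PosJetIdx n m q) 1)]
      exact Finsupp.sum_of_support_subset _ hsub (fun i a => a • β i) (fun i _ => zero_smul _ _)
    rw [h9, h10, map_sum]
    refine Finset.sum_congr rfl fun j _ => ?_
    rw [map_smul, Derivation.smul_apply, hδ, extendPos_apply _ (⟨p, hp0⟩ : PosJetIdx n m q),
      smul_eq_mul, smul_eq_mul, mul_comm]

omit [CommRing T] [Algebra k T] [CommRing U] [Algebra k U] in
set_option synthInstance.maxHeartbeats 400000 in
set_option maxHeartbeats 1000000 in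
/-- The reciprocal distribution has maximal rank. -/
theorem IsPHS.exists_mem_span_delta
    {D : Derivation k (JetField k n m q) (JetField k n m q)} (hD : KillsBase D)
    (S : Finset (JetIdx n m q)) :
    ∃ w ∈ Submodule.span (JetField k n m q) (Γ.Delta n q),
      ∀ p ∈ S, D (jetCoord k n m q p) = w (jetCoord k n m q p) := by
  let b := Module.Free.chooseBasis E (JetField k n m q)
  let μ : JetField k n m q ⊗[E] JetField k n m q →ₐ[k] JetField k n m q :=
    (Algebra.TensorProduct.lmul' E (S := JetField k n m q)).restrictScalars k
  have hμ : ∀ x y, μ (x ⊗ₜ y) = x * y := fun x y => Algebra.TensorProduct.lmul'_apply_tmul x y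
  have hc := isContraction_tensor E b
  refine @IsPHS.exists_span_of_contract k _ n m q Γ E hE hq
    (JetField k n m q ⊗[E] JetField k n m q)
    (JetField k n m q ⊗[E] (JetField k n m q ⊗[E] JetField k n m q)) _ _
    Algebra.TensorProduct.instCommRing Algebra.TensorProduct.leftAlgebra (leftMap E) (rightMap E)
    (firstSecond E) (secondThird E) (firstThird E) (isTensorSquare E)
    (firstSecond_comp_rightMap E) (firstThird_comp_leftMap E) (firstThird_comp_rightMap E) _ μ
    (AlgHom.ext fun x => (hμ x 1).trans (mul_one x))
    (AlgHom.ext fun x => (hμ 1 x).trans (one_mul x)) _ _ _ hc D hD S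

end AlgebraicPseudogroup

/-! ### The constants of the reciprocal distribution -/

/-- A polynomial which divides its derivative in a variable does not contain it: the degree would
drop. -/
theorem notMem_vars_of_dvd_pderiv {σ k : Type*} [Field k] [CharZero k] {f : MvPolynomial σ k}
    {i : σ} (h : f ∣ MvPolynomial.pderiv i f) : i ∉ f.vars := by
  classical
  have hcoeff : ∀ s ∈ (MvPolynomial.pderiv i f).support, s + Finsupp.single i 1 ∈ f.support := by
    intro s hs
    rw [MvPolynomial.mem_support_iff, MvPolynomial.coeff_pderiv] at hs
    exact MvPolynomial.mem_support_iff.2 fun h0 => hs (by rw [h0]; simp)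
  have h0 : MvPolynomial.pderiv i f = 0 := by
    by_contra hne
    obtain ⟨g, hg⟩ := h
    have hf : f ≠ 0 := by
      rintro rfl
      exact hne (map_zero _)
    have hg0 : g ≠ 0 := by
      rintro rfl
      exact hne (by rw [hg, mul_zero])
    have hdeg : MvPolynomial.degreeOf i f ≤ MvPolynomial.degreeOf i (MvPolynomial.pderiv i f) := by
      rw [hg, MvPolynomial.degreeOf_mul_eq hf hg0]
      exact Nat.le_add_right _ _
    have hle : ∀ s ∈ (MvPolynomial.pderiv i f).support, s i + 1 ≤ MvPolynomial.degreeOf i f := by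
      intro s hs
      have h1 := MvPolynomial.monomial_le_degreeOf i (hcoeff s hs)
      simpa using h1
    obtain ⟨s, hs⟩ := MvPolynomial.support_nonempty.2 hne
    have hpos : 0 < MvPolynomial.degreeOf i f := (Nat.succ_pos _).trans_le (hle s hs)
    have hlt := (MvPolynomial.degreeOf_lt_iff hpos).2 fun s hs => hle s hs
    exact absurd hdeg (not_le.2 hlt)
  intro hi
  obtain ⟨s, hs, his⟩ := (MvPolynomial.mem_vars_iff_mem_support i).1 hi
  have h1 : MvPolynomial.coeff (s - Finsupp.single i 1) (MvPolynomial.pderiv i f) = 0 := by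
    rw [h0, MvPolynomial.coeff_zero]
  have hsi : s i ≠ 0 := Finsupp.mem_support_iff.1 his
  have h2 : s - Finsupp.single i 1 + Finsupp.single i 1 = s :=
    tsub_add_cancel_of_le (Finsupp.single_le_iff.2 (Nat.one_le_iff_ne_zero.2 hsi))
  rw [MvPolynomial.coeff_pderiv, h2] at h1
  rcases mul_eq_zero.1 h1 with h3 | h3
  · exact MvPolynomial.mem_support_iff.1 hs h3
  · exact Nat.cast_add_one_ne_zero _ h3

section

variable {k : Type u} [Field k] {n m : ℕ} {q : ℕ∞}

open AlgebraicPseudogroup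

/-- The rational functions of the jets killed by all derivations over `k(y)` are in `k(y)`: the
numerator and the denominator of a reduced fraction divide their derivatives. -/
theorem exists_baseIncl_eq_of_derivation_eq_zero [CharZero k] {x : JetField k n m q}
    (hx : ∀ D : Derivation k (JetField k n m q) (JetField k n m q), KillsBase D → D x = 0) :
    ∃ c, baseIncl k n m q c = x := by
  classical
  obtain ⟨a, b, hab, rfl⟩ :=
    IsFractionRing.exists_reduced_fraction (A := MvPolynomial (JetIdx n m q) k) x
  have hb : (b : MvPolynomial (JetIdx n m q) k) ≠ 0 := nonZeroDivisors.ne_zero b.2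
  have hinj := IsFractionRing.injective (MvPolynomial (JetIdx n m q) k) (JetField k n m q)
  have hrename : ∀ f : MvPolynomial (JetIdx n m q) k,
      (∀ i : JetIdx n m q, i.1.2 ≠ 0 → i ∉ f.vars) →
      ∃ g : MvPolynomial (Fin m) k, MvPolynomial.rename JetIdx.zero g = f := by
    intro f hf
    refine MvPolynomial.exists_rename_eq_of_vars_subset_range f _ JetIdx.zero_injective ?_
    intro i hi
    refine ⟨i.1.1, Subtype.ext (Prod.ext rfl ?_)⟩
    by_contra h0
    exact hf i (fun h => h0 h.symm) hi
  have hbase : ∀ g : MvPolynomial (Fin m) k,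
      baseIncl k n m q (MvPolynomial.aeval (baseCoord k m) g) =
        algebraMap (MvPolynomial (JetIdx n m q) k) (JetField k n m q)
          (MvPolynomial.rename JetIdx.zero g) := by
    intro g
    rw [← aeval_jetCoord (n := n) (q := q) (MvPolynomial.rename JetIdx.zero g),
      MvPolynomial.aeval_rename, ← AlgHom.comp_apply, MvPolynomial.comp_aeval]
    congr 2
    funext u
    exact baseIncl_baseCoord u
  by_cases ha : a = 0
  · exact ⟨0, by rw [ha, map_zero, IsLocalization.mk'_zero]⟩
  have hdvd : ∀ i : JetIdx n m q, i.1.2 ≠ 0 → a ∣ MvPolynomial.pderiv i a ∧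
      (b : MvPolynomial (JetIdx n m q) k) ∣ MvPolynomial.pderiv i b := by
    intro i hi
    have hD := hx (fractionDerivation (A := MvPolynomial (JetIdx n m q) k)
      (MvPolynomial.pderiv i)) (killsBase_iff.2 fun u => by
      rw [jetCoord, fractionDerivation_algebraMap, MvPolynomial.pderiv_X_of_ne, map_zero]
      rintro rfl
      exact hi rfl)
    have h1 := IsLocalization.mk'_spec (M := nonZeroDivisors (MvPolynomial (JetIdx n m q) k))
      (JetField k n m q) a b
    have h2 := congrArg (fractionDerivation (A := MvPolynomial (JetIdx n m q) k)
      (F := JetField k n m q) (MvPolynomial.pderiv i)) h1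
    rw [Derivation.leibniz, hD, smul_zero, add_zero, fractionDerivation_algebraMap,
      fractionDerivation_algebraMap, smul_eq_mul] at h2
    have h3 : a * MvPolynomial.pderiv i b =
        (b : MvPolynomial (JetIdx n m q) k) * MvPolynomial.pderiv i a := by
      apply hinj
      rw [map_mul, map_mul, ← h1, ← h2]
      ring
    exact ⟨hab.dvd_of_dvd_mul_left ⟨_, h3.symm⟩, hab.symm.dvd_of_dvd_mul_left ⟨_, h3⟩⟩
  obtain ⟨a', rfl⟩ := hrename a fun i hi => notMem_vars_of_dvd_pderiv (hdvd i hi).1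
  obtain ⟨b', hb'⟩ := hrename b fun i hi => notMem_vars_of_dvd_pderiv (hdvd i hi).2
  have hb0 : b' ≠ 0 := by
    rintro rfl
    exact hb (by rw [← hb', map_zero])
  refine ⟨MvPolynomial.aeval (baseCoord k m) a' / MvPolynomial.aeval (baseCoord k m) b', ?_⟩
  rw [map_div₀, hbase, hbase, hb', IsFractionRing.mk'_eq_div]

namespace AlgebraicPseudogroup

variable {Γ : AlgebraicPseudogroup k m} {E : IntermediateField k (JetField k n m q)}

/-- The constants of the reciprocal distribution in `L_q` are the rational functions of `y`. -/
theorem IsPHS.exists_baseIncl_eq [CharZero k] (hE : Γ.IsPHS q E) (hq : (Γ.order : ℕ∞) ≤ q)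
    {x : JetField k n m q} (hx : ∀ δ ∈ Γ.Delta n q, δ x = 0) : ∃ c, baseIncl k n m q c = x := by
  refine exists_baseIncl_eq_of_derivation_eq_zero fun D hD => ?_
  obtain ⟨S, hS⟩ := exists_finset_derivation x
  obtain ⟨w, hw, hDw⟩ := hE.exists_mem_span_delta hq hD S
  rw [hS D w hDw]
  refine Submodule.span_induction (p := fun w _ => w x = 0) (fun δ hδ => hx δ hδ) rfl
    (fun a b _ _ ha hb => ?_) (fun c a _ ha => ?_) hw
  · rw [Derivation.add_apply, ha, hb, add_zero]
  · rw [Derivation.smul_apply, ha, smul_zero]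

end AlgebraicPseudogroup

end

/-! ### The ring `k[Γ]` as a subring of the tensor square -/

/-- A nonzero polynomial over a field is not a zero divisor over an algebra. -/
theorem map_mem_nonZeroDivisors {σ K A : Type*} [Field K] [CommRing A] (s : K →+* A)
    {f : MvPolynomial σ K} (hf : f ≠ 0) : MvPolynomial.map s f ∈ nonZeroDivisors _ := by
  classical
  let _ : Algebra K A := s.toAlgebra
  rw [mem_nonZeroDivisors_iff_right]
  intro h hh
  ext i
  rw [MvPolynomial.coeff_zero, ← Module.forall_dual_apply_eq_zero_iff K]
  -- Apply a linear form `φ` to the coefficients of a polynomial `h` with `h * f = 0`.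
  intro φ
  let φh : MvPolynomial σ K := ∑ i ∈ h.support, MvPolynomial.monomial i (φ (h.coeff i))
  have hφ : ∀ i, φh.coeff i = φ (h.coeff i) := by
    intro i
    simp only [φh, MvPolynomial.coeff_sum, MvPolynomial.coeff_monomial, Finset.sum_ite_eq',
      MvPolynomial.mem_support_iff]
    split_ifs with h0
    · rfl
    · rw [not_not.1 h0, map_zero]
  have h0 : φh * f = 0 := by
    ext d
    have h1 := congrArg (fun z => φ (MvPolynomial.coeff d z)) hh
    simp only [MvPolynomial.coeff_mul, MvPolynomial.coeff_zero, map_zero, map_sum,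
      MvPolynomial.coeff_map] at h1
    rw [MvPolynomial.coeff_mul, MvPolynomial.coeff_zero, ← h1]
    refine Finset.sum_congr rfl fun x _ => ?_
    rw [hφ, mul_comm (h.coeff x.1)]
    change _ = φ (f.coeff x.2 • h.coeff x.1)
    rw [map_smul, smul_eq_mul, mul_comm]
  rw [← hφ, (mul_eq_zero.1 h0).resolve_right hf, MvPolynomial.coeff_zero]

section Universal

variable {k : Type u} [Field k] {n m : ℕ} {A : Type u} [CommRing A] [Algebra k A]

open Classical in
/-- The jet with the given source point whose coordinates of positive order are
indeterminates. -/
noncomputable def universalJet (n : ℕ) (s : BaseField k m →ₐ[k] A) (p : JetIdx n m ⊤) :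
    MvPolynomial (JetIdx n m ⊤) A :=
  if p.1.2 = 0 then MvPolynomial.C (s (baseCoord k m p.1.1)) else MvPolynomial.X p

theorem universalJet_zero (s : BaseField k m →ₐ[k] A) (u : Fin m) :
    universalJet n s (JetIdx.zero u) = MvPolynomial.C (s (baseCoord k m u)) :=
  if_pos rfl

theorem JetIdx.eq_zero {d : ℕ} {q : ℕ∞} {p : JetIdx d m q} (h : p.1.2 = 0) :
    p = JetIdx.zero p.1.1 :=
  Subtype.ext (Prod.ext rfl h)

/-- The universal jet is generic up to inverting nonzerodivisors. -/
theorem aeval_universalJet_mem_nonZeroDivisors (s : BaseField k m →ₐ[k] A)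
    {f : MvPolynomial (JetIdx n m ⊤) k} (hf : f ≠ 0) :
    MvPolynomial.aeval (universalJet n s) f ∈ nonZeroDivisors _ := by
  have h1 : MvPolynomial.aeval (universalJet n s) f =
      MvPolynomial.map (s : BaseField k m →+* A)
        (MvPolynomial.aeval (universalJet n (AlgHom.id k (BaseField k m))) f) := by
    change _ = MvPolynomial.mapAlgHom (σ := JetIdx n m ⊤) s _
    rw [← AlgHom.comp_apply, MvPolynomial.comp_aeval]
    congr 2
    funext p
    unfold universalJet
    split_ifs <;> simp
  rw [h1]
  refine map_mem_nonZeroDivisors _ fun h0 => aeval_jetCoord_ne_zero hf ?_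
  have h2 : (MvPolynomial.aeval (jetCoord k n m ⊤)) =
      ((MvPolynomial.aeval (R := BaseField k m) (jetCoord k n m ⊤)).restrictScalars k).comp
      (MvPolynomial.aeval (universalJet n (AlgHom.id k (BaseField k m)))) := by
    refine MvPolynomial.algHom_ext fun p => ?_
    rw [AlgHom.comp_apply, MvPolynomial.aeval_X, MvPolynomial.aeval_X]
    unfold universalJet
    split_ifs with h
    · rw [AlgHom.restrictScalars_apply, AlgHom.id_apply, MvPolynomial.algHom_C]
      refine Eq.trans ?_ (baseIncl_baseCoord p.1.1).symm
      rw [← JetIdx.eq_zero h]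
    · rw [AlgHom.restrictScalars_apply, MvPolynomial.aeval_X]
  rw [h2, AlgHom.comp_apply, h0, map_zero]

/-- The endomorphism of the polynomials in the indeterminate jets given by the action of a
groupoid jet. -/
noncomputable def universalAction (s : BaseField k m →ₐ[k] A) (g : JetIdx m m ⊤ → A) :
    MvPolynomial (JetIdx n m ⊤) A →ₐ[A] MvPolynomial (JetIdx n m ⊤) A :=
  open Classical in MvPolynomial.aeval fun p => if p.1.2 = 0 then MvPolynomial.X p else
    chain k (universalJet n s) (fun r => MvPolynomial.C (g r)) p

theorem universalAction_universalJet (s t : BaseField k m →ₐ[k] A) {g : JetIdx m m ⊤ → A}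
    (hg : ∀ u, g (JetIdx.zero u) = t (baseCoord k m u)) (p : JetIdx n m ⊤) :
    universalAction s g (universalJet n t p) =
      chain k (universalJet n s) (fun r => MvPolynomial.C (g r)) p := by
  by_cases h : p.1.2 = 0
  · rw [JetIdx.eq_zero h, chain_zero_order, universalJet_zero, hg]
    exact MvPolynomial.algHom_C _ _
  · rw [universalJet, if_neg h, universalAction, MvPolynomial.aeval_X, if_neg h]

/-- Inverse groupoid jets act by inverse endomorphisms. -/
theorem universalAction_comp (s t : BaseField k m →ₐ[k] A) {g h : JetIdx m m ⊤ → A}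
    (hg : ∀ u, g (JetIdx.zero u) = t (baseCoord k m u)) (hgh : chain k g h = idJet ⊤ s) :
    (universalAction (n := n) s g).comp (universalAction t h) = AlgHom.id A _ := by
  refine MvPolynomial.algHom_ext fun p => ?_
  rw [AlgHom.comp_apply, AlgHom.id_apply, universalAction, universalAction, MvPolynomial.aeval_X,
    ← universalAction]
  split_ifs with h0
  · rw [universalAction, MvPolynomial.aeval_X, if_pos h0]
  · have h1 := map_chain k ((universalAction (n := n) s g).restrictScalars k) (universalJet n t)
      (fun r => MvPolynomial.C (h r)) p
    refine h1.trans ?_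
    simp only [AlgHom.restrictScalars_apply, universalAction_universalJet s t hg,
      MvPolynomial.algHom_C]
    change chain k (chain k (universalJet n s) fun r => MvPolynomial.C (g r))
      (fun r => MvPolynomial.C (h r)) p = _
    rw [chain_assoc]
    have h2 : (chain k (fun r => MvPolynomial.C (g r)) fun r => MvPolynomial.C (h r)) =
        idJet ⊤ ((IsScalarTower.toAlgHom k A (MvPolynomial (JetIdx n m ⊤) A)).comp s) := by
      funext r
      have := map_chain k (IsScalarTower.toAlgHom k A (MvPolynomial (JetIdx n m ⊤) A)) g h r
      refine this.symm.trans ?_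
      rw [hgh, map_idJet]
    rw [h2, chain_idJet, universalJet, if_neg h0]
    intro u
    rw [universalJet_zero]
    rfl

/-- The transform of the universal jet by an invertible groupoid jet is generic up to inverting
nonzerodivisors, the action being an automorphism. -/
theorem aeval_chain_universalJet_mem_nonZeroDivisors (s t : BaseField k m →ₐ[k] A)
    {g h : JetIdx m m ⊤ → A} (hg : ∀ u, g (JetIdx.zero u) = t (baseCoord k m u))
    (hh : ∀ u, h (JetIdx.zero u) = s (baseCoord k m u))
    (hgh : chain k g h = idJet ⊤ s) (hhg : chain k h g = idJet ⊤ t)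
    {f : MvPolynomial (JetIdx n m ⊤) k} (hf : f ≠ 0) :
    MvPolynomial.aeval (chain k (universalJet n s) fun r => MvPolynomial.C (g r)) f ∈
      nonZeroDivisors (MvPolynomial (JetIdx n m ⊤) A) := by
  let e : MvPolynomial (JetIdx n m ⊤) A ≃ₐ[A] MvPolynomial (JetIdx n m ⊤) A :=
    AlgEquiv.ofAlgHom (universalAction s g) (universalAction t h)
      (universalAction_comp s t hg hgh) (universalAction_comp t s hh hhg)
  have h1 : MvPolynomial.aeval (chain k (universalJet n s) fun r => MvPolynomial.C (g r)) f =
      e (MvPolynomial.aeval (universalJet n t) f) := by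
    change _ = ((universalAction s g).restrictScalars k) _
    rw [← AlgHom.comp_apply, MvPolynomial.comp_aeval]
    congr 2
    funext p
    exact (universalAction_universalJet s t hg p).symm
  rw [h1]
  rw [← MulEquivClass.map_nonZeroDivisors e]
  exact ⟨_, aeval_universalJet_mem_nonZeroDivisors t hf, rfl⟩

/-- Every groupoid jet relates two generic jets, after an injective extension of scalars. -/
theorem AlgebraicPseudogroup.exists_relates_of_isSolutionJet (n : ℕ) {Γ : AlgebraicPseudogroup k m}
    {s t : BaseField k m →ₐ[k] A} {g : JetIdx m m ⊤ → A} (hg : IsSolutionJet Γ.ideal ⊤ s t g) :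
    ∃ (B : Type u) (_ : CommRing B) (_ : Algebra k B) (i : A →ₐ[k] B)
      (a b : JetField k n m ⊤ →ₐ[k] B), Function.Injective i ∧
        a.comp (baseIncl k n m ⊤) = i.comp s ∧ b.comp (baseIncl k n m ⊤) = i.comp t ∧
        Γ.Relates ⊤ a b (fun p => i (g p)) := by
  obtain ⟨h, hh, hgh, hhg⟩ := Γ.exists_inverse hg
  let ι : MvPolynomial (JetIdx n m ⊤) A →ₐ[k] FractionRing (MvPolynomial (JetIdx n m ⊤) A) :=
    IsScalarTower.toAlgHom k _ _
  let i : A →ₐ[k] FractionRing (MvPolynomial (JetIdx n m ⊤) A) :=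
    ι.comp (IsScalarTower.toAlgHom k A _)
  have hunit : ∀ f ∈ nonZeroDivisors (MvPolynomial (JetIdx n m ⊤) A), IsUnit (ι f) := fun f hf =>
    IsLocalization.map_units _ (⟨f, hf⟩ : nonZeroDivisors (MvPolynomial (JetIdx n m ⊤) A))
  obtain ⟨a, ha⟩ := exists_jetHom (fun p => ι (universalJet n s p)) (fun f hf => by
    rw [← MvPolynomial.comp_aeval_apply]
    exact hunit _ (aeval_universalJet_mem_nonZeroDivisors s hf))
  obtain ⟨b, hb⟩ := exists_jetHom
    (fun p => ι (chain k (universalJet n s) (fun r => MvPolynomial.C (g r)) p)) (fun f hf => by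
    rw [← MvPolynomial.comp_aeval_apply]
    exact hunit _ (aeval_chain_universalJet_mem_nonZeroDivisors s t hg.1.1 hh.1.1 hgh hhg hf))
  have hs : a.comp (baseIncl k n m ⊤) = i.comp s := baseHom_ext fun u => by
    rw [AlgHom.comp_apply, baseIncl_baseCoord, ha, universalJet_zero]
    rfl
  have ht : b.comp (baseIncl k n m ⊤) = i.comp t := baseHom_ext fun u => by
    rw [AlgHom.comp_apply, baseIncl_baseCoord, hb, chain_zero_order, hg.1.1]
    rfl
  refine ⟨_, inferInstance, inferInstance, i, a, b, ?_, hs, ht, ?_, fun p => ?_⟩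
  · exact (IsFractionRing.injective (MvPolynomial (JetIdx n m ⊤) A) _).comp
      (MvPolynomial.C_injective _ _)
  · rw [hs, ht]
    exact hg.map i
  · rw [hb, map_chain]
    simp only [ha]
    rfl

end Universal

namespace AlgebraicPseudogroup

variable {k : Type u} [Field k] {n m : ℕ} {Γ : AlgebraicPseudogroup k m}
  {E : IntermediateField k (JetField k n m ⊤)} (hE : Γ.IsPHS ⊤ E)
  {T : Type u} [CommRing T] [Algebra k T] {l r : JetField k n m ⊤ →ₐ[k] T}

/-- The homomorphism from `k[Γ]` given by a jet relating two points of `L`. -/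
theorem Relates.exists_coordHom {a b : JetField k n m ⊤ →ₐ[k] T} {g : JetIdx m m ⊤ → T}
    (hg : Γ.Relates ⊤ a b g) : ∃ j : Γ.CoordRing →ₐ[k] T,
      j.comp Γ.source = a.comp (baseIncl k n m ⊤) ∧ j.comp Γ.target = b.comp (baseIncl k n m ⊤) ∧
      ∀ p : JetIdx m m ⊤, j (Γ.jet p.1) = g p :=
  Γ.exists_coordHom hg.1

/-- The homomorphism from `k[Γ]` to `L ⊗ L` given by the universal transformation is injective: the
groupoid jet given by the identity of `k[Γ]` relates two generic jets with values in an extension of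
`k[Γ]`, which define a homomorphism from `L ⊗ L`. -/
theorem IsPHS.injective_coordHom (hE : Γ.IsPHS ⊤ E) (hT : IsTensorSquare E l r)
    {j : Γ.CoordRing →ₐ[k] T} (hs : j.comp Γ.source = l.comp (baseIncl k n m ⊤))
    (hj : Γ.Relates ⊤ l r fun p => j (Γ.jet p.1)) : Function.Injective j := by
  obtain ⟨B, _, _, i, a, b, hi, ha, hb, hab⟩ := exists_relates_of_isSolutionJet n
    (Γ.isSolutionJet_coordHom (AlgHom.id k Γ.CoordRing))
  obtain ⟨φ, rfl, rfl⟩ := hT.exists_hom a b fun x hx => hE.eq_on hab hx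
  have h1 : φ.comp j = i := by
    refine coordHom_ext Γ (fun u => ?_) fun p => ?_
    · exact (congrArg φ (DFunLike.congr_fun hs _)).trans (DFunLike.congr_fun ha _)
    · exact congrFun (hE.eq_of_relates (hj.map φ) hab) ⟨p, le_top⟩
  refine Function.Injective.of_comp (f := φ) ?_
  rw [← AlgHom.coe_comp, h1]
  exact hi

/-- A derivation which kills the images of the coordinates kills the image of `k[Γ]`. -/
theorem derivation_coordHom_eq_zero {D : Derivation k T T} {j : Γ.CoordRing →ₐ[k] T}
    (hs : ∀ c, D (j (Γ.source c)) = 0) (hj : ∀ p, D (j (Γ.jet p)) = 0) (x : Γ.CoordRing) :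
    D (j x) = 0 := by
  have h : (dualLift (AlgHom.id k T) D).comp j = (TrivSqZeroExt.inlAlgHom k T T).comp j :=
    coordHom_ext Γ (fun u => by simp [dualLift_apply, hs]) (fun p => by simp [dualLift_apply, hj])
  have := congrArg TrivSqZeroExt.snd (DFunLike.congr_fun h x)
  simpa [dualLift_apply] using this

end AlgebraicPseudogroup

/-! ### The Hopf ring `k[Γ]` -/

namespace AlgebraicPseudogroup

section Hopf

variable {k : Type u} [Field k] {m : ℕ} {Γ : AlgebraicPseudogroup k m}
  {B : Type u} [CommRing B] [Algebra k B]

/-- The jet of infinite order which is the value of a point of `k[Γ]`. -/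
noncomputable def coordJet (x : Γ.CoordRing →ₐ[k] B) (p : JetIdx m m ⊤) : B := x (Γ.jet p.1)

/-- A point of `k[Γ]` is determined by its source and its jet of infinite order. -/
theorem coordHom_eq {x y : Γ.CoordRing →ₐ[k] B} (hs : x.comp Γ.source = y.comp Γ.source)
    (hj : coordJet x = coordJet y) : x = y :=
  coordHom_ext Γ (fun _ => DFunLike.congr_fun hs _) fun p => congrFun hj ⟨p, le_top⟩

theorem target_eq_of_coordJet_eq {x : Γ.CoordRing →ₐ[k] B} {t : BaseField k m →ₐ[k] B}
    (h : ∀ u : Fin m, coordJet x (JetIdx.zero u) = t (baseCoord k m u)) : x.comp Γ.target = t :=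
  baseHom_ext fun u => by
    rw [AlgHom.comp_apply, target_baseCoord]
    exact h u

/-- The structure maps of a Hopf ring with ring `k[Γ]` represent the groupoid of the solution jets
of infinite order. -/
structure RepresentsGroupoid (S : HopfRing k (BaseField k m) Γ.CoordRing) : Prop where
  src : S.src = Γ.source
  tgt : S.tgt = Γ.target
  counit_src : S.counit.comp Γ.source = AlgHom.id k _
  counit_jet : coordJet S.counit = idJet ⊤ (AlgHom.id k _)
  antipode_src : S.antipode.comp Γ.source = Γ.target
  antipode_tgt : S.antipode.comp Γ.target = Γ.source
  chain_antipode : chain k (coordJet (AlgHom.id k Γ.CoordRing)) (coordJet S.antipode) =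
    idJet ⊤ Γ.source
  antipode_chain : chain k (coordJet S.antipode) (coordJet (AlgHom.id k Γ.CoordRing)) =
    idJet ⊤ Γ.target
  conv_src : ∀ (B : Type u) [CommRing B] [Algebra k B] (x y : Γ.CoordRing →ₐ[k] B) h,
    (S.conv x y h).comp Γ.source = x.comp Γ.source
  conv_jet : ∀ (B : Type u) [CommRing B] [Algebra k B] (x y : Γ.CoordRing →ₐ[k] B) h,
    coordJet (S.conv x y h) = chain k (coordJet x) (coordJet y)

theorem map_comp_chain {C : Type u} [CommRing C] [Algebra k C] {n : ℕ} (φ : B →ₐ[k] C)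
    (a : JetIdx n m ⊤ → B) (g : JetIdx m m ⊤ → B) :
    φ ∘ chain k a g = chain k (φ ∘ a) (φ ∘ g) :=
  funext fun p => map_chain k φ a g p

theorem map_comp_idJet {C : Type u} [CommRing C] [Algebra k C] (φ : B →ₐ[k] C)
    (s : BaseField k m →ₐ[k] B) : φ ∘ idJet ⊤ s = idJet ⊤ (φ.comp s) :=
  funext fun p => map_idJet k φ s p

variable (Γ) in
/-- The jet of the identity, the inverse jet and the composite jet are points of `k[Γ]`: these are
the augmentation, the antipode and the diagonal. -/
theorem exists_representsGroupoid :
    ∃ S : HopfRing k (BaseField k m) Γ.CoordRing, RepresentsGroupoid S := by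
  obtain ⟨ε, hε1, -, hε2⟩ := Γ.exists_coordHom (Γ.isSolutionJet_id (q := ⊤) le_top
    (AlgHom.id k (BaseField k m)))
  have hu := Γ.isSolutionJet_coordHom (AlgHom.id k Γ.CoordRing)
  obtain ⟨h, hh, h1, h2⟩ := Γ.exists_inverse hu
  obtain ⟨σ, hσ1, hσ2, hσ3⟩ := Γ.exists_coordHom hh
  let i₁ : Γ.CoordRing →ₐ[k] ComposableRing Γ.source Γ.target :=
    (Ideal.Quotient.mkₐ k _).comp Algebra.TensorProduct.includeLeft
  let i₂ : Γ.CoordRing →ₐ[k] ComposableRing Γ.source Γ.target :=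
    (Ideal.Quotient.mkₐ k _).comp Algebra.TensorProduct.includeRight
  have hi : i₁.comp Γ.target = i₂.comp Γ.source := by
    refine AlgHom.ext fun c => ?_
    refine Ideal.Quotient.eq.2 (Ideal.subset_span ⟨c, rfl⟩)
  have hu1 := Γ.isSolutionJet_coordHom i₁
  rw [hi] at hu1
  obtain ⟨Δ, hΔ1, -, hΔ2⟩ := Γ.exists_coordHom
    (Γ.isSolutionJet_chain le_top hu1 (Γ.isSolutionJet_coordHom i₂))
  have hσ : coordJet σ = h := funext hσ3
  refine ⟨⟨Γ.source, Γ.target, ε, σ, Δ⟩, rfl, rfl, hε1, funext hε2, hσ1, hσ2, ?_, ?_,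
    fun B _ _ x y hxy => ?_, fun B _ _ x y hxy => ?_⟩
  · rw [hσ]; exact h1
  · rw [hσ]; exact h2
  · unfold HopfRing.conv
    refine (AlgHom.comp_assoc _ _ _).trans ?_
    rw [hΔ1]
    refine AlgHom.ext fun c => ?_
    change Algebra.TensorProduct.productMap x y (Γ.source c ⊗ₜ 1) = x (Γ.source c)
    simp
  · funext p
    unfold coordJet HopfRing.conv
    rw [AlgHom.comp_apply]
    refine (congrArg _ (hΔ2 p)).trans ?_
    refine (map_chain k _ _ _ p).trans ?_
    congr 1
    · funext r
      change Algebra.TensorProduct.productMap x y (Γ.jet r.1 ⊗ₜ 1) = x (Γ.jet r.1)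
      simp
    · funext r
      change Algebra.TensorProduct.productMap x y (1 ⊗ₜ Γ.jet r.1) = y (Γ.jet r.1)
      simp

variable {S : HopfRing k (BaseField k m) Γ.CoordRing}

/-- The axioms of a Hopf ring are the laws of the composition of jets. -/
theorem RepresentsGroupoid.isHopf (hS : RepresentsGroupoid S) : S.IsHopf := by
  have hid : ∀ {B : Type u} [CommRing B] [Algebra k B] (s : BaseField k m →ₐ[k] B),
      coordJet (s.comp S.counit) = idJet ⊤ s := by
    intro B _ _ s
    refine Eq.trans (b := s ∘ coordJet S.counit) rfl ?_
    rw [hS.counit_jet, map_comp_idJet]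
    rfl
  have hanti : ∀ {B : Type u} [CommRing B] [Algebra k B] (x : Γ.CoordRing →ₐ[k] B),
      coordJet (x.comp S.antipode) = x ∘ coordJet S.antipode := fun x => rfl
  have hx : ∀ {B : Type u} [CommRing B] [Algebra k B] (x : Γ.CoordRing →ₐ[k] B),
      coordJet x = x ∘ coordJet (AlgHom.id k Γ.CoordRing) := fun x => rfl
  have hzero : ∀ {B : Type u} [CommRing B] [Algebra k B] (x : Γ.CoordRing →ₐ[k] B) (u : Fin m),
      coordJet x (JetIdx.zero u) = x.comp Γ.target (baseCoord k m u) := fun x u => by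
    rw [AlgHom.comp_apply, target_baseCoord]; rfl
  have hcounit : S.counit.comp Γ.target = AlgHom.id k _ := by
    refine target_eq_of_coordJet_eq fun u => ?_
    rw [hS.counit_jet]
    exact if_pos rfl
  have hcounit' : ∀ {B : Type u} [CommRing B] [Algebra k B] (s : BaseField k m →ₐ[k] B),
      (s.comp S.counit).comp Γ.source = s := fun s => by
    rw [AlgHom.comp_assoc, hS.counit_src, AlgHom.comp_id]
  exact
  { counit_src := by rw [hS.src, hS.counit_src]
    counit_tgt := by rw [hS.tgt, hcounit]
    antipode_src := by rw [hS.src, hS.tgt, hS.antipode_src]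
    antipode_tgt := by rw [hS.src, hS.tgt, hS.antipode_tgt]
    conv_src := fun B _ _ x y h => by
      have := hS.conv_src B x y h
      rwa [← hS.src] at this
    conv_tgt := fun B _ _ x y h => by
      have : (S.conv x y h).comp Γ.target = y.comp Γ.target := by
        refine target_eq_of_coordJet_eq fun u => ?_
        rw [hS.conv_jet, chain_zero_order, hzero]
      rwa [← hS.tgt] at this
    conv_assoc := fun B _ _ x y z h₁ h₂ h₃ h₄ => by
      refine coordHom_eq ?_ ?_
      · rw [hS.conv_src, hS.conv_src, hS.conv_src]
      · rw [hS.conv_jet, hS.conv_jet, hS.conv_jet, hS.conv_jet, chain_assoc]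
    unit_conv := fun B _ _ x h => by
      refine coordHom_eq ?_ ?_
      · rw [hS.conv_src, hcounit', hS.src]
      · rw [hS.conv_jet, hid, idJet_chain]
    conv_unit := fun B _ _ x h => by
      refine coordHom_eq ?_ ?_
      · rw [hS.conv_src]
      · rw [hS.conv_jet, hid, chain_idJet]
        intro u
        rw [hzero, hS.tgt]
    conv_antipode := fun B _ _ x h => by
      refine coordHom_eq ?_ ?_
      · rw [hS.conv_src, hcounit', hS.src]
      · rw [hS.conv_jet, hid, hanti, hx x, ← map_comp_chain, hS.chain_antipode, map_comp_idJet,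
          hS.src]
    antipode_conv := fun B _ _ x h => by
      refine coordHom_eq ?_ ?_
      · rw [hS.conv_src, hcounit', hS.tgt, AlgHom.comp_assoc, hS.antipode_src]
      · rw [hS.conv_jet, hid, hanti, hx x, ← map_comp_chain, hS.antipode_chain, map_comp_idJet,
          hS.tgt] }

end Hopf

section Compatibility

variable {k : Type u} [Field k] {n m : ℕ} {Γ : AlgebraicPseudogroup k m}
  {E : IntermediateField k (JetField k n m ⊤)} (hE : Γ.IsPHS ⊤ E)
  {T U : Type u} [CommRing T] [Algebra k T] [CommRing U] [Algebra k U]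
  {l r : JetField k n m ⊤ →ₐ[k] T} {S : HopfRing k (BaseField k m) Γ.CoordRing}
  (hS : RepresentsGroupoid S) {j : Γ.CoordRing →ₐ[k] T}
  (hs : j.comp Γ.source = l.comp (baseIncl k n m ⊤))
  (ht : j.comp Γ.target = r.comp (baseIncl k n m ⊤)) (hj : Γ.Relates ⊤ l r (coordJet j))

include hs ht in
theorem coordHom_composable (hS : RepresentsGroupoid S) {p₁₂ p₂₃ : T →ₐ[k] U}
    (h₁₂ : p₁₂.comp r = p₂₃.comp l) :
    (p₁₂.comp j).comp S.tgt = (p₂₃.comp j).comp S.src := by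
  rw [hS.src, hS.tgt, AlgHom.comp_assoc, AlgHom.comp_assoc, hs, ht, ← AlgHom.comp_assoc, h₁₂,
    AlgHom.comp_assoc]

include hE hS hs hj

/-- The universal transformations between three generic jets are composed: the diagonal is induced
by `a ⊗ b ↦ a ⊗ 1 ⊗ b`. -/
theorem IsPHS.conv_coordHom {p₁₂ p₂₃ p₁₃ : T →ₐ[k] U}
    (h₁₂ : p₁₂.comp r = p₂₃.comp l) (hl : p₁₃.comp l = p₁₂.comp l)
    (hr : p₁₃.comp r = p₂₃.comp r) (h : (p₁₂.comp j).comp S.tgt = (p₂₃.comp j).comp S.src) :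
    S.conv (p₁₂.comp j) (p₂₃.comp j) h = p₁₃.comp j := by
  refine coordHom_eq ?_ ?_
  · rw [hS.conv_src, AlgHom.comp_assoc, AlgHom.comp_assoc, hs, ← AlgHom.comp_assoc, ← hl]
    rfl
  · rw [hS.conv_jet]
    exact (hE.chain_groupoid le_top h₁₂ hl hr hj).symm

/-- The augmentation is induced by the product. -/
theorem IsPHS.counit_coordHom {μ : T →ₐ[k] JetField k n m ⊤} (hl : μ.comp l = AlgHom.id k _)
    (hr : μ.comp r = AlgHom.id k _) : (baseIncl k n m ⊤).comp S.counit = μ.comp j := by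
  refine coordHom_eq ?_ ?_
  · rw [AlgHom.comp_assoc, hS.counit_src, AlgHom.comp_assoc, hs, ← AlgHom.comp_assoc, hl]
    rfl
  · refine Eq.trans (b := baseIncl k n m ⊤ ∘ coordJet S.counit) rfl ?_
    rw [hS.counit_jet, map_comp_idJet]
    exact (hE.groupoid_idJet le_top hl hr hj).symm

include ht

/-- The antipode is induced by the exchange of the factors, as the transformation from the second
generic jet to the first is the inverse of the universal one. -/
theorem IsPHS.antipode_coordHom {c : T →ₐ[k] T} (hl : c.comp l = r) (hr : c.comp r = l) :
    j.comp S.antipode = c.comp j := by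
  refine coordHom_eq ?_ ?_
  · rw [AlgHom.comp_assoc, hS.antipode_src, ht, AlgHom.comp_assoc, hs, ← AlgHom.comp_assoc, hl]
  · have h1 := hj.map c
    rw [hl, hr] at h1
    have h2 := hE.eq_of_relates (hj.comp le_top h1) (relates_id le_top l)
    have h3 : chain k (j ∘ coordJet S.antipode) (coordJet j) =
        idJet ⊤ (r.comp (baseIncl k n m ⊤)) := by
      have := congrArg (j ∘ ·) hS.antipode_chain
      simp only [map_comp_chain, map_comp_idJet, ht] at this
      exact this
    have h4 := chain_assoc k (j ∘ coordJet S.antipode) (coordJet j) (c ∘ coordJet j)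
    rw [h3, idJet_chain] at h4
    refine Eq.trans (b := j ∘ coordJet S.antipode) rfl (Eq.trans ?_ h4.symm)
    refine Eq.trans ?_ (congrArg _ h2.symm)
    rw [chain_idJet]
    intro u
    have h5 : j (S.antipode (Γ.target (baseCoord k m u))) = j (Γ.source (baseCoord k m u)) :=
      congrArg j (DFunLike.congr_fun hS.antipode_tgt _)
    rw [target_baseCoord] at h5
    exact ((DFunLike.congr_fun hs _).symm.trans h5.symm)

end Compatibility

end AlgebraicPseudogroup

/-! ### Reduced rings with finitely many minimal primes -/

section Reduced

variable {R : Type*} [CommRing R] [IsReduced R]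

/-- The zero divisors of a reduced ring are in minimal primes. -/
theorem exists_mem_minimalPrimes_of_notMem_nonZeroDivisors {x : R} (hx : x ∉ nonZeroDivisors R) :
    ∃ p ∈ minimalPrimes R, x ∈ p := by
  rw [mem_nonZeroDivisors_iff_right] at hx
  push Not at hx
  obtain ⟨y, hxy, hy⟩ := hx
  have h : x ∈ ⋃ p ∈ (⊥ : Ideal R).minimalPrimes, (p : Set R) := by
    rw [Ideal.iUnion_minimalPrimes]
    have h0 : (⊥ : Ideal R).radical = ⊥ := nilradical_eq_bot_iff.2 inferInstance
    refine ⟨y, ?_, ?_⟩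
    · rwa [h0]
    · rw [h0, mul_comm, hxy]
      exact Ideal.zero_mem _
  obtain ⟨p, hp, hxp⟩ := Set.mem_iUnion₂.1 h
  exact ⟨p, hp, hxp⟩

variable (hfin : (minimalPrimes R).Finite)

include hfin

/-- A minimal prime is killed by any element of the other minimal primes which is outside of it. -/
theorem exists_ne_zero_mul_eq_zero {p : Ideal R} (hp : p ∈ minimalPrimes R) :
    ∃ c : R, c ≠ 0 ∧ ∀ x ∈ p, c * x = 0 := by
  classical
  have hpp : p.IsPrime := hp.1.1
  obtain ⟨c, hc, hcp⟩ : ∃ c ∈ (hfin.toFinset.erase p).inf id, c ∉ p := by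
    by_contra! h
    obtain ⟨q, hq, hqp⟩ := hpp.inf_le'.1 h
    rw [Finset.mem_erase, Set.Finite.mem_toFinset] at hq
    exact hq.1 (le_antisymm hqp (hp.2 hq.2.1 hqp))
  refine ⟨c, fun h => hcp (h ▸ p.zero_mem), fun x hx => ?_⟩
  have h0 : c * x ∈ nilradical R := by
    rw [nilradical_eq_sInf, Ideal.mem_sInf]
    intro q hq
    have : q.IsPrime := hq
    obtain ⟨q', hq', hle⟩ := Ideal.exists_minimalPrimes_le (bot_le : ⊥ ≤ q)
    refine hle ?_
    by_cases h1 : q' = p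
    · exact h1 ▸ p.mul_mem_left _ hx
    · refine q'.mul_mem_right _ ?_
      have h2 : (hfin.toFinset.erase p).inf id ≤ q' := Finset.inf_le (f := id)
        (Finset.mem_erase.2 ⟨h1, hfin.mem_toFinset.2 hq'⟩)
      exact h2 hc
  rwa [nilradical_eq_zero] at h0

/-- An ideal without nonzerodivisors is killed by a nonzero element, since it is contained in a
minimal prime by prime avoidance. -/
theorem exists_ne_zero_mul_eq_zero_of_ideal {I : Ideal R}
    (hI : ∀ x ∈ I, x ∉ nonZeroDivisors R) : ∃ c : R, c ≠ 0 ∧ ∀ x ∈ I, c * x = 0 := by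
  have h : (I : Set R) ⊆ ⋃ p ∈ (hfin.toFinset : Set (Ideal R)), (p : Set R) := by
    intro x hx
    obtain ⟨p, hp, hxp⟩ := exists_mem_minimalPrimes_of_notMem_nonZeroDivisors (hI x hx)
    exact Set.mem_iUnion₂.2 ⟨p, by simpa using hp, hxp⟩
  rw [Ideal.subset_union_prime ⊤ ⊤ fun p hp _ _ => (hfin.mem_toFinset.1 hp).1.1] at h
  obtain ⟨p, hp, hle⟩ := h
  obtain ⟨c, hc, hcp⟩ := exists_ne_zero_mul_eq_zero hfin (hfin.mem_toFinset.1 hp)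
  exact ⟨c, hc, fun x hx => hcp x (hle hx)⟩

end Reduced

/-! ### The tensor product with `k[Γ]` over the field of the source -/

section Flat

variable {R F A : Type*} [Field R] [Field F] [CommRing A] [Algebra R F] [Algebra R A]

/-- Nonzerodivisors remain so under the extension of scalars to `F`, which is flat. -/
theorem one_tmul_mem_nonZeroDivisors {a : A} (ha : a ∈ nonZeroDivisors A) :
    (1 ⊗ₜ a : F ⊗[R] A) ∈ nonZeroDivisors (F ⊗[R] A) := by
  rw [mem_nonZeroDivisors_iff_right]
  have h1 : Function.Injective (LinearMap.mulRight R a) := by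
    rw [injective_iff_map_eq_zero]
    exact fun x hx => (mem_nonZeroDivisors_iff_right.1 ha) x hx
  have h2 := Module.Flat.lTensor_preserves_injective_linearMap (M := F) _ h1
  have h3 : ∀ z : F ⊗[R] A, (LinearMap.mulRight R a).lTensor F z = z * (1 ⊗ₜ a) := by
    intro z
    induction z using TensorProduct.induction_on with
    | zero => simp
    | tmul x y => simp
    | add x y hx hy => rw [map_add, hx, hy, add_mul]
  intro z hz
  rw [← h3] at hz
  exact h2 (hz.trans (map_zero _).symm)

theorem one_tmul_ne_zero {a : A} (ha : a ≠ 0) : (1 ⊗ₜ a : F ⊗[R] A) ≠ 0 := by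
  intro h
  have hinj : Function.Injective (Algebra.TensorProduct.includeRight : A →ₐ[R] F ⊗[R] A) :=
    Algebra.TensorProduct.includeRight_injective (algebraMap R F).injective
  exact ha (hinj (h.trans (map_zero _).symm))

end Flat

section Localize

variable {W T : Type*} [CommRing W] [CommRing T] {ρ : W →+* T} (hinj : Function.Injective ρ)
  (hloc : ∀ t : T, ∃ s w : W, IsUnit (ρ s) ∧ t * ρ s = ρ w)

include hinj hloc

/-- If the elements of `T` are fractions of elements of `W`, nonzerodivisors of `W` are
nonzerodivisors of `T`. -/
theorem map_mem_nonZeroDivisors_of_fractions {s : W} (hs : s ∈ nonZeroDivisors W) :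
    ρ s ∈ nonZeroDivisors T := by
  rw [mem_nonZeroDivisors_iff_right]
  intro t ht
  obtain ⟨m, w, hm, hw⟩ := hloc t
  have h1 : w * s = 0 := by
    apply hinj
    rw [map_mul, ← hw, map_zero, mul_right_comm, ht, zero_mul]
  rw [(mem_nonZeroDivisors_iff_right.1 hs) w h1, map_zero] at hw
  exact hm.mul_left_eq_zero.1 hw

/-- If the elements of `T` are fractions of elements of `W`, the total ring of fractions of `T` is
that of `W`. -/
theorem isFractionRing_of_fractions (Q : Type*) [CommRing Q] [Algebra T Q] [IsFractionRing T Q]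
    [Algebra W Q] (hQ : ∀ w, algebraMap W Q w = algebraMap T Q (ρ w)) : IsFractionRing W Q := by
  refine ⟨⟨fun s => ?_, fun z => ?_, fun {x y} h => ?_⟩⟩
  · rw [hQ]
    exact IsLocalization.map_units Q
      (⟨ρ s, map_mem_nonZeroDivisors_of_fractions hinj hloc s.2⟩ : nonZeroDivisors T)
  · obtain ⟨⟨t, t'⟩, h⟩ := IsLocalization.surj (nonZeroDivisors T) z
    obtain ⟨m, w, hm, hw⟩ := hloc t
    obtain ⟨m', w', hm', hw'⟩ := hloc t'
    have hmem : w' * m ∈ nonZeroDivisors W := by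
      refine mem_nonZeroDivisors_of_injective hinj ?_
      rw [map_mul, ← hw']
      exact mul_mem (mul_mem t'.2 hm'.mem_nonZeroDivisors) hm.mem_nonZeroDivisors
    refine ⟨(w * m', ⟨w' * m, hmem⟩), ?_⟩
    have h1 : z * algebraMap T Q t' = algebraMap T Q t := h
    rw [hQ, hQ]
    change z * algebraMap T Q (ρ (w' * m)) = algebraMap T Q (ρ (w * m'))
    rw [map_mul ρ, map_mul ρ, ← hw, ← hw', map_mul, map_mul, map_mul, map_mul, ← h1]
    ring
  · rw [hQ, hQ] at h
    exact ⟨1, by rw [hinj (IsFractionRing.injective T Q h)]⟩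

end Localize

namespace AlgebraicPseudogroup

variable {k : Type u} [Field k] {n m : ℕ} {Γ : AlgebraicPseudogroup k m}

/-- A derivation of `L` which is zero on `k(y)`, as a derivation over `k(y)`. -/
noncomputable def derivationOverBase {q : ℕ∞}
    (δ : Derivation k (JetField k n m q) (JetField k n m q)) (hδ : KillsBase δ) :
    Derivation (BaseField k m) (JetField k n m q) (JetField k n m q) :=
  Derivation.mk'
    { toFun := δ
      map_add' := map_add δ
      map_smul' := fun c x => by
        have h : c • x = baseIncl k n m q c * x := rfl
        rw [h, δ.leibniz, hδ c, smul_zero, add_zero]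
        rfl }
    δ.leibniz

variable (n Γ) in
/-- The reciprocal distribution of infinite order as a set of derivations over `k(y)`. -/
def deltaOverBase : Set (Derivation (BaseField k m) (JetField k n m ⊤) (JetField k n m ⊤)) :=
  {d | ∃ δ, ∃ h : δ ∈ Γ.Delta n ⊤, d = derivationOverBase δ h.1}

variable {E : IntermediateField k (JetField k n m ⊤)}

/-- The constants of the reciprocal distribution, as derivations over `k(y)`, are in `k(y)`. -/
theorem IsPHS.mem_range_of_deltaOverBase [CharZero k] (hE : Γ.IsPHS ⊤ E) (x : JetField k n m ⊤)
    (hx : ∀ d ∈ Γ.deltaOverBase n, d x = 0) :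
    x ∈ (algebraMap (BaseField k m) (JetField k n m ⊤)).range :=
  hE.exists_baseIncl_eq le_top fun δ hδ => hx _ ⟨δ, hδ, rfl⟩

variable {T : Type u} [CommRing T] [Algebra k T] {l r : JetField k n m ⊤ →ₐ[k] T}
  {j : Γ.CoordRing →ₐ[k] T}

/-- The homomorphism `x ⊗ h ↦ (x ⊗ 1) j(h)`. -/
theorem exists_tensorCoordHom (hs : j.comp Γ.source = l.comp (baseIncl k n m ⊤)) :
    ∃ ρ : JetField k n m ⊤ ⊗[BaseField k m] Γ.CoordRing →+* T, ∀ x h, ρ (x ⊗ₜ h) = l x * j h := by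
  let _ : Algebra (BaseField k m) T := (l.comp (baseIncl k n m ⊤)).toRingHom.toAlgebra
  let l' : JetField k n m ⊤ →ₐ[BaseField k m] T := { l.toRingHom with commutes' := fun _ => rfl }
  let j' : Γ.CoordRing →ₐ[BaseField k m] T :=
    { j.toRingHom with commutes' := fun c => DFunLike.congr_fun hs c }
  exact ⟨(Algebra.TensorProduct.productMap l' j').toRingHom, fun x h =>
    Algebra.TensorProduct.productMap_apply_tmul l' j' x h⟩

variable {ρ : JetField k n m ⊤ ⊗[BaseField k m] Γ.CoordRing →+* T}
  (hρ : ∀ x h, ρ (x ⊗ₜ h) = l x * j h)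

include hρ

theorem smul_tensorCoordHom (c : JetField k n m ⊤)
    (z : JetField k n m ⊤ ⊗[BaseField k m] Γ.CoordRing) : ρ (c • z) = l c * ρ z := by
  rw [Algebra.smul_def, map_mul]
  congr 1
  exact (hρ c 1).trans (by rw [map_one, mul_one])

/-- The action of `δ` on `L ⊗ L` corresponds to `δ ⊗ 1` on `L ⊗_{k(y)} k[Γ]`. -/
theorem derivation_tensorCoordHom {δ : Derivation k (JetField k n m ⊤) (JetField k n m ⊤)}
    (hδ : KillsBase δ) {D : Derivation k T T} (hl : ∀ x, D (l x) = l (δ x))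
    (hj : ∀ h, D (j h) = 0) (z : JetField k n m ⊤ ⊗[BaseField k m] Γ.CoordRing) :
    D (ρ z) = ρ (LinearMap.rTensor Γ.CoordRing
      (derivationOverBase δ hδ : JetField k n m ⊤ →ₗ[BaseField k m] JetField k n m ⊤) z) := by
  induction z using TensorProduct.induction_on with
  | zero => simp
  | add x y hx hy => simp only [map_add, hx, hy]
  | tmul x h =>
    rw [hρ, LinearMap.rTensor_tmul, hρ, D.leibniz, hj, smul_zero, zero_add, smul_eq_mul, hl,
      mul_comm]
    rfl

variable (hE : Γ.IsPHS ⊤ E) (hT : IsTensorSquare E l r)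
  (hs : j.comp Γ.source = l.comp (baseIncl k n m ⊤)) (hg : Γ.Relates ⊤ l r (coordJet j))

omit hρ in
include hE hT hs hg in
/-- The elements of the reciprocal distribution act on `L ⊗ L`, and kill the image of `k[Γ]`. -/
theorem IsPHS.exists_derivation_coordHom {δ : Derivation k (JetField k n m ⊤) (JetField k n m ⊤)}
    (hδ : δ ∈ Γ.Delta n ⊤) : ∃ D : Derivation k T T, (∀ x, D (l x) = l (δ x)) ∧
      (∀ x, D (r x) = r (δ x)) ∧ ∀ h, D (j h) = 0 := by
  obtain ⟨D, h1, h2⟩ := hE.exists_extension hT hδ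
  refine ⟨D, h1, h2, derivation_coordHom_eq_zero (fun c => ?_) fun p => ?_⟩
  · have : j (Γ.source c) = l (baseIncl k n m ⊤ c) := DFunLike.congr_fun hs c
    rw [this, h1, hδ.1, map_zero]
  · exact hE.extension_eq_zero hδ h1 h2 hg ⟨p, le_top⟩

include hE hT hs hg in
/-- The homomorphism `L ⊗_{k(y)} k[Γ] → L ⊗_K L` is injective: its kernel is stable under the
reciprocal distribution, hence spanned by elements of `k[Γ]`, where it is zero. -/
theorem IsPHS.injective_tensorCoordHom [CharZero k] : Function.Injective ρ := by
  have hinj := hE.injective_coordHom hT hs hg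
  let N : Submodule (JetField k n m ⊤) (JetField k n m ⊤ ⊗[BaseField k m] Γ.CoordRing) :=
    { carrier := {z | ρ z = 0}
      zero_mem' := map_zero ρ
      add_mem' := fun {a b} ha hb => by
        change ρ (a + b) = 0
        rw [map_add, ha, hb, add_zero]
      smul_mem' := fun c z hz => by
        change ρ (c • z) = 0
        rw [smul_tensorCoordHom hρ, hz, mul_zero] }
  have h1 := le_span_one_tmul (Γ.deltaOverBase n) hE.mem_range_of_deltaOverBase N (by
    rintro _ ⟨δ, hδ, rfl⟩ z hz
    obtain ⟨D, hD1, -, hD2⟩ := hE.exists_derivation_coordHom hT hs hg hδ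
    refine (derivation_tensorCoordHom hρ hδ.1 hD1 hD2 z).symm.trans ?_
    rw [hz, map_zero])
  rw [injective_iff_map_eq_zero]
  intro z hz
  have h2 : Submodule.span (JetField k n m ⊤) {z | z ∈ N ∧ ∃ a : Γ.CoordRing, z = 1 ⊗ₜ a} = ⊥ := by
    rw [Submodule.span_eq_bot]
    rintro _ ⟨hz, a, rfl⟩
    have h3 : ρ (1 ⊗ₜ a) = 0 := hz
    rw [hρ, map_one, one_mul] at h3
    rw [hinj (h3.trans (map_zero j).symm), TensorProduct.tmul_zero]
  have h4 := h1 (show z ∈ N from hz)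
  rwa [h2] at h4

include hT hg in
/-- The rational functions of the jets of `ȳ` are fractions of `L ⊗ k[Γ]`, by the chain rule. -/
theorem exists_tensorCoordHom_fraction (t : T) : ∃ s w, IsUnit (ρ s) ∧ t * ρ s = ρ w := by
  have hlmem : ∀ x, ρ (x ⊗ₜ 1) = l x := fun x => by rw [hρ, map_one, mul_one]
  have hjmem : ∀ h, ρ (1 ⊗ₜ h) = j h := fun h => by rw [hρ, map_one, one_mul]
  -- It suffices to show that the polynomials in the jets of `ȳ` are in the image of `ρ`.
  let R : Subalgebra k T :=
    { carrier := Set.range ρ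
      mul_mem' := fun {a b} ha hb => ρ.range.mul_mem ha hb
      add_mem' := fun {a b} ha hb => ρ.range.add_mem ha hb
      algebraMap_mem' := fun c => ⟨algebraMap k _ c ⊗ₜ 1, by rw [hlmem, AlgHom.commutes]⟩ }
  have hr : ∀ f : MvPolynomial (JetIdx n m ⊤) k,
      r (MvPolynomial.aeval (jetCoord k n m ⊤) f) ∈ R := by
    intro f
    rw [jetHom_aeval]
    have h1 : ∀ p, r (jetCoord k n m ⊤ p) ∈ R := by
      intro p
      rw [hg.2]
      let a : JetIdx n m ⊤ → R := fun p => ⟨l (jetCoord k n m ⊤ p), _, hlmem _⟩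
      let g : JetIdx m m ⊤ → R := fun p => ⟨coordJet j p, _, hjmem _⟩
      have h2 := map_chain k R.val a g p
      have h3 := (chain k a g p).2
      exact Set.mem_of_eq_of_mem h2.symm h3
    have h5 : MvPolynomial.aeval (fun p => r (jetCoord k n m ⊤ p)) f ∈
        Algebra.adjoin k (Set.range fun p => r (jetCoord k n m ⊤ p)) := by
      rw [Algebra.adjoin_range_eq_range_aeval]
      exact ⟨f, rfl⟩
    refine Algebra.adjoin_le ?_ h5
    rintro _ ⟨p, rfl⟩
    exact h1 p
  have ht : t ∈ Algebra.adjoin k (Set.range l ∪ Set.range r) := by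
    rw [hT.adjoin_eq_top]
    exact Algebra.mem_top
  induction ht using Algebra.adjoin_induction with
  | mem t ht =>
    obtain ⟨x, rfl⟩ | ⟨x, rfl⟩ := ht
    · exact ⟨1, x ⊗ₜ 1, by simp, by rw [map_one, mul_one, hlmem]⟩
    · obtain ⟨f, h, hh, hx⟩ := exists_jetField_eq_div x
      obtain ⟨w, hw⟩ := hr f
      obtain ⟨s, hs⟩ := hr h
      refine ⟨s, w, ?_, ?_⟩
      · rw [hs]
        exact (aeval_jetCoord_ne_zero hh).isUnit.map r
      · rw [hs, hw, ← map_mul, hx]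
  | algebraMap c => exact ⟨1, algebraMap k _ c ⊗ₜ 1, by simp, by
      rw [map_one, mul_one, hlmem, AlgHom.commutes]⟩
  | add t t' _ _ h h' =>
    obtain ⟨s, w, hs, hw⟩ := h
    obtain ⟨s', w', hs', hw'⟩ := h'
    refine ⟨s * s', w * s' + w' * s, by rw [map_mul]; exact hs.mul hs', ?_⟩
    rw [map_add, map_mul, map_mul, map_mul, ← hw, ← hw']
    ring
  | mul t t' _ _ h h' =>
    obtain ⟨s, w, hs, hw⟩ := h
    obtain ⟨s', w', hs', hw'⟩ := h'
    refine ⟨s * s', w * w', by rw [map_mul]; exact hs.mul hs', ?_⟩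
    rw [map_mul, map_mul, ← hw, ← hw']
    ring

end AlgebraicPseudogroup

/-! ### The constants of the total ring of fractions -/

namespace AlgebraicPseudogroup

variable {k : Type u} [Field k] {n m : ℕ} {Γ : AlgebraicPseudogroup k m}
  {E : IntermediateField k (JetField k n m ⊤)}
  {T : Type u} [CommRing T] [Algebra k T] {l r : JetField k n m ⊤ →ₐ[k] T}
  {j : Γ.CoordRing →ₐ[k] T} (hE : Γ.IsPHS ⊤ E) (hT : IsTensorSquare E l r)
  (hs : j.comp Γ.source = l.comp (baseIncl k n m ⊤)) (hg : Γ.Relates ⊤ l r (coordJet j))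

include hE hT hs hg

/-- The total ring of fractions of `L ⊗_{k(y)} k[Γ]` is that of `L ⊗_K L`. -/
theorem IsPHS.exists_fractionRing_equiv [CharZero k] (Q : Type u) [CommRing Q] [Algebra T Q]
    [IsFractionRing T Q] :
    ∃ e : FractionRing (JetField k n m ⊤ ⊗[BaseField k m] Γ.CoordRing) ≃+* Q,
      ∀ (x : JetField k n m ⊤) (h : Γ.CoordRing),
        e (algebraMap (JetField k n m ⊤ ⊗[BaseField k m] Γ.CoordRing) _ (x ⊗ₜ h)) =
          algebraMap T Q (l x * j h) := by
  obtain ⟨ρ, hρ⟩ := exists_tensorCoordHom hs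
  let _ : Algebra (JetField k n m ⊤ ⊗[BaseField k m] Γ.CoordRing) Q :=
    ((algebraMap T Q).comp ρ).toAlgebra
  have hQ : ∀ w, algebraMap (JetField k n m ⊤ ⊗[BaseField k m] Γ.CoordRing) Q w =
      algebraMap T Q (ρ w) := fun _ => rfl
  have := isFractionRing_of_fractions (hE.injective_tensorCoordHom hρ hT hs hg)
    (exists_tensorCoordHom_fraction hρ hT hg) Q hQ
  refine ⟨(IsLocalization.algEquiv
    (nonZeroDivisors (JetField k n m ⊤ ⊗[BaseField k m] Γ.CoordRing)) (FractionRing _)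
    Q).toRingEquiv, fun x h => ?_⟩
  refine (IsLocalization.algEquiv_apply _ _ _ _).trans ?_
  refine (IsLocalization.map_eq _ _).trans ?_
  rw [RingHom.id_apply, hQ, hρ]

/-- The homomorphism `j` extends to total rings of fractions. -/
theorem IsPHS.coordHom_mem_nonZeroDivisors [CharZero k] {a : Γ.CoordRing}
    (ha : a ∈ nonZeroDivisors Γ.CoordRing) : j a ∈ nonZeroDivisors T := by
  obtain ⟨ρ, hρ⟩ := exists_tensorCoordHom hs
  have h1 := map_mem_nonZeroDivisors_of_fractions (hE.injective_tensorCoordHom hρ hT hs hg)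
    (exists_tensorCoordHom_fraction hρ hT hg) (one_tmul_mem_nonZeroDivisors ha)
  rwa [hρ, map_one, one_mul] at h1

variable {Q : Type u} [CommRing Q] [Algebra k Q] [Algebra T Q] [IsScalarTower k T Q]
  [IsFractionRing T Q] {S : Type u} [CommRing S] [Algebra k S] [Algebra Γ.CoordRing S]
  [IsFractionRing Γ.CoordRing S]

variable (Q S) in
/-- The extension of `j` to the total rings of fractions. -/
theorem IsPHS.exists_fractionHom [CharZero k] [IsScalarTower k Γ.CoordRing S] :
    ∃ J : S →ₐ[k] Q, Function.Injective J ∧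
      ∀ x, J (algebraMap Γ.CoordRing S x) = algebraMap T Q (j x) := by
  have hinj := hE.injective_coordHom hT hs hg
  let J : S →ₐ[k] Q := IsLocalization.liftAlgHom (M := nonZeroDivisors Γ.CoordRing)
    (f := (IsScalarTower.toAlgHom k T Q).comp j) fun a =>
      IsLocalization.map_units Q
        (⟨j a, hE.coordHom_mem_nonZeroDivisors hT hs hg a.2⟩ : nonZeroDivisors T)
  have hJ : ∀ x, J (algebraMap Γ.CoordRing S x) = algebraMap T Q (j x) :=
    fun x => IsLocalization.lift_eq _ x
  refine ⟨J, (injective_iff_map_eq_zero J).2 fun z hz => ?_, hJ⟩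
  obtain ⟨⟨a, s⟩, h⟩ := IsLocalization.surj (nonZeroDivisors Γ.CoordRing) z
  have h1 := congrArg J h
  rw [map_mul, hz, zero_mul, hJ] at h1
  have h2 : a = 0 := hinj ((IsFractionRing.injective T Q (h1.symm.trans (map_zero _).symm)).trans
    (map_zero j).symm)
  rw [h2, map_zero] at h
  exact (IsLocalization.map_units S s).mul_left_eq_zero.1 h

/-- The action of the reciprocal distribution on `L ⊗ L` and its total ring of fractions. -/
theorem IsPHS.exists_fraction_derivation {δ : Derivation k (JetField k n m ⊤) (JetField k n m ⊤)}
    (hδ : δ ∈ Γ.Delta n ⊤) : ∃ (D : Derivation k T T) (D' : Derivation k Q Q),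
      (∀ x, D (l x) = l (δ x)) ∧ (∀ x, D (r x) = r (δ x)) ∧ (∀ h, D (j h) = 0) ∧
      ∀ t, D' (algebraMap T Q t) = algebraMap T Q (D t) := by
  obtain ⟨D, h1, h2, h3⟩ := hE.exists_derivation_coordHom hT hs hg hδ
  obtain ⟨D', h4⟩ := exists_localizationDerivation (S := Q) (nonZeroDivisors T) D
  exact ⟨D, D', h1, h2, h3, h4⟩

/-- The constants of `Q(L ⊗ L)` are the fractions of elements of `k[Γ]`. The denominators of a
constant form a subspace of `L ⊗_{k(y)} k[Γ]` stable under the reciprocal distribution, hence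
spanned by elements of `k[Γ]`; one of these is a nonzerodivisor, and the corresponding numerator is
a constant of `L ⊗_{k(y)} k[Γ]`. -/
theorem IsPHS.range_fractionHom [CharZero k] [IsReduced Γ.CoordRing]
    (hfin : (minimalPrimes Γ.CoordRing).Finite) {J : S →ₐ[k] Q}
    (hJ : ∀ x, J (algebraMap Γ.CoordRing S x) = algebraMap T Q (j x)) :
    Set.range J = {z | ∀ δ ∈ Γ.Delta n ⊤, ∀ D : Derivation k Q Q,
      (∀ x, D (algebraMap T Q (l x)) = algebraMap T Q (l (δ x)) ∧
        D (algebraMap T Q (r x)) = algebraMap T Q (r (δ x))) → D z = 0} := by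
  have hDj : ∀ δ ∈ Γ.Delta n ⊤, ∀ D : Derivation k Q Q,
      (∀ x, D (algebraMap T Q (l x)) = algebraMap T Q (l (δ x)) ∧
        D (algebraMap T Q (r x)) = algebraMap T Q (r (δ x))) →
      ∀ h, D (algebraMap T Q (j h)) = 0 := by
    intro δ hδ D hD h
    obtain ⟨D₀, D', h1, h2, h3, h4⟩ := hE.exists_fraction_derivation (Q := Q) hT hs hg hδ
    have h5 : D = D' := by
      refine localizationDerivation_ext (nonZeroDivisors T) fun t => ?_
      have h6 : (dualLift (AlgHom.id k Q) D).comp (IsScalarTower.toAlgHom k T Q) =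
          (dualLift (AlgHom.id k Q) D').comp (IsScalarTower.toAlgHom k T Q) :=
        hT.hom_ext (fun x => by simp [dualLift_apply, hD, h4, h1])
          (fun x => by simp [dualLift_apply, hD, h4, h2])
      have := congrArg TrivSqZeroExt.snd (DFunLike.congr_fun h6 t)
      simpa [dualLift_apply] using this
    rw [h5, h4, h3, map_zero]
  ext z
  constructor
  · rintro ⟨w, rfl⟩ δ hδ D hD
    obtain ⟨⟨a, s⟩, h⟩ := IsLocalization.surj (nonZeroDivisors Γ.CoordRing) w
    have h1 := congrArg (fun x => D (J x)) h
    simp only [map_mul, hJ, D.leibniz, hDj δ hδ D hD, smul_zero, zero_add] at h1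
    exact (IsLocalization.map_units Q (⟨j s, hE.coordHom_mem_nonZeroDivisors hT hs hg s.2⟩ :
      nonZeroDivisors T)).mul_right_eq_zero.1 h1
  · intro hz
    obtain ⟨ρ, hρ⟩ := exists_tensorCoordHom hs
    have hinj := hE.injective_tensorCoordHom hρ hT hs hg
    let _ : Algebra (JetField k n m ⊤ ⊗[BaseField k m] Γ.CoordRing) Q :=
      ((algebraMap T Q).comp ρ).toAlgebra
    have hQ : ∀ w, algebraMap (JetField k n m ⊤ ⊗[BaseField k m] Γ.CoordRing) Q w =
        algebraMap T Q (ρ w) := fun _ => rfl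
    have hfrac := isFractionRing_of_fractions hinj (exists_tensorCoordHom_fraction hρ hT hg) Q hQ
    have hinjQ := IsFractionRing.injective (JetField k n m ⊤ ⊗[BaseField k m] Γ.CoordRing) Q
    have hone : ∀ a : Γ.CoordRing, algebraMap (JetField k n m ⊤ ⊗[BaseField k m] Γ.CoordRing) Q
        (1 ⊗ₜ a) = algebraMap T Q (j a) := fun a => by rw [hQ, hρ, map_one, one_mul]
    have hder : ∀ δ (hδ : δ ∈ Γ.Delta n ⊤), ∃ D : Derivation k Q Q, D z = 0 ∧
        (∀ h, D (algebraMap T Q (j h)) = 0) ∧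
        ∀ w, D (algebraMap (JetField k n m ⊤ ⊗[BaseField k m] Γ.CoordRing) Q w) =
          algebraMap _ Q (LinearMap.rTensor Γ.CoordRing (derivationOverBase δ hδ.1 :
            JetField k n m ⊤ →ₗ[BaseField k m] JetField k n m ⊤) w) := by
      intro δ hδ
      obtain ⟨D₀, D', h1, h2, h3, h4⟩ := hE.exists_fraction_derivation (Q := Q) hT hs hg hδ
      refine ⟨D', hz δ hδ D' fun x => ⟨by rw [h4, h1], by rw [h4, h2]⟩,
        fun h => by rw [h4, h3, map_zero], fun w => ?_⟩
      rw [hQ, h4, derivation_tensorCoordHom hρ hδ.1 h1 h3, hQ]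
    -- The ideal of the denominators of `z` is stable under the reciprocal distribution.
    let N : Submodule (JetField k n m ⊤) (JetField k n m ⊤ ⊗[BaseField k m] Γ.CoordRing) :=
      { carrier := {w | ∃ w' : JetField k n m ⊤ ⊗[BaseField k m] Γ.CoordRing,
          algebraMap _ Q w * z = algebraMap _ Q w'}
        zero_mem' := ⟨0, by rw [map_zero, zero_mul]⟩
        add_mem' := by
          rintro a b ⟨a', ha⟩ ⟨b', hb⟩
          exact ⟨a' + b', by rw [map_add, map_add, add_mul, ha, hb]⟩
        smul_mem' := by
          rintro c a ⟨a', ha⟩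
          exact ⟨c • a', by
            rw [Algebra.smul_def, Algebra.smul_def, map_mul, map_mul, mul_assoc, ha]⟩ }
    have hN := le_span_one_tmul (Γ.deltaOverBase n) hE.mem_range_of_deltaOverBase N (by
      rintro _ ⟨δ, hδ, rfl⟩ w ⟨w', hw⟩
      obtain ⟨D, hDz, -, hD⟩ := hder δ hδ
      have h1 := congrArg D hw
      rw [D.leibniz, hDz, smul_zero, zero_add, hD, hD, smul_eq_mul, mul_comm] at h1
      exact ⟨_, h1⟩)
    -- The denominators of `z` in `k[Γ]`. If they were all zero divisors, they would be killed by a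
    -- single `c ≠ 0`, which would then kill all the denominators of `z`.
    let b : Ideal Γ.CoordRing :=
      { carrier := {a | (1 ⊗ₜ a) ∈ N}
        zero_mem' := by
          change _ ∈ N
          rw [TensorProduct.tmul_zero]
          exact N.zero_mem
        add_mem' := fun {a b} ha hb => by
          change _ ∈ N
          rw [TensorProduct.tmul_add]
          exact N.add_mem ha hb
        smul_mem' := by
          rintro c a ⟨a', ha⟩
          refine ⟨(1 ⊗ₜ c) * a', ?_⟩
          rw [map_mul, ← ha, ← mul_assoc, ← map_mul, Algebra.TensorProduct.tmul_mul_tmul, mul_one,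
            smul_eq_mul] }
    obtain ⟨a, hab, ha⟩ : ∃ a ∈ b, a ∈ nonZeroDivisors Γ.CoordRing := by
      by_contra! h
      obtain ⟨c, hc, hcb⟩ := exists_ne_zero_mul_eq_zero_of_ideal hfin h
      obtain ⟨⟨w, s⟩, hws⟩ := IsLocalization.surj
        (nonZeroDivisors (JetField k n m ⊤ ⊗[BaseField k m] Γ.CoordRing)) z
      have hsN : (s : JetField k n m ⊤ ⊗[BaseField k m] Γ.CoordRing) ∈ N :=
        ⟨w, (mul_comm _ _).trans hws⟩
      have hkill : ∀ x ∈ N, (1 ⊗ₜ c) * x = 0 := by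
        intro x hx
        refine Submodule.span_induction (p := fun x _ => (1 ⊗ₜ c) * x = 0) ?_ (mul_zero _) ?_ ?_
          (hN hx)
        · rintro _ ⟨hz, a, rfl⟩
          rw [Algebra.TensorProduct.tmul_mul_tmul, hcb a hz, TensorProduct.tmul_zero]
        · intro x y _ _ hx hy
          rw [mul_add, hx, hy, add_zero]
        · intro d x _ hx
          rw [mul_smul_comm, hx, smul_zero]
      exact one_tmul_ne_zero hc ((mem_nonZeroDivisors_iff_right.1 s.2) _ (hkill _ hsN))
    obtain ⟨w, hw⟩ := hab
    -- The numerator `w = a z` is a constant of `L ⊗ k[Γ]`.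
    obtain ⟨a', rfl⟩ := exists_eq_one_tmul (Γ.deltaOverBase n) hE.mem_range_of_deltaOverBase w (by
      rintro _ ⟨δ, hδ, rfl⟩
      obtain ⟨D, hDz, hDj, hD⟩ := hder δ hδ
      have h1 := congrArg D hw
      rw [D.leibniz, hDz, smul_zero, zero_add, hone, hDj, smul_zero, hD] at h1
      exact hinjQ (h1.symm.trans (map_zero _).symm))
    refine ⟨IsLocalization.mk' S a' (⟨a, ha⟩ : nonZeroDivisors Γ.CoordRing), ?_⟩
    have h1 := congrArg J (IsLocalization.mk'_spec S a' (⟨a, ha⟩ : nonZeroDivisors Γ.CoordRing))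
    rw [map_mul, hJ, hJ] at h1
    rw [hone, hone, mul_comm] at hw
    exact (IsLocalization.map_units Q (⟨j a, hE.coordHom_mem_nonZeroDivisors hT hs hg ha⟩ :
      nonZeroDivisors T)).mul_right_cancel (h1.trans hw.symm)

end AlgebraicPseudogroup

/-! ### Direct sums of differential fields -/

section Quotient

variable {k R S : Type*} [Field k] [CommRing R] [CommRing S] [Algebra k R] [Algebra k S]

/-- A derivation descends to a quotient by a stable ideal. -/
theorem exists_derivation_of_surjective (f : R →ₐ[k] S) (hf : Function.Surjective f)
    (d : Derivation k R R) (hd : ∀ x, f x = 0 → f (d x) = 0) :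
    ∃ D : Derivation k S S, ∀ x, D (f x) = f (d x) := by
  choose σ hσ using hf
  have h : ∀ s x, f x = s → f (d (σ s)) = f (d x) := by
    intro s x hx
    have := hd (σ s - x) (by rw [map_sub, hσ, hx, sub_self])
    rwa [map_sub, map_sub, sub_eq_zero] at this
  refine ⟨Derivation.mk'
    { toFun := fun s => f (d (σ s))
      map_add' := fun s t => by
        rw [h (s + t) (σ s + σ t) (by rw [map_add, hσ, hσ]), map_add, map_add]
      map_smul' := fun c s => by
        rw [h (c • s) (c • σ s) (by rw [map_smul, hσ]), d.map_smul, map_smul]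
        rfl }
    fun s t => ?_, fun x => h _ x rfl⟩
  change f (d (σ (s * t))) = s • f (d (σ t)) + t • f (d (σ s))
  rw [h (s * t) (σ s * σ t) (by rw [map_mul, hσ, hσ]), d.leibniz, map_add, smul_eq_mul,
    smul_eq_mul, map_mul, map_mul, hσ, hσ]
  rfl

end Quotient

theorem eq_zero_of_mul_self_eq_zero {R : Type*} [CommRing R] [IsReduced R] {x : R}
    (h : x * x = 0) : x = 0 :=
  IsNilpotent.eq_zero ⟨2, by rw [pow_two, h]⟩

/-- In a reduced ring, the elements of a minimal prime are killed by elements outside of it, so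
that derivations preserve the minimal primes. -/
theorem derivation_mem_of_isReduced {k R : Type*} [Field k] [CommRing R] [Algebra k R]
    [IsReduced R] (d : Derivation k R R) {p : Ideal R}
    (hp : p ∈ minimalPrimes R) {x : R} (hx : x ∈ p) : d x ∈ p := by
  have hpp : p.IsPrime := hp.1.1
  obtain ⟨c, hcn, hcx⟩ : ∃ c ∉ p, c * x = 0 := by
    by_contra! h
    obtain ⟨q, hq, -, hdisj⟩ := Ideal.exists_le_prime_disjoint ⊥ (p.primeCompl ⊔ Submonoid.powers x)
      (by
        rw [Set.disjoint_left]
        rintro y hy hy'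
        obtain rfl : y = 0 := hy
        obtain ⟨c, hc, z, ⟨n, rfl⟩, hcz⟩ := Submonoid.mem_sup.1 hy'
        refine h c hc (IsNilpotent.eq_zero ⟨n + 1, ?_⟩)
        change c * x ^ n = 0 at hcz
        calc (c * x) ^ (n + 1) = c ^ n * x * (c * x ^ n) := by ring
          _ = 0 := by rw [hcz, mul_zero])
    have hqp : q ≤ p := fun y hy => by
      by_contra hyp
      exact Set.disjoint_left.1 hdisj hy ((le_sup_left : p.primeCompl ≤ _) hyp)
    exact Set.disjoint_left.1 hdisj (hp.2 ⟨hq, bot_le⟩ hqp hx)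
      ((le_sup_right : Submonoid.powers x ≤ p.primeCompl ⊔ _) (Submonoid.mem_powers x))
  have h1 := congrArg d hcx
  rw [d.leibniz, map_zero, smul_eq_mul, smul_eq_mul] at h1
  refine (hpp.mem_or_mem (?_ : c * d x ∈ p)).resolve_left hcn
  rw [eq_neg_of_add_eq_zero_left h1]
  exact p.neg_mem (p.mul_mem_right _ hx)

section DirectSum

variable {k R Q : Type u} [Field k] [CommRing R] [IsReduced R] [CommRing Q] [Algebra k Q]
  [Algebra R Q] [IsFractionRing R Q] (hfin : (minimalPrimes R).Finite)

include R hfin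

/-- The total ring of fractions of a reduced ring with finitely many minimal primes is a direct
sum of fields, which are stable under derivations. -/
theorem isDirectSumOfDifferentialFields {N : ℕ} (d : Fin N → Derivation k Q Q)
    (hd : ∀ r s x, d r (d s x) = d s (d r x)) : IsDirectSumOfDifferentialFields d := by
  have hred : IsReduced Q := isReduced_localizationPreserves (nonZeroDivisors R) Q inferInstance
  have hfinQ : (minimalPrimes Q).Finite := by
    have h := IsLocalization.minimalPrimes_map (nonZeroDivisors R) Q (⊥ : Ideal R)
    rw [Ideal.map_bot] at h
    change ((⊥ : Ideal Q).minimalPrimes).Finite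
    rw [h]
    exact Set.Finite.preimage
      ((IsLocalization.orderEmbedding (nonZeroDivisors R) Q).injective.injOn) hfin
  -- In a total ring of fractions the elements of a maximal ideal are zero divisors, so that the
  -- ideal is contained in a minimal prime.
  have hmax : ∀ p ∈ minimalPrimes Q, p.IsMaximal := by
    intro p hp
    obtain ⟨M, hM, hpM⟩ := Ideal.exists_le_maximal p hp.1.1.ne_top
    have h1 : ∀ x ∈ M, x ∉ nonZeroDivisors Q := by
      intro x hx hx'
      rw [IsFractionRing.nonZeroDivisors_eq_isUnit R Q] at hx'
      exact hM.ne_top (Ideal.eq_top_of_isUnit_mem _ hx hx')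
    obtain ⟨c, hc, hcM⟩ := exists_ne_zero_mul_eq_zero_of_ideal hfinQ h1
    have hcp : ∀ q ∈ minimalPrimes Q, q ≤ M → c ∈ q → False := by
      intro q hq hqM hcq
      exact hc (eq_zero_of_mul_self_eq_zero (hcM c (hqM hcq)))
    have : p = M := le_antisymm hpM fun x hx =>
      (hp.1.1.mem_or_mem (show c * x ∈ p by rw [hcM x hx]; exact p.zero_mem)).resolve_left
        (hcp p hp hpM)
    rwa [this]
  obtain ⟨c, ⟨eq⟩⟩ := Finite.exists_equiv_fin (hfinQ.toFinset : Set (Ideal Q))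
  let P : Fin c → Ideal Q := fun i => (eq.symm i).1
  have hP : ∀ i, P i ∈ minimalPrimes Q := fun i => hfinQ.mem_toFinset.1 (eq.symm i).2
  have hPmax : ∀ i, (P i).IsMaximal := fun i => hmax _ (hP i)
  have hPinj : Function.Injective P := Subtype.val_injective.comp eq.symm.injective
  have hD : ∀ i r, ∃ D : Derivation k (Q ⧸ P i) (Q ⧸ P i),
      ∀ x, D (Ideal.Quotient.mkₐ k (P i) x) = Ideal.Quotient.mkₐ k (P i) (d r x) := fun i r =>
    exists_derivation_of_surjective _ (Ideal.Quotient.mkₐ_surjective k (P i)) (d r) fun x hx =>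
      Ideal.Quotient.eq_zero_iff_mem.2 (derivation_mem_of_isReduced (d r) (hP i)
        (Ideal.Quotient.eq_zero_iff_mem.1 hx))
  choose D hD using hD
  -- The Chinese remainder theorem, the minimal primes having intersection zero.
  let e : Q →ₐ[k] (∀ i, Q ⧸ P i) := AlgHom.pi fun i => Ideal.Quotient.mkₐ k (P i)
  have he : Function.Bijective e := by
    constructor
    · rw [injective_iff_map_eq_zero]
      intro x hx
      have h0 : x ∈ nilradical Q := by
        rw [nilradical_eq_sInf, Ideal.mem_sInf]
        intro q hq
        have : q.IsPrime := hq
        obtain ⟨q', hq', hle⟩ := Ideal.exists_minimalPrimes_le (bot_le : ⊥ ≤ q)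
        refine hle ?_
        have h1 := congrFun hx (eq ⟨q', by simpa using hq'⟩)
        have h2 := Ideal.Quotient.eq_zero_iff_mem.1 h1
        simpa [P] using h2
      rwa [nilradical_eq_zero] at h0
    · intro y
      obtain ⟨x, hx⟩ := Ideal.quotientInfToPiQuotient_surj (I := P)
        (fun i i' hii' => Ideal.isCoprime_of_isMaximal fun h => hii' (hPinj h)) y
      obtain ⟨x, rfl⟩ := Ideal.Quotient.mk_surjective x
      exact ⟨x, hx⟩
  refine ⟨c, fun i => Q ⧸ P i, fun i => Ideal.Quotient.field (P i), fun i => inferInstance, D,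
    AlgEquiv.ofBijective e he, fun i r s x => ?_, fun r x i => (hD i r x).symm⟩
  obtain ⟨x, rfl⟩ := Ideal.Quotient.mkₐ_surjective k (P i) x
  rw [hD, hD, hD, hD, hd]

end DirectSum

/-! ### Tensor squares of fields -/

/-- The derivative of a nilpotent element is nilpotent: differentiate `x ^ n = 0`, multiplied by
powers of `d x`, to lower the exponent of `x`. -/
theorem isNilpotent_derivation {k R : Type*} [Field k] [CharZero k] [CommRing R] [Algebra k R]
    (d : Derivation k R R) {x : R} (hx : IsNilpotent x) :
    IsNilpotent (d x) := by
  obtain ⟨n, hn⟩ := hx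
  have key : ∀ n e : ℕ, x ^ n * d x ^ e = 0 → IsNilpotent (d x) := by
    intro n
    induction n with
    | zero => exact fun e h => ⟨e, by simpa using h⟩
    | succ n ih =>
      intro e h
      refine ih (e + (e + 1)) ?_
      have h1 := congrArg d h
      have hd : d (x ^ (n + 1)) = (n + 1) • (x ^ n * d x) := by
        rw [d.leibniz_pow, Nat.add_sub_cancel, smul_eq_mul]
      rw [d.leibniz, hd, map_zero, smul_eq_mul, smul_eq_mul] at h1
      have h2 : ((n + 1 : ℕ) : k) • (x ^ n * d x ^ (e + (e + 1))) = 0 := by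
        calc ((n + 1 : ℕ) : k) • (x ^ n * d x ^ (e + (e + 1)))
            = d x ^ e * (x ^ (n + 1) * d (d x ^ e) + d x ^ e * ((n + 1) • (x ^ n * d x))) -
                x ^ (n + 1) * d x ^ e * d (d x ^ e) := by
              rw [Nat.cast_smul_eq_nsmul, nsmul_eq_mul, nsmul_eq_mul]
              ring
          _ = 0 := by rw [h1, h, mul_zero, zero_mul, sub_zero]
      exact (smul_eq_zero_iff_right (Nat.cast_ne_zero.2 (Nat.succ_ne_zero n))).1 h2
  exact key n 0 (by simpa using hn)

section TensorSquare

variable {K F A : Type*} [Field K] [Field F] [Algebra K F] [CommRing A] [Algebra K A]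

/-- The derivation `θ ⊗ 1` of `F ⊗ A`. -/
noncomputable def derivationTensor (θ : Derivation K F F) : Derivation K (F ⊗[K] A) (F ⊗[K] A) :=
  Derivation.mk' (LinearMap.rTensor A (θ : F →ₗ[K] F)) fun x y => by
    induction x using TensorProduct.induction_on with
    | zero => simp
    | add x x' hx hx' =>
      rw [add_mul, map_add, hx, hx', map_add, smul_add, add_smul]
      abel
    | tmul x a =>
      induction y using TensorProduct.induction_on with
      | zero => simp
      | add y y' hy hy' =>
        rw [mul_add, map_add, hy, hy', map_add, smul_add, add_smul]
        abel
      | tmul y b =>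
        rw [Algebra.TensorProduct.tmul_mul_tmul, LinearMap.rTensor_tmul, LinearMap.rTensor_tmul,
          LinearMap.rTensor_tmul, smul_eq_mul, smul_eq_mul, Algebra.TensorProduct.tmul_mul_tmul,
          Algebra.TensorProduct.tmul_mul_tmul, mul_comm b a, ← TensorProduct.add_tmul]
        exact congrArg (· ⊗ₜ (a * b)) (θ.leibniz x y)

variable [CharZero K]

/-- An algebraic extension in characteristic zero is geometrically reduced: reduce to finite
extensions, which are unramified. -/
theorem isReduced_tensorProduct_of_isAlgebraic {C : Type*} [Field C] [Algebra K C]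
    [Algebra.IsAlgebraic K C] : IsReduced (F ⊗[K] C) := by
  refine IsReduced.tensorProduct_of_flat_of_forall_fg fun B hB => ?_
  obtain ⟨s, rfl⟩ := hB
  let M : IntermediateField K C := IntermediateField.adjoin K (s : Set C)
  have hfin : FiniteDimensional K M := IntermediateField.finiteDimensional_adjoin
    fun x _ => Algebra.IsIntegral.isIntegral x
  have hunr : Algebra.FormallyUnramified K M := Algebra.FormallyUnramified.of_isSeparable K M
  have hred : IsReduced (F ⊗[K] M) := Algebra.FormallyUnramified.isReduced_of_field F (F ⊗[K] M)
  have hle : Algebra.adjoin K (s : Set C) ≤ M.toSubalgebra :=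
    IntermediateField.algebra_adjoin_le_adjoin K _
  exact isReduced_of_injective
    (Algebra.TensorProduct.map (AlgHom.id K F) (Subalgebra.inclusion hle))
    (Module.Flat.lTensor_preserves_injective_linearMap (M := F)
      (Subalgebra.inclusion hle).toLinearMap (Subalgebra.inclusion_injective hle))

end TensorSquare

section Finite

variable {K F : Type u} [Field K] [CharZero K] [Field F] [Algebra K F]

/-- The tensor square of a field extension in characteristic zero is reduced: the nilradical is
stable under the derivations of the left factor, and therefore spanned by its elements with
algebraic coefficients, which are zero. -/
theorem isReduced_tensorSquare : IsReduced (F ⊗[K] F) := by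
  rw [← nilradical_eq_bot_iff, eq_bot_iff]
  let C : IntermediateField K F := algebraicClosure K F
  let N : Submodule F (F ⊗[K] F) := (nilradical (F ⊗[K] F)).restrictScalars F
  have hN := le_span_range_rTensor (A := F) Set.univ C.toSubalgebra.toSubmodule
    (fun x hx => mem_algebraicClosure_iff.2
      (isAlgebraic_of_derivation_eq_zero fun d => hx d trivial)) N
    (fun θ _ z hz => isNilpotent_derivation (derivationTensor θ) hz)
  have h : Submodule.span F {z | z ∈ N ∧ z ∈ LinearMap.range
      (LinearMap.rTensor F C.toSubalgebra.toSubmodule.subtype)} = ⊥ := by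
    rw [Submodule.span_eq_bot]
    rintro _ ⟨hz, w, rfl⟩
    have hred : IsReduced (F ⊗[K] C) := isReduced_tensorProduct_of_isAlgebraic
    have hred' : IsReduced (C ⊗[K] F) :=
      isReduced_of_injective (Algebra.TensorProduct.comm K C F) (AlgEquiv.injective _)
    have hinj : Function.Injective (Algebra.TensorProduct.map C.val (AlgHom.id K F)) :=
      Module.Flat.rTensor_preserves_injective_linearMap (M := F) C.val.toLinearMap
        C.val.injective
    have hw : IsNilpotent (Algebra.TensorProduct.map C.val (AlgHom.id K F) w) := hz
    rw [IsNilpotent.map_iff hinj] at hw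
    have hw0 : w = 0 := hw.eq_zero
    rw [hw0, map_zero]
  intro z hz
  have h1 := hN (show z ∈ N from hz)
  rwa [h] at h1

variable {M : Type u} [Field M] [Algebra K M] [Algebra M F] [IsScalarTower K M F]

/-- If the algebraic elements of `F` are in a finitely generated extension `M` of `K`, the minimal
primes of `F ⊗ F` are determined by their intersection with the noetherian ring `M ⊗ F`: being
stable under the derivations of the left factor, they are spanned by elements of `M ⊗ F`. -/
theorem finite_minimalPrimes_tensorSquare [Algebra.EssFiniteType K M]
    (hM : ∀ x : F, IsAlgebraic K x → x ∈ Set.range (algebraMap M F)) :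
    (minimalPrimes (F ⊗[K] F)).Finite := by
  have hred : IsReduced (F ⊗[K] F) := isReduced_tensorSquare
  let i : M →ₐ[K] F := IsScalarTower.toAlgHom K M F
  let φ : M ⊗[K] F →ₐ[K] F ⊗[K] F := Algebra.TensorProduct.map i (AlgHom.id K F)
  have hflat : φ.toRingHom.Flat := RingHom.Flat.tensorProductMap
    (RingHom.Flat.of_isField (Field.toIsField M) _)
    (RingHom.Flat.of_bijective Function.bijective_id)
  have hnoeth : IsNoetherianRing (M ⊗[K] F) := by
    have : IsNoetherianRing (F ⊗[K] M) := Algebra.EssFiniteType.isNoetherianRing F _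
    exact isNoetherianRing_of_ringEquiv _ (Algebra.TensorProduct.comm K F M).toRingEquiv
  refine Set.Finite.of_injOn (f := Ideal.comap φ.toRingHom) (t := minimalPrimes (M ⊗[K] F)) ?_ ?_
    (minimalPrimes.finite_of_isNoetherianRing _)
  · intro P hP
    have hPp : P.IsPrime := hP.1.1
    let _ : Algebra (M ⊗[K] F) (F ⊗[K] F) := φ.toRingHom.toAlgebra
    have : Module.Flat (M ⊗[K] F) (F ⊗[K] F) := hflat
    refine ⟨⟨Ideal.comap_isPrime _ P, bot_le⟩, fun q ⟨hq, _⟩ hle => ?_⟩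
    -- The contraction of a minimal prime is minimal by going down, `F ⊗ F` being flat over `M ⊗ F`.
    have hover : P.LiesOver (P.under (M ⊗[K] F)) := ⟨rfl⟩
    obtain ⟨P', hP'P, hP', hP'q⟩ := Ideal.exists_ideal_le_liesOver_of_le P
      (show q ≤ P.under (M ⊗[K] F) from hle)
    rw [hP'q.over]
    exact Ideal.comap_mono (hP.2 ⟨hP', bot_le⟩ hP'P)
  · have key : ∀ P ∈ minimalPrimes (F ⊗[K] F), ∀ P' ∈ minimalPrimes (F ⊗[K] F),
        Ideal.comap φ.toRingHom P = Ideal.comap φ.toRingHom P' → P ≤ P' := by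
      intro P hP P' hP' h
      have h1 := le_span_range_rTensor (A := F) Set.univ (LinearMap.range i.toLinearMap)
        (fun x hx => hM x (isAlgebraic_of_derivation_eq_zero fun d => hx d trivial))
        (P.restrictScalars F)
        (fun θ _ z hz => derivation_mem_of_isReduced (derivationTensor θ) hP hz)
      refine h1.trans (Submodule.span_le.2 ?_ : _ ≤ P'.restrictScalars F)
      rintro z ⟨hz, w, rfl⟩
      obtain ⟨a, rfl⟩ := LinearMap.rTensor_surjective F
        (LinearMap.surjective_rangeRestrict i.toLinearMap) w
      have h2 : LinearMap.rTensor F (LinearMap.range i.toLinearMap).subtype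
          (LinearMap.rTensor F i.toLinearMap.rangeRestrict a) = φ a := by
        rw [← LinearMap.comp_apply, ← LinearMap.rTensor_comp]
        rfl
      rw [h2] at hz ⊢
      have h3 : a ∈ Ideal.comap φ.toRingHom P := hz
      rw [h] at h3
      exact h3
    exact fun P hP P' hP' h => le_antisymm (key P hP P' hP' h) (key P' hP' P hP h.symm)

end Finite

/-! ### One-parameter groups of jets -/

section Polynomials

variable {k B : Type*} [Field k] [CharZero k] [CommRing B] [Algebra k B]

variable (k) in
include k in
/-- The sums of the values of a polynomial at natural numbers are values of a polynomial. -/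
theorem exists_polynomial_sum (R : Polynomial B) :
    ∃ S : Polynomial B, ∀ N : ℕ, S.eval (N : B) = ∑ i ∈ Finset.range N, R.eval (i : B) := by
  let ι : ℚ →+* B := (algebraMap k B).comp (algebraMap ℚ k)
  induction R using Polynomial.induction_on' with
  | add p q hp hq =>
    obtain ⟨S, hS⟩ := hp
    obtain ⟨S', hS'⟩ := hq
    exact ⟨S + S', fun N => by simp only [Polynomial.eval_add, hS, hS', Finset.sum_add_distrib]⟩
  | monomial p a =>
    let Q : Polynomial ℚ := Polynomial.C ((p + 1 : ℚ)⁻¹) *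
      (Polynomial.bernoulli p.succ - Polynomial.C (bernoulli p.succ))
    have hQ : ∀ N : ℕ, Q.eval (N : ℚ) = ∑ i ∈ Finset.range N, (i : ℚ) ^ p := by
      intro N
      have h := Polynomial.sum_range_pow_eq_bernoulli_sub N p
      have hp : (p + 1 : ℚ) ≠ 0 := by positivity
      simp only [Q, Polynomial.eval_mul, Polynomial.eval_C, Polynomial.eval_sub]
      rw [← h, inv_mul_cancel_left₀ hp]
    refine ⟨Polynomial.C a * Q.map ι, fun N => ?_⟩
    rw [Polynomial.eval_mul, Polynomial.eval_C, Polynomial.eval_natCast_map, hQ, map_sum,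
      Finset.mul_sum]
    refine Finset.sum_congr rfl fun i _ => ?_
    rw [Polynomial.eval_monomial, map_pow, map_natCast]

variable (k) in
include k in
/-- A polynomial over an algebra of characteristic zero which vanishes at the natural numbers is
zero: apply linear forms to its coefficients. -/
theorem polynomial_eq_zero_of_natCast {R : Polynomial B} (h : ∀ N : ℕ, R.eval (N : B) = 0) :
    R = 0 := by
  ext i
  rw [Polynomial.coeff_zero, ← Module.forall_dual_apply_eq_zero_iff k]
  intro φ
  let Rφ : Polynomial k := ∑ i ∈ R.support, Polynomial.monomial i (φ (R.coeff i))
  have hcoeff : ∀ i, Rφ.coeff i = φ (R.coeff i) := by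
    intro i
    simp only [Rφ, Polynomial.finsetSum_coeff, Polynomial.coeff_monomial, Finset.sum_ite_eq',
      Polynomial.mem_support_iff]
    split_ifs with h0
    · rfl
    · rw [Polynomial.notMem_support_iff.1 h0, map_zero]
  have heval : ∀ N : ℕ, Rφ.eval (N : k) = 0 := by
    intro N
    have h1 := congrArg φ (h N)
    rw [map_zero, Polynomial.eval_eq_sum, Polynomial.sum, map_sum] at h1
    rw [← h1, Polynomial.eval_finsetSum]
    refine Finset.sum_congr rfl fun i _ => ?_
    rw [Polynomial.eval_monomial]
    have h2 : R.coeff i * (N : B) ^ i = ((N : k) ^ i) • R.coeff i := by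
      rw [Algebra.smul_def, map_pow, map_natCast, mul_comm]
    rw [h2, map_smul, smul_eq_mul, mul_comm]
  have h0 : Rφ = 0 := by
    refine Polynomial.eq_zero_of_infinite_isRoot _ ((Set.infinite_range_of_injective
      (Nat.cast_injective (R := k))).mono ?_)
    rintro _ ⟨N, rfl⟩
    exact heval N
  rw [← hcoeff, h0, Polynomial.coeff_zero]

end Polynomials

section Powers

variable (k : Type u) [Field k] {m : ℕ} {B : Type*} [CommRing B] [Algebra k B]

/-- The powers of the jet `g` at the fixed point `s`. -/
noncomputable def jetPow (s : Fin m → B) (g : Fin m × (Fin m →₀ ℕ) → B) :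
    ℕ → Fin m × (Fin m →₀ ℕ) → B
  | 0 => fullId s
  | N + 1 => fullChain k (jetPow s g N) g

variable {k} {s : Fin m → B} {g : Fin m × (Fin m →₀ ℕ) → B} {q : ℕ}
  (hg : ∀ p, p.2.degree ≤ q → g p = fullId s p)

include hg

theorem jetPow_eq_fullId (N : ℕ) {p : Fin m × (Fin m →₀ ℕ)} (hp : p.2.degree ≤ q) :
    jetPow k s g N p = fullId s p := by
  induction N generalizing p with
  | zero => rfl
  | succ N ih =>
    rw [jetPow, fullChain_congr k p (a' := fullId s) (g' := fullId s)
      (fun r _ hr => ih (hr.trans hp)) (fun r hr => hg r (hr.trans hp)), fullId_chain]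

/-- If the jet `g` is the identity up to some order at least one, the coordinates of its powers are
polynomials in the exponent. -/
theorem exists_polynomial_jetPow [CharZero k] (hq : 1 ≤ q) (p : Fin m × (Fin m →₀ ℕ)) :
    ∃ P : Polynomial B, ∀ N : ℕ, P.eval (N : B) = jetPow k s g N p := by
  induction hd : p.2.degree using Nat.strong_induction_on generalizing p with
  | _ d ih =>
    subst hd
    by_cases hpq : p.2.degree ≤ q
    · exact ⟨Polynomial.C (fullId s p), fun N => by
        rw [Polynomial.eval_C, jetPow_eq_fullId hg N hpq]⟩
    · classical
      choose! P hP using fun (r : Fin m × (Fin m →₀ ℕ)) (h : r.2.degree < p.2.degree) =>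
        ih _ h r rfl
      have hp0 : p.2 ≠ 0 := fun h => hpq (by simp [h])
      -- The jacobian of `g` is the identity, so that the coordinate `p` of the next power is that
      -- of the previous one plus a polynomial `R` in coordinates of lower order.
      let R : Polynomial B := MvPolynomial.aeval (Sum.elim P fun r => Polynomial.C (g r))
        (chainRest k m m p)
      have hR : ∀ N : ℕ, R.eval (N : B) =
          MvPolynomial.aeval (Sum.elim (jetPow k s g N) g) (chainRest k m m p) := by
        intro N
        have h1 : R.eval (N : B) = MvPolynomial.aeval
            (Sum.elim (fun r => (P r).eval (N : B)) g) (chainRest k m m p) := by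
          change ((Polynomial.aeval (R := B) (N : B)).restrictScalars k) R = _
          rw [← AlgHom.comp_apply, MvPolynomial.comp_aeval]
          congr 2
          funext v
          rcases v with v | v
          · exact Polynomial.coe_aeval_eq_eval (N : B) ▸ rfl
          · simp
        rw [h1]
        exact aeval_chainRest_congr k p hp0 fun r _ hr => hP r hr N
      have hstep : ∀ N, jetPow k s g (N + 1) p = jetPow k s g N p + R.eval (N : B) := by
        intro N
        rw [hR, jetPow, fullChain_top]
        congr 1
        have h1 : ∀ r, g (p.1, Finsupp.single r 1) = if r = p.1 then 1 else 0 := fun r => by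
          rw [hg _ (by simpa using hq), fullId_single]
        simp only [h1, mul_ite, mul_one, mul_zero, Finset.sum_ite_eq', Finset.mem_univ, if_true]
      obtain ⟨S, hS⟩ := exists_polynomial_sum k R
      refine ⟨Polynomial.C (fullId s p) + S, fun N => ?_⟩
      rw [Polynomial.eval_add, Polynomial.eval_C, hS]
      induction N with
      | zero => simp [jetPow]
      | succ N ihN => rw [Finset.sum_range_succ, ← add_assoc, ihN, hstep]

end Powers

section PowerSeries

variable {k L B : Type*} [Field k] [CharZero k] [Field L] [Algebra k L] [CommRing B] [Algebra k B]

/-- A one-parameter family of homomorphisms which is constant on a subfield is constant on the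
elements which are algebraic over it. -/
theorem eq_C_of_isAlgebraic {K : IntermediateField k L} (α : L →ₐ[k] PowerSeries B)
    (hα : ∀ x ∈ K, ∃ c, α x = PowerSeries.C c) {x : L} (hx : IsAlgebraic K x) :
    ∃ c, α x = PowerSeries.C c := by
  let _ : Algebra L (PowerSeries B) := α.toRingHom.toAlgebra
  let _ : Module K (PowerSeries B) := Module.compHom _ (algebraMap K L)
  have : IsScalarTower K L (PowerSeries B) := ⟨fun c x z => by
    change α (c.1 * x) * z = α c.1 * (α x * z)
    rw [map_mul, mul_assoc]⟩
  -- `D = d/dt ∘ α` is zero on `K`, hence on the elements which are separable algebraic over `K`.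
  let D : Derivation K L (PowerSeries B) := Derivation.mk'
    { toFun := fun x => PowerSeries.derivative B (α x)
      map_add' := fun x y => by rw [map_add, map_add]
      map_smul' := fun c x => by
        obtain ⟨b, hb⟩ := hα c c.2
        have h1 : α (c • x) = PowerSeries.C b * α x := by
          rw [← hb, ← map_mul]
          rfl
        rw [h1, ← PowerSeries.smul_eq_C_mul, Derivation.map_smul, PowerSeries.smul_eq_C_mul, ← hb]
        rfl }
    fun x y => by
      change PowerSeries.derivative B (α (x * y)) = _
      rw [map_mul, Derivation.leibniz]
      rfl
  have hsep := (minpoly.irreducible hx.isIntegral).separable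
  have h1 := D.map_aeval (minpoly K x) x
  rw [minpoly.aeval, map_zero] at h1
  have h2 : PowerSeries.derivative B (α x) = 0 := by
    have h3 : Polynomial.aeval x (Polynomial.derivative (minpoly K x)) ≠ 0 :=
      hsep.aeval_derivative_ne_zero (minpoly.aeval K x)
    exact ((h3.isUnit.map α).mul_right_eq_zero).1 h1.symm
  refine ⟨PowerSeries.constantCoeff (α x), PowerSeries.ext fun i => ?_⟩
  rw [PowerSeries.coeff_C]
  rcases i with _ | i
  · simp
  · rw [if_neg (Nat.succ_ne_zero i)]
    have h3 := congrArg (PowerSeries.coeff i) h2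
    rw [PowerSeries.coeff_derivative, map_zero] at h3
    have h4 : (i + 1 : B) = algebraMap k B (i + 1 : k) := by simp
    have h5 : (i + 1 : k) ≠ 0 := by exact_mod_cast Nat.succ_ne_zero i
    have h6 : IsUnit (i + 1 : B) := h4 ▸ (h5.isUnit.map (algebraMap k B))
    exact (h6.mul_left_eq_zero).1 h3

end PowerSeries

/-! ### Elements algebraic over the invariants -/

section CoefficientHoms

variable (k B : Type*) [Field k] [CommRing B] [Algebra k B]

/-- The value of a polynomial at `c`, as a homomorphism of `k`-algebras. -/
noncomputable def evalHom (c : B) : Polynomial B →ₐ[k] B :=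
  (Polynomial.aeval (R := B) c).restrictScalars k

theorem evalHom_apply (c : B) (P : Polynomial B) : evalHom k B c P = P.eval c := by
  change Polynomial.aeval (R := B) c P = _
  rw [Polynomial.coe_aeval_eq_eval]

/-- A polynomial as a power series. -/
noncomputable def toPowerSeries : Polynomial B →ₐ[k] PowerSeries B :=
  { Polynomial.coeToPowerSeries.ringHom with
    commutes' := fun c => by
      change ((algebraMap k (Polynomial B) c : Polynomial B) : PowerSeries B) = _
      rw [Polynomial.algebraMap_apply, Polynomial.coe_C, PowerSeries.algebraMap_apply] }

theorem toPowerSeries_apply (P : Polynomial B) : toPowerSeries k B P = (P : PowerSeries B) := rfl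

/-- The constant term of a power series. -/
noncomputable def constantTerm : PowerSeries B →ₐ[k] B :=
  { PowerSeries.constantCoeff with
    commutes' := fun c => by
      change PowerSeries.constantCoeff (PowerSeries.C (algebraMap k B c)) = _
      rw [PowerSeries.constantCoeff_C] }

theorem constantTerm_apply (z : PowerSeries B) :
    constantTerm k B z = PowerSeries.constantCoeff z := rfl

end CoefficientHoms

namespace AlgebraicPseudogroup

variable {k : Type u} [Field k] {n m : ℕ} {Γ : AlgebraicPseudogroup k m}
  {B : Type u} [CommRing B] [Algebra k B]

/-- The powers of a solution jet with equal source and target are solutions. -/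
theorem isSolutionJet_jetPow {s : BaseField k m →ₐ[k] B} {g : JetIdx m m ⊤ → B}
    (hg : IsSolutionJet Γ.ideal ⊤ s s g) (N : ℕ) :
    IsSolutionJet Γ.ideal ⊤ s s (fun p => jetPow k (fun u => s (baseCoord k m u))
      (fun p => g ⟨p, le_top⟩) N p.1) := by
  induction N with
  | zero =>
    have h : (fun p : JetIdx m m ⊤ => jetPow k (fun u => s (baseCoord k m u))
        (fun p => g ⟨p, le_top⟩) 0 p.1) = idJet ⊤ s := by
      funext p
      rw [idJet_eq_fullId k]
      rfl
    rw [h]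
    exact isSolutionJet_id Γ le_top s
  | succ N ih =>
    have h := isSolutionJet_chain Γ le_top ih hg
    convert h using 2 with p
    exact (chain_eq_fullChain k (fun _ => rfl) (fun _ => rfl) p).symm

/-- A polynomial family of jets which are solutions for all natural values of the parameter is a
solution over the ring of polynomials in the parameter. -/
theorem isSolutionJet_of_eval_natCast [CharZero k] {s : BaseField k m →ₐ[k] B}
    {P : JetIdx m m ⊤ → Polynomial B}
    (h0 : ∀ u, P (JetIdx.zero u) = Polynomial.C (s (baseCoord k m u)))
    (h1 : ∀ u r, P ⟨(u, Finsupp.single r 1), le_top⟩ = if r = u then 1 else 0)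
    (hP : ∀ N : ℕ, IsSolutionJet Γ.ideal ⊤ s s (fun p => (P p).eval (N : B))) :
    IsSolutionJet Γ.ideal ⊤ ((Polynomial.CAlgHom (R := k)).comp s)
      ((Polynomial.CAlgHom (R := k)).comp s) P := by
  refine ⟨⟨fun u => h0 u, ?_⟩, fun f hf hfI => ?_⟩
  · have h : jacobian (extendJet P) = 1 := by
      ext u r : 1
      have h2 := extendJet_apply P (⟨(u, Finsupp.single r 1), le_top⟩ : JetIdx m m ⊤)
      change extendJet P (u, Finsupp.single r 1) = _
      rw [h2, h1, Matrix.one_apply]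
      exact if_congr eq_comm rfl rfl
    rw [h, Matrix.det_one]
    exact isUnit_one
  · refine polynomial_eq_zero_of_natCast k fun N => ?_
    rw [← evalHom_apply k, ← AlgHom.comp_apply, MvPolynomial.comp_aeval,
      ← (hP N).2 f hf hfI]
    congr 2
    funext v
    rcases v with u | p
    · exact (evalHom_apply k B _ _).trans (Polynomial.eval_C)
    · change evalHom k B _ (extendJet P p) = extendJet (fun p => (P p).eval (N : B)) p
      have h2 := extendJet_apply P (⟨p, le_top⟩ : JetIdx m m ⊤)
      have h3 := extendJet_apply (fun p => (P p).eval (N : B)) (⟨p, le_top⟩ : JetIdx m m ⊤)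
      exact (congrArg _ h2).trans ((evalHom_apply k B _ _).trans h3.symm)

/-- Two related points which agree up to the order of `Γ` agree on the elements which are
algebraic over the invariants: the transformation relating them lies in a one-parameter group, which
has to fix these elements. -/
theorem IsAutomorphic.eq_of_isAlgebraic [CharZero k] {K : IntermediateField k (JetField k n m ⊤)}
    (hK : Γ.IsAutomorphic K) {a b : JetField k n m ⊤ →ₐ[k] B} {g : JetIdx m m ⊤ → B}
    (hg : Γ.Relates ⊤ a b g)
    (hab : ∀ p : JetIdx n m ⊤, p.1.2.degree ≤ Γ.order →
      a (jetCoord k n m ⊤ p) = b (jetCoord k n m ⊤ p))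
    {x : JetField k n m ⊤} (hx : IsAlgebraic K x) : a x = b x := by
  have hPHS : Γ.IsPHS ⊤ K := by
    have h := hK.isPHS (q := ⊤) le_top
    rwa [truncate_top] at h
  let s : BaseField k m →ₐ[k] B := a.comp (baseIncl k n m ⊤)
  let s₀ : Fin m → B := fun u => s (baseCoord k m u)
  let G : Fin m × (Fin m →₀ ℕ) → B := fun p => g ⟨p, le_top⟩
  have hsb : b.comp (baseIncl k n m ⊤) = s := by
    refine baseHom_ext fun u => ?_
    change b (baseIncl k n m ⊤ _) = a (baseIncl k n m ⊤ _)
    rw [baseIncl_baseCoord]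
    exact (hab _ (by simp [JetIdx.zero])).symm
  have hsol : IsSolutionJet Γ.ideal ⊤ s s g := by
    have h := hg.1
    rwa [hsb] at h
  -- By uniqueness in the order of `Γ`, the jet `g` is the identity up to this order.
  have hG : ∀ p, p.2.degree ≤ Γ.order → G p = fullId s₀ p := by
    intro p hp
    have h1 : Γ.Relates Γ.order (a.comp (jetIncl k n m Γ.order)) (b.comp (jetIncl k n m Γ.order))
        (truncJet le_top g) :=
      Relates.trunc le_rfl le_top (by rwa [jetIncl_top, AlgHom.comp_id, AlgHom.comp_id])
    have h2 : b.comp (jetIncl k n m Γ.order) = a.comp (jetIncl k n m Γ.order) := by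
      refine jetHom_ext fun r => ?_
      rw [AlgHom.comp_apply, AlgHom.comp_apply, jetIncl_jetCoord]
      exact (hab _ (by exact_mod_cast r.2)).symm
    rw [h2] at h1
    have h3 := (hK.2 Γ.order le_rfl).eq_of_relates h1
      (relates_id (Γ := Γ) le_rfl (a.comp (jetIncl k n m Γ.order)))
    have h4 := congrFun h3 (⟨p, by exact_mod_cast hp⟩ : JetIdx m m Γ.order)
    rw [idJet_eq_fullId k, AlgHom.comp_assoc, jetIncl_comp_baseIncl] at h4
    exact h4
  -- The one-parameter group `P`, with value `g` at `1`. It consists of solutions, as its values at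
  -- the natural numbers do.
  choose P hP using exists_polynomial_jetPow (k := k) hG Γ.one_le_order
  have hPlow : ∀ p, p.2.degree ≤ Γ.order → P p = Polynomial.C (fullId s₀ p) := by
    intro p hp
    refine sub_eq_zero.1 (polynomial_eq_zero_of_natCast k fun N => ?_)
    rw [Polynomial.eval_sub, Polynomial.eval_C, hP, jetPow_eq_fullId hG N hp, sub_self]
  let PJ : JetIdx m m ⊤ → Polynomial B := fun p => P p.1
  have hPsol : IsSolutionJet Γ.ideal ⊤ ((Polynomial.CAlgHom (R := k)).comp s)
      ((Polynomial.CAlgHom (R := k)).comp s) PJ := by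
    refine isSolutionJet_of_eval_natCast (fun u => ?_) (fun u r => ?_) fun N => ?_
    · change P (u, 0) = _
      rw [hPlow _ (by simp), fullId_zero]
    · change P (u, _) = _
      rw [hPlow _ (by simpa using Γ.one_le_order), fullId_single]
      split_ifs <;> simp
    · have h := isSolutionJet_jetPow hsol N
      convert h using 2
      exact hP _ N
  -- The jets of the point `a` displaced by the one-parameter group, with value `b` at `1`.
  let cP : JetIdx n m ⊤ → Polynomial B :=
    chain k (fun r => Polynomial.C (a (jetCoord k n m ⊤ r))) PJ
  have heval : ∀ (c : B) p, evalHom k B c (cP p) =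
      chain k (fun r => a (jetCoord k n m ⊤ r)) (fun r => (P r.1).eval c) p := by
    intro c p
    refine (map_chain k _ _ _ p).trans ?_
    congr 1
    funext r
    rw [evalHom_apply, Polynomial.eval_C]
  have hbase : ∀ u, s (baseCoord k m u) = a (jetCoord k n m ⊤ (JetIdx.zero u)) := fun u => by
    change a (baseIncl k n m ⊤ _) = _
    rw [baseIncl_baseCoord]
  have hzero : ∀ p, evalHom k B 0 (cP p) = a (jetCoord k n m ⊤ p) := by
    intro p
    have h1 : (fun r : JetIdx m m ⊤ => (P r.1).eval (0 : B)) = idJet ⊤ s := by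
      funext r
      have h2 := hP r.1 0
      rw [Nat.cast_zero] at h2
      rw [idJet_eq_fullId k, h2]
      rfl
    rw [heval, h1, chain_idJet k _ s hbase]
  have hone : ∀ p, evalHom k B 1 (cP p) = b (jetCoord k n m ⊤ p) := by
    intro p
    have h1 : (fun r : JetIdx m m ⊤ => (P r.1).eval (1 : B)) = g := by
      funext r
      have h2 := hP r.1 1
      rw [Nat.cast_one] at h2
      rw [h2]
      exact congrFun (fullId_chain k G s₀) r.1
    rw [heval, h1]
    exact (hg.2 p).symm
  -- The polynomials `cP` are the coordinates of a point `α` only over the power series, where the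
  -- nonzero polynomials in them are invertible as they are at `a`.
  obtain ⟨α, hα, hαa⟩ := exists_jetHom_of_isLocalHom (constantTerm k B)
    (fun z hz => PowerSeries.isUnit_iff_constantCoeff.2 hz) a
    (fun p => toPowerSeries k B (cP p)) (fun p => by
      rw [← hzero, constantTerm_apply, toPowerSeries_apply, Polynomial.constantCoeff_coe,
        evalHom_apply, Polynomial.coeff_zero_eq_eval_zero])
  let κC : B →ₐ[k] PowerSeries B := (toPowerSeries k B).comp Polynomial.CAlgHom
  have hrel : Γ.Relates ⊤ (κC.comp a) α (fun p => toPowerSeries k B (PJ p)) := by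
    refine ⟨?_, fun p => ?_⟩
    · have h := hPsol.map (toPowerSeries k B)
      have h1 : α.comp (baseIncl k n m ⊤) =
          (toPowerSeries k B).comp ((Polynomial.CAlgHom (R := k)).comp s) := by
        refine baseHom_ext fun u => ?_
        rw [AlgHom.comp_apply, baseIncl_baseCoord, hα]
        change toPowerSeries k B (cP (JetIdx.zero u)) = toPowerSeries k B (Polynomial.C _)
        congr 1
        exact (chain_zero_order k _ _ u).trans (hPsol.1.1 u)
      rw [h1]
      exact h
    · rw [hα]
      exact map_chain k _ _ _ p
  obtain ⟨c, hc⟩ := eq_C_of_isAlgebraic (K := K) α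
    (fun x hx => ⟨a x, by
      rw [← hPHS.eq_on hrel hx]
      exact Polynomial.coe_C (a x)⟩) hx
  have hca : c = a x := by
    have h := DFunLike.congr_fun hαa x
    rw [AlgHom.comp_apply, hc, constantTerm_apply, PowerSeries.constantCoeff_C] at h
    exact h
  subst hca
  -- Power series cannot be evaluated at `1`. Write `x = f / h`: the identity `a x * h = f` holds
  -- along the family, between polynomials in the parameter, and `h` is invertible at `b`.
  obtain ⟨f, h, hh, hfh⟩ := exists_jetField_eq_div x
  have hαF : ∀ f : MvPolynomial (JetIdx n m ⊤) k,
      α (MvPolynomial.aeval (jetCoord k n m ⊤) f) =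
        toPowerSeries k B (MvPolynomial.aeval cP f) := by
    intro f
    rw [jetHom_aeval, ← AlgHom.comp_apply, MvPolynomial.comp_aeval]
    simp only [hα]
  have hbF : ∀ f : MvPolynomial (JetIdx n m ⊤) k,
      b (MvPolynomial.aeval (jetCoord k n m ⊤) f) =
        evalHom k B 1 (MvPolynomial.aeval cP f) := by
    intro f
    rw [jetHom_aeval, ← AlgHom.comp_apply, MvPolynomial.comp_aeval]
    simp only [hone]
  have h1 : Polynomial.C (a x) * MvPolynomial.aeval cP h = MvPolynomial.aeval cP f := by
    have h2 := congrArg α hfh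
    rw [map_mul, hc, hαF, hαF] at h2
    refine Polynomial.coe_injective B ?_
    rw [Polynomial.coe_mul, Polynomial.coe_C]
    exact h2
  have h2 := congrArg (evalHom k B 1) h1
  rw [map_mul, ← hbF, ← hbF, ← hfh, map_mul, evalHom_apply, Polynomial.eval_C] at h2
  have h3 : IsUnit (b (MvPolynomial.aeval (jetCoord k n m ⊤) h)) :=
    (aeval_jetCoord_ne_zero hh).isUnit.map b
  exact h3.mul_right_cancel h2

end AlgebraicPseudogroup

/-! ### Finiteness of the minimal primes of `L ⊗ L` -/

/-- The elements of `F` with `x ⊗ 1 = 1 ⊗ x` are in the base field. -/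
theorem mem_range_of_tmul_one_eq {M F : Type*} [Field M] [Field F] [Algebra M F] {x : F}
    (h : x ⊗ₜ[M] (1 : F) = 1 ⊗ₜ[M] x) : x ∈ Set.range (algebraMap M F) := by
  obtain ⟨φ, hφ⟩ : ∃ φ : Module.Dual M F, φ 1 ≠ 0 := by
    by_contra! h0
    exact one_ne_zero ((Module.forall_dual_apply_eq_zero_iff M (1 : F)).1 h0)
  have h1 := congrArg (fun z => TensorProduct.lid M F (φ.rTensor F z)) h
  simp only [LinearMap.rTensor_tmul, TensorProduct.lid_tmul] at h1
  refine ⟨φ x / φ 1, ?_⟩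
  rw [map_div₀, div_eq_iff ((map_ne_zero _).2 hφ), mul_comm x, ← Algebra.smul_def (φ 1) x,
    ← h1, Algebra.smul_def, mul_one]

/-- The minimal primes of a subring are contractions of minimal primes. -/
theorem finite_minimalPrimes_of_injective {A T : Type*} [CommRing A] [CommRing T] (f : A →+* T)
    (hf : Function.Injective f) (hT : (minimalPrimes T).Finite) : (minimalPrimes A).Finite := by
  refine (hT.image (Ideal.comap f)).subset fun p hp => ?_
  obtain ⟨p', hp', h⟩ := Ideal.exists_minimalPrimes_comap_eq (I := ⊥) f p
    (by rwa [Ideal.comap_bot_of_injective f hf])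
  exact ⟨p', hp', h⟩

namespace AlgebraicPseudogroup

variable {k : Type u} [Field k] [CharZero k] {n m : ℕ} {Γ : AlgebraicPseudogroup k m}

/-- The ring `L ⊗_K L` has finitely many minimal primes, since the elements of `L` algebraic over
`K` are in the field generated over `K` by the jets up to the order of `Γ`. -/
theorem IsAutomorphic.finite_minimalPrimes {K : IntermediateField k (JetField k n m ⊤)}
    (hK : Γ.IsAutomorphic K) :
    (minimalPrimes (JetField k n m ⊤ ⊗[K] JetField k n m ⊤)).Finite := by
  let S : Set (JetField k n m ⊤) :=
    jetCoord k n m ⊤ '' {p | p.1.2.degree ≤ Γ.order}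
  have hS : S.Finite := by
    refine Set.Finite.image _ ?_
    have h1 : (Set.univ ×ˢ {μ : Fin n →₀ ℕ | μ.degree ≤ Γ.order} :
        Set (Fin m × (Fin n →₀ ℕ))).Finite :=
      Set.finite_univ.prod (Finsupp.finite_of_degree_le Γ.order)
    exact (h1.preimage Subtype.val_injective.injOn).subset fun p hp => ⟨trivial, hp⟩
  let M : IntermediateField K (JetField k n m ⊤) := IntermediateField.adjoin K S
  have hM : Algebra.EssFiniteType K M := by
    rw [IntermediateField.essFiniteType_iff]
    exact ⟨hS.toFinset, by rw [hS.coe_toFinset]⟩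
  have : CharZero K := charZero_of_injective_algebraMap (algebraMap k K).injective
  refine finite_minimalPrimes_tensorSquare (M := M) fun x hx => ?_
  -- The two inclusions of `L` in `L ⊗_M L` are related, and agree on the jets in `S`, hence on `x`.
  let E : IntermediateField k (JetField k n m ⊤) := M.restrictScalars k
  have hPHS : Γ.IsPHS ⊤ K := by
    have h := hK.isPHS (q := ⊤) le_top
    rwa [truncate_top] at h
  have hKE : ∀ y ∈ K, y ∈ E := fun y hy => M.algebraMap_mem ⟨y, hy⟩
  obtain ⟨g, hg, -⟩ := (hPHS _ (leftMap E) (rightMap E)).1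
    fun y hy => leftMap_eq_rightMap E (hKE y hy)
  have h1 := hK.eq_of_isAlgebraic hg (fun p hp => leftMap_eq_rightMap E
    (IntermediateField.subset_adjoin K S ⟨p, hp, rfl⟩)) hx
  obtain ⟨y, hy⟩ := mem_range_of_tmul_one_eq (M := E) h1
  exact ⟨⟨y.1, y.2⟩, hy⟩

end AlgebraicPseudogroup

/-! ### Derivations of `k[Γ]` and of `L ⊗ L` -/

section Commute

variable {k A S : Type*} [Field k] [CommRing A] [CommRing S] [Algebra k S] [Algebra A S]

/-- Derivations of a localization commute if they commute on the elements of the ring. -/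
theorem commute_of_commute_algebraMap (M : Submonoid A) [IsLocalization M S]
    {D D' : Derivation k S S}
    (h : ∀ x : A, D (D' (algebraMap A S x)) = D' (D (algebraMap A S x))) (z : S) :
    D (D' z) = D' (D z) := by
  have h1 : ⁅D, D'⁆ = 0 := localizationDerivation_ext M fun x => by
    rw [Derivation.commutator_apply, h, sub_self, Derivation.zero_apply]
  have h2 := DFunLike.congr_fun h1 z
  rwa [Derivation.commutator_apply, Derivation.zero_apply, sub_eq_zero] at h2

end Commute

theorem groupoidDeriv_comm (k : Type u) [Field k] (m : ℕ) (r s : Fin m) (f : GroupoidPoly k m) :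
    groupoidDeriv k m r (groupoidDeriv k m s f) = groupoidDeriv k m s (groupoidDeriv k m r f) := by
  have h : ⁅groupoidDeriv k m r, groupoidDeriv k m s⁆ = 0 := by
    refine MvPolynomial.derivation_ext fun v => ?_
    rw [Derivation.commutator_apply, Derivation.zero_apply, sub_eq_zero]
    rcases v with u | p
    · simp only [groupoidDeriv, MvPolynomial.mkDerivation_X, Sum.elim_inl]
      split_ifs <;> simp
    · simp only [groupoidDeriv, MvPolynomial.mkDerivation_X, Sum.elim_inr, add_right_comm]
  have h2 := DFunLike.congr_fun h f
  rwa [Derivation.commutator_apply, Derivation.zero_apply, sub_eq_zero] at h2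

theorem fractionDerivation_comm {k A F : Type*} [Field k] [CommRing A] [Field F] [Algebra k A]
    [Algebra k F] [Algebra A F] [IsScalarTower k A F] [IsDomain A] [IsFractionRing A F]
    {d d' : Derivation k A A} (h : ⁅d, d'⁆ = 0) (x : F) :
    fractionDerivation (F := F) d (fractionDerivation d' x) =
      fractionDerivation d' (fractionDerivation d x) := by
  refine commute_of_commute_algebraMap (nonZeroDivisors A) (fun f => ?_) x
  rw [fractionDerivation_algebraMap, fractionDerivation_algebraMap, fractionDerivation_algebraMap,
    fractionDerivation_algebraMap, ← sub_eq_zero, ← map_sub, ← Derivation.commutator_apply, h,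
    Derivation.zero_apply, map_zero]

theorem totalDeriv_comm (k : Type u) [Field k] (n m : ℕ) (r s : Fin n) (x : JetField k n m ⊤) :
    totalDeriv k n m r (totalDeriv k n m s x) = totalDeriv k n m s (totalDeriv k n m r x) := by
  refine fractionDerivation_comm (MvPolynomial.derivation_ext fun p => ?_) x
  rw [Derivation.commutator_apply, Derivation.zero_apply, sub_eq_zero]
  simp only [MvPolynomial.mkDerivation_X, add_right_comm]

namespace AlgebraicPseudogroup

variable {k : Type u} [Field k] {n m : ℕ} (Γ : AlgebraicPseudogroup k m)

/-- The derivations `∂/∂y^r` of `k[Γ]`. -/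
theorem exists_derivation_coordRing (r : Fin m) :
    ∃ D : Derivation k Γ.CoordRing Γ.CoordRing,
      ∀ f, D (Γ.toCoordRing f) = Γ.toCoordRing (groupoidDeriv k m r f) := by
  obtain ⟨D₀, hD₀⟩ := exists_localizationDerivation (S := JetGroupoidRing k m)
    (groupoidDenominators k m) (groupoidDeriv k m r)
  obtain ⟨D, hD⟩ := exists_derivation_of_surjective (S := Γ.CoordRing)
    (Ideal.Quotient.mkₐ k Γ.ideal) Ideal.Quotient.mk_surjective D₀ fun x hx => by
    have hx' : x ∈ Γ.ideal := Ideal.Quotient.eq_zero_iff_mem.1 hx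
    refine Ideal.Quotient.eq_zero_iff_mem.2 ?_
    obtain ⟨⟨f, t⟩, hft⟩ := IsLocalization.surj (groupoidDenominators k m) x
    -- Up to a denominator `t`, the derivative of `x` is that of the polynomial `f`.
    have hu := IsLocalization.map_units (JetGroupoidRing k m) t
    have h1 := congrArg D₀ hft
    rw [Derivation.leibniz, hD₀, smul_eq_mul, smul_eq_mul, hD₀] at h1
    have h2 : algebraMap (GroupoidPoly k m) (JetGroupoidRing k m) f ∈ Γ.ideal := by
      rw [← hft]
      exact Γ.ideal.mul_mem_right _ hx'
    have h3 := Γ.isDifferential r f h2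
    rw [← h1] at h3
    have h4 := (Ideal.add_mem_iff_right _ (Γ.ideal.mul_mem_right _ hx')).1 h3
    exact (Ideal.unit_mul_mem_iff_mem _ hu).1 h4
  exact ⟨D, fun f => (hD _).trans (congrArg _ (hD₀ f))⟩

/-- The extensions of the `∂/∂y^r` to `k(Γ)` commute. -/
theorem exists_derivation_fractionRing_coordRing :
    ∃ d : Fin m → Derivation k (FractionRing Γ.CoordRing) (FractionRing Γ.CoordRing),
      (∀ r f, d r (algebraMap Γ.CoordRing _ (Γ.toCoordRing f)) =
        algebraMap Γ.CoordRing _ (Γ.toCoordRing (groupoidDeriv k m r f))) ∧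
      ∀ r s x, d r (d s x) = d s (d r x) := by
  choose D hD using Γ.exists_derivation_coordRing
  choose d hd using fun r => exists_localizationDerivation (S := FractionRing Γ.CoordRing)
    (nonZeroDivisors Γ.CoordRing) (D r)
  refine ⟨d, fun r f => by rw [hd, hD], fun r s x => ?_⟩
  refine commute_of_commute_algebraMap (nonZeroDivisors Γ.CoordRing) (fun a => ?_) x
  rw [hd, hd, hd, hd]
  congr 1
  let π : JetGroupoidRing k m →ₐ[k] Γ.CoordRing := Ideal.Quotient.mkₐ k Γ.ideal
  obtain ⟨z, rfl⟩ : ∃ z, π z = a := Ideal.Quotient.mk_surjective a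
  obtain ⟨⟨f, t⟩, hft⟩ := IsLocalization.surj (groupoidDenominators k m) z
  have h1 : ⁅D r, D s⁆ (Γ.toCoordRing f) = 0 := by
    rw [Derivation.commutator_apply, hD, hD, hD, hD, groupoidDeriv_comm, sub_self]
  have h1' : ⁅D r, D s⁆ (Γ.toCoordRing t) = 0 := by
    rw [Derivation.commutator_apply, hD, hD, hD, hD, groupoidDeriv_comm, sub_self]
  have h2 : π z * Γ.toCoordRing t = Γ.toCoordRing f := by
    have h := congrArg π hft
    rw [map_mul] at h
    exact h
  rw [← h2, Derivation.leibniz, h1', smul_zero, zero_add, smul_eq_mul] at h1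
  have h3 := (Γ.isUnit_toCoordRing t.2).mul_right_eq_zero.1 h1
  rwa [Derivation.commutator_apply, sub_eq_zero] at h3

end AlgebraicPseudogroup

/-! ### Structure maps and derivations of the tensor square -/

section TensorMaps

variable {k F : Type*} [Field k] [Field F] [Algebra k F] (E : IntermediateField k F)

/-- The exchange of the factors of `F ⊗_E F`, over `k`. -/
theorem exists_swap : ∃ c : F ⊗[E] F →ₐ[k] F ⊗[E] F, c.comp (leftMap E) = rightMap E ∧
    c.comp (rightMap E) = leftMap E ∧ ∀ z, c z = Algebra.TensorProduct.comm E F F z :=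
  ⟨(Algebra.TensorProduct.comm E F F).toAlgHom.restrictScalars k, AlgHom.ext fun _ => rfl,
    AlgHom.ext fun _ => rfl, fun _ => rfl⟩

/-- The product `F ⊗_E F → F`, over `k`. -/
theorem exists_product : ∃ μ : F ⊗[E] F →ₐ[k] F, μ.comp (leftMap E) = AlgHom.id k F ∧
    μ.comp (rightMap E) = AlgHom.id k F ∧
    ∀ z, μ z = Algebra.TensorProduct.lmul' E (S := F) z := by
  refine ⟨(Algebra.TensorProduct.lmul' E (S := F)).restrictScalars k,
    AlgHom.ext fun x => ?_, AlgHom.ext fun x => ?_, fun _ => rfl⟩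
  · exact (Algebra.TensorProduct.lmul'_apply_tmul x 1).trans (mul_one x)
  · exact (Algebra.TensorProduct.lmul'_apply_tmul 1 x).trans (one_mul x)

end TensorMaps

namespace IsTensorSquare

variable {k F T Q : Type u} [Field k] [Field F] [Algebra k F] [CommRing T] [Algebra k T]
  {E : IntermediateField k F} {l r : F →ₐ[k] T} (h : IsTensorSquare E l r)
  [CommRing Q] [Algebra k Q] [Algebra T Q] [IsFractionRing T Q]

include h

theorem derivation_fractionRing_ext {D D' : Derivation k Q Q}
    (hl : ∀ x, D (algebraMap T Q (l x)) = D' (algebraMap T Q (l x)))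
    (hr : ∀ x, D (algebraMap T Q (r x)) = D' (algebraMap T Q (r x)))
    [IsScalarTower k T Q] : D = D' := by
  refine localizationDerivation_ext (nonZeroDivisors T) fun z => ?_
  have hz : z ∈ Algebra.adjoin k (Set.range l ∪ Set.range r) := by
    rw [h.adjoin_eq_top]
    trivial
  induction hz using Algebra.adjoin_induction with
  | mem z hz =>
    rcases hz with ⟨x, rfl⟩ | ⟨x, rfl⟩
    · exact hl x
    · exact hr x
  | algebraMap c => rw [← IsScalarTower.algebraMap_apply k T Q, D.map_algebraMap, D'.map_algebraMap]
  | add x y _ _ hx hy => rw [map_add, map_add, map_add, hx, hy]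
  | mul x y _ _ hx hy => rw [map_mul, D.leibniz, D'.leibniz, hx, hy]

/-- Commuting derivations of `F` which preserve `E` extend to commuting derivations of the total
ring of fractions of `F ⊗_E F`. -/
theorem exists_commuting_derivations [IsScalarTower k T Q] {N : ℕ} (d : Fin N → Derivation k F F)
    (hd : ∀ i, ∀ x ∈ E, d i x ∈ E) (hcomm : ∀ i j x, d i (d j x) = d j (d i x)) :
    ∃ D : Fin N → Derivation k Q Q,
      (∀ i x, D i (algebraMap T Q (l x)) = algebraMap T Q (l (d i x)) ∧
        D i (algebraMap T Q (r x)) = algebraMap T Q (r (d i x))) ∧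
      ∀ i j x, D i (D j x) = D j (D i x) := by
  choose D₀ hl hr using fun i => h.exists_derivation_of_mapsTo (d i) (hd i)
  choose D hD using fun i => exists_localizationDerivation (S := Q) (nonZeroDivisors T) (D₀ i)
  have hDl : ∀ i x, D i (algebraMap T Q (l x)) = algebraMap T Q (l (d i x)) :=
    fun i x => by rw [hD, hl]
  have hDr : ∀ i x, D i (algebraMap T Q (r x)) = algebraMap T Q (r (d i x)) :=
    fun i x => by rw [hD, hr]
  refine ⟨D, fun i x => ⟨hDl i x, hDr i x⟩, fun i j x => ?_⟩
  have h1 : ⁅D i, D j⁆ = 0 := by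
    refine h.derivation_fractionRing_ext (fun x => ?_) fun x => ?_
    · rw [Derivation.commutator_apply, hDl, hDl, hDl, hDl, hcomm, sub_self, Derivation.zero_apply]
    · rw [Derivation.commutator_apply, hDr, hDr, hDr, hDr, hcomm, sub_self, Derivation.zero_apply]
  have h2 := DFunLike.congr_fun h1 x
  rwa [Derivation.commutator_apply, Derivation.zero_apply, sub_eq_zero] at h2

end IsTensorSquare

namespace AlgebraicPseudogroup

variable {k : Type u} [Field k] {n m : ℕ} {Γ : AlgebraicPseudogroup k m}
  {T : Type u} [CommRing T] [Algebra k T]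

/-- The groupoid coordinates of order at most `q` are rational functions of the jets of order at
most `q`: they come from the universal groupoid jet with values in `L_q ⊗ L_q`. -/
theorem IsAutomorphic.jet_mem_adjoin {K : IntermediateField k (JetField k n m ⊤)}
    (hK : Γ.IsAutomorphic K) {l r : JetField k n m ⊤ →ₐ[k] T} {g : JetIdx m m ⊤ → T}
    (hg : Γ.Relates ⊤ l r g) (hlr : ∀ x ∈ K, l x = r x) {q : ℕ} (hq : Γ.order ≤ q)
    (p : JetIdx m m q) :
    g ⟨p.1, le_top⟩ ∈ Algebra.adjoin k (Set.range (fun x => l (jetIncl k n m q x)) ∪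
      Set.range (fun x => r (jetIncl k n m q x))) := by
  have hPHS := hK.2 q hq
  have hT := isTensorSquare (truncate K q)
  obtain ⟨φ, hφl, hφr⟩ := hT.exists_hom (l.comp (jetIncl k n m q)) (r.comp (jetIncl k n m q))
    fun x hx => hlr _ hx
  obtain ⟨g', hg'⟩ := hPHS.exists_relates hT
  have h1 := hg'.map φ
  rw [hφl, hφr] at h1
  have h2 : Γ.Relates q (l.comp (jetIncl k n m q)) (r.comp (jetIncl k n m q))
      (truncJet le_top g) :=
    Relates.trunc (Nat.cast_le.2 hq) le_top (by rwa [jetIncl_top, AlgHom.comp_id, AlgHom.comp_id])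
  have h3 : g ⟨p.1, le_top⟩ = φ (g' p) := congrFun (hPHS.eq_of_relates h2 h1) p
  have h4 : φ (g' p) ∈ (Algebra.adjoin k
      (Set.range (leftMap (truncate K q)) ∪ Set.range (rightMap (truncate K q)))).map φ :=
    Subalgebra.mem_map.2 ⟨g' p, by rw [hT.adjoin_eq_top]; trivial, rfl⟩
  rw [AlgHom.map_adjoin, Set.image_union, ← Set.range_comp, ← Set.range_comp] at h4
  rw [h3]
  convert h4 using 4
  · exact funext fun x => (DFunLike.congr_fun hφl x).symm
  · exact funext fun x => (DFunLike.congr_fun hφr x).symm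

/-- The action of the reciprocal distribution on `L_q ⊗ L_q` is unique. -/
theorem IsPHS.extensionsUnique {q : ℕ∞} {E : IntermediateField k (JetField k n m q)}
    (hE : Γ.IsPHS q E) {δ : Derivation k (JetField k n m q) (JetField k n m q)}
    (hδ : δ ∈ Γ.Delta n q) :
    ExtendsUniquely E (JetField k n m q ⊗[E] JetField k n m q) δ := by
  have hT := isTensorSquare E
  obtain ⟨D, hl, hr⟩ := hE.exists_extension hT hδ
  exact ⟨D, fun x => ⟨hl x, hr x⟩, fun D' h' => hT.derivation_ext
    (fun x => ((h' x).1).trans (hl x).symm) (fun x => ((h' x).2).trans (hr x).symm)⟩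

/-- The action of the reciprocal distribution on `Q(L ⊗ L)` is unique. -/
theorem IsPHS.extensionsUnique_fractionRing {E : IntermediateField k (JetField k n m ⊤)}
    (hE : Γ.IsPHS ⊤ E) {l r : JetField k n m ⊤ →ₐ[k] T} (hT : IsTensorSquare E l r)
    (Q : Type u) [CommRing Q] [Algebra k Q] [Algebra T Q] [IsScalarTower k T Q]
    [IsFractionRing T Q] {δ : Derivation k (JetField k n m ⊤) (JetField k n m ⊤)}
    (hδ : δ ∈ Γ.Delta n ⊤) :
    ∃! D : Derivation k Q Q, ∀ x, D (algebraMap T Q (l x)) = algebraMap T Q (l (δ x)) ∧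
      D (algebraMap T Q (r x)) = algebraMap T Q (r (δ x)) := by
  obtain ⟨D, hl, hr⟩ := hE.exists_extension hT hδ
  obtain ⟨D', hD'⟩ := exists_localizationDerivation (S := Q) (nonZeroDivisors T) D
  refine ⟨D', fun x => ⟨by rw [hD', hl], by rw [hD', hr]⟩, fun D'' h => ?_⟩
  refine hT.derivation_fractionRing_ext (fun x => ?_) fun x => ?_
  · rw [(h x).1, hD', hl]
  · rw [(h x).2, hD', hr]

/-- The image of `k[Γ]` in `L ⊗ L` consists of constants of the reciprocal distribution. -/
theorem IsPHS.coordHom_eq_zero {l r : JetField k n m ⊤ →ₐ[k] T} {j : Γ.CoordRing →ₐ[k] T}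
    {E : IntermediateField k (JetField k n m ⊤)} (hE : Γ.IsPHS ⊤ E)
    (hs : j.comp Γ.source = l.comp (baseIncl k n m ⊤)) (hj : Γ.Relates ⊤ l r (coordJet j))
    {δ : Derivation k (JetField k n m ⊤) (JetField k n m ⊤)} (hδ : δ ∈ Γ.Delta n ⊤)
    {D : Derivation k T T} (hl : ∀ x, D (l x) = l (δ x)) (hr : ∀ x, D (r x) = r (δ x))
    (h : Γ.CoordRing) : D (j h) = 0 := by
  refine derivation_coordHom_eq_zero (fun c => ?_)
    (fun p => hE.extension_eq_zero hδ hl hr hj ⟨p, le_top⟩) h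
  have h1 : j (Γ.source c) = l (baseIncl k n m ⊤ c) := DFunLike.congr_fun hs c
  rw [h1, hl, hδ.1 c, map_zero]

/-- The Hopf structure of `k[Γ]`, and its expression through a homomorphism `j` which represents the
universal groupoid jet. -/
theorem IsPHS.exists_hopfRing {E : IntermediateField k (JetField k n m ⊤)} (hE : Γ.IsPHS ⊤ E)
    {l r : JetField k n m ⊤ →ₐ[k] T} {j : Γ.CoordRing →ₐ[k] T}
    (hs : j.comp Γ.source = l.comp (baseIncl k n m ⊤))
    (ht : j.comp Γ.target = r.comp (baseIncl k n m ⊤)) (hj : Γ.Relates ⊤ l r (coordJet j))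
    {U : Type u} [CommRing U] [Algebra k U] {p₁₂ p₂₃ p₁₃ : T →ₐ[k] U}
    (h₂ : p₁₂.comp r = p₂₃.comp l) (h₁ : p₁₃.comp l = p₁₂.comp l) (h₃ : p₁₃.comp r = p₂₃.comp r)
    {c : T →ₐ[k] T} (hcl : c.comp l = r) (hcr : c.comp r = l) {μ : T →ₐ[k] JetField k n m ⊤}
    (hμl : μ.comp l = AlgHom.id k _) (hμr : μ.comp r = AlgHom.id k _) :
    ∃ S : HopfRing k (BaseField k m) Γ.CoordRing,
      S.IsHopf ∧ S.src = Γ.source ∧ S.tgt = Γ.target ∧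
      (∃ h, ∀ x, S.conv (p₁₂.comp j) (p₂₃.comp j) h x = p₁₃ (j x)) ∧
      (∀ x, j (S.antipode x) = c (j x)) ∧
      ∀ x, baseIncl k n m ⊤ (S.counit x) = μ (j x) := by
  obtain ⟨S, hS⟩ := exists_representsGroupoid Γ
  have h := coordHom_composable hs ht hS h₂
  exact ⟨S, hS.isHopf, hS.src, hS.tgt,
    ⟨h, DFunLike.congr_fun (hE.conv_coordHom hS hs hj h₂ h₁ h₃ h)⟩,
    DFunLike.congr_fun (hE.antipode_coordHom hS hs ht hj hcl hcr),
    DFunLike.congr_fun (hE.counit_coordHom hS hs hj hμl hμr)⟩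

end AlgebraicPseudogroup

end DiffGalois

set_option maxHeartbeats 2000000 in
set_option synthInstance.maxHeartbeats 400000 in
theorem theorem5p3 (k : Type u) [Field k] [CharZero k] (n m : ℕ)
    (Γ : AlgebraicPseudogroup k m)
    (K : IntermediateField k (JetField k n m ⊤)) (hK : Γ.IsAutomorphic K) :
    -- For every order `q` (with `q = ⊤` for all orders), with `L_q` and `K_q = K ∩ L_q`:
    (∀ q : ℕ∞, (Γ.order : ℕ∞) ≤ q →
      -- the reciprocal distribution commutes with `Θ(q)`,
      (∀ δ ∈ Γ.Delta n q, ∀ θ ∈ Γ.Theta n q, ⁅θ, δ⁆ = 0) ∧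
      -- it is characterized by this if `K_q` is algebraically closed in `L_q`,
      ((∀ x : JetField k n m q, IsAlgebraic (truncate K q) x →
          x ∈ truncate K q) →
        ∀ δ : Derivation k (JetField k n m q) (JetField k n m q),
          AlgebraicPseudogroup.KillsBase δ → (∀ θ ∈ Γ.Theta n q, ⁅θ, δ⁆ = 0) →
            δ ∈ Γ.Delta n q) ∧
      -- it has maximal rank,
      (∀ D : Derivation k (JetField k n m q) (JetField k n m q),
        AlgebraicPseudogroup.KillsBase D →
        ∀ S : Finset (JetIdx n m q),
          ∃ w ∈ Submodule.span (JetField k n m q) (Γ.Delta n q),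
            ∀ p ∈ S, D (jetCoord k n m q p) = w (jetCoord k n m q p)) ∧
      -- it acts on `L_q ⊗ L_q`,
      (∀ δ ∈ Γ.Delta n q,
        ExtendsUniquely (truncate K q) (JetField k n m q ⊗[truncate K q] JetField k n m q) δ) ∧
      -- and the groupoid components up to order `q` are elements of `L_q ⊗ L_q`, that is,
      -- rational functions of the jets of `y` and `ȳ` up to order `q`, and are constants.
      (∃ g : JetIdx m m q →
          JetField k n m q ⊗[truncate K q] JetField k n m q,
        Γ.Relates q (leftMap (truncate K q)) (rightMap (truncate K q)) g ∧
        (∀ g', Γ.Relates q (leftMap (truncate K q)) (rightMap (truncate K q)) g' → g' = g) ∧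
        ∀ p, g p ∈ cst (truncate K q)
          (JetField k n m q ⊗[truncate K q] JetField k n m q) (Γ.Delta n q))) ∧
    -- The ring `k[Γ]` is a subring of `L ⊗ L`, generated over the source and target by the
    -- groupoid components,
    (∃ j : Γ.CoordRing →ₐ[k] JetField k n m ⊤ ⊗[K] JetField k n m ⊤,
      Function.Injective j ∧
      (∀ c, j (Γ.source c) = leftMap K (baseIncl k n m ⊤ c)) ∧
      (∀ c, j (Γ.target c) = rightMap K (baseIncl k n m ⊤ c)) ∧
      (∀ p, rightMap K (jetCoord k n m ⊤ p) =
        chain k (fun r => leftMap K (jetCoord k n m ⊤ r))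
          (fun r => j (Γ.jet r.1)) p) ∧
      (∀ q : ℕ, Γ.order ≤ q → ∀ r : JetIdx m m q,
        j (Γ.jet r.1) ∈ Algebra.adjoin k
          (Set.range (fun x => leftMap K (jetIncl k n m q x)) ∪
            Set.range (fun x => rightMap K (jetIncl k n m q x)))) ∧
      -- consisting of constants,
      (∀ h, j h ∈ cst K
        (JetField k n m ⊤ ⊗[K] JetField k n m ⊤) (Γ.Delta n ⊤)) ∧
      (∀ δ ∈ Γ.Delta n ⊤,
        ExtendsUniquely K (JetField k n m ⊤ ⊗[K] JetField k n m ⊤) δ ∧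
        ExtendsUniquely K (FractionRing (JetField k n m ⊤ ⊗[K] JetField k n m ⊤)) δ) ∧
      -- it is a Hopf ring over `k(y)`, the structure maps being induced from `L ⊗ L`,
      (∃ S : HopfRing k (BaseField k m) Γ.CoordRing,
        S.IsHopf ∧ S.src = Γ.source ∧ S.tgt = Γ.target ∧
        (∃ h, ∀ x, S.conv
            (B := JetField k n m ⊤ ⊗[K] (JetField k n m ⊤ ⊗[K] JetField k n m ⊤))
            ((firstSecond K).comp j) ((secondThird K).comp j) h x = firstThird K (j x)) ∧
        (∀ x, j (S.antipode x) = Algebra.TensorProduct.comm K _ _ (j x)) ∧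
        (∀ x, baseIncl k n m ⊤ (S.counit x) =
          Algebra.TensorProduct.lmul' K (S := JetField k n m ⊤) (j x))) ∧
      -- its total ring of fractions is the ring of constants of `Q(L ⊗ L)`,
      (∃ J : FractionRing Γ.CoordRing →ₐ[k]
          FractionRing (JetField k n m ⊤ ⊗[K] JetField k n m ⊤),
        Function.Injective J ∧
        (∀ x, J (algebraMap Γ.CoordRing _ x) =
          algebraMap (JetField k n m ⊤ ⊗[K] JetField k n m ⊤) _ (j x)) ∧
        Set.range J = cst K
          (FractionRing (JetField k n m ⊤ ⊗[K] JetField k n m ⊤))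
          (Γ.Delta n ⊤)) ∧
      -- which is a direct sum of differential fields for the derivations `∂/∂y^r`,
      (∃ d : Fin m → Derivation k (FractionRing Γ.CoordRing) (FractionRing Γ.CoordRing),
        (∀ r f, d r (algebraMap Γ.CoordRing _ (Γ.toCoordRing f)) =
          algebraMap Γ.CoordRing _ (Γ.toCoordRing (groupoidDeriv k m r f))) ∧
        IsDirectSumOfDifferentialFields d) ∧
      -- while `Q(L ⊗ L)` is a direct sum of differential fields for the derivations `d_i`,
      (∃ d : Fin n → Derivation k
          (FractionRing (JetField k n m ⊤ ⊗[K] JetField k n m ⊤))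
          (FractionRing (JetField k n m ⊤ ⊗[K] JetField k n m ⊤)),
        (∀ i, ExtendsToTensor K _ (totalDeriv k n m i) (d i)) ∧
        IsDirectSumOfDifferentialFields d) ∧
      -- and `Q(L ⊗_{k(y)} k[Γ])` is isomorphic to `Q(L ⊗_K L)`.
      (∃ e : FractionRing (JetField k n m ⊤ ⊗[BaseField k m] Γ.CoordRing) ≃+*
          FractionRing (JetField k n m ⊤ ⊗[K] JetField k n m ⊤),
        ∀ (x : JetField k n m ⊤) (h : Γ.CoordRing),
          e (algebraMap (JetField k n m ⊤ ⊗[BaseField k m] Γ.CoordRing) _ (x ⊗ₜ h)) =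
            algebraMap (JetField k n m ⊤ ⊗[K] JetField k n m ⊤) _ (leftMap K x * j h))) := by
  have hPHS : ∀ q : ℕ∞, (Γ.order : ℕ∞) ≤ q → Γ.IsPHS q (truncate K q) := fun q hq => hK.isPHS hq
  have hKtop : Γ.IsPHS ⊤ K := by
    have h := hPHS ⊤ le_top
    rwa [truncate_top] at h
  refine ⟨fun q hq => ⟨fun δ hδ θ hθ => AlgebraicPseudogroup.commutator_eq_zero hδ hθ,
    fun hcl δ hδ hcomm => (hPHS q hq).mem_delta_of_commutator_eq_zero hq hcl hδ hcomm,
    fun D hD S => (hPHS q hq).exists_mem_span_delta hq hD S,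
    fun δ hδ => (hPHS q hq).extensionsUnique hδ, ?_⟩, ?_⟩
  · obtain ⟨g, hg⟩ := (hPHS q hq).exists_relates (isTensorSquare (truncate K q))
    exact ⟨g, hg, fun g' hg' => (hPHS q hq).eq_of_relates hg' hg, fun p δ hδ D hD =>
      (hPHS q hq).extension_eq_zero hδ (fun x => (hD x).1) (fun x => (hD x).2) hg p⟩
  have hT := isTensorSquare K
  obtain ⟨g, hg⟩ := hKtop.exists_relates hT
  obtain ⟨j, hs, ht, hjg⟩ := hg.exists_coordHom
  have hj : Γ.Relates ⊤ (leftMap K) (rightMap K) (AlgebraicPseudogroup.coordJet j) := by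
    have h : AlgebraicPseudogroup.coordJet j = g := funext hjg
    rwa [h]
  have hinj := hKtop.injective_coordHom hT hs hj
  have : CharZero K := charZero_of_injective_algebraMap (algebraMap k K).injective
  have hTred : IsReduced (JetField k n m ⊤ ⊗[K] JetField k n m ⊤) := isReduced_tensorSquare
  have hTfin := hK.finite_minimalPrimes
  have hAred : IsReduced Γ.CoordRing := isReduced_of_injective j hinj
  have hAfin := finite_minimalPrimes_of_injective j.toRingHom hinj hTfin
  refine ⟨j, hinj, DFunLike.congr_fun hs, DFunLike.congr_fun ht, hj.2, fun q hq r =>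
      hK.jet_mem_adjoin hj (fun x hx => leftMap_eq_rightMap K hx) hq r,
    fun h δ hδ D hD => hKtop.coordHom_eq_zero hs hj hδ (fun x => (hD x).1) (fun x => (hD x).2) h,
    fun δ hδ => ⟨hKtop.extensionsUnique hδ,
      hKtop.extensionsUnique_fractionRing hT _ hδ⟩, ?_, ?_, ?_, ?_, ?_⟩
  · obtain ⟨c, hcl, hcr, hc⟩ := exists_swap K
    obtain ⟨μ, hμl, hμr, hμ⟩ := exists_product K
    obtain ⟨S, h₁, h₂, h₃, h₄, h₅, h₆⟩ := hKtop.exists_hopfRing hs ht hj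
      (U := JetField k n m ⊤ ⊗[K] (JetField k n m ⊤ ⊗[K] JetField k n m ⊤))
      (p₁₂ := firstSecond K) (p₂₃ := secondThird K) (p₁₃ := firstThird K)
      (firstSecond_comp_rightMap K) (firstThird_comp_leftMap K) (firstThird_comp_rightMap K)
      hcl hcr hμl hμr
    exact ⟨S, h₁, h₂, h₃, h₄, fun x => (h₅ x).trans (hc _), fun x => (h₆ x).trans (hμ _)⟩
  · obtain ⟨J, hJ, hJj⟩ := hKtop.exists_fractionHom hT hs hj
      (FractionRing (JetField k n m ⊤ ⊗[K] JetField k n m ⊤)) (FractionRing Γ.CoordRing)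
    have hrange := hKtop.range_fractionHom hT hs hj hAfin hJj
    exact ⟨J, hJ, hJj, hrange⟩
  · obtain ⟨d, hd, hcomm⟩ := Γ.exists_derivation_fractionRing_coordRing
    exact ⟨d, hd, isDirectSumOfDifferentialFields hAfin d hcomm⟩
  · obtain ⟨d, hd, hcomm⟩ := hT.exists_commuting_derivations
      (Q := FractionRing (JetField k n m ⊤ ⊗[K] JetField k n m ⊤)) (totalDeriv k n m) hK.1
      (totalDeriv_comm k n m)
    exact ⟨d, fun i x => hd i x, isDirectSumOfDifferentialFields hTfin d hcomm⟩
  · obtain ⟨e, he⟩ := hKtop.exists_fractionRing_equiv hT hs hj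
      (FractionRing (JetField k n m ⊤ ⊗[K] JetField k n m ⊤))
    exact ⟨e, he⟩
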